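/- Let $n\ge 1$, $T>0$, and let $\Omega\subset\mathbb R^n$ be a uniformly convex domain with smooth boundary, that is, a bounded, nonempty, open convex set with $C^\infty$ boundary whose principal curvatures are bounded below by a positive constant. Put $Q_T=\Omega\times(0,T]$, $\overline Q_T=\overline\Omega\times[0,T]$ and $\partial_pQ_T=(\overline\Omega\times\{0\})\cup(\partial\Omega\times[0,T])$. For an integer $k\ge 0$ let $\tilde C^k(\overline Q_T)$ be the space of functions $w$ on $\overline Q_T$ whose derivatives $D_x^\gamma D_t^s w$ with $|\gamma|+2s\le k$ exist and are continuous on $\overline Q_T$, with norm $$\|w\|_{\tilde C^k(\overline Q_T)}=\sup_{|\gamma|+2s\le k,\ (x,t)\in Q_T}|D_x^\gamma D_t^s w(x,t)|.$$ Let $\phi,\psi\in C^\infty(\overline Q_T)$ and let $c_0,\kappa>0$ be constants such that (1) $\phi_t+\psi\ge c_0$ on $\partial\Omega\times[0,T]$; (2) $\phi(\cdot,0)$ is uniformly convex: $D^2\phi(x,0)\ge\kappa I_n$ for all $x\in\overline\Omega$; (3) $\psi(\cdot,t)$ is concave in $x\in\Omega$ for every $t\in[0,T]$. Let $u\in\tilde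 C^4(\overline Q_T)$ be convex in $x$ and satisfy $$-u_t+\det D^2u=\psi\ \text{ in } Q_T,\qquad u=\phi\ \text{ on }\partial_pQ_T.$$ Then there is a constant $C>0$ such that every eigenvalue $\lambda$ of the spatial Hessian $D^2u(x,t)$ satisfies $$\frac1C\le\lambda\le C\qquad\text{for all }(x,t)\in\overline Q_T .$$ Here $C$ depends only on $n$, $T$, $\Omega$, $c_0$, $\kappa$ and on upper bounds for $\|\phi\|_{\tilde C^4(\overline Q_T)}$, $\|\psi\|_{L^\infty(Q_T)}$, $\|D_x\psi\|_{L^\infty(Q_T)}$ and $\|\psi_t\|_{L^{n+1}(Q_T)}$. -/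

import Mathlib

open Set Topology MeasureTheory
open scoped NNReal ENNReal ContDiff

noncomputable section

/-- A bounded convex domain of `ℝⁿ` with smooth boundary whose principal curvatures are bounded
below by a positive constant. Near a boundary point `x₀` the domain is `{r < 0}` for a smooth `r`
with `Dr(x₀) ≠ 0`; the second fundamental form of the boundary at `x₀` (with respect to the inner
normal) is then `D²r(x₀)(v, v) / |Dr(x₀)|` on the tangent space `{v | Dr(x₀) v = 0}`. -/
structure IsUniformlyConvexDomain {n : ℕ} (Ω : Set (EuclideanSpace ℝ (Fin n))) : Prop where
  isOpen : IsOpen Ω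
  nonempty : Ω.Nonempty
  isBounded : Bornology.IsBounded Ω
  convex : Convex ℝ Ω
  curvature_pos : ∃ κ : ℝ, 0 < κ ∧ ∀ x₀ ∈ frontier Ω,
    ∃ r : EuclideanSpace ℝ (Fin n) → ℝ, ∃ V ∈ 𝓝 x₀,
      ContDiffOn ℝ ∞ r V ∧ (∀ x ∈ V, x ∈ Ω ↔ r x < 0) ∧ fderiv ℝ r x₀ ≠ 0 ∧
      ∀ v : EuclideanSpace ℝ (Fin n), fderiv ℝ r x₀ v = 0 →
        κ * ‖fderiv ℝ r x₀‖ * ‖v‖ ^ 2 ≤ iteratedFDeriv ℝ 2 r x₀ ![v, v]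

/-- The cylinder `Q_T = Ω × (0, T]`. -/
def parabolicCylinder {n : ℕ} (Ω : Set (EuclideanSpace ℝ (Fin n))) (T : ℝ) :
    Set (EuclideanSpace ℝ (Fin n) × ℝ) :=
  Ω ×ˢ Ioc 0 T

/-- The closed cylinder `closure Ω × [0, T]`. -/
def closedCylinder {n : ℕ} (Ω : Set (EuclideanSpace ℝ (Fin n))) (T : ℝ) :
    Set (EuclideanSpace ℝ (Fin n) × ℝ) :=
  closure Ω ×ˢ Icc 0 T

/-- The parabolic boundary `(closure Ω × {0}) ∪ (∂Ω × [0, T])`. -/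
def parabolicBoundary {n : ℕ} (Ω : Set (EuclideanSpace ℝ (Fin n))) (T : ℝ) :
    Set (EuclideanSpace ℝ (Fin n) × ℝ) :=
  closure Ω ×ˢ {0} ∪ frontier Ω ×ˢ Icc 0 T

/-- The tensor `D_x^j D_t^s w (x, t)` of a function `w` on the closed cylinder. All derivatives
are taken within the closed cylinder: they are the usual ones at interior points and the
one-sided ones at boundary points. -/
def spaceTimeDeriv {n : ℕ} (Ω : Set (EuclideanSpace ℝ (Fin n))) (T : ℝ)
    (w : EuclideanSpace ℝ (Fin n) → ℝ → ℝ) (j s : ℕ) (x : EuclideanSpace ℝ (Fin n)) (t : ℝ) :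
    EuclideanSpace ℝ (Fin n) [×j]→L[ℝ] ℝ :=
  iteratedFDerivWithin ℝ j (fun y => iteratedDerivWithin s (w y) (Icc 0 T) t) (closure Ω) x

/-- The time derivative `w_t (x, t)` (one-sided at `t = 0` and `t = T`). -/
def timeDeriv {n : ℕ} (T : ℝ) (w : EuclideanSpace ℝ (Fin n) → ℝ → ℝ)
    (x : EuclideanSpace ℝ (Fin n)) (t : ℝ) : ℝ :=
  derivWithin (w x) (Icc 0 T) t

/-- The spatial differential `D_x w (x, t)`. -/
def spaceGrad {n : ℕ} (Ω : Set (EuclideanSpace ℝ (Fin n)))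
    (w : EuclideanSpace ℝ (Fin n) → ℝ → ℝ) (x : EuclideanSpace ℝ (Fin n)) (t : ℝ) :
    EuclideanSpace ℝ (Fin n) →L[ℝ] ℝ :=
  fderivWithin ℝ (fun y => w y t) (closure Ω) x

/-- The spatial Hessian matrix `D²w (x, t)`. -/
def spaceHessian {n : ℕ} (Ω : Set (EuclideanSpace ℝ (Fin n)))
    (w : EuclideanSpace ℝ (Fin n) → ℝ → ℝ) (x : EuclideanSpace ℝ (Fin n)) (t : ℝ) :
    Matrix (Fin n) (Fin n) ℝ :=
  Matrix.of fun i k => iteratedFDerivWithin ℝ 2 (fun y => w y t) (closure Ω) x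
    ![EuclideanSpace.single i 1, EuclideanSpace.single k 1]

/-- The parabolic class `C̃^k` on the closed cylinder: the derivatives `D_x^γ D_t^s w` with
`|γ| + 2 s ≤ k` exist and are continuous up to the boundary. -/
structure MemParabolicC {n : ℕ} (k : ℕ) (Ω : Set (EuclideanSpace ℝ (Fin n))) (T : ℝ)
    (w : EuclideanSpace ℝ (Fin n) → ℝ → ℝ) : Prop where
  contDiffOn_time : ∀ x ∈ closure Ω, ContDiffOn ℝ ((k / 2 : ℕ) : WithTop ℕ∞) (w x) (Icc 0 T)
  contDiffOn_space : ∀ s : ℕ, 2 * s ≤ k → ∀ t ∈ Icc 0 T,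
    ContDiffOn ℝ ((k - 2 * s : ℕ) : WithTop ℕ∞)
      (fun y => iteratedDerivWithin s (w y) (Icc 0 T) t) (closure Ω)
  continuousOn : ∀ j s : ℕ, j + 2 * s ≤ k →
    ContinuousOn (fun p : EuclideanSpace ℝ (Fin n) × ℝ => spaceTimeDeriv Ω T w j s p.1 p.2)
      (closedCylinder Ω T)

/-- The norm of `C̃^k`: the supremum of `|D_x^γ D_t^s w|` over the cylinder and over all
`|γ| + 2 s ≤ k`. A multi-index `γ` with `|γ| = j` is represented by a list of `j` coordinate
directions. -/
def parabolicNorm {n : ℕ} (k : ℕ) (Ω : Set (EuclideanSpace ℝ (Fin n))) (T : ℝ)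
    (w : EuclideanSpace ℝ (Fin n) → ℝ → ℝ) : ℝ≥0∞ :=
  ⨆ (j : ℕ) (s : ℕ) (_ : j + 2 * s ≤ k) (γ : Fin j → Fin n) (p ∈ parabolicCylinder Ω T),
    ‖spaceTimeDeriv Ω T w j s p.1 p.2 (fun l => EuclideanSpace.single (γ l) 1)‖ₑ

/-- `u` solves `-u_t + det D²u = ψ` in `Q_T` and `u = φ` on the parabolic boundary. -/
structure SolvesParabolicMongeAmpere {n : ℕ} (Ω : Set (EuclideanSpace ℝ (Fin n))) (T : ℝ)
    (φ ψ u : EuclideanSpace ℝ (Fin n) → ℝ → ℝ) : Prop where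
  equation : ∀ p ∈ parabolicCylinder Ω T,
    -timeDeriv T u p.1 p.2 + (spaceHessian Ω u p.1 p.2).det = ψ p.1 p.2
  boundary : ∀ p ∈ parabolicBoundary Ω T, u p.1 p.2 = φ p.1 p.2

end

/-!
# A priori bounds for the Hessian of solutions of `-u_t + det D²u = ψ`

The speed `F = u_t + ψ` equals `det D²u`. It obeys a minimum principle, because `ψ` is concave in
space: at a spatial minimum of `F` the form `D²u_t` is nonnegative, so that `F_t ≥ 0`
there. Hence `F ≥ min c₀ (κ ^ n)` (`MongeAmpereData.le_speed`). An upper bound for `F` has to use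
`ψ_t` only through its norm in `L^(n + 1)`. The difference quotient `w` of `u` in time is studied by
the map `(x, t) ↦ (∇w, w - ⟨∇w, x - x₁⟩)` on the set where `w` is concave in space and increasing in
time: the Jacobian of the map is bounded there by the power `n + 1` of the difference quotient of
`ψ`, while the image has a volume which is large if `w` is large somewhere
(`MongeAmpereData.volume_le_lintegral`, `MongeAmpereData.exists_speed_le`).

Each time slice is therefore a convex function `f` with `c₁ ≤ det D²f ≤ C₁` and smooth boundary
values (`EllipticSlice`). At a boundary point with inner normal `ν`, the normal derivative is bounded
by a barrier and by convexity, and the tangential second derivatives are expressed through it. They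
are also bounded below: if `D²f(e, e)` were tiny, a section of `f` would contain a box which is very
long in the direction `e`, and a paraboloid touching `f` in this box would have a Hessian
determinant below `c₁` (`EllipticSlice.exists_le_hess_tangential`). The mixed derivatives are bounded
by a parabolic barrier for the derivative of `u - φ` in a direction which is tangential to the
boundary up to second order (`MongeAmpereData.exists_abs_mixed_le`); this uses the quantitative
description of the boundary in `BoundaryFrame`. No bound for `D²u(ν, ν)` is needed to bound the
lowest eigenvalue from below on the boundary (`exists_le_form`): if this number is large, it
dominates the mixed terms, and otherwise the determinant gives the bound.

The lowest eigenvalue of `D²u` obeys a minimum principle as well (`MongeAmpereData.le_hess`). At an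
interior minimum, in the direction `ξ`, the equation is differentiated twice along `ξ`. The terms
quadratic in the third derivatives have the right sign once the minimality of the eigenvalue is
tested with suitably rotated directions, and the concavity of `ψ` yields `D²u_t(ξ, ξ) ≥ 0`. The lower
bound for all eigenvalues and the upper bound for their product give the upper bound.
-/

/-! ### One-variable calculus and the first touching time -/

/-- Interchange of derivatives: if `∂_τ a = b`, `∂_s b = c` is continuous and `∂_s a (0, ·) = d`,
then `d' = c (0, ·)`. No continuity of `d` is needed. -/
theorem hasDerivAt_of_mixed_partial {a b c : ℝ → ℝ → ℝ} {d : ℝ → ℝ} {t₀ : ℝ}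
    (ha : ∀ᶠ p : ℝ × ℝ in 𝓝 (0, t₀), HasDerivAt (fun τ => a p.1 τ) (b p.1 p.2) p.2)
    (hb : ∀ᶠ p : ℝ × ℝ in 𝓝 (0, t₀), HasDerivAt (fun s => b s p.2) (c p.1 p.2) p.1)
    (hc : ContinuousAt (fun p : ℝ × ℝ => c p.1 p.2) (0, t₀))
    (hd : ∀ᶠ τ in 𝓝 t₀, HasDerivAt (fun s => a s τ) (d τ) 0) :
    HasDerivAt d (c 0 t₀) t₀ := by
  rw [hasDerivAt_iff_isLittleO, Asymptotics.isLittleO_iff]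
  intro ε hε
  have hcε : ∀ᶠ p : ℝ × ℝ in 𝓝 (0, t₀), ‖c p.1 p.2 - c 0 t₀‖ ≤ ε := by
    have := hc.eventually (Metric.closedBall_mem_nhds (c 0 t₀) hε)
    filter_upwards [this] with p hp
    simpa [dist_eq_norm] using hp
  obtain ⟨δ, hδ, hball⟩ := Metric.eventually_nhds_iff.1 ((ha.and hb).and hcε)
  have hball' : ∀ s τ : ℝ, |s| < δ → |τ - t₀| < δ →
      HasDerivAt (fun τ => a s τ) (b s τ) τ ∧ HasDerivAt (fun s => b s τ) (c s τ) s ∧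
        ‖c s τ - c 0 t₀‖ ≤ ε := by
    intro s τ hs hτ
    have := @hball (s, τ) (by
      rw [Prod.dist_eq]; simp only [Real.dist_eq, sub_zero]; exact max_lt hs hτ)
    exact ⟨this.1.1, this.1.2, this.2⟩
  -- the mixed difference of `a` over a small rectangle is `s (τ - t₀) c(0, t₀)` up to `ε |s| |τ - t₀|`
  have key : ∀ s τ : ℝ, |s| < δ → |τ - t₀| < δ →
      ‖(a s τ - a 0 τ - τ * (s * c 0 t₀)) - (a s t₀ - a 0 t₀ - t₀ * (s * c 0 t₀))‖
        ≤ (ε * |s|) * ‖τ - t₀‖ := by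
    intro s τ hs hτ
    have hconv : Convex ℝ (Metric.ball t₀ δ) := convex_ball _ _
    refine Convex.norm_image_sub_le_of_norm_hasDerivWithin_le
      (f := fun τ => a s τ - a 0 τ - τ * (s * c 0 t₀))
      (f' := fun τ => b s τ - b 0 τ - 1 * (s * c 0 t₀)) (s := Metric.ball t₀ δ) ?_ ?_ hconv
      (Metric.mem_ball_self hδ) (by simpa [Real.dist_eq] using hτ)
    · intro σ hσ
      have hσ' : |σ - t₀| < δ := by simpa [Real.dist_eq] using hσ
      exact (((hball' s σ hs hσ').1.sub (hball' 0 σ (by simpa using hδ) hσ').1).sub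
        ((hasDerivAt_id σ).mul_const _)).hasDerivWithinAt
    · intro σ hσ
      have hσ' : |σ - t₀| < δ := by simpa [Real.dist_eq] using hσ
      have h2 := Convex.norm_image_sub_le_of_norm_hasDerivWithin_le
        (f := fun s => b s σ - s * c 0 t₀) (f' := fun s => c s σ - 1 * c 0 t₀)
        (s := Metric.ball (0 : ℝ) δ) (C := ε) (x := 0) (y := s) ?_ ?_ (convex_ball _ _)
        (Metric.mem_ball_self hδ) (by simpa [Real.dist_eq] using hs)
      · have : b s σ - b 0 σ - 1 * (s * c 0 t₀) = (b s σ - s * c 0 t₀) - (b 0 σ - 0 * c 0 t₀) := by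
          ring
        rw [this]
        simpa using h2
      · intro r hr
        have hr' : |r| < δ := by simpa [Real.dist_eq] using hr
        exact ((hball' r σ hr' hσ').2.1.sub ((hasDerivAt_id r).mul_const _)).hasDerivWithinAt
      · intro r hr
        have hr' : |r| < δ := by simpa [Real.dist_eq] using hr
        simpa using (hball' r σ hr' hσ').2.2
  have hd0 := hd.self_of_nhds
  filter_upwards [hd, Metric.ball_mem_nhds t₀ hδ] with τ hdτ hτ
  have hτ' : |τ - t₀| < δ := by simpa [Real.dist_eq] using hτ
  -- divide by `s` and let `s → 0`
  have hder : HasDerivAt (fun s => (a s τ - a 0 τ - τ * (s * c 0 t₀)) -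
      (a s t₀ - a 0 t₀ - t₀ * (s * c 0 t₀)))
      ((d τ - τ * (1 * c 0 t₀)) - (d t₀ - t₀ * (1 * c 0 t₀))) 0 :=
    ((hdτ.sub_const _).sub (((hasDerivAt_id (0 : ℝ)).mul_const _).const_mul _)).sub
      ((hd0.sub_const _).sub (((hasDerivAt_id (0 : ℝ)).mul_const _).const_mul _))
  have hle := HasFDerivAt.le_of_lip' hder.hasFDerivAt (C := ε * ‖τ - t₀‖) (by positivity) (by
    filter_upwards [Metric.ball_mem_nhds (0 : ℝ) hδ] with s hs
    have := key s τ (by simpa [Real.dist_eq] using hs) hτ'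
    simp only [zero_mul, mul_zero, sub_self, sub_zero]
    calc _ ≤ _ := this
      _ = _ := by rw [Real.norm_eq_abs s]; ring)
  have : d τ - d t₀ - (τ - t₀) • c 0 t₀ =
      (d τ - τ * (1 * c 0 t₀)) - (d t₀ - t₀ * (1 * c 0 t₀)) := by
    simp only [smul_eq_mul]; ring
  rw [this]
  simpa using hle

theorem nonneg_second_deriv_of_isLocalMin {f f' : ℝ → ℝ} {m x : ℝ}
    (hf : ∀ᶠ s in 𝓝 x, HasDerivAt f (f' s) s) (hf' : HasDerivAt f' m x)
    (hmin : IsLocalMin f x) : 0 ≤ m := by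
  by_contra hm
  push Not at hm
  have h0 : f' x = 0 := hmin.hasDerivAt_eq_zero hf.self_of_nhds
  have hev : f' =ᶠ[𝓝 x] deriv f := hf.mono fun s hs => hs.deriv.symm
  have hd : deriv (deriv f) x = m := by
    rw [← hev.deriv_eq, hf'.deriv]
  have hmax : IsLocalMax f x := isLocalMax_of_deriv_deriv_neg (by rw [hd]; exact hm)
    (by rw [← hev.self_of_nhds, h0]) hf.self_of_nhds.continuousAt
  have hconst : ∀ᶠ s in 𝓝 x, f s = f x := by
    filter_upwards [hmin, hmax] with s h1 h2 using le_antisymm h2 h1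
  have hc1 : f =ᶠ[𝓝 x] fun _ => f x := hconst
  have : f' =ᶠ[𝓝 x] fun _ => 0 := by
    filter_upwards [hf, hc1.eventuallyEq_nhds] with s hs h2
    have := hs.deriv
    rw [h2.deriv_eq] at this
    simpa using this.symm
  have h3 := this.deriv_eq
  rw [hf'.deriv] at h3
  simp at h3
  linarith

theorem nonpos_second_deriv_of_isLocalMax {f f' : ℝ → ℝ} {m x : ℝ}
    (hf : ∀ᶠ s in 𝓝 x, HasDerivAt f (f' s) s) (hf' : HasDerivAt f' m x)
    (hmax : IsLocalMax f x) : m ≤ 0 := by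
  have := nonneg_second_deriv_of_isLocalMin (f := fun s => - f s) (f' := fun s => - f' s) (m := -m)
    (x := x) (hf.mono fun s hs => hs.neg) hf'.neg hmax.neg
  linarith

theorem nonneg_deriv_of_le_left {f : ℝ → ℝ} {m a x : ℝ} (hf : HasDerivAt f m x) (hax : a < x)
    (hmax : ∀ s ∈ Icc a x, f s ≤ f x) : 0 ≤ m := by
  have h' := (hasDerivWithinAt_iff_tendsto_slope' (by simp)).1 (hf.hasDerivWithinAt (s := Iio x))
  refine ge_of_tendsto h' ?_
  have : ∀ᶠ s in 𝓝[<] x, a < s := by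
    have := Ioo_mem_nhdsLT hax
    filter_upwards [this] with s hs using hs.1
  filter_upwards [this, self_mem_nhdsWithin] with s h1 h2
  rw [slope_def_field]
  have h2' : s < x := h2
  exact div_nonneg_of_nonpos (by linarith [hmax s ⟨h1.le, h2'.le⟩]) (by linarith)

theorem nonpos_right_deriv_of_le {f : ℝ → ℝ} {m a : ℝ}
    (ha : 0 < a) (hf : HasDerivWithinAt f m (Icc 0 a) 0)
    (hmax : ∀ s ∈ Icc 0 a, f s ≤ f 0) : m ≤ 0 := by
  have h : HasDerivWithinAt f m (Ioi 0) 0 :=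
    (hf.mono_of_mem_nhdsWithin (Icc_mem_nhdsGT ha))
  rw [hasDerivWithinAt_iff_tendsto_slope' (by simp)] at h
  refine le_of_tendsto h ?_
  filter_upwards [Ioo_mem_nhdsGT ha] with s hs
  rw [slope_def_field]
  exact div_nonpos_of_nonpos_of_nonneg (by linarith [hmax s ⟨hs.1.le, hs.2.le⟩]) (by linarith [hs.1])

/-- First touching time: a continuous function on `K × [0, T]` which is below the level `c` at
time `0` and above it somewhere reaches the level `c` for the first time strictly inside `(0, T)`. -/
theorem exists_first_touching {Y : Type*} [TopologicalSpace Y] {K : Set Y} (hK : IsCompact K)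
    {T : ℝ} {G : Y → ℝ → ℝ}
    (hG : ContinuousOn (fun p : Y × ℝ => G p.1 p.2) (K ×ˢ Icc 0 T)) {c : ℝ}
    (h0 : ∀ y ∈ K, G y 0 < c) {y₁ : Y} {t₁ : ℝ} (hy₁ : y₁ ∈ K) (ht₁ : t₁ ∈ Icc 0 T)
    (h1 : c < G y₁ t₁) :
    ∃ y₀ ∈ K, ∃ t₀ ∈ Ioo 0 T, G y₀ t₀ = c ∧ ∀ y ∈ K, ∀ t ∈ Icc 0 t₀, G y t ≤ c := by
  have hcomp : IsCompact (K ×ˢ Icc (0 : ℝ) T) := hK.prod isCompact_Icc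
  -- the superlevel set, projected to time, has a least element
  obtain ⟨Z, hZ, hZeq⟩ := (continuousOn_iff_isClosed.1 hG) (Ici c) isClosed_Ici
  have hSc : IsCompact ((fun p : Y × ℝ => G p.1 p.2) ⁻¹' Ici c ∩ (K ×ˢ Icc (0 : ℝ) T)) := by
    rw [hZeq, inter_comm]
    exact hcomp.inter_right hZ
  obtain ⟨⟨y₀, t₀⟩, hp, hmin⟩ := hSc.exists_isMinOn ⟨(y₁, t₁), h1.le, hy₁, ht₁⟩
    (continuous_snd.continuousOn)
  obtain ⟨hpc, hy₀, ht₀⟩ := hp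
  simp only [mem_preimage, mem_Ici] at hpc
  have hmin' : ∀ y ∈ K, ∀ t ∈ Icc 0 T, c ≤ G y t → t₀ ≤ t := fun y hy t ht h =>
    isMinOn_iff.1 hmin (y, t) ⟨h, hy, ht⟩
  have ht₀pos : 0 < t₀ := by
    rcases ht₀.1.lt_or_eq with h | h
    · exact h
    · simp only at h
      subst h
      exact absurd (h0 y₀ hy₀) (not_lt.2 hpc)
  have hlt : ∀ y ∈ K, ∀ t ∈ Ico 0 t₀, G y t < c := by
    intro y hy t ht
    by_contra h
    push Not at h
    exact absurd (hmin' y hy t ⟨ht.1, ht.2.le.trans ht₀.2⟩ h) (not_le.2 ht.2)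
  have hle : ∀ y ∈ K, ∀ t ∈ Icc 0 t₀, G y t ≤ c := by
    intro y hy t ht
    rcases ht.2.lt_or_eq with h | h
    · exact (hlt y hy t ⟨ht.1, h⟩).le
    · subst h
      have hcy : ContinuousOn (fun τ => G y τ) (Icc 0 T) :=
        hG.comp (f := fun τ => (y, τ)) (by fun_prop) (fun τ hτ => ⟨hy, hτ⟩)
      have := (hcy t ht₀).mono (Ico_subset_Icc_self.trans (Icc_subset_Icc_right ht₀.2) :
        Ico 0 t ⊆ Icc 0 T)
      have hne : (𝓝[Ico 0 t] t).NeBot := by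
        rw [← mem_closure_iff_nhdsWithin_neBot, closure_Ico ht₀pos.ne]
        exact ⟨ht₀pos.le, le_rfl⟩
      refine le_of_tendsto this ?_
      filter_upwards [self_mem_nhdsWithin] with τ hτ using (hlt y hy τ hτ).le
  have heq : G y₀ t₀ = c := le_antisymm (hle y₀ hy₀ t₀ ⟨ht₀pos.le, le_rfl⟩) hpc
  refine ⟨y₀, hy₀, t₀, ⟨ht₀pos, ?_⟩, heq, hle⟩
  rcases ht₀.2.lt_or_eq with h | h
  · exact h
  · exfalso
    have hT : t₁ ≤ t₀ := ht₁.2.trans h.ge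
    exact absurd (hle y₁ hy₁ t₁ ⟨ht₁.1, hT⟩) (not_le.2 h1)

theorem taylor_two_bound {g₀ g₁ g₂ : ℝ → ℝ} {K : ℝ}
    (h0 : ∀ s ∈ Icc (0 : ℝ) 1, HasDerivWithinAt g₀ (g₁ s) (Icc 0 1) s)
    (h1 : ∀ s ∈ Icc (0 : ℝ) 1, HasDerivWithinAt g₁ (g₂ s) (Icc 0 1) s)
    (hK : ∀ s ∈ Icc (0 : ℝ) 1, |g₂ s| ≤ K) :
    |g₀ 1 - g₀ 0 - g₁ 0| ≤ K := by
  have e1 : ∀ s ∈ Icc (0 : ℝ) 1, ‖g₁ s - g₁ 0‖ ≤ K := by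
    intro s hs
    have := Convex.norm_image_sub_le_of_norm_hasDerivWithin_le h1 hK (convex_Icc 0 1)
      (left_mem_Icc.2 zero_le_one) hs
    have hK0 : 0 ≤ K := (abs_nonneg _).trans (hK 0 (by simp))
    refine this.trans ?_
    rw [Real.norm_eq_abs, sub_zero, abs_of_nonneg hs.1]
    nlinarith [hs.2]
  have e2 := Convex.norm_image_sub_le_of_norm_hasDerivWithin_le
    (f := fun s => g₀ s - s * g₁ 0) (f' := fun s => g₁ s - 1 * g₁ 0) (C := K)
    (fun s hs => (h0 s hs).sub ((hasDerivWithinAt_id s _).mul_const _))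
    (by simpa using e1) (convex_Icc 0 1)
    (left_mem_Icc.2 zero_le_one) (right_mem_Icc.2 zero_le_one)
  have : g₀ 1 - g₀ 0 - g₁ 0 = g₀ 1 - 1 * g₁ 0 - (g₀ 0 - 0 * g₁ 0) := by ring
  rw [this]
  simpa using e2

theorem taylor_four_bound {g₀ g₁ g₂ g₃ g₄ : ℝ → ℝ} {K : ℝ}
    (h0 : ∀ s ∈ Icc (0 : ℝ) 1, HasDerivWithinAt g₀ (g₁ s) (Icc 0 1) s)
    (h1 : ∀ s ∈ Icc (0 : ℝ) 1, HasDerivWithinAt g₁ (g₂ s) (Icc 0 1) s)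
    (h2 : ∀ s ∈ Icc (0 : ℝ) 1, HasDerivWithinAt g₂ (g₃ s) (Icc 0 1) s)
    (h3 : ∀ s ∈ Icc (0 : ℝ) 1, HasDerivWithinAt g₃ (g₄ s) (Icc 0 1) s)
    (hK : ∀ s ∈ Icc (0 : ℝ) 1, |g₄ s| ≤ K) :
    |g₀ 1 - g₀ 0 - g₁ 0 - g₂ 0 / 2 - g₃ 0 / 6| ≤ K := by
  have hz : ∀ s : ℝ, HasDerivWithinAt (fun s : ℝ => s ^ 2 / 2 * g₃ 0) (s * g₃ 0) (Icc 0 1) s := by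
    intro s
    have : HasDerivAt (fun s : ℝ => s ^ 2 / 2 * g₃ 0) ((2 : ℕ) * s ^ (2 - 1) / 2 * g₃ 0) s :=
      ((hasDerivAt_pow 2 s).div_const 2).mul_const _
    exact this.hasDerivWithinAt.congr_deriv (by norm_num)
  have hz3 : ∀ s : ℝ, HasDerivWithinAt (fun s : ℝ => s ^ 3 / 6 * g₃ 0) (s ^ 2 / 2 * g₃ 0)
      (Icc 0 1) s := by
    intro s
    have : HasDerivAt (fun s : ℝ => s ^ 3 / 6 * g₃ 0) ((3 : ℕ) * s ^ (3 - 1) / 6 * g₃ 0) s :=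
      ((hasDerivAt_pow 3 s).div_const 6).mul_const _
    exact this.hasDerivWithinAt.congr_deriv (by push_cast; ring)
  have hz2 : ∀ s : ℝ, HasDerivWithinAt (fun s : ℝ => s ^ 2 / 2 * g₂ 0) (s * g₂ 0) (Icc 0 1) s := by
    intro s
    have : HasDerivAt (fun s : ℝ => s ^ 2 / 2 * g₂ 0) ((2 : ℕ) * s ^ (2 - 1) / 2 * g₂ 0) s :=
      ((hasDerivAt_pow 2 s).div_const 2).mul_const _
    exact this.hasDerivWithinAt.congr_deriv (by norm_num)
  have hid : ∀ (c s : ℝ), HasDerivWithinAt (fun s : ℝ => s * c) c (Icc 0 1) s := by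
    intro c s
    simpa using (hasDerivWithinAt_id s (Icc (0 : ℝ) 1)).mul_const c
  -- integrate twice by applying the second order bound to `g₂` and then to `g₀`
  have e2 : ∀ s ∈ Icc (0 : ℝ) 1, |g₂ s - g₂ 0 - s * g₃ 0| ≤ K := by
    intro s hs
    have e1 : ∀ r ∈ Icc (0 : ℝ) 1, ‖g₃ r - g₃ 0‖ ≤ K := by
      intro r hr
      have := Convex.norm_image_sub_le_of_norm_hasDerivWithin_le h3 hK (convex_Icc 0 1)
        (left_mem_Icc.2 zero_le_one) hr
      have hK0 : 0 ≤ K := (abs_nonneg _).trans (hK 0 (by simp))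
      refine this.trans ?_
      rw [Real.norm_eq_abs, sub_zero, abs_of_nonneg hr.1]
      nlinarith [hr.2]
    have := Convex.norm_image_sub_le_of_norm_hasDerivWithin_le
      (f := fun s => g₂ s - s * g₃ 0) (f' := fun s => g₃ s - g₃ 0) (C := K)
      (fun s hs => (h2 s hs).sub (hid _ s)) e1 (convex_Icc 0 1)
      (left_mem_Icc.2 zero_le_one) hs
    have hK0 : 0 ≤ K := (abs_nonneg _).trans (hK 0 (by simp))
    rw [Real.norm_eq_abs, Real.norm_eq_abs, sub_zero, abs_of_nonneg hs.1] at this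
    have h' : g₂ s - g₂ 0 - s * g₃ 0 = g₂ s - s * g₃ 0 - (g₂ 0 - 0 * g₃ 0) := by ring
    rw [h']
    refine this.trans ?_
    nlinarith [hs.2]
  have := taylor_two_bound (g₀ := fun s => g₀ s - s ^ 2 / 2 * g₂ 0 - s ^ 3 / 6 * g₃ 0)
    (g₁ := fun s => g₁ s - s * g₂ 0 - s ^ 2 / 2 * g₃ 0)
    (g₂ := fun s => g₂ s - g₂ 0 - s * g₃ 0) (K := K)
    (fun s hs => ((h0 s hs).sub (hz2 s)).sub (hz3 s))
    (fun s hs => ((h1 s hs).sub (hid _ s)).sub (hz s)) e2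
  convert this using 2
  norm_num
  ring

/-! ### Determinants of symmetric bilinear forms -/

/-- The quantities attached to a real symmetric matrix that are read off its eigenvalues. -/
theorem Matrix.IsHermitian.exists_eigenvalue_data {n : ℕ} {Y : Matrix (Fin n) (Fin n) ℝ}
    (hY : Y.IsHermitian) :
    ∃ y : Fin n → ℝ, (1 + Y).det = ∏ i, (1 + y i) ∧ Y.det = ∏ i, y i ∧ Y.trace = ∑ i, y i ∧
      ∑ k, ∑ l, Y k l ^ 2 = ∑ i, y i ^ 2 ∧
      ((∀ x : Fin n → ℝ, 0 ≤ x ⬝ᵥ Matrix.mulVec Y x) → ∀ i, 0 ≤ y i) := by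
  refine ⟨hY.eigenvalues, ?_, by simpa using hY.det_eq_prod_eigenvalues,
    by simpa using hY.trace_eq_sum_eigenvalues, ?_, ?_⟩
  · have h1 := Y.eval_charpoly (-1)
    rw [hY.charpoly_eq, Polynomial.eval_prod] at h1
    simp only [Polynomial.eval_sub, Polynomial.eval_X, Polynomial.eval_C, RCLike.ofReal_real_eq_id,
      id] at h1
    have h2 : (Matrix.scalar (Fin n) (-1 : ℝ) - Y) = -(1 + Y) := by
      rw [map_neg, map_one]; abel
    rw [h2, Matrix.det_neg] at h1
    have h3 : ∏ i, (-1 - hY.eigenvalues i) = (-1) ^ Fintype.card (Fin n) *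
        ∏ i, (1 + hY.eigenvalues i) := by
      rw [← Finset.card_univ, ← Finset.prod_const, ← Finset.prod_mul_distrib]
      exact Finset.prod_congr rfl fun i _ => by ring
    rw [h3] at h1
    exact (mul_left_cancel₀ (by simp) h1).symm
  · have h1 : (Y * Y).trace = ∑ k, ∑ l, Y k l ^ 2 := by
      simp only [Matrix.trace, Matrix.diag, Matrix.mul_apply]
      refine Finset.sum_congr rfl fun k _ => Finset.sum_congr rfl fun l _ => ?_
      have := hY.apply k l
      simp only [star_trivial] at this
      rw [this]; ring
    rw [← h1]
    have hs := hY.spectral_theorem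
    have h2 : Y * Y = Unitary.conjStarAlgAut ℝ _ hY.eigenvectorUnitary
        (Matrix.diagonal (RCLike.ofReal ∘ hY.eigenvalues) *
          Matrix.diagonal (RCLike.ofReal ∘ hY.eigenvalues)) := by
      rw [map_mul, ← hs]
    rw [h2, Unitary.conjStarAlgAut_apply, Matrix.trace_mul_cycle]
    simp [Matrix.diagonal_mul_diagonal, Matrix.trace_diagonal, sq]
  · intro h i
    rw [hY.eigenvalues_eq]
    simpa using h _

theorem sub_sq_le_log_one_add {y : ℝ} (hy : |y| ≤ 1 / 4) : y - y ^ 2 ≤ Real.log (1 + y) := by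
  have h := abs_le.1 hy
  have h1 : 0 < 1 + y := by linarith
  -- apply `1 - 1 / r ≤ log r` to `r = √(1 + y)`
  set r := √(1 + y) with hr
  have hr2 : r ^ 2 = 1 + y := Real.sq_sqrt h1.le
  have hr0 : 0 < r := Real.sqrt_pos.2 h1
  have hr1 : 43 / 50 ≤ r := by
    by_contra hc
    push Not at hc
    nlinarith [h.1]
  have h2 := Real.one_sub_inv_le_log_of_pos hr0
  have h3 : Real.log (1 + y) = 2 * Real.log r := by
    rw [← hr2, Real.log_pow]; norm_num
  rw [h3]
  refine le_trans ?_ (mul_le_mul_of_nonneg_left h2 zero_le_two)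
  have hy' : y = r ^ 2 - 1 := by linarith
  rw [hy', ← sub_nonneg]
  have : 2 * (1 - r⁻¹) - (r ^ 2 - 1 - (r ^ 2 - 1) ^ 2) =
      (r - 1) ^ 2 * (r ^ 3 + 2 * r ^ 2 - 2) / r := by
    field_simp; ring
  rw [this]
  have h4 : 0 ≤ r ^ 3 + 2 * r ^ 2 - 2 := by nlinarith [mul_pos hr0 hr0, sq_nonneg (r - 43 / 50)]
  positivity

theorem one_add_sum_le_prod_one_add {ι : Type*} (s : Finset ι) (y : ι → ℝ) (hy : ∀ i ∈ s, 0 ≤ y i) :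
    1 + ∑ i ∈ s, y i ≤ ∏ i ∈ s, (1 + y i) := by
  classical
  induction s using Finset.induction_on with
  | empty => simp
  | insert a s ha ih =>
    rw [Finset.sum_insert ha, Finset.prod_insert ha]
    have h1 := ih fun i hi => hy i (Finset.mem_insert_of_mem hi)
    have h2 := hy a (Finset.mem_insert_self _ _)
    have h3 : 0 ≤ ∑ i ∈ s, y i := Finset.sum_nonneg fun i hi => hy i (Finset.mem_insert_of_mem hi)
    nlinarith

/-- A lower bound of second order for the determinant near the identity. The quadratic term is
weaker than the one of the Taylor expansion but is attached to a one-sided bound. -/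
theorem Matrix.IsHermitian.le_det_one_add {n : ℕ} {Y : Matrix (Fin n) (Fin n) ℝ}
    (hY : Y.IsHermitian) (hs : ∑ k, ∑ l, Y k l ^ 2 ≤ 1 / 16) :
    1 + Y.trace - ∑ k, ∑ l, Y k l ^ 2 ≤ (1 + Y).det := by
  obtain ⟨y, h1, -, h3, h4, -⟩ := hY.exists_eigenvalue_data
  have hy : ∀ i, |y i| ≤ 1 / 4 := by
    intro i
    have : y i ^ 2 ≤ ∑ i, y i ^ 2 :=
      Finset.single_le_sum (f := fun i => y i ^ 2) (fun _ _ => sq_nonneg _) (Finset.mem_univ i)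
    refine abs_le_of_sq_le_sq (by rw [h4] at hs; linarith) (by norm_num)
  have hpos : ∀ i, 0 < 1 + y i := fun i => by have := (abs_le.1 (hy i)).1; linarith
  rw [h1, h3, h4]
  have h5 : ∏ i, (1 + y i) = Real.exp (∑ i, Real.log (1 + y i)) := by
    rw [Real.exp_sum]
    exact Finset.prod_congr rfl fun i _ => (Real.exp_log (hpos i)).symm
  rw [h5]
  have h6 := Real.add_one_le_exp (∑ i, Real.log (1 + y i))
  have h7 : ∑ i, (y i - y i ^ 2) ≤ ∑ i, Real.log (1 + y i) :=
    Finset.sum_le_sum fun i _ => sub_sq_le_log_one_add (hy i)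
  rw [Finset.sum_sub_distrib] at h7
  linarith

/-- For `Y ≥ 0`, the increment of the determinant controls the trace, hence also `det Y`. -/
theorem Matrix.IsHermitian.one_add_trace_le_det {n : ℕ} {Y : Matrix (Fin n) (Fin n) ℝ}
    (hY : Y.IsHermitian) (h : ∀ x : Fin n → ℝ, 0 ≤ x ⬝ᵥ Matrix.mulVec Y x) :
    1 + Y.trace ≤ (1 + Y).det ∧ 0 ≤ Y.trace ∧ Y.det ≤ Y.trace ^ n := by
  obtain ⟨y, h1, h2, h3, -, h5⟩ := hY.exists_eigenvalue_data
  have hy := h5 h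
  rw [h1, h2, h3]
  refine ⟨one_add_sum_le_prod_one_add _ _ fun i _ => hy i, Finset.sum_nonneg fun i _ => hy i, ?_⟩
  calc ∏ i, y i ≤ ∏ _i : Fin n, ∑ j, y j :=
        Finset.prod_le_prod (fun i _ => hy i) fun i _ =>
          Finset.single_le_sum (fun j _ => hy j) (Finset.mem_univ i)
    _ = _ := by simp

/-- The determinant of the matrix of a bilinear form on Euclidean space. -/
noncomputable def formDet {n : ℕ} (H : LinearMap.BilinForm ℝ (EuclideanSpace ℝ (Fin n))) : ℝ :=
  (LinearMap.BilinForm.toMatrix (EuclideanSpace.basisFun (Fin n) ℝ).toBasis H).det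

theorem formDet_eq {n : ℕ} (H : LinearMap.BilinForm ℝ (EuclideanSpace ℝ (Fin n)))
    (b : OrthonormalBasis (Fin n) ℝ (EuclideanSpace ℝ (Fin n))) :
    formDet H = (Matrix.of fun k l => H (b k) (b l)).det := by
  have h : (Matrix.of fun k l => H (b k) (b l)) = LinearMap.BilinForm.toMatrix b.toBasis H := by
    ext k l; simp [LinearMap.BilinForm.toMatrix_apply]
  rw [h, formDet, ← LinearMap.BilinForm.toMatrix_mul_basis_toMatrix
    (EuclideanSpace.basisFun (Fin n) ℝ).toBasis b.toBasis, Matrix.det_mul, Matrix.det_mul,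
    Matrix.det_transpose]
  have := (EuclideanSpace.basisFun (Fin n) ℝ).det_to_matrix_orthonormalBasis_real b
  rw [Module.Basis.det_apply] at this
  rw [OrthonormalBasis.coe_toBasis]
  rcases this with h | h <;> rw [h] <;> ring

/-- An orthonormal basis diagonalizing a bilinear form, with the diagonal entries. -/
structure Diagonalizes {n : ℕ} (H : LinearMap.BilinForm ℝ (EuclideanSpace ℝ (Fin n)))
    (b : OrthonormalBasis (Fin n) ℝ (EuclideanSpace ℝ (Fin n))) (lam : Fin n → ℝ) : Prop where
  apply_eq : ∀ k w, H (b k) w = lam k * inner ℝ (b k) w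
  symm : ∀ v w, H v w = H w v

theorem Diagonalizes.basis_apply {n : ℕ} {H : LinearMap.BilinForm ℝ (EuclideanSpace ℝ (Fin n))}
    {b : OrthonormalBasis (Fin n) ℝ (EuclideanSpace ℝ (Fin n))} {lam : Fin n → ℝ}
    (h : Diagonalizes H b lam) (k l : Fin n) : H (b k) (b l) = if k = l then lam k else 0 := by
  rw [h.apply_eq, b.inner_eq_ite]
  split_ifs <;> simp

theorem Diagonalizes.formDet_eq_prod {n : ℕ}
    {H : LinearMap.BilinForm ℝ (EuclideanSpace ℝ (Fin n))}
    {b : OrthonormalBasis (Fin n) ℝ (EuclideanSpace ℝ (Fin n))} {lam : Fin n → ℝ}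
    (h : Diagonalizes H b lam) : formDet H = ∏ k, lam k := by
  rw [formDet_eq H b, ← Matrix.det_diagonal]
  congr 1
  ext k l
  simp [h.basis_apply, Matrix.diagonal_apply]

theorem exists_diagonalizes {n : ℕ} (H : LinearMap.BilinForm ℝ (EuclideanSpace ℝ (Fin n)))
    (hs : ∀ v w, H v w = H w v) : ∃ b lam, Diagonalizes H b lam := by
  set A := LinearMap.BilinForm.toMatrix (EuclideanSpace.basisFun (Fin n) ℝ).toBasis H with hA
  have hAh : A.IsHermitian := by
    ext i j
    simp [hA, LinearMap.BilinForm.toMatrix_apply, hs]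
  refine ⟨hAh.eigenvectorBasis, hAh.eigenvalues, ⟨fun k w => ?_, hs⟩⟩
  rw [hs, LinearMap.BilinForm.apply_eq_dotProduct_toMatrix_mulVec
    (EuclideanSpace.basisFun (Fin n) ℝ).toBasis]
  have h1 : ∀ v : EuclideanSpace ℝ (Fin n),
      ⇑((EuclideanSpace.basisFun (Fin n) ℝ).toBasis.repr v) = ⇑v := by
    intro v; ext i; simp
  rw [h1, h1, ← hA, hAh.mulVec_eigenvectorBasis, dotProduct_smul, smul_eq_mul,
    EuclideanSpace.inner_eq_star_dotProduct]
  simp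

theorem form_apply_sum {n : ℕ} (B : LinearMap.BilinForm ℝ (EuclideanSpace ℝ (Fin n)))
    (b : OrthonormalBasis (Fin n) ℝ (EuclideanSpace ℝ (Fin n))) (c : Fin n → ℝ) :
    B (∑ l, c l • b l) (∑ l, c l • b l) = ∑ k, ∑ l, c k * c l * B (b k) (b l) := by
  simp only [map_sum, LinearMap.sum_apply, map_smul, LinearMap.smul_apply, smul_eq_mul,
    Finset.mul_sum]
  rw [Finset.sum_comm]
  refine Finset.sum_congr rfl fun k _ => Finset.sum_congr rfl fun l _ => ?_
  ring

theorem Diagonalizes.apply_sum {n : ℕ} {H : LinearMap.BilinForm ℝ (EuclideanSpace ℝ (Fin n))}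
    {b : OrthonormalBasis (Fin n) ℝ (EuclideanSpace ℝ (Fin n))} {lam : Fin n → ℝ}
    (h : Diagonalizes H b lam) (c : Fin n → ℝ) :
    H (∑ l, c l • b l) (∑ l, c l • b l) = ∑ l, lam l * c l ^ 2 := by
  simp only [map_sum, LinearMap.sum_apply, map_smul, LinearMap.smul_apply, h.basis_apply,
    smul_eq_mul]
  refine Finset.sum_congr rfl fun l _ => ?_
  rw [Finset.sum_eq_single l (fun k _ hk => by simp [hk]) (by simp)]
  simp; ring

/-- Normalized difference of a form with a positive diagonalized form `H₀`. -/
noncomputable def relMatrix {n : ℕ} (H₀ H : LinearMap.BilinForm ℝ (EuclideanSpace ℝ (Fin n)))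
    (b : OrthonormalBasis (Fin n) ℝ (EuclideanSpace ℝ (Fin n))) (lam : Fin n → ℝ) :
    Matrix (Fin n) (Fin n) ℝ :=
  Matrix.of fun k l => (H (b k) (b l) - H₀ (b k) (b l)) / (√(lam k) * √(lam l))

section relMatrix

variable {n : ℕ} {H₀ H : LinearMap.BilinForm ℝ (EuclideanSpace ℝ (Fin n))}
  {b : OrthonormalBasis (Fin n) ℝ (EuclideanSpace ℝ (Fin n))} {lam : Fin n → ℝ}

theorem relMatrix_isHermitian (h : Diagonalizes H₀ b lam) (hs : ∀ v w, H v w = H w v) :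
    (relMatrix H₀ H b lam).IsHermitian := by
  ext k l
  simp [relMatrix, hs (b k) (b l), h.symm (b k) (b l), mul_comm]

theorem trace_relMatrix (hl : ∀ k, 0 < lam k) :
    (relMatrix H₀ H b lam).trace = ∑ k, (H (b k) (b k) - H₀ (b k) (b k)) / lam k := by
  simp only [Matrix.trace, Matrix.diag, relMatrix, Matrix.of_apply]
  exact Finset.sum_congr rfl fun k _ => by rw [Real.mul_self_sqrt (hl k).le]

theorem relMatrix_sq (hl : ∀ k, 0 < lam k) (k l : Fin n) :
    relMatrix H₀ H b lam k l ^ 2 = (H (b k) (b l) - H₀ (b k) (b l)) ^ 2 / (lam k * lam l) := by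
  simp only [relMatrix, Matrix.of_apply, div_pow, mul_pow]
  rw [Real.sq_sqrt (hl k).le, Real.sq_sqrt (hl l).le]

/-- Conjugation by the diagonal matrix of the `√(lam k)`. -/
theorem det_conj_sqrt (hl : ∀ k, 0 < lam k) (M : Matrix (Fin n) (Fin n) ℝ) :
    (Matrix.of fun k l => √(lam k) * M k l * √(lam l)).det = (∏ k, lam k) * M.det := by
  have : (Matrix.of fun k l => √(lam k) * M k l * √(lam l)) =
      Matrix.diagonal (fun k => √(lam k)) * M * Matrix.diagonal (fun k => √(lam k)) := by
    ext k l
    simp [Matrix.diagonal_mul, Matrix.mul_diagonal]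
  rw [this, Matrix.det_mul, Matrix.det_mul, Matrix.det_diagonal, mul_comm, ← mul_assoc,
    ← Finset.prod_mul_distrib]
  congr 1
  exact Finset.prod_congr rfl fun k _ => Real.mul_self_sqrt (hl k).le

theorem formDet_eq_relMatrix (h : Diagonalizes H₀ b lam) (hl : ∀ k, 0 < lam k) :
    formDet H = (∏ k, lam k) * (1 + relMatrix H₀ H b lam).det := by
  rw [← det_conj_sqrt hl, formDet_eq H b]
  congr 1
  ext k l
  have h1 : √(lam k) ≠ 0 := (Real.sqrt_pos.2 (hl k)).ne'
  have h2 : √(lam l) ≠ 0 := (Real.sqrt_pos.2 (hl l)).ne'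
  simp only [Matrix.of_apply, Matrix.add_apply, relMatrix, h.basis_apply, Matrix.one_apply]
  split_ifs with hkl
  · subst hkl
    field_simp
    rw [Real.sq_sqrt (hl k).le]; ring
  · field_simp; ring

theorem formDet_sub_eq_relMatrix (hl : ∀ k, 0 < lam k) :
    formDet (H - H₀) = (∏ k, lam k) * (relMatrix H₀ H b lam).det := by
  rw [← det_conj_sqrt hl, formDet_eq _ b]
  congr 1
  ext k l
  have h1 : √(lam k) ≠ 0 := (Real.sqrt_pos.2 (hl k)).ne'
  have h2 : √(lam l) ≠ 0 := (Real.sqrt_pos.2 (hl l)).ne'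
  simp only [Matrix.of_apply, relMatrix, LinearMap.sub_apply]
  field_simp

theorem relMatrix_nonneg (hle : ∀ v, H₀ v v ≤ H v v) (x : Fin n → ℝ) :
    0 ≤ x ⬝ᵥ Matrix.mulVec (relMatrix H₀ H b lam) x := by
  have := hle (∑ k, (x k / √(lam k)) • b k)
  rw [← sub_nonneg, ← LinearMap.sub_apply, ← LinearMap.sub_apply, form_apply_sum] at this
  refine this.trans_eq ?_
  simp only [dotProduct, Matrix.mulVec, relMatrix, Matrix.of_apply, Finset.mul_sum,
    LinearMap.sub_apply]
  refine Finset.sum_congr rfl fun k _ => Finset.sum_congr rfl fun l _ => ?_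
  ring

/-- Second order lower bound for the determinant near a positive definite form. -/
theorem Diagonalizes.le_formDet (h : Diagonalizes H₀ b lam) (hl : ∀ k, 0 < lam k)
    (hs : ∀ v w, H v w = H w v)
    (hsmall : ∑ k, ∑ l, (H (b k) (b l) - H₀ (b k) (b l)) ^ 2 / (lam k * lam l) ≤ 1 / 16) :
    (∏ k, lam k) * (1 + ∑ k, (H (b k) (b k) - H₀ (b k) (b k)) / lam k -
      ∑ k, ∑ l, (H (b k) (b l) - H₀ (b k) (b l)) ^ 2 / (lam k * lam l)) ≤ formDet H := by
  rw [formDet_eq_relMatrix h hl]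
  have h1 := (relMatrix_isHermitian h hs).le_det_one_add
  simp only [relMatrix_sq hl, trace_relMatrix hl] at h1
  exact mul_le_mul_of_nonneg_left (h1 hsmall) (Finset.prod_nonneg fun k _ => (hl k).le)

/-- The increment of the determinant between a positive form and a larger form. -/
theorem Diagonalizes.formDet_increment (h : Diagonalizes H₀ b lam) (hl : ∀ k, 0 < lam k)
    (hs : ∀ v w, H v w = H w v) (hle : ∀ v, H₀ v v ≤ H v v) :
    formDet H₀ ≤ formDet H ∧
      formDet H₀ ^ n * formDet (H - H₀) ≤ formDet H₀ * (formDet H - formDet H₀) ^ n := by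
  have h1 := (relMatrix_isHermitian h hs).one_add_trace_le_det (relMatrix_nonneg hle)
  obtain ⟨h1, h2, h3⟩ := h1
  have hP : 0 < ∏ k, lam k := Finset.prod_pos fun k _ => hl k
  rw [formDet_sub_eq_relMatrix hl (b := b), h.formDet_eq_prod,
    formDet_eq_relMatrix (H := H) h hl]
  set P := ∏ k, lam k
  set R := relMatrix H₀ H b lam
  constructor
  · nlinarith
  · have h4 : P * (1 + R).det - P = P * ((1 + R).det - 1) := by ring
    have h5 : R.det ≤ ((1 + R).det - 1) ^ n :=
      h3.trans (pow_le_pow_left₀ h2 (by linarith) n)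
    rw [h4, mul_pow]
    calc P ^ n * (P * R.det) = (P * P ^ n) * R.det := by ring
      _ ≤ (P * P ^ n) * ((1 + R).det - 1) ^ n := mul_le_mul_of_nonneg_left h5 (by positivity)
      _ = _ := by ring

end relMatrix

theorem Diagonalizes.nonneg {n : ℕ} {H : LinearMap.BilinForm ℝ (EuclideanSpace ℝ (Fin n))}
    {b : OrthonormalBasis (Fin n) ℝ (EuclideanSpace ℝ (Fin n))} {lam : Fin n → ℝ}
    (h : Diagonalizes H b lam) (hn : ∀ v, 0 ≤ H v v) (k : Fin n) : 0 ≤ lam k := by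
  have := hn (b k)
  rwa [h.basis_apply, if_pos rfl] at this

theorem Diagonalizes.pos {n : ℕ} {H : LinearMap.BilinForm ℝ (EuclideanSpace ℝ (Fin n))}
    {b : OrthonormalBasis (Fin n) ℝ (EuclideanSpace ℝ (Fin n))} {lam : Fin n → ℝ}
    (h : Diagonalizes H b lam) (hn : ∀ v, 0 ≤ H v v) (hd : 0 < formDet H) (k : Fin n) :
    0 < lam k := by
  refine (h.nonneg hn k).lt_of_ne fun h0 => hd.ne' ?_
  rw [h.formDet_eq_prod]
  exact Finset.prod_eq_zero (Finset.mem_univ k) h0.symm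

theorem formDet_nonneg {n : ℕ} {H : LinearMap.BilinForm ℝ (EuclideanSpace ℝ (Fin n))}
    (hs : ∀ v w, H v w = H w v) (hn : ∀ v, 0 ≤ H v v) : 0 ≤ formDet H := by
  obtain ⟨b, lam, h⟩ := exists_diagonalizes H hs
  rw [h.formDet_eq_prod]
  exact Finset.prod_nonneg fun k _ => h.nonneg hn k

theorem formDet_mono {n : ℕ} {H₀ H : LinearMap.BilinForm ℝ (EuclideanSpace ℝ (Fin n))}
    (hs₀ : ∀ v w, H₀ v w = H₀ w v) (hs : ∀ v w, H v w = H w v) (hn : ∀ v, 0 ≤ H₀ v v)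
    (hle : ∀ v, H₀ v v ≤ H v v) : formDet H₀ ≤ formDet H := by
  obtain ⟨b, lam, h⟩ := exists_diagonalizes H₀ hs₀
  rcases (formDet_nonneg hs₀ hn).eq_or_lt with h0 | h0
  · rw [← h0]
    exact formDet_nonneg hs fun v => (hn v).trans (hle v)
  · exact (h.formDet_increment (h.pos hn h0) hs hle).1

/-- The quadratic polynomial in the entries that touches the determinant from below. -/
theorem eventually_le_formDet {n : ℕ} {H : ℝ → LinearMap.BilinForm ℝ (EuclideanSpace ℝ (Fin n))}
    {b : OrthonormalBasis (Fin n) ℝ (EuclideanSpace ℝ (Fin n))} {lam : Fin n → ℝ} {s₀ : ℝ}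
    (hd : Diagonalizes (H s₀) b lam) (hl : ∀ k, 0 < lam k)
    (hs : ∀ᶠ s in 𝓝 s₀, ∀ v w, H s v w = H s w v)
    (hc : ∀ k l, ContinuousAt (fun s => H s (b k) (b l)) s₀) :
    ∀ᶠ s in 𝓝 s₀, (∏ k, lam k) * (1 + ∑ k, (H s (b k) (b k) - H s₀ (b k) (b k)) / lam k -
      ∑ k, ∑ l, (H s (b k) (b l) - H s₀ (b k) (b l)) ^ 2 / (lam k * lam l)) ≤ formDet (H s) := by
  have h1 : ContinuousAt (fun s => ∑ k, ∑ l,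
      (H s (b k) (b l) - H s₀ (b k) (b l)) ^ 2 / (lam k * lam l)) s₀ := by
    refine tendsto_finsetSum _ fun k _ => tendsto_finsetSum _ fun l _ => ?_
    exact (((hc k l).sub continuousAt_const).pow 2).div_const _
  have h2 := h1.eventually_lt (continuousAt_const (y := (1 / 16 : ℝ))) (by simp)
  filter_upwards [hs, h2] with s h3 h4
  exact hd.le_formDet hl h3 h4.le

/-- Jacobi's formula for the first derivative of the determinant at a positive form. -/
theorem deriv_formDet {n : ℕ} {H : ℝ → LinearMap.BilinForm ℝ (EuclideanSpace ℝ (Fin n))}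
    {b : OrthonormalBasis (Fin n) ℝ (EuclideanSpace ℝ (Fin n))} {lam : Fin n → ℝ} {s₀ : ℝ}
    (hd : Diagonalizes (H s₀) b lam) (hl : ∀ k, 0 < lam k)
    (hs : ∀ᶠ s in 𝓝 s₀, ∀ v w, H s v w = H s w v) {D : Fin n → Fin n → ℝ}
    (hD : ∀ k l, HasDerivAt (fun s => H s (b k) (b l)) (D k l) s₀) {F' : ℝ}
    (hF : HasDerivAt (fun s => formDet (H s)) F' s₀) :
    F' = formDet (H s₀) * ∑ k, D k k / lam k := by
  have hev := eventually_le_formDet hd hl hs fun k l => (hD k l).continuousAt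
  have hq : HasDerivAt (fun s => (∏ k, lam k) *
      (1 + ∑ k, (H s (b k) (b k) - H s₀ (b k) (b k)) / lam k -
      ∑ k, ∑ l, (H s (b k) (b l) - H s₀ (b k) (b l)) ^ 2 / (lam k * lam l)))
      ((∏ k, lam k) * (∑ k, D k k / lam k - ∑ k, ∑ l,
        (2 : ℕ) * (H s₀ (b k) (b l) - H s₀ (b k) (b l)) ^ (2 - 1) * D k l / (lam k * lam l)))
      s₀ := by
    refine HasDerivAt.const_mul _ (HasDerivAt.sub (HasDerivAt.const_add _ ?_) ?_)
    · exact HasDerivAt.fun_sum fun k _ => ((hD k k).sub_const _).div_const _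
    · exact HasDerivAt.fun_sum fun k _ => HasDerivAt.fun_sum fun l _ =>
        (((hD k l).sub_const _).pow 2).div_const _
  have hmin : IsLocalMin (fun s => formDet (H s) - (∏ k, lam k) *
      (1 + ∑ k, (H s (b k) (b k) - H s₀ (b k) (b k)) / lam k -
      ∑ k, ∑ l, (H s (b k) (b l) - H s₀ (b k) (b l)) ^ 2 / (lam k * lam l))) s₀ := by
    filter_upwards [hev] with s h
    simp only [sub_self, zero_div, Finset.sum_const_zero, add_zero, mul_one, ne_eq,
      OfNat.ofNat_ne_zero, not_false_eq_true, zero_pow, sub_zero, hd.formDet_eq_prod]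
    linarith
  have := hmin.hasDerivAt_eq_zero (hF.sub hq)
  rw [hd.formDet_eq_prod]
  simp only [sub_self, Nat.add_one_sub_one, pow_one, mul_zero, zero_mul, zero_div,
    Finset.sum_const_zero, sub_zero] at this
  linarith

/-- One-sided bound for the second derivative of the determinant at a positive form. It loses the
nonnegative terms `(tr (A⁻¹ A'))² + tr (A⁻¹ A' A⁻¹ A')`. -/
theorem second_deriv_formDet_ge {n : ℕ}
    {H : ℝ → LinearMap.BilinForm ℝ (EuclideanSpace ℝ (Fin n))}
    {b : OrthonormalBasis (Fin n) ℝ (EuclideanSpace ℝ (Fin n))} {lam : Fin n → ℝ} {s₀ : ℝ}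
    (hd : Diagonalizes (H s₀) b lam) (hl : ∀ k, 0 < lam k)
    (hs : ∀ᶠ s in 𝓝 s₀, ∀ v w, H s v w = H s w v)
    {D : ℝ → Fin n → Fin n → ℝ} {D₂ : Fin n → Fin n → ℝ}
    (hD : ∀ k l, ∀ᶠ s in 𝓝 s₀, HasDerivAt (fun s => H s (b k) (b l)) (D s k l) s)
    (hD₂ : ∀ k l, HasDerivAt (fun s => D s k l) (D₂ k l) s₀) {F' : ℝ → ℝ} {F₂ : ℝ}
    (hF : ∀ᶠ s in 𝓝 s₀, HasDerivAt (fun s => formDet (H s)) (F' s) s)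
    (hF₂ : HasDerivAt F' F₂ s₀) :
    formDet (H s₀) * (∑ k, D₂ k k / lam k - 2 * ∑ k, ∑ l, D s₀ k l ^ 2 / (lam k * lam l)) ≤ F₂ := by
  have hD0 : ∀ k l, HasDerivAt (fun s => H s (b k) (b l)) (D s₀ k l) s₀ := fun k l =>
    (hD k l).self_of_nhds
  have hev := eventually_le_formDet hd hl hs fun k l => (hD0 k l).continuousAt
  have hq : ∀ᶠ s in 𝓝 s₀, HasDerivAt (fun s => (∏ k, lam k) *
      (1 + ∑ k, (H s (b k) (b k) - H s₀ (b k) (b k)) / lam k -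
      ∑ k, ∑ l, (H s (b k) (b l) - H s₀ (b k) (b l)) ^ 2 / (lam k * lam l)))
      ((∏ k, lam k) * (∑ k, D s k k / lam k - ∑ k, ∑ l,
        (2 : ℕ) * (H s (b k) (b l) - H s₀ (b k) (b l)) ^ (2 - 1) * D s k l / (lam k * lam l)))
      s := by
    have hD' : ∀ᶠ s in 𝓝 s₀, ∀ k l, HasDerivAt (fun s => H s (b k) (b l)) (D s k l) s :=
      Filter.eventually_all.2 fun k => Filter.eventually_all.2 fun l => hD k l
    filter_upwards [hD'] with s hD
    refine HasDerivAt.const_mul _ (HasDerivAt.sub (HasDerivAt.const_add _ ?_) ?_)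
    · exact HasDerivAt.fun_sum fun k _ => ((hD k k).sub_const _).div_const _
    · exact HasDerivAt.fun_sum fun k _ => HasDerivAt.fun_sum fun l _ =>
        (((hD k l).sub_const _).pow 2).div_const _
  have hq₂ : HasDerivAt (fun s => (∏ k, lam k) * (∑ k, D s k k / lam k - ∑ k, ∑ l,
        (2 : ℕ) * (H s (b k) (b l) - H s₀ (b k) (b l)) ^ (2 - 1) * D s k l / (lam k * lam l)))
      ((∏ k, lam k) * (∑ k, D₂ k k / lam k - ∑ k, ∑ l,
        (2 * D s₀ k l * D s₀ k l + (2 * (H s₀ (b k) (b l) - H s₀ (b k) (b l))) * D₂ k l)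
          / (lam k * lam l))) s₀ := by
    refine HasDerivAt.const_mul _ (HasDerivAt.sub ?_ ?_)
    · exact HasDerivAt.fun_sum fun k _ => (hD₂ k k).div_const _
    · refine HasDerivAt.fun_sum fun k _ => HasDerivAt.fun_sum fun l _ => HasDerivAt.div_const ?_ _
      simp only [Nat.add_one_sub_one, pow_one, Nat.cast_ofNat]
      exact (((hD0 k l).sub_const _).const_mul 2).mul (hD₂ k l)
  have hmin : IsLocalMin (fun s => formDet (H s) - (∏ k, lam k) *
      (1 + ∑ k, (H s (b k) (b k) - H s₀ (b k) (b k)) / lam k -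
      ∑ k, ∑ l, (H s (b k) (b l) - H s₀ (b k) (b l)) ^ 2 / (lam k * lam l))) s₀ := by
    filter_upwards [hev] with s h
    simp only [sub_self, zero_div, Finset.sum_const_zero, add_zero, mul_one, ne_eq,
      OfNat.ofNat_ne_zero, not_false_eq_true, zero_pow, sub_zero, hd.formDet_eq_prod]
    linarith
  have := nonneg_second_deriv_of_isLocalMin (by
    filter_upwards [hF, hq] with s h1 h2 using h1.sub h2) (hF₂.sub hq₂) hmin
  rw [hd.formDet_eq_prod]
  have h5 : ∑ k, ∑ l, (2 * D s₀ k l * D s₀ k l +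
      (2 * (H s₀ (b k) (b l) - H s₀ (b k) (b l))) * D₂ k l) / (lam k * lam l) =
      2 * ∑ k, ∑ l, D s₀ k l ^ 2 / (lam k * lam l) := by
    simp only [Finset.mul_sum]
    refine Finset.sum_congr rfl fun k _ => Finset.sum_congr rfl fun l _ => ?_
    ring
  rw [h5] at this
  linarith

/-! ### Higher derivatives along lines -/

section Jets

variable {E : Type*} [NormedAddCommGroup E] [NormedSpace ℝ E] {S : Set E} {f : E → ℝ}
  {N : WithTop ℕ∞}

theorem hasDerivWithinAt_iteratedFDerivWithin_line (hS : UniqueDiffOn ℝ S)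
    (hf : ContDiffOn ℝ N f S) {k : ℕ} (hk : (k : WithTop ℕ∞) < N) {I : Set ℝ} {x v : E}
    (hI : ∀ s ∈ I, x + s • v ∈ S) {s : ℝ} (hs : s ∈ I) (m : Fin k → E) :
    HasDerivWithinAt (fun r : ℝ => iteratedFDerivWithin ℝ k f S (x + r • v) m)
      (iteratedFDerivWithin ℝ (k + 1) f S (x + s • v) (Fin.cons v m)) I s := by
  have h1 := (hf.differentiableOn_iteratedFDerivWithin hk hS _ (hI s hs)).hasFDerivWithinAt
  have h2 : HasDerivWithinAt (fun r : ℝ => x + r • v) v I s := by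
    simpa using (((hasDerivAt_id s).smul_const v).const_add x).hasDerivWithinAt
  have h3 := h1.comp_hasDerivWithinAt s h2 hI
  have h4 := ((ContinuousMultilinearMap.apply ℝ (fun _ : Fin k => E) ℝ m).hasFDerivAt
    (x := iteratedFDerivWithin ℝ k f S (x + s • v))).comp_hasDerivWithinAt s h3
  rw [iteratedFDerivWithin_succ_apply_left]
  exact h4

theorem hasDerivAt_iteratedFDerivWithin_line (hS : UniqueDiffOn ℝ S)
    (hf : ContDiffOn ℝ N f S) {k : ℕ} (hk : (k : WithTop ℕ∞) < N) {x v : E} {s : ℝ}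
    (hx : x + s • v ∈ interior S) (m : Fin k → E) :
    HasDerivAt (fun r : ℝ => iteratedFDerivWithin ℝ k f S (x + r • v) m)
      (iteratedFDerivWithin ℝ (k + 1) f S (x + s • v) (Fin.cons v m)) s := by
  have hc : Continuous fun r : ℝ => x + r • v := by fun_prop
  have hI : (fun r : ℝ => x + r • v) ⁻¹' interior S ∈ 𝓝 s :=
    hc.continuousAt.preimage_mem_nhds (isOpen_interior.mem_nhds hx)
  exact (hasDerivWithinAt_iteratedFDerivWithin_line hS hf hk
    (I := (fun r : ℝ => x + r • v) ⁻¹' interior S)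
    (fun r hr => interior_subset hr) hx m).hasDerivAt hI

theorem eventually_line_mem_interior {x : E} (hx : x ∈ interior S) (v : E) :
    ∀ᶠ s : ℝ in 𝓝 0, x + s • v ∈ interior S := by
  have hc : Continuous fun r : ℝ => x + r • v := by fun_prop
  exact hc.continuousAt.preimage_mem_nhds (isOpen_interior.mem_nhds (by simpa using hx))

theorem iteratedFDerivWithin_succ_eq_fderivWithin (hS : UniqueDiffOn ℝ S)
    (hf : ContDiffOn ℝ N f S) {k : ℕ} (hk : (k : WithTop ℕ∞) < N) {x : E} (hx : x ∈ S)
    (v : E) (m : Fin k → E) :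
    iteratedFDerivWithin ℝ (k + 1) f S x (Fin.cons v m) =
      fderivWithin ℝ (fun y => iteratedFDerivWithin ℝ k f S y m) S x v := by
  have h1 := (hf.differentiableOn_iteratedFDerivWithin hk hS _ hx).hasFDerivWithinAt
  have h4 := ((ContinuousMultilinearMap.apply ℝ (fun _ : Fin k => E) ℝ m).hasFDerivAt
    (x := iteratedFDerivWithin ℝ k f S x)).comp_hasFDerivWithinAt x h1
  have h5 := h4.fderivWithin (hS x hx)
  rw [iteratedFDerivWithin_succ_apply_left]
  change _ = fderivWithin ℝ (⇑(ContinuousMultilinearMap.apply ℝ (fun _ : Fin k => E) ℝ m) ∘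
    iteratedFDerivWithin ℝ k f S) S x v
  rw [h5]
  simp

/-- The two outermost directions of an iterated derivative may be exchanged. -/
theorem iteratedFDerivWithin_swap (hS : UniqueDiffOn ℝ S) (hcl : S ⊆ closure (interior S))
    (hf : ContDiffOn ℝ N f S) {k : ℕ} (hk : ((k + 2 : ℕ) : WithTop ℕ∞) ≤ N) {x : E} (hx : x ∈ S)
    (v w : E) (m : Fin k → E) :
    iteratedFDerivWithin ℝ (k + 2) f S x (Fin.cons v (Fin.cons w m)) =
      iteratedFDerivWithin ℝ (k + 2) f S x (Fin.cons w (Fin.cons v m)) := by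
  have hk0 : (k : WithTop ℕ∞) < N := lt_of_lt_of_le
    (by exact_mod_cast (show k < k + 2 by omega)) hk
  have hk1 : ((k + 1 : ℕ) : WithTop ℕ∞) < N := lt_of_lt_of_le
    (by exact_mod_cast Nat.lt_succ_self _) hk
  -- reduce to the scalar function `g y = D^k f (y) m`
  set g : E → ℝ := fun y => iteratedFDerivWithin ℝ k f S y m with hg
  have hgC : ContDiffOn ℝ 2 g S := by
    have h1 : ContDiffOn ℝ 2 (iteratedFDerivWithin ℝ k f S) S := by
      refine fun y hy => (hf y hy).iteratedFDerivWithin_right hS ?_ hy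
      refine le_trans (le_of_eq ?_) hk
      push_cast; rw [add_comm]
    exact (ContinuousMultilinearMap.apply ℝ (fun _ : Fin k => E) ℝ m).contDiff.comp_contDiffOn h1
  have h2 : ∀ a c : E, iteratedFDerivWithin ℝ (k + 2) f S x (Fin.cons a (Fin.cons c m)) =
      fderivWithin ℝ (fderivWithin ℝ g S) S x a c := by
    intro a c
    rw [iteratedFDerivWithin_succ_eq_fderivWithin hS hf hk1 hx]
    have h3 : fderivWithin ℝ (fun y => iteratedFDerivWithin ℝ (k + 1) f S y (Fin.cons c m)) S x =
        fderivWithin ℝ (fun y => fderivWithin ℝ g S y c) S x :=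
      fderivWithin_congr (fun y hy =>
        iteratedFDerivWithin_succ_eq_fderivWithin hS hf hk0 hy c m)
        (iteratedFDerivWithin_succ_eq_fderivWithin hS hf hk0 hx c m)
    rw [h3]
    have hd : DifferentiableWithinAt ℝ (fderivWithin ℝ g S) S x :=
      ((hgC.fderivWithin hS (m := 1) (by norm_num)).differentiableOn (by norm_num)) x hx
    rw [fderivWithin_clm_apply (hS x hx) hd (differentiableWithinAt_const c)]
    simp
  rw [h2, h2]
  exact (hgC.contDiffWithinAt hx).isSymmSndFDerivWithinAt (by simp) hS (hcl hx) hx v w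

theorem iteratedFDerivWithin_cons_congr (hS : UniqueDiffOn ℝ S)
    (hf : ContDiffOn ℝ N f S) {k : ℕ} (hk : (k : WithTop ℕ∞) < N) {m m' : Fin k → E}
    (h : ∀ y ∈ S, iteratedFDerivWithin ℝ k f S y m = iteratedFDerivWithin ℝ k f S y m')
    {x : E} (hx : x ∈ S) (v : E) :
    iteratedFDerivWithin ℝ (k + 1) f S x (Fin.cons v m) =
      iteratedFDerivWithin ℝ (k + 1) f S x (Fin.cons v m') := by
  rw [iteratedFDerivWithin_succ_eq_fderivWithin hS hf hk hx,
    iteratedFDerivWithin_succ_eq_fderivWithin hS hf hk hx, fderivWithin_congr h (h x hx)]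

theorem third_deriv_swap₀₁ (hS : UniqueDiffOn ℝ S) (hcl : S ⊆ closure (interior S))
    (hf : ContDiffOn ℝ 4 f S) {x : E} (hx : x ∈ S) (u v w : E) :
    iteratedFDerivWithin ℝ 3 f S x ![u, v, w] = iteratedFDerivWithin ℝ 3 f S x ![v, u, w] :=
  iteratedFDerivWithin_swap hS hcl hf (k := 1) (by norm_num) hx u v ![w]

theorem second_deriv_swap (hS : UniqueDiffOn ℝ S) (hcl : S ⊆ closure (interior S))
    (hf : ContDiffOn ℝ 2 f S) {x : E} (hx : x ∈ S) (u v : E) :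
    iteratedFDerivWithin ℝ 2 f S x ![u, v] = iteratedFDerivWithin ℝ 2 f S x ![v, u] :=
  iteratedFDerivWithin_swap hS hcl hf (k := 0) (by norm_num) hx u v ![]

theorem third_deriv_swap₁₂ (hS : UniqueDiffOn ℝ S) (hcl : S ⊆ closure (interior S))
    (hf : ContDiffOn ℝ 4 f S) {x : E} (hx : x ∈ S) (u v w : E) :
    iteratedFDerivWithin ℝ 3 f S x ![u, v, w] = iteratedFDerivWithin ℝ 3 f S x ![u, w, v] :=
  iteratedFDerivWithin_cons_congr hS hf (k := 2) (by norm_cast)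
    (fun _ hy => second_deriv_swap hS hcl (hf.of_le (by norm_num)) hy v w) hx u

theorem fourth_deriv_swap_pairs (hS : UniqueDiffOn ℝ S) (hcl : S ⊆ closure (interior S))
    (hf : ContDiffOn ℝ 4 f S) {x : E} (hx : x ∈ S) (a c : E) :
    iteratedFDerivWithin ℝ 4 f S x ![a, a, c, c] = iteratedFDerivWithin ℝ 4 f S x ![c, c, a, a] := by
  have s₁ : ∀ p q r s : E, iteratedFDerivWithin ℝ 4 f S x ![p, q, r, s] =
      iteratedFDerivWithin ℝ 4 f S x ![q, p, r, s] := fun p q r s =>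
    iteratedFDerivWithin_swap hS hcl hf (k := 2) (by norm_num) hx p q ![r, s]
  have s₂ : ∀ p q r s : E, iteratedFDerivWithin ℝ 4 f S x ![p, q, r, s] =
      iteratedFDerivWithin ℝ 4 f S x ![p, r, q, s] := fun p q r s =>
    iteratedFDerivWithin_cons_congr hS hf (k := 3) (by norm_cast)
      (fun _ hy => third_deriv_swap₀₁ hS hcl hf hy q r s) hx p
  have s₃ : ∀ p q r s : E, iteratedFDerivWithin ℝ 4 f S x ![p, q, r, s] =
      iteratedFDerivWithin ℝ 4 f S x ![p, q, s, r] := fun p q r s =>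
    iteratedFDerivWithin_cons_congr hS hf (k := 3) (by norm_cast)
      (fun _ hy => third_deriv_swap₁₂ hS hcl hf hy q r s) hx p
  rw [s₂ a a c c, s₁ a c a c, s₃ c a a c, s₂ c a c a]

/-- The Hessian as a bilinear form. -/
noncomputable def hessForm (S : Set E) (f : E → ℝ) (x : E) : LinearMap.BilinForm ℝ E :=
  LinearMap.mk₂ ℝ (fun v w => iteratedFDerivWithin ℝ 2 f S x ![v, w])
    (fun v v' w => (iteratedFDerivWithin ℝ 2 f S x).toMultilinearMap.cons_add ![w] v v')
    (fun c v w => (iteratedFDerivWithin ℝ 2 f S x).toMultilinearMap.cons_smul ![w] c v)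
    (fun v w w' => by
      have e : ∀ z, Function.update ![v, w] 1 z = ![v, z] := by
        intro z; ext i; fin_cases i <;> simp
      have := (iteratedFDerivWithin ℝ 2 f S x).map_update_add ![v, w] 1 w w'
      rwa [e, e, e] at this)
    (fun c v w => by
      have e : ∀ z, Function.update ![v, w] 1 z = ![v, z] := by
        intro z; ext i; fin_cases i <;> simp
      have := (iteratedFDerivWithin ℝ 2 f S x).map_update_smul ![v, w] 1 c w
      rwa [e, e] at this)

theorem hessForm_apply (S : Set E) (f : E → ℝ) (x v w : E) :
    hessForm S f x v w = iteratedFDerivWithin ℝ 2 f S x ![v, w] := rfl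

theorem abs_hessForm_le {K : ℝ} {x : E} (hK : ‖iteratedFDerivWithin ℝ 2 f S x‖ ≤ K) (v w : E) :
    |hessForm S f x v w| ≤ K * ‖v‖ * ‖w‖ := by
  have := (iteratedFDerivWithin ℝ 2 f S x).le_of_opNorm_le hK ![v, w]
  simpa [Fin.prod_univ_succ, hessForm_apply, mul_assoc] using this

theorem abs_third_le {K : ℝ} {x : E} (hK : ‖iteratedFDerivWithin ℝ 3 f S x‖ ≤ K) (u v w : E) :
    |iteratedFDerivWithin ℝ 3 f S x ![u, v, w]| ≤ K * ‖u‖ * ‖v‖ * ‖w‖ := by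
  have := (iteratedFDerivWithin ℝ 3 f S x).le_of_opNorm_le hK ![u, v, w]
  simpa [Fin.prod_univ_succ, mul_assoc] using this

theorem abs_fourth_le {K : ℝ} {x : E} (hK : ‖iteratedFDerivWithin ℝ 4 f S x‖ ≤ K) (v : E) :
    |iteratedFDerivWithin ℝ 4 f S x ![v, v, v, v]| ≤ K * ‖v‖ ^ 4 := by
  have := (iteratedFDerivWithin ℝ 4 f S x).le_of_opNorm_le hK ![v, v, v, v]
  refine this.trans (le_of_eq ?_)
  simp only [Fin.prod_univ_four, Matrix.cons_val]; ring

theorem norm_fderivWithin_le {K : ℝ} {x : E} (hS : UniqueDiffOn ℝ S) (hx : x ∈ S)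
    (hK : ‖iteratedFDerivWithin ℝ 1 f S x‖ ≤ K) : ‖fderivWithin ℝ f S x‖ ≤ K := by
  rwa [← norm_iteratedFDerivWithin_one f (hS x hx)]

theorem hessForm_symm (hS : UniqueDiffOn ℝ S) (hcl : S ⊆ closure (interior S))
    (hf : ContDiffOn ℝ 2 f S) {x : E} (hx : x ∈ S) (u v : E) :
    hessForm S f x u v = hessForm S f x v u := second_deriv_swap hS hcl hf hx u v

theorem hasDerivWithinAt_line₀ (hf : DifferentiableOn ℝ f S) {I : Set ℝ} {x v : E}
    (hI : ∀ s ∈ I, x + s • v ∈ S) {s : ℝ} (hs : s ∈ I) :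
    HasDerivWithinAt (fun r : ℝ => f (x + r • v)) (fderivWithin ℝ f S (x + s • v) v) I s := by
  have h1 := (hf _ (hI s hs)).hasFDerivWithinAt
  have h2 : HasDerivWithinAt (fun r : ℝ => x + r • v) v I s := by
    simpa using (((hasDerivAt_id s).smul_const v).const_add x).hasDerivWithinAt
  exact h1.comp_hasDerivWithinAt s h2 hI

theorem hasDerivWithinAt_line₁ (hS : UniqueDiffOn ℝ S) (hf : ContDiffOn ℝ 2 f S) {I : Set ℝ}
    {x v : E} (hI : ∀ s ∈ I, x + s • v ∈ S) {s : ℝ} (hs : s ∈ I) (w : E) :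
    HasDerivWithinAt (fun r : ℝ => fderivWithin ℝ f S (x + r • v) w)
      (hessForm S f (x + s • v) v w) I s := by
  have := hasDerivWithinAt_iteratedFDerivWithin_line hS hf (k := 1) (by norm_cast) hI hs ![w]
  refine (this.congr (fun r hr => ?_) ?_)
  · rw [iteratedFDerivWithin_one_apply (hS _ (hI r hr))]; rfl
  · rw [iteratedFDerivWithin_one_apply (hS _ (hI s hs))]; rfl

theorem hasDerivWithinAt_line₂ (hS : UniqueDiffOn ℝ S) (hf : ContDiffOn ℝ 3 f S) {I : Set ℝ}
    {x v : E} (hI : ∀ s ∈ I, x + s • v ∈ S) {s : ℝ} (hs : s ∈ I) (w z : E) :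
    HasDerivWithinAt (fun r : ℝ => hessForm S f (x + r • v) w z)
      (iteratedFDerivWithin ℝ 3 f S (x + s • v) ![v, w, z]) I s :=
  hasDerivWithinAt_iteratedFDerivWithin_line hS hf (k := 2) (by norm_cast) hI hs ![w, z]

theorem hasDerivWithinAt_line₃ (hS : UniqueDiffOn ℝ S) (hf : ContDiffOn ℝ 4 f S) {I : Set ℝ}
    {x v : E} (hI : ∀ s ∈ I, x + s • v ∈ S) {s : ℝ} (hs : s ∈ I) (u w z : E) :
    HasDerivWithinAt (fun r : ℝ => iteratedFDerivWithin ℝ 3 f S (x + r • v) ![u, w, z])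
      (iteratedFDerivWithin ℝ 4 f S (x + s • v) ![v, u, w, z]) I s :=
  hasDerivWithinAt_iteratedFDerivWithin_line hS hf (k := 3) (by norm_cast) hI hs ![u, w, z]

theorem line_preimage_mem_nhds {x v : E} {s : ℝ} (hx : x + s • v ∈ interior S) :
    (fun r : ℝ => x + r • v) ⁻¹' S ∈ 𝓝 s := by
  have hc : Continuous fun r : ℝ => x + r • v := by fun_prop
  exact Filter.mem_of_superset
    (hc.continuousAt.preimage_mem_nhds (isOpen_interior.mem_nhds hx))
    (preimage_mono interior_subset)

theorem hasDerivAt_line₀ (hf : DifferentiableOn ℝ f S) {x v : E} {s : ℝ}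
    (hx : x + s • v ∈ interior S) :
    HasDerivAt (fun r : ℝ => f (x + r • v)) (fderivWithin ℝ f S (x + s • v) v) s :=
  (hasDerivWithinAt_line₀ hf (I := (fun r : ℝ => x + r • v) ⁻¹' S) (fun _ h => h)
    (show x + s • v ∈ S from interior_subset hx)).hasDerivAt (line_preimage_mem_nhds hx)

theorem hasDerivAt_line₁ (hS : UniqueDiffOn ℝ S) (hf : ContDiffOn ℝ 2 f S) {x v : E} {s : ℝ}
    (hx : x + s • v ∈ interior S) (w : E) :
    HasDerivAt (fun r : ℝ => fderivWithin ℝ f S (x + r • v) w)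
      (hessForm S f (x + s • v) v w) s :=
  (hasDerivWithinAt_line₁ hS hf (I := (fun r : ℝ => x + r • v) ⁻¹' S) (fun _ h => h)
    (show x + s • v ∈ S from interior_subset hx) w).hasDerivAt (line_preimage_mem_nhds hx)

theorem hasDerivAt_line₂ (hS : UniqueDiffOn ℝ S) (hf : ContDiffOn ℝ 3 f S) {x v : E} {s : ℝ}
    (hx : x + s • v ∈ interior S) (w z : E) :
    HasDerivAt (fun r : ℝ => hessForm S f (x + r • v) w z)
      (iteratedFDerivWithin ℝ 3 f S (x + s • v) ![v, w, z]) s :=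
  (hasDerivWithinAt_line₂ hS hf (I := (fun r : ℝ => x + r • v) ⁻¹' S) (fun _ h => h)
    (show x + s • v ∈ S from interior_subset hx) w z).hasDerivAt (line_preimage_mem_nhds hx)

theorem hasDerivAt_line₃ (hS : UniqueDiffOn ℝ S) (hf : ContDiffOn ℝ 4 f S) {x v : E} {s : ℝ}
    (hx : x + s • v ∈ interior S) (u w z : E) :
    HasDerivAt (fun r : ℝ => iteratedFDerivWithin ℝ 3 f S (x + r • v) ![u, w, z])
      (iteratedFDerivWithin ℝ 4 f S (x + s • v) ![v, u, w, z]) s :=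
  (hasDerivWithinAt_line₃ hS hf (I := (fun r : ℝ => x + r • v) ⁻¹' S) (fun _ h => h)
    (show x + s • v ∈ S from interior_subset hx) u w z).hasDerivAt (line_preimage_mem_nhds hx)

theorem hessForm_nonneg_of_isLocalMin (hS : UniqueDiffOn ℝ S) (hf : ContDiffOn ℝ 2 f S) {x : E}
    (hx : x ∈ interior S) (hmin : ∀ y ∈ S, f x ≤ f y) (v : E) : 0 ≤ hessForm S f x v v := by
  have hev := eventually_line_mem_interior hx v
  have h2 := hasDerivAt_line₁ hS hf (x := x) (v := v) (s := 0) (by simpa using hx) v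
  simp only [zero_smul, add_zero] at h2
  refine nonneg_second_deriv_of_isLocalMin (x := 0) (f := fun r : ℝ => f (x + r • v))
    (hev.mono fun s hs => hasDerivAt_line₀ (hf.differentiableOn (by norm_num)) hs) h2 ?_
  filter_upwards [hev] with s hs
  simpa using hmin _ (interior_subset hs)

theorem hessForm_nonneg_of_convexOn (hS : UniqueDiffOn ℝ S) (hf : ContDiffOn ℝ 2 f S)
    (hc : ConvexOn ℝ (interior S) f) {x : E}
    (hx : x ∈ interior S) (v : E) : 0 ≤ hessForm S f x v v := by
  -- the symmetric difference `f (x + s v) + f (x - s v)` is minimal at `s = 0`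
  have hev := (eventually_line_mem_interior hx v).and (eventually_line_mem_interior hx (-v))
  have hD := hf.differentiableOn (by norm_num)
  have h2 := hasDerivAt_line₁ hS hf (x := x) (v := v) (s := 0) (by simpa using hx) v
  have h3 := hasDerivAt_line₁ hS hf (x := x) (v := -v) (s := 0) (by simpa using hx) (-v)
  simp only [zero_smul, add_zero] at h2 h3
  have := nonneg_second_deriv_of_isLocalMin (x := 0)
    (f := fun r : ℝ => f (x + r • v) + f (x + r • (-v)))
    (hev.mono fun s hs => (hasDerivAt_line₀ hD hs.1).add (hasDerivAt_line₀ hD hs.2))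
    (h2.add h3) (by
      filter_upwards [hev] with s hs
      have := hc.2 hs.1 hs.2 (show (0 : ℝ) ≤ 1 / 2 by norm_num) (show (0 : ℝ) ≤ 1 / 2 by norm_num)
        (by norm_num)
      have he : (1 / 2 : ℝ) • (x + s • v) + (1 / 2 : ℝ) • (x + s • -v) = x := by module
      rw [he] at this
      simp only [smul_eq_mul] at this
      simp only [zero_smul, add_zero]
      linarith)
  simp only [map_neg, LinearMap.neg_apply, neg_neg] at this
  linarith

theorem taylor_two (hS : UniqueDiffOn ℝ S) (hconv : Convex ℝ S) (hf : ContDiffOn ℝ 2 f S) {K : ℝ}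
    (hK : ∀ x ∈ S, ‖iteratedFDerivWithin ℝ 2 f S x‖ ≤ K) {y h : E} (hy : y ∈ S)
    (hyh : y + h ∈ S) : |f (y + h) - f y - fderivWithin ℝ f S y h| ≤ K * ‖h‖ ^ 2 := by
  have hI : ∀ s ∈ Icc (0 : ℝ) 1, y + s • h ∈ S := fun s hs => by
    simpa using hconv.add_smul_mem hy hyh hs
  have := taylor_two_bound (g₀ := fun s => f (y + s • h))
    (K := K * ‖h‖ ^ 2)
    (fun s hs => hasDerivWithinAt_line₀ (hf.differentiableOn (by norm_num)) hI hs)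
    (fun s hs => hasDerivWithinAt_line₁ hS hf hI hs h)
    (fun s hs => by
      refine (abs_hessForm_le (hK _ (hI s hs)) h h).trans (le_of_eq (by ring)))
  simpa using this

theorem taylor_four (hS : UniqueDiffOn ℝ S) (hconv : Convex ℝ S) (hf : ContDiffOn ℝ 4 f S) {K : ℝ}
    (hK : ∀ x ∈ S, ‖iteratedFDerivWithin ℝ 4 f S x‖ ≤ K) {y h : E} (hy : y ∈ S)
    (hyh : y + h ∈ S) :
    |f (y + h) - f y - fderivWithin ℝ f S y h - hessForm S f y h h / 2 -
      iteratedFDerivWithin ℝ 3 f S y ![h, h, h] / 6| ≤ K * ‖h‖ ^ 4 := by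
  have hI : ∀ s ∈ Icc (0 : ℝ) 1, y + s • h ∈ S := fun s hs => by
    simpa using hconv.add_smul_mem hy hyh hs
  have := taylor_four_bound (g₀ := fun s => f (y + s • h))
    (K := K * ‖h‖ ^ 4)
    (fun s hs => hasDerivWithinAt_line₀ (hf.differentiableOn (by norm_num)) hI hs)
    (fun s hs => hasDerivWithinAt_line₁ hS (hf.of_le (by norm_num)) hI hs h)
    (fun s hs => hasDerivWithinAt_line₂ hS (hf.of_le (by norm_num)) hI hs h h)
    (fun s hs => hasDerivWithinAt_line₃ hS hf hI hs h h h)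
    (fun s hs => abs_fourth_le (hK _ (hI s hs)) h)
  simpa using this

end Jets

/-! ### Expansions along nearly opposite increments -/

theorem taylor_two_lower {g₀ g₁ g₂ : ℝ → ℝ} {c : ℝ}
    (h0 : ∀ s ∈ Icc (0 : ℝ) 1, HasDerivWithinAt g₀ (g₁ s) (Icc 0 1) s)
    (h1 : ∀ s ∈ Icc (0 : ℝ) 1, HasDerivWithinAt g₁ (g₂ s) (Icc 0 1) s)
    (hc : ∀ s ∈ Icc (0 : ℝ) 1, c ≤ g₂ s) : g₀ 0 + g₁ 0 + c / 2 ≤ g₀ 1 := by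
  have hid : ∀ (a s : ℝ), HasDerivAt (fun s : ℝ => s * a) a s := by
    intro a s; simpa using (hasDerivAt_id s).mul_const a
  have hsq : ∀ s : ℝ, HasDerivAt (fun s : ℝ => s ^ 2 / 2 * c) (s * c) s := by
    intro s
    exact (((hasDerivAt_pow 2 s).div_const 2).mul_const c).congr_deriv (by push_cast; ring)
  have h1' : ∀ s ∈ Icc (0 : ℝ) 1, g₁ 0 + s * c ≤ g₁ s := by
    have hm : MonotoneOn (fun s => g₁ s - s * c) (Icc (0 : ℝ) 1) := by
      refine monotoneOn_of_hasDerivWithinAt_nonneg (f' := fun s => g₂ s - c) (convex_Icc 0 1)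
        (fun s hs => ((h1 s hs).continuousWithinAt.sub
          (hid c s).continuousAt.continuousWithinAt)) (fun s hs => ?_) (fun s hs => ?_)
      · exact ((h1 s (interior_subset hs)).mono interior_subset).sub (hid c s).hasDerivWithinAt
      · linarith [hc s (interior_subset hs)]
    intro s hs
    have := hm (left_mem_Icc.2 zero_le_one) hs hs.1
    simp only at this
    linarith
  have hm : MonotoneOn (fun s => g₀ s - s * g₁ 0 - s ^ 2 / 2 * c) (Icc (0 : ℝ) 1) := by
    refine monotoneOn_of_hasDerivWithinAt_nonneg (f' := fun s => g₁ s - g₁ 0 - s * c)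
      (convex_Icc 0 1)
      (fun s hs => (((h0 s hs).continuousWithinAt.sub
        (hid (g₁ 0) s).continuousAt.continuousWithinAt).sub
          (hsq s).continuousAt.continuousWithinAt)) (fun s hs => ?_) (fun s hs => ?_)
    · exact (((h0 s (interior_subset hs)).mono interior_subset).sub
        (hid (g₁ 0) s).hasDerivWithinAt).sub (hsq s).hasDerivWithinAt
    · linarith [h1' s (interior_subset hs)]
  have := hm (left_mem_Icc.2 zero_le_one) (right_mem_Icc.2 zero_le_one) zero_le_one
  simp only at this
  linarith

theorem abs_mul_add_mul_le {a b c d A B K : ℝ} (ha : |a| ≤ A) (hb : |b| ≤ K) (hc : |c| ≤ B)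
    (hd : |d| ≤ K) : |a * b + c * d| ≤ A * K + B * K := by
  refine (abs_add_le _ _).trans ?_
  rw [abs_mul, abs_mul]
  exact add_le_add (mul_le_mul ha hb (abs_nonneg _) ((abs_nonneg _).trans ha))
    (mul_le_mul hc hd (abs_nonneg _) ((abs_nonneg _).trans hc))

section Symmetric

variable {E : Type*} [NormedAddCommGroup E] [InnerProductSpace ℝ E]

theorem norm_tangent_add_normal_le {e ν : E} (he : ‖e‖ = 1) (hν : ‖ν‖ = 1) {s z M : ℝ}
    (hs : 0 ≤ s) (hs1 : s ≤ 1) (hz0 : 0 ≤ z) (hz : z ≤ M * s ^ 2) :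
    ‖s • e + z • ν‖ ≤ (1 + M) * s := by
  have hM : M * s ^ 2 ≤ M * s ∨ s = 0 := by
    rcases hs.eq_or_lt with h | h
    · exact Or.inr h.symm
    · left
      have : 0 ≤ M := by
        by_contra hM
        push Not at hM
        nlinarith [mul_pos h h]
      nlinarith [mul_nonneg this hs]
  calc ‖s • e + z • ν‖ ≤ ‖s • e‖ + ‖z • ν‖ := norm_add_le _ _
    _ = s + z := by rw [norm_smul, norm_smul, he, hν, Real.norm_of_nonneg hs,
        Real.norm_of_nonneg hz0]; ring
    _ ≤ (1 + M) * s := by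
      rcases hM with h | h
      · nlinarith
      · subst h; nlinarith

/-- Along two almost opposite increments the cubic terms of a Taylor expansion cancel. -/
theorem abs_cubic_add_le (C : E [×3]→L[ℝ] ℝ) {K : ℝ} (hC : ‖C‖ ≤ K) {h₁ h₂ : E} {a d : ℝ}
    (h1 : ‖h₁‖ ≤ a) (h2 : ‖h₂‖ ≤ a) (h12 : ‖h₁ + h₂‖ ≤ d) :
    |C ![h₁, h₁, h₁] + C ![h₂, h₂, h₂]| ≤ 3 * K * a ^ 2 * d := by
  have e : ∀ h : E, ![h, h, h] = fun _ => h := by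
    intro h; ext i; fin_cases i <;> rfl
  have hneg : C (fun _ => -h₁) = - C (fun _ => h₁) := by
    have := C.map_smul_univ (fun _ => (-1 : ℝ)) (fun _ => h₁)
    norm_num at this
    exact this
  have h := C.norm_image_sub_le (fun _ => h₂) (fun _ => -h₁)
  rw [e, e, add_comm, ← sub_neg_eq_add, ← hneg, ← Real.norm_eq_abs]
  refine h.trans ?_
  have e3 : ‖(fun _ : Fin 3 => h₂) - fun _ => -h₁‖ ≤ d := by
    have : ((fun _ : Fin 3 => h₂) - fun _ => -h₁) = fun _ => h₁ + h₂ := by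
      ext i; simp [add_comm]
    rw [this, pi_norm_const]; exact h12
  have e4 : max ‖(fun _ : Fin 3 => h₂)‖ ‖(fun _ : Fin 3 => -h₁)‖ ≤ a := by
    rw [pi_norm_const, pi_norm_const, norm_neg]; exact max_le h2 h1
  have hK : 0 ≤ K := (norm_nonneg _).trans hC
  have hd : 0 ≤ d := (norm_nonneg _).trans h12
  have e5 : max ‖(fun _ : Fin 3 => h₂)‖ ‖(fun _ : Fin 3 => -h₁)‖ ^ 2 ≤ a ^ 2 :=
    pow_le_pow_left₀ (le_max_of_le_left (norm_nonneg _)) e4 2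
  simp only [Fintype.card_fin, Nat.add_one_sub_one, Nat.cast_ofNat]
  calc ‖C‖ * 3 * max ‖(fun _ : Fin 3 => h₂)‖ ‖(fun _ : Fin 3 => -h₁)‖ ^ 2 * _
      ≤ K * 3 * a ^ 2 * d := by gcongr
    _ = _ := by ring

theorem quadratic_expand (H : LinearMap.BilinForm ℝ E) (hsym : ∀ v w, H v w = H w v) (e ν : E)
    (s z : ℝ) : H (s • e + z • ν) (s • e + z • ν) =
      s ^ 2 * H e e + 2 * s * z * H e ν + z ^ 2 * H ν ν := by
  simp only [map_add, map_smul, LinearMap.add_apply, LinearMap.smul_apply, smul_eq_mul, hsym ν e]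
  ring

variable {H : LinearMap.BilinForm ℝ E} {C : E [×3]→L[ℝ] ℝ} {K M : ℝ} {e ν : E} {s z₁ z₂ : ℝ}

/-- The almost even increments `± s e + z ν` with `z = O(s²)`: odd part of a cubic polynomial. -/
theorem abs_quadratic_sub_le (hsym : ∀ v w, H v w = H w v) (hH : ∀ v w, |H v w| ≤ K * ‖v‖ * ‖w‖)
    (he : ‖e‖ = 1) (hν : ‖ν‖ = 1)
    (hs : 0 ≤ s) (hs1 : s ≤ 1) (hz₁ : z₁ ∈ Icc 0 (M * s ^ 2)) (hz₂ : z₂ ∈ Icc 0 (M * s ^ 2)) :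
    |H (s • e + z₁ • ν) (s • e + z₁ • ν) - H ((-s) • e + z₂ • ν) ((-s) • e + z₂ • ν)| ≤
      K * (4 * M + M ^ 2) * s ^ 3 := by
  rw [quadratic_expand H hsym, quadratic_expand H hsym]
  have h1 := abs_le.1 (hH e ν)
  have h2 := abs_le.1 (hH ν ν)
  simp only [he, hν, mul_one] at h1 h2
  have hK : 0 ≤ K := by linarith
  have hs3 : 0 ≤ s ^ 3 := by positivity
  have e1 : 0 ≤ s * (z₁ + z₂) ∧ s * (z₁ + z₂) ≤ 2 * M * s ^ 3 :=
    ⟨mul_nonneg hs (add_nonneg hz₁.1 hz₂.1), by nlinarith [hz₁.2, hz₂.2]⟩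
  have e2 : |z₁ ^ 2 - z₂ ^ 2| ≤ M ^ 2 * s ^ 3 := by
    have a1 : z₁ ^ 2 ≤ (M * s ^ 2) ^ 2 := pow_le_pow_left₀ hz₁.1 hz₁.2 2
    have a2 : z₂ ^ 2 ≤ (M * s ^ 2) ^ 2 := pow_le_pow_left₀ hz₂.1 hz₂.2 2
    have a3 : (M * s ^ 2) ^ 2 ≤ M ^ 2 * s ^ 3 := by
      have : s ^ 4 ≤ s ^ 3 := pow_le_pow_of_le_one hs hs1 (by norm_num)
      nlinarith [sq_nonneg M]
    rw [abs_le]; constructor <;> nlinarith [sq_nonneg z₁, sq_nonneg z₂]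
  have : s ^ 2 * H e e + 2 * s * z₁ * H e ν + z₁ ^ 2 * H ν ν -
      ((-s) ^ 2 * H e e + 2 * (-s) * z₂ * H e ν + z₂ ^ 2 * H ν ν) =
      2 * (s * (z₁ + z₂)) * H e ν + (z₁ ^ 2 - z₂ ^ 2) * H ν ν := by ring
  rw [this]
  refine (abs_mul_add_mul_le (A := 2 * (2 * M * s ^ 3)) ?_ (abs_le.2 h1) e2 (abs_le.2 h2)).trans
    (le_of_eq (by ring))
  rw [abs_of_nonneg (by linarith [e1.1])]
  linarith [e1.2]

theorem abs_quadratic_add_le (hsym : ∀ v w, H v w = H w v) (hH : ∀ v w, |H v w| ≤ K * ‖v‖ * ‖w‖)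
    (he : ‖e‖ = 1) (hν : ‖ν‖ = 1)
    (hs : 0 ≤ s) (hz₁ : z₁ ∈ Icc 0 (M * s ^ 2)) (hz₂ : z₂ ∈ Icc 0 (M * s ^ 2))
    (hz : |z₁ - z₂| ≤ M * s ^ 3) :
    |H (s • e + z₁ • ν) (s • e + z₁ • ν) + H ((-s) • e + z₂ • ν) ((-s) • e + z₂ • ν) -
      2 * s ^ 2 * H e e| ≤ K * (2 * M + 2 * M ^ 2) * s ^ 4 := by
  rw [quadratic_expand H hsym, quadratic_expand H hsym]
  have h1 := hH e ν
  have h2 := hH ν ν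
  simp only [he, hν, mul_one] at h1 h2
  have hK : 0 ≤ K := (abs_nonneg _).trans h1
  have a1 : z₁ ^ 2 ≤ (M * s ^ 2) ^ 2 := pow_le_pow_left₀ hz₁.1 hz₁.2 2
  have a2 : z₂ ^ 2 ≤ (M * s ^ 2) ^ 2 := pow_le_pow_left₀ hz₂.1 hz₂.2 2
  have : s ^ 2 * H e e + 2 * s * z₁ * H e ν + z₁ ^ 2 * H ν ν +
      ((-s) ^ 2 * H e e + 2 * (-s) * z₂ * H e ν + z₂ ^ 2 * H ν ν) - 2 * s ^ 2 * H e e =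
      2 * s * (z₁ - z₂) * H e ν + (z₁ ^ 2 + z₂ ^ 2) * H ν ν := by ring
  rw [this]
  refine (abs_mul_add_mul_le (A := 2 * s * (M * s ^ 3))
    (B := (M * s ^ 2) ^ 2 + (M * s ^ 2) ^ 2) ?_ h1 ?_ h2).trans (le_of_eq (by ring))
  · rw [abs_mul, abs_of_nonneg (by linarith : 0 ≤ 2 * s)]
    exact mul_le_mul_of_nonneg_left hz (by linarith)
  · rw [abs_of_nonneg (by positivity)]
    linarith

theorem abs_cubic_increment_le (hC : ‖C‖ ≤ K) (he : ‖e‖ = 1) (hν : ‖ν‖ = 1)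
    (hs : 0 ≤ s) (hs1 : s ≤ 1) (hz₁ : z₁ ∈ Icc 0 (M * s ^ 2)) (hz₂ : z₂ ∈ Icc 0 (M * s ^ 2)) :
    |C ![s • e + z₁ • ν, s • e + z₁ • ν, s • e + z₁ • ν] +
      C ![(-s) • e + z₂ • ν, (-s) • e + z₂ • ν, (-s) • e + z₂ • ν]| ≤
      6 * K * (1 + M) ^ 2 * M * s ^ 4 := by
  have n1 := norm_tangent_add_normal_le he hν hs hs1 hz₁.1 hz₁.2
  have n2 := norm_tangent_add_normal_le (e := -e) (by rwa [norm_neg]) hν hs hs1 hz₂.1 hz₂.2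
  rw [smul_neg, ← neg_smul] at n2
  have n3 : ‖(s • e + z₁ • ν) + ((-s) • e + z₂ • ν)‖ ≤ 2 * M * s ^ 2 := by
    have : (s • e + z₁ • ν) + ((-s) • e + z₂ • ν) = (z₁ + z₂) • ν := by module
    rw [this, norm_smul, hν, mul_one, Real.norm_of_nonneg (add_nonneg hz₁.1 hz₂.1)]
    linarith [hz₁.2, hz₂.2]
  refine (abs_cubic_add_le C hC n1 n2 n3).trans (le_of_eq (by ring))

end Symmetric

/-! ### Uniformly convex domains -/

/-- A strictly convex local defining function of `Ω` near `x₀`, with quantitative bounds. -/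
structure LocalDefining {n : ℕ} (Ω : Set (EuclideanSpace ℝ (Fin n))) (x₀ : EuclideanSpace ℝ (Fin n))
    (δ m g K : ℝ) (r : EuclideanSpace ℝ (Fin n) → ℝ) : Prop where
  δ_pos : 0 < δ
  m_pos : 0 < m
  g_pos : 0 < g
  contDiffOn : ContDiffOn ℝ 4 r (Metric.closedBall x₀ δ)
  mem_iff : ∀ x ∈ Metric.closedBall x₀ δ, x ∈ Ω ↔ r x < 0
  grad_ge : ∀ x ∈ Metric.closedBall x₀ δ, g ≤ ‖fderivWithin ℝ r (Metric.closedBall x₀ δ) x‖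
  hess_ge : ∀ x ∈ Metric.closedBall x₀ δ, ∀ v,
    m * ‖v‖ ^ 2 ≤ hessForm (Metric.closedBall x₀ δ) r x v v
  bound : ∀ k : ℕ, k ≤ 4 → ∀ x ∈ Metric.closedBall x₀ δ,
    ‖iteratedFDerivWithin ℝ k r (Metric.closedBall x₀ δ) x‖ ≤ K

/-- A form which is positive on the kernel of `ℓ` becomes positive after adding a multiple of
`ℓ ⊗ ℓ`. -/
theorem exists_pos_add_sq {E : Type*} [NormedAddCommGroup E] [InnerProductSpace ℝ E]
    [CompleteSpace E] {H : LinearMap.BilinForm ℝ E} (hsym : ∀ v w, H v w = H w v) {B k : ℝ}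
    (hB : ∀ v w, |H v w| ≤ B * ‖v‖ * ‖w‖) {ℓ : E →L[ℝ] ℝ} (hℓ : ℓ ≠ 0) (hk : 0 < k)
    (hpos : ∀ v, ℓ v = 0 → k * ‖v‖ ^ 2 ≤ H v v) :
    ∃ Λ : ℝ, 0 ≤ Λ ∧ ∀ v, k / 2 * ‖v‖ ^ 2 ≤ H v v + Λ * ℓ v ^ 2 := by
  set q := (InnerProductSpace.toDual ℝ E).symm ℓ with hq
  have hqℓ : ∀ v, ℓ v = inner ℝ q v := fun v => (InnerProductSpace.toDual_symm_apply).symm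
  have hq0 : q ≠ 0 := by
    rw [hq]; simpa using hℓ
  have hqn : 0 < ‖q‖ := norm_pos_iff.2 hq0
  obtain ⟨u, hun, hquu⟩ : ∃ u : E, ‖u‖ = 1 ∧ q = ‖q‖ • u :=
    ⟨‖q‖⁻¹ • q, by rw [norm_smul, norm_inv, norm_norm, inv_mul_cancel₀ hqn.ne'],
      by rw [smul_smul, mul_inv_cancel₀ hqn.ne', one_smul]⟩
  have hB0 : 0 ≤ B := by
    have := (abs_nonneg _).trans (hB u u)
    rwa [hun, mul_one, mul_one] at this
  set Λ := (B + 2 * B ^ 2 / k + k / 2) / ‖q‖ ^ 2 with hΛ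
  refine ⟨Λ, by positivity, fun v => ?_⟩
  -- split `v = w + a u` with `w ∈ ker ℓ`
  set a := inner ℝ u v with ha
  set w := v - a • u with hw
  have hv : v = w + a • u := by rw [hw]; abel
  have huu : inner ℝ u u = 1 := by rw [real_inner_self_eq_norm_sq, hun]; norm_num
  have huw : inner ℝ u w = 0 := by
    rw [hw, inner_sub_right, inner_smul_right, huu]; simp [ha]
  have hℓw : ℓ w = 0 := by
    rw [hqℓ, hquu, inner_smul_left, huw, mul_zero]
  have hℓv : ℓ v = ‖q‖ * a := by
    rw [hqℓ, hquu, inner_smul_left, ← hquu]; simp [ha]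
  have hnv : ‖v‖ ^ 2 = ‖w‖ ^ 2 + a ^ 2 := by
    rw [hv, norm_add_sq_real, inner_smul_right, real_inner_comm u w, huw, norm_smul, hun, mul_one,
      Real.norm_eq_abs, sq_abs]
    ring
  have hHv : H v v = H w w + 2 * a * H w u + a ^ 2 * H u u := by
    rw [hv]
    simp only [map_add, map_smul, LinearMap.add_apply, LinearMap.smul_apply, smul_eq_mul, hsym u w]
    ring
  have hΛℓ : Λ * ℓ v ^ 2 = (B + 2 * B ^ 2 / k + k / 2) * a ^ 2 := by
    rw [hℓv, hΛ]; field_simp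
  rw [hΛℓ, hnv, hHv]
  have b1 := hpos w hℓw
  have b2 := abs_le.1 (hB w u)
  have b3 := abs_le.1 (hB u u)
  rw [hun, mul_one] at b2 b3
  have b4 : -(2 * |a| * (B * ‖w‖)) ≤ 2 * a * H w u := by
    have := abs_le.1 (le_of_eq (abs_mul (2 * a) (H w u)))
    have h5 : |2 * a| * |H w u| ≤ 2 * |a| * (B * ‖w‖) := by
      rw [abs_mul, abs_two]
      exact mul_le_mul_of_nonneg_left (abs_le.2 b2) (by positivity)
    linarith [this.1]
  have b5 : 2 * |a| * (B * ‖w‖) ≤ k / 2 * ‖w‖ ^ 2 + 2 * B ^ 2 / k * a ^ 2 := by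
    have h6 : 2 * B ^ 2 / k * a ^ 2 = 2 * (B * |a|) ^ 2 / k := by
      rw [mul_pow, sq_abs]; ring
    rw [h6, ← sub_nonneg]
    have : k / 2 * ‖w‖ ^ 2 + 2 * (B * |a|) ^ 2 / k - 2 * |a| * (B * ‖w‖) =
        (k * ‖w‖ - 2 * (B * |a|)) ^ 2 / (2 * k) := by
      field_simp; ring
    rw [this]; positivity
  nlinarith [sq_nonneg a]

theorem IsUniformlyConvexDomain.exists_localDefining {n : ℕ}
    {Ω : Set (EuclideanSpace ℝ (Fin n))} (hΩ : IsUniformlyConvexDomain Ω)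
    {x₀ : EuclideanSpace ℝ (Fin n)} (hx₀ : x₀ ∈ frontier Ω) :
    ∃ δ m g K r, LocalDefining Ω x₀ δ m g K r := by
  obtain ⟨κ, hκ, hcurv⟩ := hΩ.curvature_pos
  obtain ⟨r, V, hV, hr, hmem, hgrad, hhess⟩ := hcurv x₀ hx₀
  obtain ⟨ρ, hρ, hρV⟩ := Metric.mem_nhds_iff.1 hV
  set U := Metric.ball x₀ ρ with hU
  have hx₀U : x₀ ∈ U := Metric.mem_ball_self hρ
  have hrU : ∀ x ∈ U, ContDiffAt ℝ ∞ r x := fun x hx =>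
    (hr.mono hρV).contDiffAt (Metric.isOpen_ball.mem_nhds hx)
  have hrc : ContinuousOn r U := fun x hx => (hrU x hx).continuousAt.continuousWithinAt
  -- `r` vanishes at the boundary point `x₀`
  have hr0 : r x₀ = 0 := by
    have h1 : ¬ r x₀ < 0 := fun h => by
      have := (hmem x₀ (hρV hx₀U)).2 h
      rw [hΩ.isOpen.frontier_eq] at hx₀
      exact hx₀.2 this
    refine le_antisymm ?_ (not_lt.1 h1)
    by_contra h
    push Not at h
    have h2 : ∀ᶠ x in 𝓝 x₀, 0 < r x := (hrU x₀ hx₀U).continuousAt.eventually_const_lt h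
    have h3 : ∀ᶠ x in 𝓝 x₀, x ∉ Ω := by
      filter_upwards [h2, hV] with x hx hxV hxΩ
      exact absurd ((hmem x hxV).1 hxΩ) (not_lt.2 hx.le)
    have h4 : x₀ ∈ closure Ω := frontier_subset_closure hx₀
    exact (mem_closure_iff_frequently.1 h4) h3
  have hsym0 : ∀ v w, hessForm univ r x₀ v w = hessForm univ r x₀ w v := by
    intro v w
    have h := ((hrU x₀ hx₀U).of_le (m := 2) (by norm_cast)).isSymmSndFDerivAt
      (by simp)
    simp only [hessForm_apply, iteratedFDerivWithin_univ, iteratedFDeriv_two_apply]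
    exact h v w
  obtain ⟨Λ, hΛ0, hΛ⟩ := exists_pos_add_sq (H := hessForm univ r x₀) hsym0
    (abs_hessForm_le (S := univ) (x := x₀) le_rfl) hgrad
    (k := κ * ‖fderiv ℝ r x₀‖) (mul_pos hκ (norm_pos_iff.2 hgrad)) (fun v hv => by
      simpa [hessForm_apply, iteratedFDerivWithin_univ] using hhess v hv)
  set k := κ * ‖fderiv ℝ r x₀‖ with hk
  have hkpos : 0 < k := mul_pos hκ (norm_pos_iff.2 hgrad)
  -- the modified defining function
  set r₁ : EuclideanSpace ℝ (Fin n) → ℝ := fun x => r x + Λ / 2 * r x ^ 2 with hr₁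
  have hr₁U : ∀ x ∈ U, ContDiffAt ℝ ∞ r₁ x := fun x hx =>
    (hrU x hx).add (contDiffAt_const.mul ((hrU x hx).pow 2))
  have hfd : ∀ x ∈ U, HasFDerivAt r₁ ((1 + Λ * r x) • fderiv ℝ r x) x := by
    intro x hx
    have h := ((hrU x hx).differentiableAt (by simp)).hasFDerivAt
    have h2 := h.add ((h.pow 2).const_mul (Λ / 2))
    refine h2.congr_fderiv ?_
    ext v
    simp
    ring
  have hfd2 : HasFDerivAt (fderiv ℝ r₁) (fderiv ℝ (fderiv ℝ r) x₀ +
      (Λ • fderiv ℝ r x₀).smulRight (fderiv ℝ r x₀)) x₀ := by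
    have h1 : HasFDerivAt r (fderiv ℝ r x₀) x₀ :=
      ((hrU x₀ hx₀U).differentiableAt (by simp)).hasFDerivAt
    have h2 : HasFDerivAt (fderiv ℝ r) (fderiv ℝ (fderiv ℝ r) x₀) x₀ :=
      (((hrU x₀ hx₀U).fderiv_right (m := 1) (by norm_cast)).differentiableAt
        (by norm_num)).hasFDerivAt
    have h3 := ((h1.const_mul Λ).const_add 1).smul h2
    have h4 : fderiv ℝ r₁ =ᶠ[𝓝 x₀] fun x => (1 + Λ * r x) • fderiv ℝ r x := by
      filter_upwards [Metric.isOpen_ball.mem_nhds hx₀U] with x hx using (hfd x hx).fderiv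
    refine (h3.congr_of_eventuallyEq h4).congr_fderiv ?_
    simp [hr0]
  have hpos0 : ∀ v, k / 2 * ‖v‖ ^ 2 ≤ iteratedFDeriv ℝ 2 r₁ x₀ ![v, v] := by
    intro v
    have := hΛ v
    rw [iteratedFDeriv_two_apply, hfd2.fderiv]
    simp [hessForm_apply, iteratedFDerivWithin_univ, iteratedFDeriv_two_apply] at this ⊢
    linarith
  have hgrad1 : fderiv ℝ r₁ x₀ ≠ 0 := by
    rw [(hfd x₀ hx₀U).fderiv, hr0]; simpa using hgrad
  -- all requirements hold near `x₀` by continuity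
  have c2 : ContinuousAt (iteratedFDeriv ℝ 2 r₁) x₀ :=
    ((hr₁U x₀ hx₀U).iteratedFDeriv_right (i := 2) (m := 0) (by norm_cast)).continuousAt
  have c1 : ContinuousAt (fderiv ℝ r₁) x₀ :=
    ((hr₁U x₀ hx₀U).fderiv_right (m := 0) (by norm_cast)).continuousAt
  have e1 : ∀ᶠ x in 𝓝 x₀, ‖fderiv ℝ r₁ x₀‖ / 2 < ‖fderiv ℝ r₁ x‖ :=
    c1.norm.eventually_const_lt (half_lt_self (norm_pos_iff.2 hgrad1))
  have e2 : ∀ᶠ x in 𝓝 x₀, ‖iteratedFDeriv ℝ 2 r₁ x - iteratedFDeriv ℝ 2 r₁ x₀‖ < k / 4 := by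
    have := (c2.sub continuousAt_const).norm.eventually_lt_const
      (u := k / 4) (v := ‖iteratedFDeriv ℝ 2 r₁ x₀ - iteratedFDeriv ℝ 2 r₁ x₀‖)
    exact this (by simpa using hkpos)
  have e3 : ∀ᶠ x in 𝓝 x₀, -1 < Λ / 2 * r x := by
    have : ContinuousAt (fun x => Λ / 2 * r x) x₀ := (hrU x₀ hx₀U).continuousAt.const_mul _
    exact this.eventually_const_lt (by simp [hr0])
  obtain ⟨δ, hδ, hδ'⟩ := Metric.nhds_basis_closedBall.eventually_iff.1
    ((e1.and (e2.and e3)).and (Metric.isOpen_ball.mem_nhds hx₀U))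
  set S := Metric.closedBall x₀ δ with hS
  have hSu : UniqueDiffOn ℝ S := uniqueDiffOn_convex (convex_closedBall _ _) (by
    rw [interior_closedBall _ hδ.ne']; exact ⟨x₀, Metric.mem_ball_self hδ⟩)
  have hC4 : ContDiffOn ℝ 4 r₁ S := fun x hx =>
    ((hr₁U x (hδ' hx).2).of_le (by norm_cast)).contDiffWithinAt
  have hbd : ∀ j : ℕ, ∃ C, ∀ x ∈ S, j ≤ 4 → ‖iteratedFDerivWithin ℝ j r₁ S x‖ ≤ C := by
    intro j
    by_cases hj : j ≤ 4
    · obtain ⟨C, hC⟩ := (isCompact_closedBall x₀ δ).exists_bound_of_continuousOn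
        (hC4.continuousOn_iteratedFDerivWithin (m := j) (by exact_mod_cast hj) hSu)
      exact ⟨C, fun x hx _ => hC x hx⟩
    · exact ⟨0, fun x hx h => absurd h hj⟩
  choose C hC using hbd
  refine ⟨δ, k / 4, ‖fderiv ℝ r₁ x₀‖ / 2, ∑ j ∈ Finset.range 5, |C j|, r₁, hδ, by positivity,
    half_pos (norm_pos_iff.2 hgrad1), hC4, ?_, ?_, ?_, ?_⟩
  · intro x hx
    have h := (hδ' hx).1.2.2
    rw [hmem x (hρV (hδ' hx).2)]
    have : r₁ x = r x * (1 + Λ / 2 * r x) := by rw [hr₁]; ring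
    rw [this]
    have h1 : 0 < 1 + Λ / 2 * r x := by linarith
    constructor
    · intro h2; exact mul_neg_of_neg_of_pos h2 h1
    · intro h2; by_contra h3; push Not at h3
      exact absurd h2 (not_lt.2 (mul_nonneg h3 h1.le))
  · intro x hx
    rw [(hfd x (hδ' hx).2).differentiableAt.fderivWithin (hSu x hx)]
    exact (hδ' hx).1.1.le
  · intro x hx v
    rw [hessForm_apply, iteratedFDerivWithin_eq_iteratedFDeriv hSu
      ((hr₁U x (hδ' hx).2).of_le (by norm_cast)) hx]
    have h1 := (iteratedFDeriv ℝ 2 r₁ x - iteratedFDeriv ℝ 2 r₁ x₀).le_of_opNorm_le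
      (hδ' hx).1.2.1.le ![v, v]
    simp only [Fin.prod_univ_two, sub_apply, Real.norm_eq_abs] at h1
    have h2 := (abs_le.1 h1).1
    have h3 := hpos0 v
    simp only [Matrix.cons_val_zero, Matrix.cons_val_one] at h2
    nlinarith
  · intro j hj x hx
    refine (hC j x hx hj).trans ((le_abs_self _).trans ?_)
    exact Finset.single_le_sum (f := fun j => |C j|) (fun _ _ => abs_nonneg _)
      (Finset.mem_range.2 (by omega))

/-- A unit vector `ν` is an inner normal of `Ω` at `y` if the half-space `{x | ⟨x - y, ν⟩ ≥ 0}`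
contains `Ω`. -/
def IsInnerNormal {n : ℕ} (Ω : Set (EuclideanSpace ℝ (Fin n))) (y ν : EuclideanSpace ℝ (Fin n)) :
    Prop :=
  ‖ν‖ = 1 ∧ ∀ x ∈ closure Ω, 0 ≤ inner ℝ (x - y) ν

/-- Quantitative description of a uniformly convex boundary near `y`, with one constant `M`:
`ν` is the inner unit normal and `Q` extends the second fundamental form. Through `y` there are
boundary points `y ± s e + z ν` for each unit tangent vector `e`, and `s² Q(e, e)` is the sum of
their heights `z` up to an error of fourth order. -/
structure BoundaryFrame {n : ℕ} (Ω : Set (EuclideanSpace ℝ (Fin n))) (M : ℝ)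
    (y ν : EuclideanSpace ℝ (Fin n)) (Q : LinearMap.BilinForm ℝ (EuclideanSpace ℝ (Fin n))) :
    Prop where
  norm_eq : ‖ν‖ = 1
  support : ∀ x ∈ closure Ω, ‖x - y‖ ^ 2 ≤ M * inner ℝ (x - y) ν
  inward : ∀ s ∈ Ioc 0 (1 / M), y + s • ν ∈ Ω
  abs_le : ∀ v w, |Q v w| ≤ M * ‖v‖ * ‖w‖
  normal_variation : ∀ x ∈ frontier Ω, ∀ ν', IsInnerNormal Ω x ν' → ∀ e, inner ℝ e ν = 0 →
    |inner ℝ ν' (e + Q (x - y) e • ν)| ≤ M * ‖x - y‖ ^ 2 * ‖e‖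
  points : ∀ e, ‖e‖ = 1 → inner ℝ e ν = 0 → ∀ s ∈ Ioc 0 (1 / M), ∃ z₁ z₂ : ℝ,
    z₁ ∈ Icc 0 (M * s ^ 2) ∧ z₂ ∈ Icc 0 (M * s ^ 2) ∧
    y + (s • e + z₁ • ν) ∈ frontier Ω ∧ y + ((-s) • e + z₂ • ν) ∈ frontier Ω ∧
    |z₁ - z₂| ≤ M * s ^ 3 ∧ |z₁ + z₂ - s ^ 2 * Q e e| ≤ M * s ^ 4

section LocalDefining

variable {n : ℕ} {Ω : Set (EuclideanSpace ℝ (Fin n))} {x₀ : EuclideanSpace ℝ (Fin n)}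
  {δ m g K : ℝ} {r : EuclideanSpace ℝ (Fin n) → ℝ}

theorem LocalDefining.uniqueDiffOn (h : LocalDefining Ω x₀ δ m g K r) :
    UniqueDiffOn ℝ (Metric.closedBall x₀ δ) :=
  uniqueDiffOn_convex (convex_closedBall _ _) (by
    rw [interior_closedBall _ h.δ_pos.ne']; exact ⟨x₀, Metric.mem_ball_self h.δ_pos⟩)

theorem LocalDefining.subset_closure_interior (h : LocalDefining Ω x₀ δ m g K r) :
    Metric.closedBall x₀ δ ⊆ closure (interior (Metric.closedBall x₀ δ)) := by
  rw [interior_closedBall _ h.δ_pos.ne', closure_ball _ h.δ_pos.ne']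

theorem LocalDefining.nonpos (h : LocalDefining Ω x₀ δ m g K r) {x : EuclideanSpace ℝ (Fin n)}
    (hx : x ∈ Metric.ball x₀ δ) (hxΩ : x ∈ closure Ω) : r x ≤ 0 := by
  by_contra hc
  push Not at hc
  have hnb : Metric.closedBall x₀ δ ∈ 𝓝 x :=
    Filter.mem_of_superset (Metric.isOpen_ball.mem_nhds hx) Metric.ball_subset_closedBall
  have h1 : ContinuousAt r x := (h.contDiffOn.continuousOn x
    (Metric.ball_subset_closedBall hx)).continuousAt hnb
  have h2 : ∀ᶠ z in 𝓝 x, z ∉ Ω := by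
    filter_upwards [h1.eventually_const_lt hc, hnb] with z hz hzb hzΩ
    exact absurd ((h.mem_iff z hzb).1 hzΩ) (not_lt.2 hz.le)
  exact (mem_closure_iff_frequently.1 hxΩ) h2

theorem LocalDefining.eq_zero (hΩ : IsOpen Ω) (h : LocalDefining Ω x₀ δ m g K r)
    {x : EuclideanSpace ℝ (Fin n)}
    (hx : x ∈ Metric.ball x₀ δ) (hxΩ : x ∈ frontier Ω) : r x = 0 := by
  refine le_antisymm (h.nonpos hx (frontier_subset_closure hxΩ)) ?_
  rw [hΩ.frontier_eq] at hxΩ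
  exact not_lt.1 fun hc => hxΩ.2 ((h.mem_iff x (Metric.ball_subset_closedBall hx)).2 hc)

/-- The inner unit normal computed from a local defining function. -/
noncomputable def LocalDefining.normal (_h : LocalDefining Ω x₀ δ m g K r)
    (x : EuclideanSpace ℝ (Fin n)) : EuclideanSpace ℝ (Fin n) :=
  (-‖fderivWithin ℝ r (Metric.closedBall x₀ δ) x‖⁻¹) •
    (InnerProductSpace.toDual ℝ _).symm (fderivWithin ℝ r (Metric.closedBall x₀ δ) x)

theorem LocalDefining.norm_fderiv_pos (h : LocalDefining Ω x₀ δ m g K r)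
    {x : EuclideanSpace ℝ (Fin n)} (hx : x ∈ Metric.closedBall x₀ δ) :
    0 < ‖fderivWithin ℝ r (Metric.closedBall x₀ δ) x‖ := h.g_pos.trans_le (h.grad_ge x hx)

theorem LocalDefining.norm_normal (h : LocalDefining Ω x₀ δ m g K r)
    {x : EuclideanSpace ℝ (Fin n)} (hx : x ∈ Metric.closedBall x₀ δ) : ‖h.normal x‖ = 1 := by
  rw [LocalDefining.normal, norm_smul, LinearIsometryEquiv.norm_map, norm_neg, norm_inv, norm_norm,
    inv_mul_cancel₀ (h.norm_fderiv_pos hx).ne']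

theorem LocalDefining.fderiv_apply (h : LocalDefining Ω x₀ δ m g K r)
    {x : EuclideanSpace ℝ (Fin n)} (hx : x ∈ Metric.closedBall x₀ δ)
    (v : EuclideanSpace ℝ (Fin n)) :
    fderivWithin ℝ r (Metric.closedBall x₀ δ) x v =
      -‖fderivWithin ℝ r (Metric.closedBall x₀ δ) x‖ * inner ℝ v (h.normal x) := by
  rw [LocalDefining.normal, inner_smul_right, real_inner_comm,
    InnerProductSpace.toDual_symm_apply]
  have := (h.norm_fderiv_pos hx).ne'
  field_simp

theorem LocalDefining.normal_eq (h : LocalDefining Ω x₀ δ m g K r)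
    {x : EuclideanSpace ℝ (Fin n)} (hx : x ∈ Metric.ball x₀ δ) (hr : r x = 0)
    {ν : EuclideanSpace ℝ (Fin n)} (hν : IsInnerNormal Ω x ν) : ν = h.normal x := by
  have hxc := Metric.ball_subset_closedBall hx
  have hxi : x ∈ interior (Metric.closedBall x₀ δ) := Metric.ball_subset_interior_closedBall hx
  set u := h.normal x with hu
  have hun : ‖u‖ = 1 := h.norm_normal hxc
  -- directions pointing into `Ω` have nonnegative product with `ν`
  have key : ∀ v, 0 < inner ℝ v u → 0 ≤ inner ℝ v ν := by
    intro v hv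
    by_contra hc
    push Not at hc
    have hd := hasDerivAt_line₀ (h.contDiffOn.differentiableOn (by norm_num)) (x := x) (v := v)
      (s := 0) (by simpa using hxi)
    simp only [zero_smul, add_zero] at hd
    have hneg : fderivWithin ℝ r (Metric.closedBall x₀ δ) x v < 0 := by
      rw [h.fderiv_apply hxc]
      have := mul_pos (h.norm_fderiv_pos hxc) hv
      linarith
    have hnot : ¬ ∀ᶠ s : ℝ in 𝓝[>] 0, 0 ≤ r (x + s • v) := by
      intro hev
      have h1 := (hasDerivWithinAt_iff_tendsto_slope' (by simp)).1
        (hd.hasDerivWithinAt (s := Ioi 0))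
      refine absurd (ge_of_tendsto h1 ?_) (not_le.2 hneg)
      filter_upwards [hev, self_mem_nhdsWithin] with s hs hs0
      rw [slope_def_field]
      simp only [zero_smul, add_zero, hr, sub_zero]
      exact div_nonneg hs (le_of_lt hs0)
    refine hnot ?_
    filter_upwards [self_mem_nhdsWithin, (eventually_line_mem_interior hxi v).filter_mono
      nhdsWithin_le_nhds] with s hs hsb
    by_contra hc2
    push Not at hc2
    have hmem := (h.mem_iff _ (interior_subset hsb)).2 hc2
    have := hν.2 _ (subset_closure hmem)
    rw [add_sub_cancel_left, inner_smul_left] at this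
    have hs' : (0 : ℝ) < s := hs
    simp only [conj_trivial] at this
    nlinarith
  -- test with `v = ε u - p`, `p` the tangential part of `ν`
  set a := inner ℝ ν u with ha
  set p := ν - a • u with hp
  have hpu : inner ℝ p u = 0 := by
    rw [hp, inner_sub_left, inner_smul_left, real_inner_self_eq_norm_sq, hun]; simp [ha]
  have huν : inner ℝ u ν = a := by rw [ha, real_inner_comm]
  have hνp : ν = p + a • u := by rw [hp]; abel
  have hpν : inner ℝ p ν = ‖p‖ ^ 2 := by
    conv_lhs => rw [hνp]
    rw [inner_add_right, inner_smul_right, hpu, real_inner_self_eq_norm_sq]; ring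
  have h1 : ∀ ε : ℝ, 0 < ε → 0 ≤ ε * a - ‖p‖ ^ 2 := by
    intro ε hε
    have := key (ε • u - p) (by
      rw [inner_sub_left, inner_smul_left, hpu, real_inner_self_eq_norm_sq, hun]; simpa using hε)
    rw [inner_sub_left, inner_smul_left, hpν, huν] at this
    simpa using this
  have ha1 : 0 ≤ a := by
    have := h1 1 one_pos
    nlinarith [sq_nonneg ‖p‖]
  have hp0 : p = 0 := by
    by_contra hpne
    have hpp : 0 < ‖p‖ := norm_pos_iff.2 hpne
    have := h1 (‖p‖ ^ 2 / (2 * (a + 1))) (by positivity)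
    have e : ‖p‖ ^ 2 / (2 * (a + 1)) * a ≤ ‖p‖ ^ 2 / 2 := by
      rw [div_mul_eq_mul_div, div_le_div_iff₀ (by positivity) two_pos]
      nlinarith [sq_nonneg ‖p‖]
    nlinarith
  rw [hp0, zero_add] at hνp
  have : |a| = 1 := by
    have := congrArg norm hνp
    rw [hν.1, norm_smul, hun, mul_one] at this
    exact this.symm
  rw [abs_of_nonneg ha1] at this
  rw [hνp, this, one_smul]

end LocalDefining

theorem inner_add_smul_normal {E : Type*} [NormedAddCommGroup E] [InnerProductSpace ℝ E] {e ν : E}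
    (hν : ‖ν‖ = 1) (heν : inner ℝ e ν = 0) (s z : ℝ) :
    inner ℝ (s • e + z • ν) ν = z := by
  rw [inner_add_left, inner_smul_left, inner_smul_left, heν, real_inner_self_eq_norm_sq, hν]
  simp

/-- A segment which starts outside the closure of an open set and ends in the set crosses the
frontier. -/
theorem exists_mem_frontier_of_line {E : Type*} [NormedAddCommGroup E] [NormedSpace ℝ E]
    {Ω : Set E} (hΩ : IsOpen Ω) {x v : E} {Z : ℝ} (hZ : 0 ≤ Z) (h0 : x ∉ Ω)
    (h1 : x + Z • v ∈ Ω) : ∃ z ∈ Icc 0 Z, x + z • v ∈ frontier Ω := by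
  have hc : Continuous fun z : ℝ => x + z • v := by fun_prop
  have hcomp : IsCompact (Icc (0 : ℝ) Z ∩ (fun z : ℝ => x + z • v) ⁻¹' closure Ω) :=
    isCompact_Icc.inter_right (isClosed_closure.preimage hc)
  obtain ⟨z, ⟨hz, hzcl⟩, hmin⟩ := hcomp.exists_isLeast ⟨Z, right_mem_Icc.2 hZ, subset_closure h1⟩
  refine ⟨z, hz, ?_⟩
  rw [hΩ.frontier_eq]
  refine ⟨hzcl, fun hzΩ => ?_⟩
  have hz0 : 0 < z := by
    rcases hz.1.lt_or_eq with h | h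
    · exact h
    · subst h; simp at hzΩ; exact absurd hzΩ h0
  have hnb' : ∀ᶠ w in 𝓝 z, x + w • v ∈ Ω :=
    hc.continuousAt.preimage_mem_nhds (hΩ.mem_nhds hzΩ)
  have hnb : ∀ᶠ w in 𝓝[<] z, x + w • v ∈ Ω := hnb'.filter_mono nhdsWithin_le_nhds
  obtain ⟨w, hwΩ, hw⟩ := (hnb.and (Ioo_mem_nhdsLT hz0)).exists
  exact absurd (hmin ⟨⟨hw.1.le, hw.2.le.trans hz.2⟩, subset_closure hwΩ⟩) (not_le.2 hw.2)

section LocalFrame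

variable {n : ℕ} {Ω : Set (EuclideanSpace ℝ (Fin n))} {x₀ : EuclideanSpace ℝ (Fin n)}
  {δ m g K : ℝ} {r : EuclideanSpace ℝ (Fin n) → ℝ}

theorem LocalDefining.ball_subset (h : LocalDefining Ω x₀ δ m g K r)
    {y x : EuclideanSpace ℝ (Fin n)} (hy : y ∈ Metric.closedBall x₀ (δ / 2))
    (hx : ‖x - y‖ ≤ δ / 4) : x ∈ Metric.ball x₀ δ := by
  rw [mem_closedBall_iff_norm] at hy
  rw [mem_ball_iff_norm]
  have : x - x₀ = (x - y) + (y - x₀) := by abel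
  rw [this]
  have := norm_add_le (x - y) (y - x₀)
  linarith [h.δ_pos]

theorem LocalDefining.mem_ball (h : LocalDefining Ω x₀ δ m g K r)
    {y : EuclideanSpace ℝ (Fin n)} (hy : y ∈ Metric.closedBall x₀ (δ / 2)) :
    y ∈ Metric.ball x₀ δ := h.ball_subset hy (by simpa using by linarith [h.δ_pos])

theorem LocalDefining.norm_fderiv_le (h : LocalDefining Ω x₀ δ m g K r)
    {x : EuclideanSpace ℝ (Fin n)} (hx : x ∈ Metric.closedBall x₀ δ) :
    ‖fderivWithin ℝ r (Metric.closedBall x₀ δ) x‖ ≤ K :=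
  norm_fderivWithin_le h.uniqueDiffOn hx (h.bound 1 (by norm_num) x hx)

theorem LocalDefining.K_pos (h : LocalDefining Ω x₀ δ m g K r) : 0 < K := by
  have hx : x₀ ∈ Metric.closedBall x₀ δ := Metric.mem_closedBall_self h.δ_pos.le
  exact (h.norm_fderiv_pos hx).trans_le (h.norm_fderiv_le hx)

/-- Strict convexity of the defining function makes the domain lie above a paraboloid. -/
theorem LocalDefining.exists_support (hΩ : IsUniformlyConvexDomain Ω)
    (h : LocalDefining Ω x₀ δ m g K r) :
    ∃ M : ℝ, 0 < M ∧ ∀ y ∈ frontier Ω, y ∈ Metric.closedBall x₀ (δ / 2) →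
      ∀ x ∈ closure Ω, ‖x - y‖ ^ 2 ≤ M * inner ℝ (x - y) (h.normal y) := by
  obtain ⟨R, hR⟩ := hΩ.isBounded.closure.exists_norm_le
  have hK := h.K_pos
  have hm := h.m_pos
  have hδ := h.δ_pos
  set M₁ := 2 * K / m with hM₁
  have hM₁pos : 0 < M₁ := by positivity
  set D := 2 * |R| + 1 with hD
  refine ⟨M₁ + M₁ * D / (δ / 4), by positivity, fun y hy hyb x hx => ?_⟩
  have hyB := h.mem_ball hyb
  have hyC := Metric.ball_subset_closedBall hyB
  have hycl := frontier_subset_closure hy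
  -- points near `y`
  have near : ∀ x ∈ closure Ω, ‖x - y‖ ≤ δ / 4 →
      ‖x - y‖ ^ 2 ≤ M₁ * inner ℝ (x - y) (h.normal y) := by
    intro x hx hxy
    have hxB := h.ball_subset hyb hxy
    have hxC := Metric.ball_subset_closedBall hxB
    have hI : ∀ s ∈ Icc (0 : ℝ) 1, y + s • (x - y) ∈ Metric.closedBall x₀ δ := fun s hs =>
      (convex_closedBall x₀ δ).add_smul_sub_mem hyC hxC hs
    have ht := taylor_two_lower (g₀ := fun s => r (y + s • (x - y))) (c := m * ‖x - y‖ ^ 2)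
      (fun s hs => hasDerivWithinAt_line₀ (h.contDiffOn.differentiableOn (by norm_num)) hI hs)
      (fun s hs => hasDerivWithinAt_line₁ h.uniqueDiffOn (h.contDiffOn.of_le (by norm_num)) hI hs
        (x - y))
      (fun s hs => h.hess_ge _ (hI s hs) _)
    simp only [zero_smul, add_zero, one_smul, add_sub_cancel] at ht
    rw [h.eq_zero hΩ.isOpen hyB hy, h.fderiv_apply hyC] at ht
    have h1 := h.nonpos hxB hx
    have h2 := h.norm_fderiv_le hyC
    have h3 := h.norm_fderiv_pos hyC
    set G := ‖fderivWithin ℝ r (Metric.closedBall x₀ δ) y‖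
    set I := inner ℝ (x - y) (h.normal y)
    have h4 : m / 2 * ‖x - y‖ ^ 2 ≤ G * I := by nlinarith
    have hI0 : 0 ≤ I := by
      by_contra hc
      push Not at hc
      nlinarith [sq_nonneg ‖x - y‖]
    have h5 : m / 2 * ‖x - y‖ ^ 2 ≤ K * I := h4.trans (mul_le_mul_of_nonneg_right h2 hI0)
    rw [hM₁, div_mul_eq_mul_div, le_div_iff₀ hm]
    linarith
  by_cases hxy : ‖x - y‖ ≤ δ / 4
  · have h1 := near x hx hxy
    have hI0 : 0 ≤ inner ℝ (x - y) (h.normal y) := by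
      by_contra hc
      push Not at hc
      nlinarith [sq_nonneg ‖x - y‖]
    have : 0 ≤ M₁ * D / (δ / 4) := by positivity
    nlinarith
  · push Not at hxy
    have hpos : 0 < ‖x - y‖ := by linarith
    -- shrink `x` towards `y`
    set θ := δ / 4 / ‖x - y‖ with hθ
    have hθ0 : 0 < θ := by positivity
    have hθ1 : θ ≤ 1 := by rw [hθ, div_le_one hpos]; exact hxy.le
    have hx' : y + θ • (x - y) ∈ closure Ω :=
      hΩ.convex.closure.add_smul_sub_mem hycl hx ⟨hθ0.le, hθ1⟩
    have hn : ‖θ • (x - y)‖ = δ / 4 := by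
      rw [norm_smul, Real.norm_of_nonneg hθ0.le, hθ]; field_simp
    have h1 := near _ hx' (by rw [add_sub_cancel_left, hn])
    rw [add_sub_cancel_left, hn, inner_smul_left] at h1
    simp only [conj_trivial] at h1
    set I := inner ℝ (x - y) (h.normal y)
    have hI0 : 0 < I := by
      by_contra hc
      push Not at hc
      have : 0 < (δ / 4) ^ 2 := by positivity
      nlinarith [mul_nonneg hM₁pos.le hθ0.le]
    have hxD : ‖x - y‖ ≤ D := by
      have a1 := hR x hx
      have a2 := hR y hycl
      have a3 := norm_sub_le x y
      have := le_abs_self R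
      linarith
    have e1 : θ * ‖x - y‖ = δ / 4 := by rw [hθ]; field_simp
    have h2 : (δ / 4) * ‖x - y‖ ≤ M₁ * I := by
      have : (δ / 4) * ‖x - y‖ * θ ≤ M₁ * I * θ := by nlinarith
      exact le_of_mul_le_mul_right this hθ0
    have h3 : ‖x - y‖ ^ 2 ≤ M₁ * D / (δ / 4) * I := by
      rw [div_mul_eq_mul_div, le_div_iff₀ (by positivity)]
      nlinarith [mul_nonneg hM₁pos.le hI0.le]
    nlinarith [mul_nonneg hM₁pos.le hI0.le]

theorem LocalDefining.exists_inward (hΩ : IsUniformlyConvexDomain Ω)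
    (h : LocalDefining Ω x₀ δ m g K r) :
    ∃ s₁ : ℝ, 0 < s₁ ∧ ∀ y ∈ frontier Ω, y ∈ Metric.closedBall x₀ (δ / 2) →
      ∀ s ∈ Ioc 0 s₁, y + s • h.normal y ∈ Ω := by
  have hK := h.K_pos
  have hδ := h.δ_pos
  have hg := h.g_pos
  refine ⟨min (δ / 4) (g / (2 * K)), by positivity, fun y hy hyb s hs => ?_⟩
  have hyB := h.mem_ball hyb
  have hyC := Metric.ball_subset_closedBall hyB
  have hν := h.norm_normal hyC
  have hn : ‖s • h.normal y‖ = s := by rw [norm_smul, hν, mul_one, Real.norm_of_nonneg hs.1.le]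
  have hx : y + s • h.normal y ∈ Metric.closedBall x₀ δ := Metric.ball_subset_closedBall
    (h.ball_subset hyb (by rw [add_sub_cancel_left, hn]; exact hs.2.trans (min_le_left _ _)))
  have ht := taylor_two h.uniqueDiffOn (convex_closedBall x₀ δ) (h.contDiffOn.of_le (by norm_num))
    (h.bound 2 (by norm_num)) hyC hx
  rw [h.eq_zero hΩ.isOpen hyB hy, h.fderiv_apply hyC, hn, inner_smul_left,
    real_inner_self_eq_norm_sq, hν] at ht
  simp only [conj_trivial, one_pow, mul_one] at ht
  rw [h.mem_iff _ hx]
  have h1 := (abs_le.1 ht).2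
  have h2 := h.grad_ge y hyC
  have h3 : s * (2 * K) ≤ g := by
    rw [← le_div_iff₀ (by positivity)]; exact hs.2.trans (min_le_right _ _)
  nlinarith [hs.1, mul_le_mul_of_nonneg_left h3 hs.1.le, mul_le_mul_of_nonneg_left h2 hs.1.le,
    mul_pos hs.1 hg]

/-- The second fundamental form, extended to all vectors by the Hessian of the defining function. -/
noncomputable def LocalDefining.fundForm (_h : LocalDefining Ω x₀ δ m g K r)
    (y : EuclideanSpace ℝ (Fin n)) : LinearMap.BilinForm ℝ (EuclideanSpace ℝ (Fin n)) :=
  ‖fderivWithin ℝ r (Metric.closedBall x₀ δ) y‖⁻¹ • hessForm (Metric.closedBall x₀ δ) r y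

theorem LocalDefining.mul_fundForm (h : LocalDefining Ω x₀ δ m g K r)
    {y : EuclideanSpace ℝ (Fin n)} (hy : y ∈ Metric.closedBall x₀ δ)
    (v w : EuclideanSpace ℝ (Fin n)) :
    ‖fderivWithin ℝ r (Metric.closedBall x₀ δ) y‖ * h.fundForm y v w =
      hessForm (Metric.closedBall x₀ δ) r y v w := by
  simp only [LocalDefining.fundForm, LinearMap.smul_apply, smul_eq_mul]
  rw [mul_inv_cancel_left₀ (h.norm_fderiv_pos hy).ne']

theorem LocalDefining.abs_fundForm_le (h : LocalDefining Ω x₀ δ m g K r)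
    {y : EuclideanSpace ℝ (Fin n)} (hy : y ∈ Metric.closedBall x₀ δ)
    (v w : EuclideanSpace ℝ (Fin n)) : |h.fundForm y v w| ≤ K / g * ‖v‖ * ‖w‖ := by
  have h1 := abs_hessForm_le (h.bound 2 (by norm_num) y hy) v w
  rw [← h.mul_fundForm hy, abs_mul, abs_norm] at h1
  have h2 := h.grad_ge y hy
  rw [div_mul_eq_mul_div, div_mul_eq_mul_div, le_div_iff₀ h.g_pos]
  calc |h.fundForm y v w| * g ≤ |h.fundForm y v w| * _ :=
        mul_le_mul_of_nonneg_left h2 (abs_nonneg _)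
    _ ≤ _ := by rw [mul_comm]; exact h1

theorem LocalDefining.exists_normal_variation (hΩ : IsUniformlyConvexDomain Ω)
    (h : LocalDefining Ω x₀ δ m g K r) :
    ∃ M : ℝ, 0 < M ∧ ∀ y ∈ frontier Ω, y ∈ Metric.closedBall x₀ (δ / 2) →
      ∀ x ∈ frontier Ω, ∀ ν', IsInnerNormal Ω x ν' → ∀ e, inner ℝ e (h.normal y) = 0 →
      |inner ℝ ν' (e + h.fundForm y (x - y) e • h.normal y)| ≤ M * ‖x - y‖ ^ 2 * ‖e‖ := by
  have hK := h.K_pos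
  have hδ := h.δ_pos
  have hg := h.g_pos
  refine ⟨(K + K / g * K) / g + (1 / (δ / 4) ^ 2 + K / g / (δ / 4)), by positivity,
    fun y hy hyb x hx ν' hν' e he => ?_⟩
  have hyB := h.mem_ball hyb
  have hyC := Metric.ball_subset_closedBall hyB
  have hν := h.norm_normal hyC
  have hQ := h.abs_fundForm_le hyC (x - y) e
  set q := h.fundForm y (x - y) e with hq
  by_cases hxy : ‖x - y‖ ≤ δ / 4
  · have hxB := h.ball_subset hyb hxy
    have hxC := Metric.ball_subset_closedBall hxB
    rw [h.normal_eq hxB (h.eq_zero hΩ.isOpen hxB hx) hν']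
    have hI : ∀ s ∈ Icc (0 : ℝ) 1, y + s • (x - y) ∈ Metric.closedBall x₀ δ := fun s hs =>
      (convex_closedBall x₀ δ).add_smul_sub_mem hyC hxC hs
    -- expansion of the gradient of `r` at `y`, to second order along `e` and to first along `ν`
    have t1 := taylor_two_bound
      (g₀ := fun s => fderivWithin ℝ r (Metric.closedBall x₀ δ) (y + s • (x - y)) e)
      (K := K * ‖x - y‖ ^ 2 * ‖e‖)
      (fun s hs => hasDerivWithinAt_line₁ h.uniqueDiffOn (h.contDiffOn.of_le (by norm_num)) hI hs e)
      (fun s hs => hasDerivWithinAt_line₂ h.uniqueDiffOn (h.contDiffOn.of_le (by norm_num)) hI hs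
        (x - y) e)
      (fun s hs => (abs_third_le (h.bound 3 (by norm_num) _ (hI s hs)) _ _ _).trans
        (le_of_eq (by ring)))
    have t2 := Convex.norm_image_sub_le_of_norm_hasDerivWithin_le
      (f := fun s => fderivWithin ℝ r (Metric.closedBall x₀ δ) (y + s • (x - y)) (h.normal y))
      (C := K * ‖x - y‖)
      (fun s hs => hasDerivWithinAt_line₁ h.uniqueDiffOn (h.contDiffOn.of_le (by norm_num)) hI hs
        (h.normal y))
      (fun s hs => (abs_hessForm_le (h.bound 2 (by norm_num) _ (hI s hs)) _ _).trans
        (le_of_eq (by rw [hν]; ring))) (convex_Icc 0 1)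
      (left_mem_Icc.2 zero_le_one) (right_mem_Icc.2 zero_le_one)
    simp only [zero_smul, add_zero, one_smul, add_sub_cancel, sub_zero, norm_one, mul_one,
      Real.norm_eq_abs] at t1 t2
    rw [h.fderiv_apply hyC e, he, mul_zero, sub_zero, ← h.mul_fundForm hyC, ← hq] at t1
    rw [h.fderiv_apply hyC (h.normal y), real_inner_self_eq_norm_sq, hν] at t2
    have hx1 := h.fderiv_apply hxC (e + q • h.normal y)
    rw [map_add, map_smul, smul_eq_mul] at hx1
    rw [real_inner_comm]
    have hGx := h.grad_ge x hxC
    set I := inner ℝ (e + q • h.normal y) (h.normal x)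
    set G := ‖fderivWithin ℝ r (Metric.closedBall x₀ δ) y‖
    set Gx := ‖fderivWithin ℝ r (Metric.closedBall x₀ δ) x‖
    set A := fderivWithin ℝ r (Metric.closedBall x₀ δ) x e
    set Bv := fderivWithin ℝ r (Metric.closedBall x₀ δ) x (h.normal y)
    have e1 : A + q * Bv = (A - G * q) + q * (Bv - -G * 1 ^ 2) := by ring
    have e2 : |A + q * Bv| ≤ K * ‖x - y‖ ^ 2 * ‖e‖ + K / g * ‖x - y‖ * ‖e‖ * (K * ‖x - y‖) := by
      rw [e1]
      refine (abs_add_le _ _).trans (add_le_add t1 ?_)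
      rw [abs_mul]
      exact mul_le_mul hQ t2 (abs_nonneg _) (by positivity)
    rw [hx1, abs_mul, abs_neg, abs_of_nonneg (hg.le.trans hGx)] at e2
    have e3 : g * |I| ≤ (K + K / g * K) * (‖x - y‖ ^ 2 * ‖e‖) := by
      have := mul_le_mul_of_nonneg_right hGx (abs_nonneg I)
      calc g * |I| ≤ _ := this.trans e2
        _ = _ := by ring
    have e4 : |I| ≤ (K + K / g * K) / g * (‖x - y‖ ^ 2 * ‖e‖) := by
      rw [div_mul_eq_mul_div, le_div_iff₀ hg]; linarith
    have e5 : 0 ≤ (1 / (δ / 4) ^ 2 + K / g / (δ / 4)) * (‖x - y‖ ^ 2 * ‖e‖) := by positivity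
    nlinarith
  · push Not at hxy
    have h1 : |inner ℝ ν' (e + q • h.normal y)| ≤ ‖e‖ + |q| := by
      refine (abs_real_inner_le_norm _ _).trans ?_
      rw [hν'.1, one_mul]
      refine (norm_add_le _ _).trans ?_
      rw [norm_smul, hν, mul_one, Real.norm_eq_abs]
    have e1 : 1 ≤ 1 / (δ / 4) ^ 2 * ‖x - y‖ ^ 2 := by
      rw [div_mul_eq_mul_div, le_div_iff₀ (by positivity), one_mul, one_mul]
      exact pow_le_pow_left₀ (by positivity) hxy.le 2
    have e2 : ‖x - y‖ ≤ 1 / (δ / 4) * ‖x - y‖ ^ 2 := by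
      rw [div_mul_eq_mul_div, le_div_iff₀ (by positivity)]
      nlinarith
    have e3 : |q| ≤ K / g / (δ / 4) * ‖x - y‖ ^ 2 * ‖e‖ := by
      refine hQ.trans ?_
      have : K / g * ‖x - y‖ ≤ K / g * (1 / (δ / 4) * ‖x - y‖ ^ 2) :=
        mul_le_mul_of_nonneg_left e2 (by positivity)
      calc K / g * ‖x - y‖ * ‖e‖ ≤ K / g * (1 / (δ / 4) * ‖x - y‖ ^ 2) * ‖e‖ :=
            mul_le_mul_of_nonneg_right this (norm_nonneg _)
        _ = _ := by ring
    have e4 : ‖e‖ ≤ 1 / (δ / 4) ^ 2 * ‖x - y‖ ^ 2 * ‖e‖ := by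
      nlinarith [norm_nonneg e]
    have e5 : 0 ≤ (K + K / g * K) / g * (‖x - y‖ ^ 2 * ‖e‖) := by positivity
    nlinarith

end LocalFrame

theorem abs_height_sub_le {G z₁ z₂ A₁ A₂ c₁ c₂ P R D : ℝ}
    (h₁ : |0 - 0 - -G * z₁ - A₁ / 2 - c₁ / 6| ≤ P) (h₂ : |0 - 0 - -G * z₂ - A₂ / 2 - c₂ / 6| ≤ P)
    (hA : |A₁ - A₂| ≤ R) (hc₁ : |c₁| ≤ D) (hc₂ : |c₂| ≤ D) :
    |G * (z₁ - z₂)| ≤ R / 2 + D / 3 + 2 * P := by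
  rw [abs_le] at *
  constructor <;> linarith

theorem abs_height_add_le {G z₁ z₂ A₁ A₂ c₁ c₂ P R D B : ℝ}
    (h₁ : |0 - 0 - -G * z₁ - A₁ / 2 - c₁ / 6| ≤ P) (h₂ : |0 - 0 - -G * z₂ - A₂ / 2 - c₂ / 6| ≤ P)
    (hA : |A₁ + A₂ - B| ≤ R) (hc : |c₁ + c₂| ≤ D) :
    |G * (z₁ + z₂) - B / 2| ≤ R / 2 + D / 6 + 2 * P := by
  rw [abs_le] at *
  constructor <;> linarith

section LocalFrame

variable {n : ℕ} {Ω : Set (EuclideanSpace ℝ (Fin n))} {x₀ : EuclideanSpace ℝ (Fin n)}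
  {δ m g K : ℝ} {r : EuclideanSpace ℝ (Fin n) → ℝ}

theorem LocalDefining.exists_height (hΩ : IsUniformlyConvexDomain Ω)
    (h : LocalDefining Ω x₀ δ m g K r) :
    ∃ C s₂ : ℝ, 0 < C ∧ 0 < s₂ ∧ s₂ ≤ 1 ∧ (1 + C) * s₂ ≤ δ / 4 ∧
      ∀ y ∈ frontier Ω, y ∈ Metric.closedBall x₀ (δ / 2) → ∀ e, ‖e‖ = 1 →
        inner ℝ e (h.normal y) = 0 → ∀ s ∈ Ioc 0 s₂, ∃ z ∈ Icc 0 (C * s ^ 2),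
          y + (s • e + z • h.normal y) ∈ frontier Ω := by
  have hK := h.K_pos
  have hδ := h.δ_pos
  have hg := h.g_pos
  obtain ⟨M, hM, hsup⟩ := h.exists_support hΩ
  set C := (4 * K + 1) / g with hC
  have hCpos : 0 < C := by positivity
  refine ⟨C, min 1 (min (1 / C) (δ / (4 * (1 + C)))), hCpos, by positivity, min_le_left _ _, ?_,
    fun y hy hyb e he heν s hs => ?_⟩
  · have : min 1 (min (1 / C) (δ / (4 * (1 + C)))) ≤ δ / (4 * (1 + C)) :=
      (min_le_right _ _).trans (min_le_right _ _)
    rw [le_div_iff₀ (by positivity)] at this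
    linarith
  have hs1 : s ≤ 1 := hs.2.trans (min_le_left _ _)
  have hsC : s * C ≤ 1 := by
    rw [← le_div_iff₀ hCpos]; exact hs.2.trans ((min_le_right _ _).trans (min_le_left _ _))
  have hsδ : s * (4 * (1 + C)) ≤ δ := by
    rw [← le_div_iff₀ (by positivity)]
    exact hs.2.trans ((min_le_right _ _).trans (min_le_right _ _))
  have hs0 := hs.1
  have hyB := h.mem_ball hyb
  have hyC := Metric.ball_subset_closedBall hyB
  have hν := h.norm_normal hyC
  have hZ : 0 ≤ C * s ^ 2 := by positivity
  have hn := norm_tangent_add_normal_le he hν hs0.le hs1 hZ le_rfl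
  have hout : y + s • e ∉ Ω := by
    intro hc
    have := hsup y hy hyb _ (subset_closure hc)
    rw [add_sub_cancel_left, inner_smul_left, heν, norm_smul, he, Real.norm_eq_abs, mul_one,
      sq_abs] at this
    simp only [mul_zero] at this
    nlinarith [mul_pos hs0 hs0]
  have hin : y + s • e + (C * s ^ 2) • h.normal y ∈ Ω := by
    have hx : y + (s • e + (C * s ^ 2) • h.normal y) ∈ Metric.closedBall x₀ δ :=
      Metric.ball_subset_closedBall (h.ball_subset hyb (by
        rw [add_sub_cancel_left]; refine hn.trans ?_; linarith))
    rw [add_assoc, h.mem_iff _ hx]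
    have ht := taylor_two h.uniqueDiffOn (convex_closedBall x₀ δ)
      (h.contDiffOn.of_le (by norm_num)) (h.bound 2 (by norm_num)) hyC hx
    rw [h.eq_zero hΩ.isOpen hyB hy, h.fderiv_apply hyC, inner_add_smul_normal hν heν] at ht
    have h1 := (abs_le.1 ht).2
    have h2 := h.grad_ge y hyC
    have hn2 : ‖s • e + (C * s ^ 2) • h.normal y‖ ≤ 2 * s := by
      refine (norm_add_le _ _).trans ?_
      rw [norm_smul, norm_smul, he, hν, Real.norm_of_nonneg hs0.le, Real.norm_of_nonneg hZ]
      nlinarith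
    have h3 : ‖s • e + (C * s ^ 2) • h.normal y‖ ^ 2 ≤ (2 * s) ^ 2 :=
      pow_le_pow_left₀ (norm_nonneg _) hn2 2
    have h4 : g * (C * s ^ 2) = (4 * K + 1) * s ^ 2 := by rw [hC]; field_simp
    have h5 : g * (C * s ^ 2) ≤
        ‖fderivWithin ℝ r (Metric.closedBall x₀ δ) y‖ * (C * s ^ 2) :=
      mul_le_mul_of_nonneg_right h2 hZ
    have h6 := mul_le_mul_of_nonneg_left h3 hK.le
    nlinarith [mul_pos hs0 hs0]
  obtain ⟨z, hz, hzf⟩ := exists_mem_frontier_of_line hΩ.isOpen hZ hout hin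
  exact ⟨z, hz, by rwa [← add_assoc]⟩

theorem LocalDefining.exists_points (hΩ : IsUniformlyConvexDomain Ω)
    (h : LocalDefining Ω x₀ δ m g K r) :
    ∃ M s₂ : ℝ, 0 < M ∧ 0 < s₂ ∧
      ∀ y ∈ frontier Ω, y ∈ Metric.closedBall x₀ (δ / 2) → ∀ e, ‖e‖ = 1 →
        inner ℝ e (h.normal y) = 0 → ∀ s ∈ Ioc 0 s₂, ∃ z₁ z₂ : ℝ,
    z₁ ∈ Icc 0 (M * s ^ 2) ∧ z₂ ∈ Icc 0 (M * s ^ 2) ∧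
    y + (s • e + z₁ • h.normal y) ∈ frontier Ω ∧ y + ((-s) • e + z₂ • h.normal y) ∈ frontier Ω ∧
    |z₁ - z₂| ≤ M * s ^ 3 ∧ |z₁ + z₂ - s ^ 2 * h.fundForm y e e| ≤ M * s ^ 4 := by
  have hK := h.K_pos
  have hδ := h.δ_pos
  have hg := h.g_pos
  obtain ⟨C, s₂, hC, hs₂, hs₂1, hs₂δ, hh⟩ := h.exists_height hΩ
  -- constants for the difference and the sum of the heights
  set M₂ := (K * (4 * C + C ^ 2) / 2 + 2 * K * (1 + C) ^ 3 + 2 * K * (1 + C) ^ 4) / g with hM₂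
  have hM₂p : 0 < M₂ := by positivity
  set M₃ := C + M₂ with hM₃
  set M₄ := (K * (2 * M₃ + 2 * M₃ ^ 2) / 2 + K * (1 + M₃) ^ 2 * M₃ + 2 * K * (1 + C) ^ 4) / g
    with hM₄
  have hM₃p : 0 < M₃ := by positivity
  have hM₄p : 0 < M₄ := by positivity
  refine ⟨M₃ + M₄, s₂, by positivity, hs₂, fun y hy hyb e he heν s hs => ?_⟩
  have hs0 := hs.1
  have hs1 : s ≤ 1 := hs.2.trans hs₂1
  have hyB := h.mem_ball hyb
  have hyC := Metric.ball_subset_closedBall hyB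
  have hν := h.norm_normal hyC
  obtain ⟨z₁, hz₁, hf₁⟩ := hh y hy hyb e he heν s hs
  obtain ⟨z₂, hz₂, hf₂⟩ := hh y hy hyb (-e) (by rwa [norm_neg])
    (by rw [inner_neg_left, heν, neg_zero]) s hs
  rw [smul_neg, ← neg_smul] at hf₂
  have n1 := norm_tangent_add_normal_le he hν hs0.le hs1 hz₁.1 hz₁.2
  have n2 := norm_tangent_add_normal_le (e := -e) (by rwa [norm_neg]) hν hs0.le hs1 hz₂.1 hz₂.2
  rw [smul_neg, ← neg_smul] at n2
  have hsmall : (1 + C) * s ≤ δ / 4 :=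
    (mul_le_mul_of_nonneg_left hs.2 (by positivity)).trans hs₂δ
  have b1 : y + (s • e + z₁ • h.normal y) ∈ Metric.ball x₀ δ :=
    h.ball_subset hyb (by rw [add_sub_cancel_left]; exact n1.trans hsmall)
  have b2 : y + ((-s) • e + z₂ • h.normal y) ∈ Metric.ball x₀ δ :=
    h.ball_subset hyb (by rw [add_sub_cancel_left]; exact n2.trans hsmall)
  have t1 := taylor_four h.uniqueDiffOn (convex_closedBall x₀ δ) h.contDiffOn
    (h.bound 4 le_rfl) hyC (Metric.ball_subset_closedBall b1)
  have t2 := taylor_four h.uniqueDiffOn (convex_closedBall x₀ δ) h.contDiffOn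
    (h.bound 4 le_rfl) hyC (Metric.ball_subset_closedBall b2)
  rw [h.eq_zero hΩ.isOpen hyB hy, h.fderiv_apply hyC, inner_add_smul_normal hν heν] at t1 t2
  rw [h.eq_zero hΩ.isOpen b1 hf₁] at t1
  rw [h.eq_zero hΩ.isOpen b2 hf₂] at t2
  have hbH := fun v w => abs_hessForm_le (h.bound 2 (by norm_num) y hyC) v w
  have hsym := fun v w => hessForm_symm h.uniqueDiffOn h.subset_closure_interior
    (h.contDiffOn.of_le (by norm_num)) hyC v w
  have hbC := h.bound 3 (by norm_num) y hyC
  have c1 := abs_third_le hbC (s • e + z₁ • h.normal y) (s • e + z₁ • h.normal y)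
    (s • e + z₁ • h.normal y)
  have c2 := abs_third_le hbC ((-s) • e + z₂ • h.normal y) ((-s) • e + z₂ • h.normal y)
    ((-s) • e + z₂ • h.normal y)
  have q1 := abs_quadratic_sub_le hsym hbH he hν hs0.le hs1 hz₁ hz₂
  have hz₁' : z₁ ∈ Icc 0 (M₃ * s ^ 2) := ⟨hz₁.1, hz₁.2.trans (by gcongr; linarith)⟩
  have hz₂' : z₂ ∈ Icc 0 (M₃ * s ^ 2) := ⟨hz₂.1, hz₂.2.trans (by gcongr; linarith)⟩
  have q2 := fun hz => abs_quadratic_add_le (M := M₃) hsym hbH he hν hs0.le hz₁' hz₂' hz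
  have q3 := abs_cubic_increment_le (M := M₃) hbC he hν hs0.le hs1 hz₁' hz₂'
  have hQ := h.mul_fundForm hyC e e
  have hGg := h.grad_ge y hyC
  set v₁ := s • e + z₁ • h.normal y
  set v₂ := (-s) • e + z₂ • h.normal y
  set H := hessForm (Metric.closedBall x₀ δ) r y
  set G := ‖fderivWithin ℝ r (Metric.closedBall x₀ δ) y‖
  set c₁ := iteratedFDerivWithin ℝ 3 r (Metric.closedBall x₀ δ) y ![v₁, v₁, v₁]
  set c₂ := iteratedFDerivWithin ℝ 3 r (Metric.closedBall x₀ δ) y ![v₂, v₂, v₂]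
  have p1 : ‖v₁‖ ^ 4 ≤ ((1 + C) * s) ^ 4 := pow_le_pow_left₀ (norm_nonneg _) n1 4
  have p2 : ‖v₂‖ ^ 4 ≤ ((1 + C) * s) ^ 4 := pow_le_pow_left₀ (norm_nonneg _) n2 4
  have p3 : ‖v₁‖ ^ 3 ≤ ((1 + C) * s) ^ 3 := pow_le_pow_left₀ (norm_nonneg _) n1 3
  have p4 : ‖v₂‖ ^ 3 ≤ ((1 + C) * s) ^ 3 := pow_le_pow_left₀ (norm_nonneg _) n2 3
  have e2 : K * ((1 + C) * s) ^ 4 = K * (1 + C) ^ 4 * s ^ 4 := by ring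
  have t1' := (t1.trans (mul_le_mul_of_nonneg_left p1 hK.le)).trans e2.le
  have t2' := (t2.trans (mul_le_mul_of_nonneg_left p2 hK.le)).trans e2.le
  have c1' : |c₁| ≤ K * (1 + C) ^ 3 * s ^ 3 := c1.trans
    (le_trans (le_of_eq (by ring)) ((mul_le_mul_of_nonneg_left p3 hK.le).trans (by ring_nf; rfl)))
  have c2' : |c₂| ≤ K * (1 + C) ^ 3 * s ^ 3 := c2.trans
    (le_trans (le_of_eq (by ring)) ((mul_le_mul_of_nonneg_left p4 hK.le).trans (by ring_nf; rfl)))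
  have hs43 : s ^ 4 ≤ s ^ 3 := pow_le_pow_of_le_one hs0.le hs1 (by norm_num)
  have e3 : K * (1 + C) ^ 4 * s ^ 4 ≤ K * (1 + C) ^ 4 * s ^ 3 :=
    mul_le_mul_of_nonneg_left hs43 (by positivity)
  have hG0 : 0 ≤ G := hg.le.trans hGg
  have hdiff : |z₁ - z₂| ≤ M₂ * s ^ 3 := by
    have hX := abs_height_sub_le (t1'.trans e3) (t2'.trans e3) q1 c1' c2'
    rw [abs_mul, abs_of_nonneg hG0] at hX
    rw [hM₂, div_mul_eq_mul_div, le_div_iff₀ hg]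
    have : 0 ≤ K * (1 + C) ^ 3 * s ^ 3 := by positivity
    linarith [mul_le_mul_of_nonneg_right hGg (abs_nonneg (z₁ - z₂))]
  have hdiff' : |z₁ - z₂| ≤ M₃ * s ^ 3 := hdiff.trans (by gcongr; linarith)
  have hsum : |z₁ + z₂ - s ^ 2 * h.fundForm y e e| ≤ M₄ * s ^ 4 := by
    have hX := abs_height_add_le t1' t2' (q2 hdiff') q3
    have e1 : G * (z₁ + z₂) - 2 * s ^ 2 * H e e / 2 =
        G * (z₁ + z₂ - s ^ 2 * h.fundForm y e e) := by
      rw [← hQ]; ring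
    rw [e1, abs_mul, abs_of_nonneg hG0] at hX
    rw [hM₄, div_mul_eq_mul_div, le_div_iff₀ hg]
    linarith [mul_le_mul_of_nonneg_right hGg (abs_nonneg (z₁ + z₂ - s ^ 2 * h.fundForm y e e))]
  have hM : M₃ ≤ M₃ + M₄ := by linarith
  exact ⟨z₁, z₂, ⟨hz₁'.1, hz₁'.2.trans (by gcongr)⟩, ⟨hz₂'.1, hz₂'.2.trans (by gcongr)⟩, hf₁, hf₂,
    hdiff'.trans (by gcongr), hsum.trans (by gcongr; linarith)⟩

end LocalFrame

theorem BoundaryFrame.mono {n : ℕ} {Ω : Set (EuclideanSpace ℝ (Fin n))} {M M' : ℝ}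
    {y ν : EuclideanSpace ℝ (Fin n)} {Q : LinearMap.BilinForm ℝ (EuclideanSpace ℝ (Fin n))}
    (h : BoundaryFrame Ω M y ν Q) (hM : 0 < M) (hMM' : M ≤ M') : BoundaryFrame Ω M' y ν Q where
  norm_eq := h.norm_eq
  support x hx := by
    have h1 := h.support x hx
    have : 0 ≤ inner ℝ (x - y) ν := by
      by_contra hc
      push Not at hc
      nlinarith [sq_nonneg ‖x - y‖]
    exact h1.trans (mul_le_mul_of_nonneg_right hMM' this)
  inward s hs := h.inward s ⟨hs.1, hs.2.trans (one_div_le_one_div_of_le hM hMM')⟩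
  abs_le v w := (h.abs_le v w).trans (by gcongr)
  normal_variation x hx ν' hν' e he := (h.normal_variation x hx ν' hν' e he).trans (by gcongr)
  points e he heν s hs := by
    obtain ⟨z₁, z₂, h1, h2, h3, h4, h5, h6⟩ := h.points e he heν s
      ⟨hs.1, hs.2.trans (one_div_le_one_div_of_le hM hMM')⟩
    have hs0 := hs.1
    exact ⟨z₁, z₂, ⟨h1.1, h1.2.trans (by gcongr)⟩, ⟨h2.1, h2.2.trans (by gcongr)⟩, h3, h4,
      h5.trans (by gcongr), h6.trans (by gcongr)⟩

theorem LocalDefining.exists_boundaryFrame {n : ℕ} {Ω : Set (EuclideanSpace ℝ (Fin n))}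
    {x₀ : EuclideanSpace ℝ (Fin n)} {δ m g K : ℝ} {r : EuclideanSpace ℝ (Fin n) → ℝ}
    (hΩ : IsUniformlyConvexDomain Ω) (h : LocalDefining Ω x₀ δ m g K r) :
    ∃ M : ℝ, 0 < M ∧ ∀ y ∈ frontier Ω, y ∈ Metric.closedBall x₀ (δ / 2) →
      BoundaryFrame Ω M y (h.normal y) (h.fundForm y) := by
  obtain ⟨M₁, hM₁, h1⟩ := h.exists_support hΩ
  obtain ⟨s₁, hs₁, h2⟩ := h.exists_inward hΩ
  obtain ⟨M₃, hM₃, h3⟩ := h.exists_normal_variation hΩ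
  obtain ⟨M₄, s₂, hM₄, hs₂, h4⟩ := h.exists_points hΩ
  have hK := h.K_pos
  have hg := h.g_pos
  set M := M₁ + 1 / s₁ + M₃ + M₄ + 1 / s₂ + K / g with hM
  have p1 : 0 < 1 / s₁ := by positivity
  have p2 : 0 < 1 / s₂ := by positivity
  have p3 : 0 < K / g := by positivity
  have hMpos : 0 < M := by positivity
  have i1 : 1 / M ≤ s₁ := by
    rw [div_le_iff₀ hMpos]
    have : s₁ * (1 / s₁) = 1 := by field_simp
    nlinarith
  have i2 : 1 / M ≤ s₂ := by
    rw [div_le_iff₀ hMpos]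
    have : s₂ * (1 / s₂) = 1 := by field_simp
    nlinarith
  refine ⟨M, hMpos, fun y hy hyb => ?_⟩
  have hyC := Metric.ball_subset_closedBall (h.mem_ball hyb)
  refine ⟨h.norm_normal hyC, fun x hx => ?_, fun s hs => h2 y hy hyb s ⟨hs.1, hs.2.trans i1⟩,
    fun v w => ?_, fun x hx ν' hν' e he => ?_, fun e he heν s hs => ?_⟩
  · have h5 := h1 y hy hyb x hx
    have : 0 ≤ inner ℝ (x - y) (h.normal y) := by
      by_contra hc
      push Not at hc
      nlinarith [sq_nonneg ‖x - y‖]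
    exact h5.trans (mul_le_mul_of_nonneg_right (by linarith) this)
  · refine (h.abs_fundForm_le hyC v w).trans ?_
    gcongr
    linarith
  · refine (h3 y hy hyb x hx ν' hν' e he).trans ?_
    gcongr
    linarith
  · have hs0 := hs.1
    have hMM : M₄ ≤ M := by linarith
    obtain ⟨z₁, z₂, a1, a2, a3, a4, a5, a6⟩ := h4 y hy hyb e he heν s ⟨hs.1, hs.2.trans i2⟩
    exact ⟨z₁, z₂, ⟨a1.1, a1.2.trans (by gcongr)⟩, ⟨a2.1, a2.2.trans (by gcongr)⟩, a3, a4,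
      a5.trans (by gcongr), a6.trans (by gcongr)⟩

/-- The constants of the local descriptions are uniform because the boundary is compact. -/
theorem IsUniformlyConvexDomain.exists_boundaryFrame {n : ℕ}
    {Ω : Set (EuclideanSpace ℝ (Fin n))} (hΩ : IsUniformlyConvexDomain Ω) :
    ∃ M : ℝ, 1 ≤ M ∧ ∀ y ∈ frontier Ω, ∃ ν Q, BoundaryFrame Ω M y ν Q := by
  have hcomp : IsCompact (frontier Ω) :=
    Metric.isCompact_of_isClosed_isBounded isClosed_frontier
      (hΩ.isBounded.closure.subset frontier_subset_closure)
  have := hcomp.induction_on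
    (p := fun A => ∃ M : ℝ, 0 < M ∧ ∀ y ∈ A ∩ frontier Ω, ∃ ν Q, BoundaryFrame Ω M y ν Q)
    ⟨1, one_pos, by simp⟩
    (fun s t hst ⟨M, hM, h⟩ => ⟨M, hM, fun y hy => h y ⟨hst hy.1, hy.2⟩⟩)
    (fun s t ⟨M, hM, h⟩ ⟨M', hM', h'⟩ => ⟨M + M', by positivity, fun y hy => by
      rcases hy.1 with hs | ht
      · obtain ⟨ν, Q, hf⟩ := h y ⟨hs, hy.2⟩
        exact ⟨ν, Q, hf.mono hM (by linarith)⟩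
      · obtain ⟨ν, Q, hf⟩ := h' y ⟨ht, hy.2⟩
        exact ⟨ν, Q, hf.mono hM' (by linarith)⟩⟩)
    (fun x hx => by
      obtain ⟨δ, m, g, K, r, hr⟩ := hΩ.exists_localDefining hx
      obtain ⟨M, hM, h⟩ := hr.exists_boundaryFrame hΩ
      exact ⟨Metric.closedBall x (δ / 2), mem_nhdsWithin_of_mem_nhds
        (Metric.closedBall_mem_nhds x (half_pos hr.δ_pos)), M, hM, fun y hy =>
          ⟨_, _, h y hy.2 hy.1⟩⟩)
  obtain ⟨M, hM, h⟩ := this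
  refine ⟨M + 1, by linarith, fun y hy => ?_⟩
  obtain ⟨ν, Q, hf⟩ := h y ⟨hy, hy⟩
  exact ⟨ν, Q, hf.mono hM (by linarith)⟩

/-! ### Parabolic regularity classes -/

section ClosureDomain

variable {n : ℕ} {Ω : Set (EuclideanSpace ℝ (Fin n))}

theorem IsUniformlyConvexDomain.interior_closure (hΩ : IsUniformlyConvexDomain Ω) :
    interior (closure Ω) = Ω := by
  have hne : (interior Ω).Nonempty := by rw [hΩ.isOpen.interior_eq]; exact hΩ.nonempty
  rw [hΩ.convex.interior_closure_eq_interior_of_nonempty_interior hne, hΩ.isOpen.interior_eq]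

theorem IsUniformlyConvexDomain.uniqueDiffOn_closure (hΩ : IsUniformlyConvexDomain Ω) :
    UniqueDiffOn ℝ (closure Ω) :=
  uniqueDiffOn_convex hΩ.convex.closure (by rw [hΩ.interior_closure]; exact hΩ.nonempty)

theorem IsUniformlyConvexDomain.closure_subset (hΩ : IsUniformlyConvexDomain Ω) :
    closure Ω ⊆ closure (interior (closure Ω)) := by
  rw [hΩ.interior_closure]

theorem IsUniformlyConvexDomain.isCompact_closure (hΩ : IsUniformlyConvexDomain Ω) :
    IsCompact (closure Ω) :=
  Metric.isCompact_of_isClosed_isBounded isClosed_closure hΩ.isBounded.closure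

theorem IsUniformlyConvexDomain.mem_or_frontier (hΩ : IsUniformlyConvexDomain Ω)
    {x : EuclideanSpace ℝ (Fin n)} (hx : x ∈ closure Ω) : x ∈ Ω ∨ x ∈ frontier Ω := by
  rw [hΩ.isOpen.frontier_eq]
  by_cases h : x ∈ Ω
  · exact Or.inl h
  · exact Or.inr ⟨hx, h⟩

theorem closedCylinder_subset_closure {T : ℝ} (hT : 0 < T) :
    closedCylinder Ω T ⊆ closure (Ω ×ˢ Ioo 0 T) := by
  rw [closure_prod_eq, closure_Ioo hT.ne]
  exact subset_rfl

end ClosureDomain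

section ParabolicClass

variable {n : ℕ} {Ω : Set (EuclideanSpace ℝ (Fin n))} {T : ℝ}
  {w : EuclideanSpace ℝ (Fin n) → ℝ → ℝ}

theorem MemParabolicC.contDiffOn_slice (h : MemParabolicC 4 Ω T w) {t : ℝ} (ht : t ∈ Icc 0 T) :
    ContDiffOn ℝ 4 (fun y => w y t) (closure Ω) := by
  simpa using h.contDiffOn_space 0 (by norm_num) t ht

theorem MemParabolicC.contDiffOn_timeDeriv (h : MemParabolicC 4 Ω T w) {t : ℝ}
    (ht : t ∈ Icc 0 T) : ContDiffOn ℝ 2 (fun y => timeDeriv T w y t) (closure Ω) := by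
  simpa [iteratedDerivWithin_one, timeDeriv] using h.contDiffOn_space 1 (by norm_num) t ht

theorem MemParabolicC.continuousOn_iterated (h : MemParabolicC 4 Ω T w) {j : ℕ} (hj : j ≤ 4) :
    ContinuousOn (fun p : EuclideanSpace ℝ (Fin n) × ℝ =>
      iteratedFDerivWithin ℝ j (fun y => w y p.2) (closure Ω) p.1) (closure Ω ×ˢ Icc 0 T) := by
  have := h.continuousOn j 0 (by omega)
  simpa [spaceTimeDeriv, closedCylinder] using this

theorem MemParabolicC.continuousOn_iterated_timeDeriv (h : MemParabolicC 4 Ω T w) {j : ℕ}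
    (hj : j ≤ 2) :
    ContinuousOn (fun p : EuclideanSpace ℝ (Fin n) × ℝ =>
      iteratedFDerivWithin ℝ j (fun y => timeDeriv T w y p.2) (closure Ω) p.1)
      (closure Ω ×ˢ Icc 0 T) := by
  have := h.continuousOn j 1 (by omega)
  simpa [spaceTimeDeriv, iteratedDerivWithin_one, timeDeriv, closedCylinder] using this

theorem MemParabolicC.continuousOn_uncurry (h : MemParabolicC 4 Ω T w) :
    ContinuousOn (fun p : EuclideanSpace ℝ (Fin n) × ℝ => w p.1 p.2) (closure Ω ×ˢ Icc 0 T) := by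
  have := h.continuousOn_iterated (j := 0) (by norm_num)
  have h2 := (ContinuousMultilinearMap.apply ℝ (fun _ : Fin 0 => EuclideanSpace ℝ (Fin n)) ℝ
    ![]).continuous.comp_continuousOn this
  simpa [Function.comp_def] using h2

theorem MemParabolicC.continuousOn_timeDeriv (h : MemParabolicC 4 Ω T w) :
    ContinuousOn (fun p : EuclideanSpace ℝ (Fin n) × ℝ => timeDeriv T w p.1 p.2)
      (closure Ω ×ˢ Icc 0 T) := by
  have := h.continuousOn_iterated_timeDeriv (j := 0) (by norm_num)
  have h2 := (ContinuousMultilinearMap.apply ℝ (fun _ : Fin 0 => EuclideanSpace ℝ (Fin n)) ℝ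
    ![]).continuous.comp_continuousOn this
  simpa [Function.comp_def] using h2

theorem MemParabolicC.hasDerivWithinAt_time (h : MemParabolicC 4 Ω T w)
    {x : EuclideanSpace ℝ (Fin n)} (hx : x ∈ closure Ω) {t : ℝ} (ht : t ∈ Icc 0 T) :
    HasDerivWithinAt (w x) (timeDeriv T w x t) (Icc 0 T) t :=
  ((h.contDiffOn_time x hx).differentiableOn (by norm_num) t ht).hasDerivWithinAt

theorem MemParabolicC.hasDerivAt_time (h : MemParabolicC 4 Ω T w)
    {x : EuclideanSpace ℝ (Fin n)} (hx : x ∈ closure Ω) {t : ℝ} (ht : t ∈ Ioo 0 T) :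
    HasDerivAt (w x) (timeDeriv T w x t) t :=
  (h.hasDerivWithinAt_time hx (Ioo_subset_Icc_self ht)).hasDerivAt (Icc_mem_nhds ht.1 ht.2)

theorem MemParabolicC.differentiableAt_timeDeriv (h : MemParabolicC 4 Ω T w)
    {x : EuclideanSpace ℝ (Fin n)} (hx : x ∈ closure Ω) {t : ℝ} (ht : t ∈ Ioo 0 T) :
    DifferentiableAt ℝ (timeDeriv T w x) t := by
  have h1 : ContDiffOn ℝ 1 (derivWithin (w x) (Icc 0 T)) (Icc 0 T) :=
    (h.contDiffOn_time x hx).derivWithin (uniqueDiffOn_Icc (ht.1.trans ht.2)) (by norm_num)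
  exact (h1.differentiableOn (by norm_num) t (Ioo_subset_Icc_self ht)).differentiableAt
    (Icc_mem_nhds ht.1 ht.2)

/-- Time derivatives and space derivatives commute in the interior. -/
theorem MemParabolicC.hasDerivAt_iterated (hΩ : IsUniformlyConvexDomain Ω)
    (h : MemParabolicC 4 Ω T w) :
    ∀ {j : ℕ}, j ≤ 2 → ∀ {x : EuclideanSpace ℝ (Fin n)}, x ∈ Ω → ∀ {t : ℝ}, t ∈ Ioo 0 T →
      ∀ m : Fin j → EuclideanSpace ℝ (Fin n),
      HasDerivAt (fun τ => iteratedFDerivWithin ℝ j (fun y => w y τ) (closure Ω) x m)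
        (iteratedFDerivWithin ℝ j (fun y => timeDeriv T w y t) (closure Ω) x m) t
  | 0, _, x, hx, t, ht, m => by
    simpa using h.hasDerivAt_time (subset_closure hx) ht
  | j + 1, hj, x, hx, t, ht, m => by
    have ih := fun {x} hx {t} ht m =>
      hasDerivAt_iterated hΩ h (j := j) (by omega) (x := x) hx (t := t) ht m
    have hS := hΩ.uniqueDiffOn_closure
    set v := m 0
    set m' : Fin j → EuclideanSpace ℝ (Fin n) := Fin.tail m
    have hm : m = Fin.cons v m' := (Fin.cons_self_tail m).symm
    have hev : ∀ᶠ p : ℝ × ℝ in 𝓝 (0, t), x + p.1 • v ∈ Ω ∧ p.2 ∈ Ioo 0 T := by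
      have h1 : ContinuousAt (fun p : ℝ × ℝ => x + p.1 • v) (0, t) := by fun_prop
      have h2 : ∀ᶠ p : ℝ × ℝ in 𝓝 (0, t), x + p.1 • v ∈ Ω :=
        h1.preimage_mem_nhds (hΩ.isOpen.mem_nhds (by simpa using hx))
      have h3 : ∀ᶠ p : ℝ × ℝ in 𝓝 (0, t), p.2 ∈ Ioo 0 T :=
        continuousAt_snd.preimage_mem_nhds (Ioo_mem_nhds ht.1 ht.2)
      exact h2.and h3
    have hint : ∀ {z : EuclideanSpace ℝ (Fin n)}, z ∈ Ω → z ∈ interior (closure Ω) := by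
      intro z hz; rwa [hΩ.interior_closure]
    have key := hasDerivAt_of_mixed_partial (t₀ := t)
      (a := fun s τ => iteratedFDerivWithin ℝ j (fun y => w y τ) (closure Ω) (x + s • v) m')
      (b := fun s τ => iteratedFDerivWithin ℝ j (fun y => timeDeriv T w y τ) (closure Ω)
        (x + s • v) m')
      (c := fun s τ => iteratedFDerivWithin ℝ (j + 1) (fun y => timeDeriv T w y τ) (closure Ω)
        (x + s • v) (Fin.cons v m'))
      (d := fun τ => iteratedFDerivWithin ℝ (j + 1) (fun y => w y τ) (closure Ω) x
        (Fin.cons v m'))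
      (by filter_upwards [hev] with p hp; exact ih hp.1 hp.2 m')
      (by
        filter_upwards [hev] with p hp
        refine hasDerivAt_iteratedFDerivWithin_line hS
          (h.contDiffOn_timeDeriv (Ioo_subset_Icc_self hp.2)) ?_ (hint hp.1) m'
        exact_mod_cast (by omega : j < 2))
      (by
        have h1 := h.continuousOn_iterated_timeDeriv (j := j + 1) hj
        have h2 : ContinuousAt (fun p : EuclideanSpace ℝ (Fin n) × ℝ =>
            iteratedFDerivWithin ℝ (j + 1) (fun y => timeDeriv T w y p.2) (closure Ω) p.1)
            (x + (0 : ℝ) • v, t) := by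
          refine (h1 _ ⟨by simpa using subset_closure hx,
            Ioo_subset_Icc_self ht⟩).continuousAt ?_
          refine prod_mem_nhds ?_ (Icc_mem_nhds ht.1 ht.2)
          exact Filter.mem_of_superset (hΩ.isOpen.mem_nhds (by simpa using hx)) subset_closure
        have h3 : ContinuousAt (fun p : ℝ × ℝ => (x + p.1 • v, p.2)) (0, t) := by fun_prop
        have h4 := (ContinuousMultilinearMap.apply ℝ
          (fun _ : Fin (j + 1) => EuclideanSpace ℝ (Fin n)) ℝ
          (Fin.cons v m')).continuous.continuousAt.comp
            (ContinuousAt.comp (f := fun p : ℝ × ℝ => (x + p.1 • v, p.2)) h2 h3)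
        exact h4)
      (by
        filter_upwards [Ioo_mem_nhds ht.1 ht.2] with τ hτ
        have := hasDerivAt_iteratedFDerivWithin_line hS
          (h.contDiffOn_slice (Ioo_subset_Icc_self hτ)) (k := j) (x := x) (v := v) (s := 0) (by
            exact_mod_cast (by omega : j < 4)) (hint (by simpa using hx)) m'
        simpa using this)
    rw [hm]
    simpa using key

theorem MemParabolicC.hasDerivAt_hessForm (hΩ : IsUniformlyConvexDomain Ω)
    (h : MemParabolicC 4 Ω T w) {x : EuclideanSpace ℝ (Fin n)} (hx : x ∈ Ω) {t : ℝ}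
    (ht : t ∈ Ioo 0 T) (v v' : EuclideanSpace ℝ (Fin n)) :
    HasDerivAt (fun τ => hessForm (closure Ω) (fun y => w y τ) x v v')
      (hessForm (closure Ω) (fun y => timeDeriv T w y t) x v v') t :=
  h.hasDerivAt_iterated hΩ le_rfl hx ht ![v, v']

theorem iteratedFDerivWithin_one_apply_fderiv {E : Type*} [NormedAddCommGroup E]
    [NormedSpace ℝ E] {S : Set E} (hS : UniqueDiffOn ℝ S) {f : E → ℝ} {x : E} (hx : x ∈ S)
    (m : Fin 1 → E) : iteratedFDerivWithin ℝ 1 f S x m = fderivWithin ℝ f S x (m 0) :=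
  iteratedFDerivWithin_one_apply (hS x hx) m

theorem MemParabolicC.hasDerivAt_fderivWithin (hΩ : IsUniformlyConvexDomain Ω)
    (h : MemParabolicC 4 Ω T w) {x : EuclideanSpace ℝ (Fin n)} (hx : x ∈ Ω) {t : ℝ}
    (ht : t ∈ Ioo 0 T) (v : EuclideanSpace ℝ (Fin n)) :
    HasDerivAt (fun τ => fderivWithin ℝ (fun y => w y τ) (closure Ω) x v)
      (fderivWithin ℝ (fun y => timeDeriv T w y t) (closure Ω) x v) t := by
  have := h.hasDerivAt_iterated hΩ (j := 1) (by norm_num) hx ht ![v]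
  simp only [iteratedFDerivWithin_one_apply (hΩ.uniqueDiffOn_closure x (subset_closure hx))] at this
  exact this

end ParabolicClass

section JointSmoothness

variable {E F : Type*} [NormedAddCommGroup E] [NormedSpace ℝ E] [NormedAddCommGroup F]
  [NormedSpace ℝ F] {S : Set E} {I : Set ℝ}

theorem ContDiffOn.fderivWithin_fst (hS : UniqueDiffOn ℝ S) (hI : UniqueDiffOn ℝ I)
    {G : E × ℝ → F} (hG : ContDiffOn ℝ ∞ G (S ×ˢ I)) :
    ContDiffOn ℝ ∞ (fun p : E × ℝ => fderivWithin ℝ (fun y => G (y, p.2)) S p.1) (S ×ˢ I) := by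
  have h1 : ContDiffOn ℝ ∞ (fderivWithin ℝ G (S ×ˢ I)) (S ×ˢ I) :=
    hG.fderivWithin (hS.prod hI) (by simp)
  refine ContDiffOn.congr (f := fun p => (fderivWithin ℝ G (S ×ˢ I) p).comp
    (ContinuousLinearMap.inl ℝ E ℝ)) (h1.clm_comp contDiffOn_const) fun p hp => ?_
  have h2 : HasFDerivWithinAt G (fderivWithin ℝ G (S ×ˢ I) p) (S ×ˢ I) (p.1, p.2) :=
    (hG.differentiableOn (by simp) p hp).hasFDerivWithinAt
  have h3 : HasFDerivWithinAt (fun y : E => (y, p.2)) (ContinuousLinearMap.inl ℝ E ℝ) S p.1 :=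
    (hasFDerivAt_prodMk_left p.1 p.2).hasFDerivWithinAt
  exact (h2.comp p.1 h3 (fun y hy => mk_mem_prod hy hp.2)).fderivWithin (hS _ hp.1)

theorem ContDiffOn.derivWithin_snd (hS : UniqueDiffOn ℝ S) (hI : UniqueDiffOn ℝ I)
    {G : E × ℝ → F} (hG : ContDiffOn ℝ ∞ G (S ×ˢ I)) :
    ContDiffOn ℝ ∞ (fun p : E × ℝ => derivWithin (fun τ => G (p.1, τ)) I p.2) (S ×ˢ I) := by
  have h1 : ContDiffOn ℝ ∞ (fderivWithin ℝ G (S ×ˢ I)) (S ×ˢ I) :=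
    hG.fderivWithin (hS.prod hI) (by simp)
  refine ContDiffOn.congr (f := fun p => fderivWithin ℝ G (S ×ˢ I) p (0, 1))
    (h1.clm_apply contDiffOn_const) fun p hp => ?_
  have h2 : HasFDerivWithinAt G (fderivWithin ℝ G (S ×ˢ I) p) (S ×ˢ I) (p.1, p.2) :=
    (hG.differentiableOn (by simp) p hp).hasFDerivWithinAt
  have h3 : HasDerivWithinAt (fun τ : ℝ => (p.1, τ)) ((0 : E), (1 : ℝ)) I p.2 :=
    (hasDerivWithinAt_const _ _ _).prodMk (hasDerivWithinAt_id _ _)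
  exact (h2.comp_hasDerivWithinAt p.2 h3 (fun τ hτ => ⟨hp.1, hτ⟩)).derivWithin (hI _ hp.2)

theorem ContDiffOn.iteratedDerivWithin_snd (hS : UniqueDiffOn ℝ S) (hI : UniqueDiffOn ℝ I)
    {G : E × ℝ → F} (hG : ContDiffOn ℝ ∞ G (S ×ˢ I)) (s : ℕ) :
    ContDiffOn ℝ ∞ (fun p : E × ℝ => iteratedDerivWithin s (fun τ => G (p.1, τ)) I p.2)
      (S ×ˢ I) := by
  induction s with
  | zero => simpa using hG
  | succ s ih =>
    simp only [iteratedDerivWithin_succ]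
    exact ih.derivWithin_snd hS hI

theorem ContDiffOn.iteratedFDerivWithin_fst (hS : UniqueDiffOn ℝ S) (hI : UniqueDiffOn ℝ I)
    {G : E × ℝ → F} (hG : ContDiffOn ℝ ∞ G (S ×ˢ I)) (j : ℕ) :
    ContDiffOn ℝ ∞ (fun p : E × ℝ => iteratedFDerivWithin ℝ j (fun y => G (y, p.2)) S p.1)
      (S ×ˢ I) := by
  induction j with
  | zero =>
    simp only [iteratedFDerivWithin_zero_eq_comp]
    exact (continuousMultilinearCurryFin0 ℝ E F).symm.contDiff.comp_contDiffOn hG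
  | succ j ih =>
    simp only [iteratedFDerivWithin_succ_eq_comp_left]
    exact (continuousMultilinearCurryLeftEquiv ℝ (fun _ : Fin (j + 1) => E)
      F).symm.contDiff.comp_contDiffOn (ih.fderivWithin_fst hS hI)

end JointSmoothness

theorem memParabolicC_of_contDiffOn {n : ℕ} {Ω : Set (EuclideanSpace ℝ (Fin n))} {T : ℝ}
    (hΩ : IsUniformlyConvexDomain Ω) (hT : 0 < T) {w : EuclideanSpace ℝ (Fin n) → ℝ → ℝ}
    (hw : ContDiffOn ℝ ∞ (fun p : EuclideanSpace ℝ (Fin n) × ℝ => w p.1 p.2)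
      (closedCylinder Ω T)) (k : ℕ) : MemParabolicC k Ω T w where
  contDiffOn_time x hx := (hw.comp (f := fun τ : ℝ => (x, τ)) (by fun_prop)
    (fun τ hτ => ⟨hx, hτ⟩)).of_le (by exact_mod_cast le_top)
  contDiffOn_space s _ t ht :=
    ((ContDiffOn.iteratedDerivWithin_snd hΩ.uniqueDiffOn_closure (uniqueDiffOn_Icc hT) hw s).comp
      (f := fun y => (y, t)) (by fun_prop) (fun y hy => ⟨hy, ht⟩)).of_le
        (WithTop.coe_le_coe.2 (le_top : ((k - 2 * s : ℕ) : ℕ∞) ≤ ⊤))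
  continuousOn j s _ :=
    (ContDiffOn.iteratedFDerivWithin_fst hΩ.uniqueDiffOn_closure (uniqueDiffOn_Icc hT)
      (ContDiffOn.iteratedDerivWithin_snd hΩ.uniqueDiffOn_closure (uniqueDiffOn_Icc hT) hw s)
      j).continuousOn

/-! ### The data of the problem -/

theorem ContinuousMultilinearMap.norm_le_of_single {n j : ℕ}
    (A : EuclideanSpace ℝ (Fin n) [×j]→L[ℝ] ℝ) {K : ℝ} (hK : 0 ≤ K)
    (h : ∀ γ : Fin j → Fin n, |A fun l => EuclideanSpace.single (γ l) 1| ≤ K) :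
    ‖A‖ ≤ (n : ℝ) ^ j * K := by
  refine A.opNorm_le_bound (by positivity) fun m => ?_
  have hm : m = fun l => ∑ i : Fin n, (m l i) • EuclideanSpace.single i (1 : ℝ) := by
    funext l
    have := (EuclideanSpace.basisFun (Fin n) ℝ).sum_repr (m l)
    simpa using this.symm
  rw [Real.norm_eq_abs]
  conv_lhs => rw [hm, A.map_sum]
  refine (Finset.abs_sum_le_sum_abs _ _).trans ?_
  have hb : ∀ r : Fin j → Fin n,
      |A fun l => (m l (r l)) • EuclideanSpace.single (r l) (1 : ℝ)| ≤ K * ∏ l, ‖m l‖ := by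
    intro r
    rw [A.map_smul_univ, smul_eq_mul, abs_mul, Finset.abs_prod, mul_comm]
    refine mul_le_mul (h r) ?_ (Finset.prod_nonneg fun _ _ => abs_nonneg _) hK
    exact Finset.prod_le_prod (fun _ _ => abs_nonneg _)
      (fun l _ => by simpa using PiLp.norm_apply_le (m l) (r l))
  refine (Finset.sum_le_card_nsmul _ _ _ fun r _ => hb r).trans (le_of_eq ?_)
  rw [nsmul_eq_mul, Finset.card_univ, Fintype.card_fun, Fintype.card_fin, Fintype.card_fin]
  push_cast
  ring

theorem norm_le_of_mem_closure {X F : Type*} [TopologicalSpace X] [NormedAddCommGroup F]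
    {f : X → F} {U S : Set X} (hf : ContinuousOn f S) (hUS : U ⊆ S) (hSU : S ⊆ closure U) {K : ℝ}
    (h : ∀ p ∈ U, ‖f p‖ ≤ K) : ∀ p ∈ S, ‖f p‖ ≤ K := by
  intro p hp
  have : (𝓝[U] p).NeBot := mem_closure_iff_nhdsWithin_neBot.1 (hSU hp)
  exact le_of_tendsto ((hf p hp).mono hUS).norm (by
    filter_upwards [self_mem_nhdsWithin] with q hq using h q hq)

theorem norm_le_of_eLpNorm_top_le {n : ℕ} {Ω : Set (EuclideanSpace ℝ (Fin n))} {T : ℝ}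
    (hΩ : IsOpen Ω) (hT : 0 < T) {F : Type*} [NormedAddCommGroup F]
    {f : EuclideanSpace ℝ (Fin n) × ℝ → F} (hf : ContinuousOn f (closedCylinder Ω T)) {K : ℝ≥0}
    (h : eLpNorm f ⊤ (volume.restrict (parabolicCylinder Ω T)) ≤ K) :
    ∀ p ∈ closedCylinder Ω T, ‖f p‖ ≤ K := by
  have hsub : Ω ×ˢ Ioo 0 T ⊆ closedCylinder Ω T := prod_mono subset_closure Ioo_subset_Icc_self
  have hsub' : Ω ×ˢ Ioo 0 T ⊆ parabolicCylinder Ω T := prod_mono subset_rfl Ioo_subset_Ioc_self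
  have hopen : IsOpen (Ω ×ˢ Ioo 0 T) := hΩ.prod isOpen_Ioo
  refine norm_le_of_mem_closure hf hsub (closedCylinder_subset_closure hT) fun p hp => ?_
  by_contra hc
  push Not at hc
  have hV : IsOpen ((Ω ×ˢ Ioo 0 T) ∩ f ⁻¹' {z | (K : ℝ) < ‖z‖}) :=
    (hf.mono hsub).isOpen_inter_preimage hopen (isOpen_lt continuous_const continuous_norm)
  have h0 : volume ((Ω ×ˢ Ioo 0 T) ∩ f ⁻¹' {z | (K : ℝ) < ‖z‖}) = 0 := by
    rw [eLpNorm_exponent_top] at h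
    have hae := ae_le_eLpNormEssSup (f := f) (μ := volume.restrict (Ω ×ˢ Ioo 0 T))
    have hae' : ∀ᵐ q ∂(volume.restrict (Ω ×ˢ Ioo 0 T)), ‖f q‖ ≤ K := by
      have hmono := eLpNormEssSup_mono_measure (f := f)
        (Measure.absolutelyContinuous_of_le (Measure.restrict_mono hsub' le_rfl) :
          volume.restrict (Ω ×ˢ Ioo 0 T) ≪ volume.restrict (parabolicCylinder Ω T))
      filter_upwards [hae] with q hq
      have := hq.trans (hmono.trans h)
      rw [enorm_le_coe] at this
      exact_mod_cast this
    rw [ae_restrict_iff' hopen.measurableSet] at hae'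
    refine measure_mono_null (fun q hq => ?_) hae'
    exact fun hcon => not_lt.2 (hcon hq.1) hq.2
  have h1 := (hV.measure_eq_zero_iff (μ := volume)).1 h0
  exact (h1 ▸ (⟨hp, hc⟩ : p ∈ (Ω ×ˢ Ioo 0 T) ∩ f ⁻¹' {z | (K : ℝ) < ‖z‖}) : p ∈ (∅ : Set _))

theorem norm_spaceTimeDeriv_le {n : ℕ} {Ω : Set (EuclideanSpace ℝ (Fin n))} {T : ℝ} (hT : 0 < T)
    {w : EuclideanSpace ℝ (Fin n) → ℝ → ℝ} {k : ℕ} (hw : MemParabolicC k Ω T w) {K : ℝ≥0}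
    (h : parabolicNorm k Ω T w ≤ K) {j s : ℕ} (hjs : j + 2 * s ≤ k) :
    ∀ p ∈ closedCylinder Ω T, ‖spaceTimeDeriv Ω T w j s p.1 p.2‖ ≤ (n : ℝ) ^ j * K := by
  refine norm_le_of_mem_closure (hw.continuousOn j s hjs)
    (prod_mono subset_closure Ioo_subset_Icc_self) (closedCylinder_subset_closure hT)
    fun p hp => ?_
  refine ContinuousMultilinearMap.norm_le_of_single _ K.coe_nonneg fun γ => ?_
  have hp' : p ∈ parabolicCylinder Ω T := ⟨hp.1, Ioo_subset_Ioc_self hp.2⟩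
  have := le_trans (le_iSup₂_of_le (f := fun (j : ℕ) (s : ℕ) => ⨆ (_ : j + 2 * s ≤ k)
    (γ : Fin j → Fin n) (p ∈ parabolicCylinder Ω T),
    ‖spaceTimeDeriv Ω T w j s p.1 p.2 (fun l => EuclideanSpace.single (γ l) 1)‖ₑ) j s
    (le_iSup_of_le hjs (le_iSup_of_le γ (le_iSup₂_of_le p hp' le_rfl)))) h
  rw [enorm_le_coe] at this
  exact_mod_cast this

/-- The hypotheses of the a priori estimate, with all derivatives up to the boundary and one
constant `K` for the pointwise bounds on the data. The constant `J` bounds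
`∫ |ψ_t| ^ (n + 1)`. -/
structure MongeAmpereData {n : ℕ} (Ω : Set (EuclideanSpace ℝ (Fin n))) (T c₀ κ K : ℝ) (J : ℝ≥0)
    (φ ψ u : EuclideanSpace ℝ (Fin n) → ℝ → ℝ) : Prop where
  mem_φ : MemParabolicC 4 Ω T φ
  mem_ψ : MemParabolicC 4 Ω T ψ
  mem_u : MemParabolicC 4 Ω T u
  lateral : ∀ x ∈ frontier Ω, ∀ t ∈ Icc 0 T, c₀ ≤ timeDeriv T φ x t + ψ x t
  initial : ∀ x ∈ closure Ω, ∀ v, κ * ‖v‖ ^ 2 ≤ hessForm (closure Ω) (fun y => φ y 0) x v v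
  concave : ∀ t ∈ Icc 0 T, ConcaveOn ℝ Ω fun x => ψ x t
  convex : ∀ t ∈ Icc 0 T, ConvexOn ℝ Ω fun x => u x t
  bound_φ : ∀ j, j ≤ 4 → ∀ x ∈ closure Ω, ∀ t ∈ Icc 0 T,
    ‖iteratedFDerivWithin ℝ j (fun y => φ y t) (closure Ω) x‖ ≤ K
  bound_φt : ∀ j, j ≤ 2 → ∀ x ∈ closure Ω, ∀ t ∈ Icc 0 T,
    ‖iteratedFDerivWithin ℝ j (fun y => timeDeriv T φ y t) (closure Ω) x‖ ≤ K
  bound_ψ : ∀ x ∈ closure Ω, ∀ t ∈ Icc 0 T, |ψ x t| ≤ K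
  bound_Dψ : ∀ x ∈ closure Ω, ∀ t ∈ Icc 0 T,
    ‖fderivWithin ℝ (fun y => ψ y t) (closure Ω) x‖ ≤ K
  bound_ψt : ∫⁻ p in parabolicCylinder Ω T, ‖timeDeriv T ψ p.1 p.2‖ₑ ^ (n + 1) ≤ J
  equation : ∀ x ∈ closure Ω, ∀ t ∈ Icc 0 T,
    formDet (hessForm (closure Ω) (fun y => u y t) x) = timeDeriv T u x t + ψ x t
  initial_eq : ∀ x ∈ closure Ω, u x 0 = φ x 0
  lateral_eq : ∀ x ∈ frontier Ω, ∀ t ∈ Icc 0 T, u x t = φ x t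

theorem det_spaceHessian {n : ℕ} (Ω : Set (EuclideanSpace ℝ (Fin n)))
    (w : EuclideanSpace ℝ (Fin n) → ℝ → ℝ) (x : EuclideanSpace ℝ (Fin n)) (t : ℝ) :
    (spaceHessian Ω w x t).det = formDet (hessForm (closure Ω) (fun y => w y t) x) := by
  rw [_root_.formDet_eq _ (EuclideanSpace.basisFun (Fin n) ℝ)]
  congr 1
  ext i k
  simp [spaceHessian, hessForm_apply]

theorem continuous_det_spaceHessian {n : ℕ} {Ω : Set (EuclideanSpace ℝ (Fin n))} {T : ℝ}
    {w : EuclideanSpace ℝ (Fin n) → ℝ → ℝ} (hw : MemParabolicC 4 Ω T w) :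
    ContinuousOn (fun p : EuclideanSpace ℝ (Fin n) × ℝ => (spaceHessian Ω w p.1 p.2).det)
      (closure Ω ×ˢ Icc 0 T) := by
  simp only [Matrix.det_apply]
  refine continuousOn_finsetSum _ fun σ _ => ContinuousOn.const_smul
    (continuousOn_finsetProd _ fun i _ => ?_) _
  exact (ContinuousMultilinearMap.apply ℝ (fun _ : Fin 2 => EuclideanSpace ℝ (Fin n)) ℝ
    ![EuclideanSpace.single (σ i) 1, EuclideanSpace.single i 1]).continuous.comp_continuousOn
      (hw.continuousOn_iterated (j := 2) (by norm_num))

theorem SolvesParabolicMongeAmpere.formDet_eq {n : ℕ} {Ω : Set (EuclideanSpace ℝ (Fin n))}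
    {T : ℝ} (hT : 0 < T) {φ ψ u : EuclideanSpace ℝ (Fin n) → ℝ → ℝ}
    (hψ : MemParabolicC 4 Ω T ψ) (hu : MemParabolicC 4 Ω T u)
    (h : SolvesParabolicMongeAmpere Ω T φ ψ u) :
    ∀ x ∈ closure Ω, ∀ t ∈ Icc 0 T,
      formDet (hessForm (closure Ω) (fun y => u y t) x) = timeDeriv T u x t + ψ x t := by
  intro x hx t ht
  rw [← det_spaceHessian]
  have heq : EqOn (fun p : EuclideanSpace ℝ (Fin n) × ℝ => (spaceHessian Ω u p.1 p.2).det)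
      (fun p => timeDeriv T u p.1 p.2 + ψ p.1 p.2) (Ω ×ˢ Ioo 0 T) := by
    intro p hp
    have := h.equation p ⟨hp.1, Ioo_subset_Ioc_self hp.2⟩
    change (spaceHessian Ω u p.1 p.2).det = timeDeriv T u p.1 p.2 + ψ p.1 p.2
    linarith
  have hcl : closure Ω ×ˢ Icc 0 T ⊆ closure (Ω ×ˢ Ioo 0 T) := closedCylinder_subset_closure hT
  have h1 : ContinuousOn (fun p : EuclideanSpace ℝ (Fin n) × ℝ =>
      timeDeriv T u p.1 p.2 + ψ p.1 p.2) (closure Ω ×ˢ Icc 0 T) :=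
    hu.continuousOn_timeDeriv.add hψ.continuousOn_uncurry
  have h2 : Ω ×ˢ Ioo 0 T ⊆ closure Ω ×ˢ Icc 0 T := prod_mono subset_closure Ioo_subset_Icc_self
  have key := heq.of_subset_closure (continuous_det_spaceHessian hu) h1 h2 hcl
  have hp : (x, t) ∈ closure Ω ×ˢ Icc 0 T := ⟨hx, ht⟩
  have h3 := key hp
  dsimp only at h3
  rw [h3]

theorem mongeAmpereData_of_hypotheses {n : ℕ} (hn : 1 ≤ n) {T : ℝ} (hT : 0 < T)
    {Ω : Set (EuclideanSpace ℝ (Fin n))} (hΩ : IsUniformlyConvexDomain Ω) {c₀ κ : ℝ}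
    {Kφ Kψ KDψ Kψt : ℝ≥0} {φ ψ u : EuclideanSpace ℝ (Fin n) → ℝ → ℝ}
    (hφ : ContDiffOn ℝ ∞ (fun p : EuclideanSpace ℝ (Fin n) × ℝ => φ p.1 p.2)
      (closedCylinder Ω T))
    (hψ : ContDiffOn ℝ ∞ (fun p : EuclideanSpace ℝ (Fin n) × ℝ => ψ p.1 p.2)
      (closedCylinder Ω T))
    (hlat : ∀ x ∈ frontier Ω, ∀ t ∈ Icc 0 T, c₀ ≤ timeDeriv T φ x t + ψ x t)
    (hinit : ∀ x ∈ closure Ω, ∀ v : EuclideanSpace ℝ (Fin n),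
      κ * ‖v‖ ^ 2 ≤ iteratedFDerivWithin ℝ 2 (fun y => φ y 0) (closure Ω) x ![v, v])
    (hconc : ∀ t ∈ Icc 0 T, ConcaveOn ℝ Ω (fun x => ψ x t))
    (hKφ : parabolicNorm 4 Ω T φ ≤ Kφ)
    (hKψ : eLpNorm (fun p : EuclideanSpace ℝ (Fin n) × ℝ => ψ p.1 p.2) ⊤
      (volume.restrict (parabolicCylinder Ω T)) ≤ Kψ)
    (hKDψ : eLpNorm (fun p : EuclideanSpace ℝ (Fin n) × ℝ => spaceGrad Ω ψ p.1 p.2) ⊤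
      (volume.restrict (parabolicCylinder Ω T)) ≤ KDψ)
    (hKψt : eLpNorm (fun p : EuclideanSpace ℝ (Fin n) × ℝ => timeDeriv T ψ p.1 p.2) (n + 1)
      (volume.restrict (parabolicCylinder Ω T)) ≤ Kψt)
    (hu : MemParabolicC 4 Ω T u) (hconv : ∀ t ∈ Icc 0 T, ConvexOn ℝ Ω (fun x => u x t))
    (hsol : SolvesParabolicMongeAmpere Ω T φ ψ u) :
    MongeAmpereData Ω T c₀ κ ((n : ℝ) ^ 4 * Kφ + Kψ + KDψ + 1) (Kψt ^ (n + 1)) φ ψ u := by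
  have mφ := memParabolicC_of_contDiffOn hΩ hT hφ 4
  have mψ := memParabolicC_of_contDiffOn hΩ hT hψ 4
  have hn' : (1 : ℝ) ≤ n := by exact_mod_cast hn
  have hK : ∀ j : ℕ, j ≤ 4 → (n : ℝ) ^ j * Kφ ≤ (n : ℝ) ^ 4 * Kφ + Kψ + KDψ + 1 := by
    intro j hj
    have h1 : (n : ℝ) ^ j * Kφ ≤ (n : ℝ) ^ 4 * Kφ :=
      mul_le_mul_of_nonneg_right (pow_le_pow_right₀ hn' hj) Kφ.coe_nonneg
    linarith [Kψ.coe_nonneg, KDψ.coe_nonneg]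
  have hK0 : 0 ≤ (n : ℝ) ^ 4 * Kφ := by positivity
  refine
    { mem_φ := mφ, mem_ψ := mψ, mem_u := hu, lateral := hlat, initial := hinit,
      concave := hconc, convex := hconv, equation := hsol.formDet_eq hT mψ hu,
      bound_φ := fun j hj x hx t ht => ?_
      bound_φt := fun j hj x hx t ht => ?_
      bound_ψ := fun x hx t ht => ?_
      bound_Dψ := fun x hx t ht => ?_
      bound_ψt := ?_
      initial_eq := fun x hx => hsol.boundary (x, 0) (Or.inl ⟨hx, rfl⟩)
      lateral_eq := fun x hx t ht => hsol.boundary (x, t) (Or.inr ⟨hx, ht⟩) }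
  · have := norm_spaceTimeDeriv_le hT mφ hKφ (j := j) (s := 0) (by omega) (x, t) ⟨hx, ht⟩
    simp only [spaceTimeDeriv, iteratedDerivWithin_zero] at this
    exact this.trans (hK j hj)
  · have := norm_spaceTimeDeriv_le hT mφ hKφ (j := j) (s := 1) (by omega) (x, t) ⟨hx, ht⟩
    simp only [spaceTimeDeriv, iteratedDerivWithin_one] at this
    exact this.trans (hK j (by omega))
  · have := norm_le_of_eLpNorm_top_le hΩ.isOpen hT mψ.continuousOn_uncurry hKψ (x, t) ⟨hx, ht⟩
    rw [← Real.norm_eq_abs]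
    linarith [KDψ.coe_nonneg]
  · have hc := (ContDiffOn.fderivWithin_fst hΩ.uniqueDiffOn_closure (uniqueDiffOn_Icc hT)
      hψ).continuousOn
    have := norm_le_of_eLpNorm_top_le hΩ.isOpen hT hc hKDψ (x, t) ⟨hx, ht⟩
    dsimp only at this
    linarith [Kψ.coe_nonneg]
  · have hne : ((n : ℝ≥0∞) + 1) ≠ 0 := by simp
    have hnt : ((n : ℝ≥0∞) + 1) ≠ ⊤ := by simp
    rw [eLpNorm_eq_lintegral_rpow_enorm_toReal hne hnt] at hKψt
    have hr : ((n : ℝ≥0∞) + 1).toReal = ((n + 1 : ℕ) : ℝ) := by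
      rw [ENNReal.toReal_add (by simp) (by simp)]; simp
    rw [hr] at hKψt
    have := ENNReal.rpow_le_rpow hKψt (z := ((n + 1 : ℕ) : ℝ)) (by positivity)
    rw [← ENNReal.rpow_mul, one_div, inv_mul_cancel₀ (by positivity), ENNReal.rpow_one,
      ENNReal.rpow_natCast] at this
    simpa only [ENNReal.rpow_natCast, ENNReal.coe_pow] using this

section HessForm

variable {E : Type*} [NormedAddCommGroup E] [NormedSpace ℝ E] {S : Set E} {f g : E → ℝ} {x : E}

theorem hessForm_add (hS : UniqueDiffOn ℝ S) (hf : ContDiffOn ℝ 2 f S) (hg : ContDiffOn ℝ 2 g S)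
    (hx : x ∈ S) (v w : E) :
    hessForm S (fun y => f y + g y) x v w = hessForm S f x v w + hessForm S g x v w := by
  simp only [hessForm_apply]
  rw [show (fun y => f y + g y) = f + g from rfl, iteratedFDerivWithin_add_apply (hf x hx) (hg x hx)
    hS hx]
  rfl

theorem hessForm_neg (hS : UniqueDiffOn ℝ S) (hx : x ∈ S) (v w : E) :
    hessForm S (fun y => -f y) x v w = -hessForm S f x v w := by
  simp only [hessForm_apply]
  rw [show (fun y => -f y) = -f from rfl, iteratedFDerivWithin_neg_apply hS hx]
  rfl

theorem hessForm_sub (hS : UniqueDiffOn ℝ S) (hf : ContDiffOn ℝ 2 f S) (hg : ContDiffOn ℝ 2 g S)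
    (hx : x ∈ S) (v w : E) :
    hessForm S (fun y => f y - g y) x v w = hessForm S f x v w - hessForm S g x v w := by
  simp only [sub_eq_add_neg]
  rw [hessForm_add hS hf hg.neg hx, hessForm_neg hS hx]

theorem ContDiffOn.continuousOn_hessForm (hS : UniqueDiffOn ℝ S) (hf : ContDiffOn ℝ 2 f S)
    (v w : E) : ContinuousOn (fun x => hessForm S f x v w) S :=
  (ContinuousMultilinearMap.apply ℝ (fun _ : Fin 2 => E) ℝ ![v, w]).continuous.comp_continuousOn
    (hf.continuousOn_iteratedFDerivWithin le_rfl hS)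

theorem hessForm_nonneg_of_convexOn_interior (hS : UniqueDiffOn ℝ S)
    (hcl : S ⊆ closure (interior S)) (hf : ContDiffOn ℝ 2 f S)
    (hc : ConvexOn ℝ (interior S) f) (hx : x ∈ S) (v : E) : 0 ≤ hessForm S f x v v := by
  have : (𝓝[interior S] x).NeBot := mem_closure_iff_nhdsWithin_neBot.1 (hcl hx)
  refine ge_of_tendsto ((hf.continuousOn_hessForm hS v v x hx).mono interior_subset) ?_
  filter_upwards [self_mem_nhdsWithin] with z hz
  exact hessForm_nonneg_of_convexOn hS hf hc hz v

end HessForm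

theorem pow_le_formDet {n : ℕ} {H : LinearMap.BilinForm ℝ (EuclideanSpace ℝ (Fin n))} {κ : ℝ}
    (hκ : 0 ≤ κ) (hs : ∀ v w, H v w = H w v) (h : ∀ v, κ * ‖v‖ ^ 2 ≤ H v v) :
    κ ^ n ≤ formDet H := by
  obtain ⟨b, lam, hd⟩ := exists_diagonalizes H hs
  rw [hd.formDet_eq_prod]
  have : ∀ k, κ ≤ lam k := fun k => by
    have := h (b k)
    rw [hd.basis_apply, if_pos rfl, b.norm_eq_one] at this
    simpa using this
  calc κ ^ n = ∏ _k : Fin n, κ := by simp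
    _ ≤ _ := Finset.prod_le_prod (fun _ _ => hκ) fun k _ => this k

/-! ### Lower bound for the speed -/

namespace MongeAmpereData

variable {n : ℕ} {Ω : Set (EuclideanSpace ℝ (Fin n))} {T c₀ κ K : ℝ} {J : ℝ≥0}
  {φ ψ u : EuclideanSpace ℝ (Fin n) → ℝ → ℝ} {x : EuclideanSpace ℝ (Fin n)} {t : ℝ}

theorem hess_symm (hΩ : IsUniformlyConvexDomain Ω) (d : MongeAmpereData Ω T c₀ κ K J φ ψ u)
    (hx : x ∈ closure Ω) (ht : t ∈ Icc 0 T) (v w : EuclideanSpace ℝ (Fin n)) :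
    hessForm (closure Ω) (fun y => u y t) x v w = hessForm (closure Ω) (fun y => u y t) x w v :=
  hessForm_symm hΩ.uniqueDiffOn_closure hΩ.closure_subset
    ((d.mem_u.contDiffOn_slice ht).of_le (by norm_num)) hx v w

theorem hess_nonneg (hΩ : IsUniformlyConvexDomain Ω) (d : MongeAmpereData Ω T c₀ κ K J φ ψ u)
    (hx : x ∈ closure Ω) (ht : t ∈ Icc 0 T) (v : EuclideanSpace ℝ (Fin n)) :
    0 ≤ hessForm (closure Ω) (fun y => u y t) x v v :=
  hessForm_nonneg_of_convexOn_interior hΩ.uniqueDiffOn_closure hΩ.closure_subset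
    ((d.mem_u.contDiffOn_slice ht).of_le (by norm_num))
    (by rw [hΩ.interior_closure]; exact d.convex t ht) hx v

theorem hess_ψ_nonpos (hΩ : IsUniformlyConvexDomain Ω) (d : MongeAmpereData Ω T c₀ κ K J φ ψ u)
    (hx : x ∈ closure Ω) (ht : t ∈ Icc 0 T) (v : EuclideanSpace ℝ (Fin n)) :
    hessForm (closure Ω) (fun y => ψ y t) x v v ≤ 0 := by
  have h := hessForm_nonneg_of_convexOn_interior (f := fun y => -ψ y t) hΩ.uniqueDiffOn_closure
    hΩ.closure_subset ((d.mem_ψ.contDiffOn_slice ht).of_le (by norm_num)).neg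
    (by rw [hΩ.interior_closure]; exact (d.concave t ht).neg) hx v
  rw [hessForm_neg hΩ.uniqueDiffOn_closure hx] at h
  linarith

theorem timeDeriv_lateral (d : MongeAmpereData Ω T c₀ κ K J φ ψ u) (hx : x ∈ frontier Ω)
    (ht : t ∈ Icc 0 T) : timeDeriv T u x t = timeDeriv T φ x t :=
  derivWithin_congr (fun τ hτ => d.lateral_eq x hx τ hτ) (d.lateral_eq x hx t ht)

theorem iterated_initial (d : MongeAmpereData Ω T c₀ κ K J φ ψ u) (hx : x ∈ closure Ω) (j : ℕ) :
    iteratedFDerivWithin ℝ j (fun y => u y 0) (closure Ω) x =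
      iteratedFDerivWithin ℝ j (fun y => φ y 0) (closure Ω) x :=
  iteratedFDerivWithin_congr (fun y hy => d.initial_eq y hy) hx j

theorem hess_initial (d : MongeAmpereData Ω T c₀ κ K J φ ψ u) (hx : x ∈ closure Ω)
    (v w : EuclideanSpace ℝ (Fin n)) : hessForm (closure Ω) (fun y => u y 0) x v w =
      hessForm (closure Ω) (fun y => φ y 0) x v w := by
  rw [hessForm_apply, hessForm_apply, d.iterated_initial hx]

theorem le_speed_initial (hΩ : IsUniformlyConvexDomain Ω) (hT : 0 < T) (hκ : 0 < κ)
    (d : MongeAmpereData Ω T c₀ κ K J φ ψ u) (hx : x ∈ closure Ω) :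
    κ ^ n ≤ timeDeriv T u x 0 + ψ x 0 := by
  have h0 : (0 : ℝ) ∈ Icc 0 T := ⟨le_rfl, hT.le⟩
  rw [← d.equation x hx 0 h0]
  exact pow_le_formDet hκ.le (d.hess_symm hΩ hx h0) fun v => by
    rw [d.hess_initial hx]; exact d.initial x hx v

theorem continuousOn_speed (d : MongeAmpereData Ω T c₀ κ K J φ ψ u) :
    ContinuousOn (fun p : EuclideanSpace ℝ (Fin n) × ℝ => timeDeriv T u p.1 p.2 + ψ p.1 p.2)
      (closure Ω ×ˢ Icc 0 T) :=
  d.mem_u.continuousOn_timeDeriv.add d.mem_ψ.continuousOn_uncurry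

/-- The linearized operator applied to the time derivative of the solution. -/
theorem hasDerivAt_speed_time (hΩ : IsUniformlyConvexDomain Ω)
    (d : MongeAmpereData Ω T c₀ κ K J φ ψ u) (hx : x ∈ Ω) (ht : t ∈ Ioo 0 T)
    {b : OrthonormalBasis (Fin n) ℝ (EuclideanSpace ℝ (Fin n))} {lam : Fin n → ℝ}
    (hd : Diagonalizes (hessForm (closure Ω) (fun y => u y t) x) b lam) (hl : ∀ k, 0 < lam k) :
    HasDerivAt (fun τ => timeDeriv T u x τ + ψ x τ)
      ((timeDeriv T u x t + ψ x t) * ∑ k,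
        hessForm (closure Ω) (fun y => timeDeriv T u y t) x (b k) (b k) / lam k) t := by
  have hxc := subset_closure hx
  have htc := Ioo_subset_Icc_self ht
  have h1 := (d.mem_u.differentiableAt_timeDeriv hxc ht).add
    (d.mem_ψ.hasDerivAt_time hxc ht).differentiableAt
  have h2 := h1.hasDerivAt
  have hev : (fun τ => formDet (hessForm (closure Ω) (fun y => u y τ) x)) =ᶠ[𝓝 t]
      fun τ => timeDeriv T u x τ + ψ x τ := by
    filter_upwards [Ioo_mem_nhds ht.1 ht.2] with τ hτ
    exact d.equation x hxc τ (Ioo_subset_Icc_self hτ)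
  have h3 : HasDerivAt (fun τ => formDet (hessForm (closure Ω) (fun y => u y τ) x)) _ t :=
    HasDerivAt.congr_of_eventuallyEq h2 hev
  have h4 := deriv_formDet (H := fun τ => hessForm (closure Ω) (fun y => u y τ) x) hd hl
    (by
      filter_upwards [Ioo_mem_nhds ht.1 ht.2] with τ hτ
      exact d.hess_symm hΩ hxc (Ioo_subset_Icc_self hτ))
    (fun k l => d.mem_u.hasDerivAt_hessForm hΩ hx ht (b k) (b l)) h3
  rw [d.equation x hxc t htc] at h4
  rw [← h4]
  exact h2

/-- The minimum principle for the speed `u_t + ψ = det D²u`. -/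
theorem le_speed (hΩ : IsUniformlyConvexDomain Ω) (hT : 0 < T) (hκ : 0 < κ)
    (d : MongeAmpereData Ω T c₀ κ K J φ ψ u) (hx : x ∈ closure Ω) (ht : t ∈ Icc 0 T) :
    min c₀ (κ ^ n) ≤ timeDeriv T u x t + ψ x t := by
  by_contra hc
  push Not at hc
  set c₁ := min c₀ (κ ^ n) with hc₁
  set F : EuclideanSpace ℝ (Fin n) → ℝ → ℝ := fun y τ => timeDeriv T u y τ + ψ y τ with hF
  have hF0 : 0 ≤ F x t := by
    rw [hF]
    dsimp only
    rw [← d.equation x hx t ht]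
    exact formDet_nonneg (d.hess_symm hΩ hx ht) (d.hess_nonneg hΩ hx ht)
  -- an intermediate level and a small slope
  set c' := (F x t + c₁) / 2 with hc'
  have hFc : F x t < c' := by rw [hc']; change F x t < c₁ at hc; linarith
  have hcc : c' < c₁ := by rw [hc']; change F x t < c₁ at hc; linarith
  have hc'0 : 0 < c' := by linarith
  set ε := (c' - F x t) / (2 * T) with hε
  have hε0 : 0 < ε := div_pos (by linarith) (by linarith)
  have hεT : ε * T = (c' - F x t) / 2 := by rw [hε]; field_simp
  obtain ⟨y, hy, τ, hτ, hyτ, hmax⟩ := exists_first_touching hΩ.isCompact_closure (T := T)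
    (G := fun y τ => -(F y τ + ε * τ)) (c := -c')
    (d.continuousOn_speed.add (by fun_prop)).neg
    (fun y hy => by
      have := d.le_speed_initial hΩ hT hκ hy
      have h2 : c₁ ≤ κ ^ n := min_le_right _ _
      simp only [hF, mul_zero, add_zero]
      linarith) hx ht (by
      have := mul_le_mul_of_nonneg_left ht.2 hε0.le
      linarith)
  have hτc := Ioo_subset_Icc_self hτ
  have hετ : ε * τ < c' := by
    have := mul_le_mul_of_nonneg_left hτ.2.le hε0.le
    linarith
  have hετ0 : 0 < ε * τ := mul_pos hε0 hτ.1
  have hFpos : 0 < F y τ := by linarith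
  have hyΩ : y ∈ Ω := by
    rcases hΩ.mem_or_frontier hy with h | h
    · exact h
    · have h1 := d.lateral y h τ hτc
      rw [← d.timeDeriv_lateral h hτc] at h1
      have h2 : c₁ ≤ c₀ := min_le_left _ _
      change c₀ ≤ F y τ at h1
      linarith
  have hint : y ∈ interior (closure Ω) := by rwa [hΩ.interior_closure]
  obtain ⟨b, lam, hd⟩ := exists_diagonalizes _ (d.hess_symm hΩ hy hτc)
  have hl := hd.pos (d.hess_nonneg hΩ hy hτc) (by rw [d.equation y hy τ hτc]; exact hFpos)
  -- the speed has a spatial minimum, hence `D² u_t ≥ - D² ψ ≥ 0`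
  have hut : ∀ v, 0 ≤ hessForm (closure Ω) (fun z => timeDeriv T u z τ) y v v := by
    intro v
    have hψ2 := (d.mem_ψ.contDiffOn_slice hτc).of_le (show (2 : WithTop ℕ∞) ≤ 4 by norm_num)
    have := hessForm_nonneg_of_isLocalMin (f := fun z => timeDeriv T u z τ + ψ z τ)
      hΩ.uniqueDiffOn_closure ((d.mem_u.contDiffOn_timeDeriv hτc).add hψ2) hint
      (fun z hz => by
        have := hmax z hz τ ⟨hτ.1.le, le_rfl⟩
        change F y τ ≤ F z τ
        linarith) v
    rw [hessForm_add hΩ.uniqueDiffOn_closure (d.mem_u.contDiffOn_timeDeriv hτc) hψ2 hy] at this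
    linarith [d.hess_ψ_nonpos hΩ hy hτc v]
  have hder := (d.hasDerivAt_speed_time hΩ hyΩ hτ hd hl).add ((hasDerivAt_id τ).const_mul ε)
  have hle := nonneg_deriv_of_le_left hder.neg hτ.1 (fun s hs => by
    have := hmax y hy s hs
    change -(F y s + ε * s) ≤ -(F y τ + ε * τ)
    linarith)
  have hsum : 0 ≤ (timeDeriv T u y τ + ψ y τ) * ∑ k,
      hessForm (closure Ω) (fun y => timeDeriv T u y τ) y (b k) (b k) / lam k :=
    mul_nonneg hFpos.le (Finset.sum_nonneg fun k _ => div_nonneg (hut _) (hl k).le)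
  linarith

end MongeAmpereData

/-! ### The parabolic Legendre-type map -/

section LegendreDeriv

variable {n : ℕ}

theorem det_toEuclidean_form (A : EuclideanSpace ℝ (Fin n) →ₗ[ℝ] EuclideanSpace ℝ (Fin n))
    (B : LinearMap.BilinForm ℝ (EuclideanSpace ℝ (Fin n))) (h : ∀ v w, B v w = inner ℝ (A v) w) :
    LinearMap.det A = formDet B := by
  rw [formDet_eq B (EuclideanSpace.basisFun (Fin n) ℝ),
    ← LinearMap.det_toMatrix (EuclideanSpace.basisFun (Fin n) ℝ).toBasis, ← Matrix.det_transpose]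
  congr 1
  ext k l
  simp [LinearMap.toMatrix_apply, h, EuclideanSpace.inner_single_right]

/-- The derivative of `(x, t) ↦ (∇w, w - ⟨∇w, x - x₁⟩)`, where `A` is the derivative of `∇w`,
`c = w_t` and `z = x - x₁`. -/
noncomputable def legendreDeriv
    (A : EuclideanSpace ℝ (Fin n) × ℝ →L[ℝ] EuclideanSpace ℝ (Fin n)) (c : ℝ)
    (z : EuclideanSpace ℝ (Fin n)) :
    EuclideanSpace ℝ (Fin n) × ℝ →L[ℝ] EuclideanSpace ℝ (Fin n) × ℝ :=
  A.prod (c • ContinuousLinearMap.snd ℝ _ _ - (innerSL ℝ z).comp A)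

theorem det_legendreDeriv (A : EuclideanSpace ℝ (Fin n) × ℝ →L[ℝ] EuclideanSpace ℝ (Fin n))
    (c : ℝ) (z : EuclideanSpace ℝ (Fin n)) (B : LinearMap.BilinForm ℝ (EuclideanSpace ℝ (Fin n)))
    (h : ∀ v w, B v w = inner ℝ (A (v, 0)) w) :
    (legendreDeriv A c z).det = c * formDet B := by
  set A₁ : EuclideanSpace ℝ (Fin n) →ₗ[ℝ] EuclideanSpace ℝ (Fin n) :=
    A.toLinearMap ∘ₗ LinearMap.inl ℝ _ _
  -- factor the map into transvections and a block diagonal map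
  set s₁ : EuclideanSpace ℝ (Fin n) × ℝ →ₗ[ℝ] EuclideanSpace ℝ (Fin n) × ℝ :=
    LinearMap.transvection (-((innerSL ℝ z).toLinearMap ∘ₗ LinearMap.fst ℝ _ _)) (0, 1)
  set s₂ : EuclideanSpace ℝ (Fin n) × ℝ →ₗ[ℝ] EuclideanSpace ℝ (Fin n) × ℝ :=
    LinearMap.transvection (LinearMap.snd ℝ _ _) (A (0, 1), 0)
  have hfac : (legendreDeriv A c z).toLinearMap =
      s₁ ∘ₗ (LinearMap.prodMap LinearMap.id (c • LinearMap.id)) ∘ₗ s₂ ∘ₗ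
        (LinearMap.prodMap A₁ LinearMap.id) := by
    refine LinearMap.ext fun p => ?_
    have hp : A p = A (p.1, 0) + p.2 • A (0, 1) := by
      rw [← map_smul, ← map_add]; simp
    simp only [legendreDeriv, s₁, s₂, A₁, LinearMap.transvection.apply, LinearMap.comp_apply]
    ext1
    · simp [hp]
    · simp [hp]
      ring
  rw [ContinuousLinearMap.det, hfac, LinearMap.det_comp, LinearMap.det_comp, LinearMap.det_comp,
    LinearMap.det_prodMap, LinearMap.det_prodMap, LinearMap.transvection.det,
    LinearMap.transvection.det, det_toEuclidean_form A₁ B h]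
  simp

end LegendreDeriv

section JointDerivative

variable {n : ℕ} {Ω : Set (EuclideanSpace ℝ (Fin n))} {T : ℝ}
  {w : EuclideanSpace ℝ (Fin n) → ℝ → ℝ}

theorem MemParabolicC.hasFDerivAt_uncurry (hΩ : IsUniformlyConvexDomain Ω)
    (h : MemParabolicC 4 Ω T w) {x : EuclideanSpace ℝ (Fin n)} (hx : x ∈ Ω) {t : ℝ}
    (ht : t ∈ Ioo 0 T) :
    HasFDerivAt (fun p : EuclideanSpace ℝ (Fin n) × ℝ => w p.1 p.2)
      ((fderivWithin ℝ (fun y => w y t) (closure Ω) x).coprod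
        (ContinuousLinearMap.toSpanSingleton ℝ (timeDeriv T w x t))) (x, t) := by
  have hU : Ω ×ˢ Ioo 0 T ∈ 𝓝 (x, t) :=
    prod_mem_nhds (hΩ.isOpen.mem_nhds hx) (Ioo_mem_nhds ht.1 ht.2)
  have hUS : Ω ×ˢ Ioo 0 T ⊆ closure Ω ×ˢ Icc 0 T := prod_mono subset_closure Ioo_subset_Icc_self
  refine (hasStrictFDerivAt_uncurry_coprod (𝕜 := ℝ) (u := (x, t)) (f := w)
    (f₁ := fun x t => fderivWithin ℝ (fun y => w y t) (closure Ω) x)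
    (f₂ := fun x t => ContinuousLinearMap.toSpanSingleton ℝ (timeDeriv T w x t))
    ?_ ?_ ?_ ?_).hasFDerivAt
  · filter_upwards [hU] with p hp
    exact (((h.contDiffOn_slice (Ioo_subset_Icc_self hp.2)).differentiableOn (by norm_num) p.1
      (subset_closure hp.1)).hasFDerivWithinAt).hasFDerivAt
      (Filter.mem_of_superset (hΩ.isOpen.mem_nhds hp.1) subset_closure)
  · filter_upwards [hU] with p hp
    exact (h.hasDerivAt_time (subset_closure hp.1) hp.2).hasFDerivAt
  · refine ContinuousOn.continuousAt (s := Ω ×ˢ Ioo 0 T) ?_ hU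
    refine continuousOn_clm_apply.2 fun v => ?_
    have h1 := (ContinuousMultilinearMap.apply ℝ (fun _ : Fin 1 => EuclideanSpace ℝ (Fin n)) ℝ
      ![v]).continuous.comp_continuousOn
        ((h.continuousOn_iterated (j := 1) (by norm_num)).mono hUS)
    refine h1.congr fun p hp => ?_
    exact (iteratedFDerivWithin_one_apply_fderiv hΩ.uniqueDiffOn_closure (hUS hp).1 ![v]).symm
  · refine ContinuousOn.continuousAt (s := Ω ×ˢ Ioo 0 T) ?_ hU
    refine continuousOn_clm_apply.2 fun v => ?_
    have : ContinuousOn (fun p : EuclideanSpace ℝ (Fin n) × ℝ => v * timeDeriv T w p.1 p.2)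
      (Ω ×ˢ Ioo 0 T) := continuousOn_const.mul (h.continuousOn_timeDeriv.mono hUS)
    exact this.congr fun p hp => by simp [Function.HasUncurry.uncurry]

theorem MemParabolicC.hasFDerivAt_fderivWithin (hΩ : IsUniformlyConvexDomain Ω)
    (h : MemParabolicC 4 Ω T w) {x : EuclideanSpace ℝ (Fin n)} (hx : x ∈ Ω) {t : ℝ}
    (ht : t ∈ Ioo 0 T) (e : EuclideanSpace ℝ (Fin n)) :
    ∃ L : EuclideanSpace ℝ (Fin n) × ℝ →L[ℝ] ℝ,
      HasFDerivAt (fun p : EuclideanSpace ℝ (Fin n) × ℝ =>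
        fderivWithin ℝ (fun y => w y p.2) (closure Ω) p.1 e) L (x, t) ∧
      ∀ v, L (v, 0) = hessForm (closure Ω) (fun y => w y t) x v e := by
  have hU : Ω ×ˢ Ioo 0 T ∈ 𝓝 (x, t) :=
    prod_mem_nhds (hΩ.isOpen.mem_nhds hx) (Ioo_mem_nhds ht.1 ht.2)
  have hUS : Ω ×ˢ Ioo 0 T ⊆ closure Ω ×ˢ Icc 0 T := prod_mono subset_closure Ioo_subset_Icc_self
  have hS := hΩ.uniqueDiffOn_closure
  set f₁ : EuclideanSpace ℝ (Fin n) → ℝ → EuclideanSpace ℝ (Fin n) →L[ℝ] ℝ := fun x t =>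
    fderivWithin ℝ (fun y => fderivWithin ℝ (fun y => w y t) (closure Ω) y e) (closure Ω) x
  have hf₁ : ∀ x ∈ closure Ω, ∀ t ∈ Icc 0 T, ∀ v,
      f₁ x t v = hessForm (closure Ω) (fun y => w y t) x v e := by
    intro x hx t ht v
    have h1 := iteratedFDerivWithin_succ_eq_fderivWithin hS (h.contDiffOn_slice ht) (k := 1)
      (by norm_num) hx v ![e]
    rw [hessForm_apply]
    refine Eq.trans ?_ h1.symm
    refine congrArg (fun L : EuclideanSpace ℝ (Fin n) →L[ℝ] ℝ => L v)
      (fderivWithin_congr (fun y hy => ?_) ?_)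
    · exact (iteratedFDerivWithin_one_apply_fderiv hS hy ![e]).symm
    · exact (iteratedFDerivWithin_one_apply_fderiv hS hx ![e]).symm
  refine ⟨(f₁ x t).coprod (ContinuousLinearMap.toSpanSingleton ℝ
    (fderivWithin ℝ (fun y => timeDeriv T w y t) (closure Ω) x e)), ?_, fun v => ?_⟩
  · refine (hasStrictFDerivAt_uncurry_coprod (𝕜 := ℝ) (u := (x, t))
      (f := fun x t => fderivWithin ℝ (fun y => w y t) (closure Ω) x e)
      (f₁ := f₁)
      (f₂ := fun x t => ContinuousLinearMap.toSpanSingleton ℝ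
        (fderivWithin ℝ (fun y => timeDeriv T w y t) (closure Ω) x e))
      ?_ ?_ ?_ ?_).hasFDerivAt
    · filter_upwards [hU] with p hp
      have hd : ContDiffOn ℝ 3 (fun y => fderivWithin ℝ (fun y => w y p.2) (closure Ω) y e)
          (closure Ω) :=
        ((h.contDiffOn_slice (Ioo_subset_Icc_self hp.2)).fderivWithin hS
          (by norm_num)).clm_apply contDiffOn_const
      exact ((hd.differentiableOn (by norm_num) p.1
        (subset_closure hp.1)).hasFDerivWithinAt).hasFDerivAt
        (Filter.mem_of_superset (hΩ.isOpen.mem_nhds hp.1) subset_closure)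
    · filter_upwards [hU] with p hp
      exact (h.hasDerivAt_fderivWithin hΩ hp.1 hp.2 e).hasFDerivAt
    · refine ContinuousOn.continuousAt (s := Ω ×ˢ Ioo 0 T) ?_ hU
      refine continuousOn_clm_apply.2 fun v => ?_
      have h1 := (ContinuousMultilinearMap.apply ℝ (fun _ : Fin 2 => EuclideanSpace ℝ (Fin n)) ℝ
        ![v, e]).continuous.comp_continuousOn
          ((h.continuousOn_iterated (j := 2) (by norm_num)).mono hUS)
      exact h1.congr fun p hp => hf₁ _ (hUS hp).1 _ (hUS hp).2 v
    · refine ContinuousOn.continuousAt (s := Ω ×ˢ Ioo 0 T) ?_ hU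
      refine continuousOn_clm_apply.2 fun v => ?_
      have h1 := (ContinuousMultilinearMap.apply ℝ (fun _ : Fin 1 => EuclideanSpace ℝ (Fin n)) ℝ
        ![e]).continuous.comp_continuousOn
          ((h.continuousOn_iterated_timeDeriv (j := 1) (by norm_num)).mono hUS)
      refine (continuousOn_const (c := v).mul h1).congr fun p hp => ?_
      simp [Function.HasUncurry.uncurry, iteratedFDerivWithin_one_apply (hS _ (hUS hp).1)]
  · simp [hf₁ x (subset_closure hx) t (Ioo_subset_Icc_self ht)]

theorem MemParabolicC.exists_slope (h : MemParabolicC 4 Ω T w) {x : EuclideanSpace ℝ (Fin n)}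
    (hx : x ∈ closure Ω) {a b : ℝ} (ha : 0 ≤ a) (hab : a < b) (hb : b ≤ T) :
    ∃ c ∈ Ioo a b, timeDeriv T w x c = (w x b - w x a) / (b - a) := by
  refine exists_hasDerivAt_eq_slope (w x) (timeDeriv T w x) hab ?_ fun c hc =>
    h.hasDerivAt_time hx ⟨ha.trans_lt hc.1, hc.2.trans_le hb⟩
  exact (h.contDiffOn_time x hx).continuousOn.mono (Icc_subset_Icc ha hb)

theorem exists_uniform_time_modulus {S : Set (EuclideanSpace ℝ (Fin n))} (hS : IsCompact S)
    (hw : ContinuousOn (fun p : EuclideanSpace ℝ (Fin n) × ℝ => w p.1 p.2) (S ×ˢ Icc 0 T)) :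
    ∃ δ > 0, ∀ x ∈ S, ∀ t ∈ Icc 0 T, ∀ t' ∈ Icc 0 T, |t - t'| < δ → |w x t - w x t'| ≤ 1 := by
  have huc := (hS.prod isCompact_Icc).uniformContinuousOn_of_continuous hw
  obtain ⟨δ, hδ, h⟩ := Metric.uniformContinuousOn_iff.1 huc 1 one_pos
  refine ⟨δ, hδ, fun x hx t ht t' ht' htt => ?_⟩
  have := h (x, t) ⟨hx, ht⟩ (x, t') ⟨hx, ht'⟩ (by
    rw [Prod.dist_eq, dist_self, Real.dist_eq]
    exact max_lt hδ htt)
  rw [Real.dist_eq] at this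
  exact this.le

end JointDerivative

/-! ### Upper bound for the speed -/

theorem formDet_smul {n : ℕ} (a : ℝ) (H : LinearMap.BilinForm ℝ (EuclideanSpace ℝ (Fin n))) :
    formDet (a • H) = a ^ n * formDet H := by
  rw [formDet_eq _ (EuclideanSpace.basisFun (Fin n) ℝ),
    formDet_eq H (EuclideanSpace.basisFun (Fin n) ℝ)]
  have : (Matrix.of fun k l => (a • H) (EuclideanSpace.basisFun (Fin n) ℝ k)
      (EuclideanSpace.basisFun (Fin n) ℝ l)) =
      a • Matrix.of fun k l => H (EuclideanSpace.basisFun (Fin n) ℝ k)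
        (EuclideanSpace.basisFun (Fin n) ℝ l) := by
    ext k l; simp
  rw [this, Matrix.det_smul, Fintype.card_fin]

/-- The vector representing a linear functional. -/
noncomputable def gradVec {n : ℕ} (L : EuclideanSpace ℝ (Fin n) →L[ℝ] ℝ) :
    EuclideanSpace ℝ (Fin n) :=
  ∑ k, L (EuclideanSpace.basisFun (Fin n) ℝ k) • EuclideanSpace.basisFun (Fin n) ℝ k

theorem inner_gradVec {n : ℕ} (L : EuclideanSpace ℝ (Fin n) →L[ℝ] ℝ)
    (v : EuclideanSpace ℝ (Fin n)) : inner ℝ (gradVec L) v = L v := by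
  conv_rhs => rw [← (EuclideanSpace.basisFun (Fin n) ℝ).sum_repr' v, map_sum]
  rw [gradVec, sum_inner]
  refine Finset.sum_congr rfl fun k _ => ?_
  rw [inner_smul_left, map_smul, smul_eq_mul, mul_comm]
  simp

theorem MemParabolicC.hasFDerivAt_gradVec {n : ℕ} {Ω : Set (EuclideanSpace ℝ (Fin n))} {T : ℝ}
    {w : EuclideanSpace ℝ (Fin n) → ℝ → ℝ} (hΩ : IsUniformlyConvexDomain Ω)
    (h : MemParabolicC 4 Ω T w) {x : EuclideanSpace ℝ (Fin n)} (hx : x ∈ Ω) {t : ℝ}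
    (ht : t ∈ Ioo 0 T) :
    ∃ A : EuclideanSpace ℝ (Fin n) × ℝ →L[ℝ] EuclideanSpace ℝ (Fin n),
      HasFDerivAt (fun p : EuclideanSpace ℝ (Fin n) × ℝ =>
        gradVec (fderivWithin ℝ (fun y => w y p.2) (closure Ω) p.1)) A (x, t) ∧
      ∀ v e, inner ℝ (A (v, 0)) e = hessForm (closure Ω) (fun y => w y t) x v e := by
  choose L hL hL' using h.hasFDerivAt_fderivWithin hΩ hx ht
  refine ⟨∑ k, (L (EuclideanSpace.basisFun (Fin n) ℝ k)).smulRight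
    (EuclideanSpace.basisFun (Fin n) ℝ k), ?_, fun v e => ?_⟩
  · unfold gradVec
    exact HasFDerivAt.fun_sum fun k _ => (hL _).smul_const _
  · have he : hessForm (closure Ω) (fun y => w y t) x v e = ∑ k,
        inner ℝ (EuclideanSpace.basisFun (Fin n) ℝ k) e *
          hessForm (closure Ω) (fun y => w y t) x v (EuclideanSpace.basisFun (Fin n) ℝ k) := by
      conv_lhs => rw [← (EuclideanSpace.basisFun (Fin n) ℝ).sum_repr' e, map_sum]
      exact Finset.sum_congr rfl fun k _ => by rw [map_smul, smul_eq_mul]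
    rw [he, sum_apply, sum_inner]
    refine Finset.sum_congr rfl fun k _ => ?_
    rw [ContinuousLinearMap.smulRight_apply, inner_smul_left, hL', mul_comm]
    simp

namespace MongeAmpereData

variable {n : ℕ} {Ω : Set (EuclideanSpace ℝ (Fin n))} {T c₀ κ K : ℝ} {J : ℝ≥0}
  {φ ψ u : EuclideanSpace ℝ (Fin n) → ℝ → ℝ} {x : EuclideanSpace ℝ (Fin n)} {t : ℝ}

theorem continuousOn_formDet_diff {Ω : Set (EuclideanSpace ℝ (Fin n))}
    {w : EuclideanSpace ℝ (Fin n) → ℝ → ℝ} (hw : MemParabolicC 4 Ω T w) {h : ℝ} (hh : 0 < h) :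
    ContinuousOn (fun p : EuclideanSpace ℝ (Fin n) × ℝ =>
      formDet (hessForm (closure Ω) (fun y => w y (p.2 + h)) p.1 -
        hessForm (closure Ω) (fun y => w y p.2) p.1)) (Ω ×ˢ Ioo 0 (T - h)) := by
  simp only [formDet_eq _ (EuclideanSpace.basisFun (Fin n) ℝ), Matrix.det_apply]
  refine continuousOn_finsetSum _ fun σ _ => ContinuousOn.const_smul
    (continuousOn_finsetProd _ fun i _ => ?_) _
  have h1 : ∀ v e : EuclideanSpace ℝ (Fin n), ContinuousOn
      (fun p : EuclideanSpace ℝ (Fin n) × ℝ => hessForm (closure Ω) (fun y => w y p.2) p.1 v e)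
      (closure Ω ×ˢ Icc 0 T) := fun v e =>
    (ContinuousMultilinearMap.apply ℝ (fun _ : Fin 2 => EuclideanSpace ℝ (Fin n)) ℝ
      ![v, e]).continuous.comp_continuousOn (hw.continuousOn_iterated (j := 2) (by norm_num))
  have h2 : ∀ v e : EuclideanSpace ℝ (Fin n), ContinuousOn
      (fun p : EuclideanSpace ℝ (Fin n) × ℝ =>
        hessForm (closure Ω) (fun y => w y (p.2 + h)) p.1 v e) (Ω ×ˢ Ioo 0 (T - h)) := fun v e =>
    (h1 v e).comp (f := fun p : EuclideanSpace ℝ (Fin n) × ℝ => (p.1, p.2 + h)) (by fun_prop)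
      fun p hp => ⟨subset_closure hp.1, by linarith [hp.2.1], by linarith [hp.2.2]⟩
  exact (h2 _ _).sub ((h1 _ _).mono (prod_mono subset_closure
    fun s hs => ⟨hs.1.le, by linarith [hs.2]⟩))

/-- At a point where the difference quotient of `u` in time has nonnegative time derivative and
nonpositive Hessian, the Jacobian of the Legendre-type map is controlled by the difference
quotient of `ψ`. -/
theorem jacobian_le (hΩ : IsUniformlyConvexDomain Ω) (hT : 0 < T) (hκ : 0 < κ) (hc₀ : 0 < c₀)
    {m : ℕ} (hn : n = m + 1) (d : MongeAmpereData Ω T c₀ κ K J φ ψ u) {h : ℝ} (hh : 0 < h)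
    (hx : x ∈ Ω) (ht : t ∈ Ioo 0 (T - h)) (hw : 0 ≤ timeDeriv T u x (t + h) - timeDeriv T u x t)
    (hH : ∀ v, hessForm (closure Ω) (fun y => u y (t + h)) x v v ≤
      hessForm (closure Ω) (fun y => u y t) x v v) :
    |(timeDeriv T u x (t + h) - timeDeriv T u x t) / h * formDet (h⁻¹ •
      (hessForm (closure Ω) (fun y => u y (t + h)) x - hessForm (closure Ω) (fun y => u y t) x))| ≤
      (|ψ x (t + h) - ψ x t| / h) ^ (n + 1) / min c₀ (κ ^ n) ^ m := by
  have hxc := subset_closure hx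
  have t1 : t ∈ Icc 0 T := ⟨ht.1.le, by linarith [ht.2]⟩
  have t2 : t + h ∈ Icc 0 T := ⟨by linarith [ht.1], by linarith [ht.2]⟩
  set c₁ := min c₀ (κ ^ n) with hc₁
  have hc₁p : 0 < c₁ := lt_min hc₀ (by positivity)
  set H₀ := hessForm (closure Ω) (fun y => u y (t + h)) x with hH₀
  set H := hessForm (closure Ω) (fun y => u y t) x with hHd
  have hF₀ : c₁ ≤ formDet H₀ := by
    rw [d.equation x hxc _ t2]; exact d.le_speed hΩ hT hκ hxc t2
  have hF₀p := hc₁p.trans_le hF₀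
  obtain ⟨b, lam, hd⟩ := exists_diagonalizes H₀ (d.hess_symm hΩ hxc t2)
  have hl := hd.pos (d.hess_nonneg hΩ hxc t2) hF₀p
  obtain ⟨hle, hinc⟩ := hd.formDet_increment hl (d.hess_symm hΩ hxc t1) hH
  have e1 := d.equation x hxc _ t1
  have e2 := d.equation x hxc _ t2
  rw [← hH₀] at e2
  rw [← hHd] at e1
  set D := |ψ x (t + h) - ψ x t| with hD
  have hψD : ψ x t - ψ x (t + h) ≤ D := by
    rw [hD, abs_sub_comm]; exact le_abs_self _
  have hδ : timeDeriv T u x (t + h) - timeDeriv T u x t ≤ D := by linarith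
  have hFD : formDet H - formDet H₀ ≤ D := by linarith
  have hD0 : 0 ≤ D := abs_nonneg _
  have hP0 : 0 ≤ formDet (H - H₀) := formDet_nonneg
    (fun v w => by
      simp only [LinearMap.sub_apply, hH₀, hHd]
      rw [d.hess_symm hΩ hxc t1 v w, d.hess_symm hΩ hxc t2 v w])
    (fun v => by simp only [LinearMap.sub_apply]; linarith [hH v])
  have hpw : formDet H₀ ^ n = formDet H₀ * formDet H₀ ^ m :=
    (congrArg (formDet H₀ ^ ·) hn).trans (pow_succ' _ _)
  have hP : c₁ ^ m * formDet (H - H₀) ≤ D ^ n := by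
    have h1 : formDet H₀ * (formDet H₀ ^ m * formDet (H - H₀)) ≤ formDet H₀ * D ^ n := by
      calc formDet H₀ * (formDet H₀ ^ m * formDet (H - H₀)) =
          formDet H₀ ^ n * formDet (H - H₀) := by rw [hpw]; ring
        _ ≤ formDet H₀ * (formDet H - formDet H₀) ^ n := hinc
        _ ≤ _ := mul_le_mul_of_nonneg_left (pow_le_pow_left₀ (by linarith) hFD n) hF₀p.le
    exact (mul_le_mul_of_nonneg_right (pow_le_pow_left₀ hc₁p.le hF₀ m) hP0).trans
      (le_of_mul_le_mul_left h1 hF₀p)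
  have hneg : H₀ - H = (-1 : ℝ) • (H - H₀) :=
    LinearMap.ext fun v => LinearMap.ext fun w => by simp
  rw [hneg, smul_smul, formDet_smul, abs_mul, abs_mul, abs_pow, abs_of_nonneg hP0, abs_div,
    abs_of_nonneg hw, abs_of_pos hh, mul_neg_one, abs_neg, abs_of_pos (inv_pos.2 hh), div_pow,
    le_div_iff₀ (pow_pos hc₁p m)]
  calc (timeDeriv T u x (t + h) - timeDeriv T u x t) / h * (h⁻¹ ^ n * formDet (H - H₀)) * c₁ ^ m
      = (timeDeriv T u x (t + h) - timeDeriv T u x t) * (c₁ ^ m * formDet (H - H₀)) *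
        (h⁻¹ ^ (n + 1)) := by rw [pow_succ]; ring
    _ ≤ D * D ^ n * (h⁻¹ ^ (n + 1)) := by
        refine mul_le_mul_of_nonneg_right ?_ (by positivity)
        exact mul_le_mul hδ hP (mul_nonneg (by positivity) hP0) hD0
    _ = _ := by rw [pow_succ, inv_pow, ← div_eq_mul_inv]; ring

/-- Parabolic Aleksandrov-Bakelman-Pucci estimate in integrated form for the difference quotient
`w = (u(x, t + h) - u(x, t)) / h`. -/
theorem volume_le_lintegral (hΩ : IsUniformlyConvexDomain Ω) (hT : 0 < T) (hκ : 0 < κ)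
    (hc₀ : 0 < c₀) {m : ℕ} (hn : n = m + 1) (d : MongeAmpereData Ω T c₀ κ K J φ ψ u) {h : ℝ}
    (hh : 0 < h) {a L r : ℝ} (hr : 0 < r)
    (hinit : ∀ x ∈ closure Ω, (u x h - u x 0) / h ≤ a)
    (hlat : ∀ x ∈ frontier Ω, ∀ t ∈ Icc 0 (T - h), (u x (t + h) - u x t) / h ≤ a)
    {x₁ : EuclideanSpace ℝ (Fin n)} {t₁ : ℝ} (hx₁ : x₁ ∈ closure Ω) (ht₁ : t₁ ∈ Icc 0 (T - h))
    (hrad : ∀ x ∈ closure Ω, ‖x - x₁‖ ≤ r)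
    (hlarge : a + L < (u x₁ (t₁ + h) - u x₁ t₁) / h) :
    volume (Metric.ball (0 : EuclideanSpace ℝ (Fin n)) (L / (2 * r)) ×ˢ
        Ioo (a + L / 2) (a + L)) ≤
      ∫⁻ p in Ω ×ˢ Ioo 0 (T - h), ENNReal.ofReal
        ((|ψ p.1 (p.2 + h) - ψ p.1 p.2| / h) ^ (n + 1) / min c₀ (κ ^ n) ^ m) := by
  have hS := hΩ.uniqueDiffOn_closure
  set U : Set (EuclideanSpace ℝ (Fin n) × ℝ) := Ω ×ˢ Ioo 0 (T - h) with hU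
  have hUo : IsOpen U := hΩ.isOpen.prod isOpen_Ioo
  have hI : ∀ {τ : ℝ}, τ ∈ Icc 0 (T - h) → τ ∈ Icc 0 T ∧ τ + h ∈ Icc 0 T := fun hτ =>
    ⟨⟨hτ.1, by linarith [hτ.2]⟩, ⟨by linarith [hτ.1], by linarith [hτ.2]⟩⟩
  have hIo : ∀ {τ : ℝ}, τ ∈ Ioo 0 (T - h) → τ ∈ Ioo 0 T ∧ τ + h ∈ Ioo 0 T := fun hτ =>
    ⟨⟨hτ.1, by linarith [hτ.2]⟩, ⟨by linarith [hτ.1], by linarith [hτ.2]⟩⟩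
  set w : EuclideanSpace ℝ (Fin n) → ℝ → ℝ := fun x t => (u x (t + h) - u x t) / h with hw
  set G : EuclideanSpace ℝ (Fin n) × ℝ → EuclideanSpace ℝ (Fin n) := fun p => h⁻¹ •
    (gradVec (fderivWithin ℝ (fun y => u y (p.2 + h)) (closure Ω) p.1) -
      gradVec (fderivWithin ℝ (fun y => u y p.2) (closure Ω) p.1)) with hG
  set Φ : EuclideanSpace ℝ (Fin n) × ℝ → EuclideanSpace ℝ (Fin n) × ℝ := fun p =>
    (G p, w p.1 p.2 - inner ℝ (p.1 - x₁) (G p)) with hΦ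
  set jac : EuclideanSpace ℝ (Fin n) × ℝ → ℝ := fun p =>
    (timeDeriv T u p.1 (p.2 + h) - timeDeriv T u p.1 p.2) / h * formDet (h⁻¹ •
      (hessForm (closure Ω) (fun y => u y (p.2 + h)) p.1 -
        hessForm (closure Ω) (fun y => u y p.2) p.1)) with hjac
  set g : EuclideanSpace ℝ (Fin n) × ℝ → ℝ := fun p =>
    (|ψ p.1 (p.2 + h) - ψ p.1 p.2| / h) ^ (n + 1) / min c₀ (κ ^ n) ^ m with hg
  have hcont₀ : ∀ {f : EuclideanSpace ℝ (Fin n) → ℝ → ℝ},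
      ContinuousOn (fun p : EuclideanSpace ℝ (Fin n) × ℝ => f p.1 p.2) (closure Ω ×ˢ Icc 0 T) →
      ContinuousOn (fun p : EuclideanSpace ℝ (Fin n) × ℝ => f p.1 (p.2 + h) - f p.1 p.2)
        (closure Ω ×ˢ Icc 0 (T - h)) := fun hf =>
    (hf.comp (f := fun p : EuclideanSpace ℝ (Fin n) × ℝ => (p.1, p.2 + h)) (by fun_prop)
      fun p hp => ⟨hp.1, (hI hp.2).2⟩).sub (hf.mono (prod_mono subset_rfl fun s hs => (hI hs).1))
  have hsub : U ⊆ closure Ω ×ˢ Icc 0 (T - h) := prod_mono subset_closure Ioo_subset_Icc_self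
  -- differentiability of the map and its Jacobian
  have hder : ∀ p ∈ U, ∃ Φ' : EuclideanSpace ℝ (Fin n) × ℝ →L[ℝ] EuclideanSpace ℝ (Fin n) × ℝ,
      HasFDerivAt Φ Φ' p ∧ Φ'.det = jac p := by
    rintro ⟨x, t⟩ ⟨hx, ht⟩
    obtain ⟨ht0, hth⟩ := hIo ht
    obtain ⟨A, hA, hA'⟩ := d.mem_u.hasFDerivAt_gradVec hΩ hx ht0
    obtain ⟨A₁, hA₁, hA₁'⟩ := d.mem_u.hasFDerivAt_gradVec hΩ hx hth
    have hshift : HasFDerivAt (fun p : EuclideanSpace ℝ (Fin n) × ℝ => (p.1, p.2 + h))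
        (ContinuousLinearMap.id ℝ (EuclideanSpace ℝ (Fin n) × ℝ)) (x, t) :=
      ((hasFDerivAt_id (x, t)).add_const ((0, h) : EuclideanSpace ℝ (Fin n) × ℝ)
        ).congr_of_eventuallyEq (Filter.Eventually.of_forall fun p => by simp [Prod.ext_iff])
    have hA₁s : HasFDerivAt (fun p : EuclideanSpace ℝ (Fin n) × ℝ =>
        gradVec (fderivWithin ℝ (fun y => u y (p.2 + h)) (closure Ω) p.1)) A₁ (x, t) :=
      HasFDerivAt.comp (x, t) (f := fun p : EuclideanSpace ℝ (Fin n) × ℝ => (p.1, p.2 + h)) hA₁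
        hshift
    have hGd : HasFDerivAt G (h⁻¹ • (A₁ - A)) (x, t) := (hA₁s.sub hA).const_smul h⁻¹
    have hu := d.mem_u.hasFDerivAt_uncurry hΩ hx ht0
    have hus : HasFDerivAt (fun p : EuclideanSpace ℝ (Fin n) × ℝ => u p.1 (p.2 + h)) _ (x, t) :=
      HasFDerivAt.comp (x, t) (f := fun p : EuclideanSpace ℝ (Fin n) × ℝ => (p.1, p.2 + h))
        (d.mem_u.hasFDerivAt_uncurry hΩ hx hth) hshift
    have hwd : HasFDerivAt (fun p : EuclideanSpace ℝ (Fin n) × ℝ => w p.1 p.2) _ (x, t) :=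
      ((hus.sub hu).mul_const h⁻¹).congr_of_eventuallyEq
        (Filter.Eventually.of_forall fun p => by simp [hw, div_eq_mul_inv])
    have hin := (hasFDerivAt_fst.sub_const x₁).inner ℝ hGd
    refine ⟨legendreDeriv (h⁻¹ • (A₁ - A))
      ((timeDeriv T u x (t + h) - timeDeriv T u x t) / h) (x - x₁), ?_, ?_⟩
    · refine (hGd.prodMk (hwd.sub hin)).congr_fderiv ?_
      refine ContinuousLinearMap.ext fun p => ?_
      have e1 : ∀ v, inner ℝ v (G (x, t)) =
          h⁻¹ * (fderivWithin ℝ (fun y => u y (t + h)) (closure Ω) x v -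
            fderivWithin ℝ (fun y => u y t) (closure Ω) x v) := fun v => by
        rw [hG, inner_smul_right, inner_sub_right, real_inner_comm, inner_gradVec,
          real_inner_comm, inner_gradVec]
      ext1
      · rfl
      · simp [legendreDeriv, fderivInnerCLM_apply, e1, inner_smul_right, inner_sub_right,
          inner_sub_left]
        ring
    · refine det_legendreDeriv _ _ _ (h⁻¹ •
        (hessForm (closure Ω) (fun y => u y (t + h)) x -
          hessForm (closure Ω) (fun y => u y t) x)) fun v e => ?_
      simp [inner_smul_left, inner_sub_left, hA', hA₁']
  choose! Φ' hΦ' hdet using hder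
  -- the set where the Jacobian is controlled
  set s : Set (EuclideanSpace ℝ (Fin n) × ℝ) := {p ∈ U | |jac p| ≤ g p} with hs
  have hjc : ContinuousOn jac U := by
    have h1 := continuousOn_formDet_diff d.mem_u hh
    have h2 := (hcont₀ d.mem_u.continuousOn_timeDeriv).mono hsub
    have h3 := (h2.div_const h).mul (continuousOn_const (c := h⁻¹ ^ n) |>.mul h1)
    refine h3.congr fun p _ => ?_
    simp only [hjac]
    rw [formDet_smul]
    rfl
  have hgc : ContinuousOn g U :=
    ((((hcont₀ d.mem_ψ.continuousOn_uncurry).mono hsub).abs.div_const h).pow (n + 1)).div_const _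
  have hsm : MeasurableSet s := by
    have h1 : IsOpen (U ∩ (fun p => |jac p| - g p) ⁻¹' Ioi 0) :=
      (hjc.abs.sub hgc).isOpen_inter_preimage hUo isOpen_Ioi
    have h2 : s = U \ (U ∩ (fun p => |jac p| - g p) ⁻¹' Ioi 0) := by
      ext p
      simp only [hs, mem_ofPred_eq, mem_sdiff, mem_inter_iff, mem_preimage, mem_Ioi, sub_pos]
      constructor
      · rintro ⟨h1, h2⟩
        exact ⟨h1, fun h3 => absurd h3.2 (not_lt.2 h2)⟩
      · rintro ⟨h1, h2⟩
        exact ⟨h1, not_lt.1 fun h3 => h2 ⟨h1, h3⟩⟩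
    rw [h2]
    exact hUo.measurableSet.diff h1.measurableSet
  -- every slope and intercept in the range is attained on the contact set
  have hcover : Metric.ball (0 : EuclideanSpace ℝ (Fin n)) (L / (2 * r)) ×ˢ
      Ioo (a + L / 2) (a + L) ⊆ Φ '' s := by
    rintro ⟨p, c⟩ ⟨hp, hc⟩
    rw [mem_ball_zero_iff] at hp
    have hpr : ‖p‖ * r < L / 2 := by
      rw [lt_div_iff₀ (by positivity)] at hp
      linarith
    have hip : ∀ x ∈ closure Ω, -inner ℝ p (x - x₁) ≤ L / 2 := fun x hx => by
      have h1 := abs_real_inner_le_norm p (x - x₁)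
      have h2 := mul_le_mul_of_nonneg_left (hrad x hx) (norm_nonneg p)
      linarith [neg_abs_le (inner ℝ p (x - x₁))]
    have hwc : ContinuousOn (fun p : EuclideanSpace ℝ (Fin n) × ℝ => w p.1 p.2)
        (closure Ω ×ˢ Icc 0 (T - h)) := (hcont₀ d.mem_u.continuousOn_uncurry).div_const h
    obtain ⟨y, hy, τ, hτ, hyτ, hmax⟩ := exists_first_touching hΩ.isCompact_closure (T := T - h)
      (G := fun x t => w x t - inner ℝ p (x - x₁)) (c := c) (hwc.sub (by fun_prop))
      (fun x hx => by
        have h1 := hinit x hx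
        have h2 := hip x hx
        simp only [hw, zero_add]
        linarith [hc.1]) hx₁ ht₁ (by
        simp only [sub_self, inner_zero_right, sub_zero]
        linarith [hc.2])
    have hτc := Ioo_subset_Icc_self hτ
    obtain ⟨hτ0, hτh⟩ := hI hτc
    have hyΩ : y ∈ Ω := by
      rcases hΩ.mem_or_frontier hy with h1 | h1
      · exact h1
      · have h2 := hlat y h1 τ hτc
        have h3 := hip y hy
        change w y τ ≤ a at h2
        linarith [hc.1]
    have hint : y ∈ interior (closure Ω) := by rwa [hΩ.interior_closure]
    have hd0 := d.mem_u.contDiffOn_slice hτ0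
    have hdh := d.mem_u.contDiffOn_slice hτh
    have hmaxs : ∀ x ∈ closure Ω, w x τ - inner ℝ p (x - x₁) ≤ w y τ - inner ℝ p (y - x₁) :=
      fun x hx => by
        have := hmax x hx τ ⟨hτ.1.le, le_rfl⟩
        linarith
    -- first and second order conditions in space
    have hline : ∀ v : EuclideanSpace ℝ (Fin n),
        h⁻¹ * (fderivWithin ℝ (fun y => u y (τ + h)) (closure Ω) y v -
          fderivWithin ℝ (fun y => u y τ) (closure Ω) y v) = inner ℝ p v ∧
        hessForm (closure Ω) (fun y => u y (τ + h)) y v v ≤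
          hessForm (closure Ω) (fun y => u y τ) y v v := by
      intro v
      have hev := eventually_line_mem_interior hint v
      have hD : ∀ᶠ s : ℝ in 𝓝 0, HasDerivAt
          (fun s : ℝ => w (y + s • v) τ - inner ℝ p (y + s • v - x₁))
          ((fderivWithin ℝ (fun y => u y (τ + h)) (closure Ω) (y + s • v) v -
            fderivWithin ℝ (fun y => u y τ) (closure Ω) (y + s • v) v) / h - inner ℝ p v) s := by
        filter_upwards [hev] with s hs
        have h1 := hasDerivAt_line₀ (hdh.differentiableOn (by norm_num)) hs
        have h2 := hasDerivAt_line₀ (hd0.differentiableOn (by norm_num)) hs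
        have h3 : HasDerivAt (fun s : ℝ => inner ℝ p (y + s • v - x₁)) (inner ℝ p v) s := by
          have h4 : HasDerivAt (fun s : ℝ => y + s • v - x₁) v s := by
            simpa using (((hasDerivAt_id s).smul_const v).const_add y).sub_const x₁
          simpa using (hasDerivAt_const s p).inner ℝ h4
        exact ((h1.sub h2).div_const h).sub h3
      have hmaxl : IsLocalMax (fun s : ℝ => w (y + s • v) τ - inner ℝ p (y + s • v - x₁)) 0 := by
        filter_upwards [hev] with s hs
        simpa using hmaxs _ (interior_subset hs)
      constructor
      · have h0 := hmaxl.hasDerivAt_eq_zero hD.self_of_nhds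
        simp only [zero_smul, add_zero, sub_eq_zero] at h0
        rw [← h0, div_eq_inv_mul]
      · have h1 := hasDerivAt_line₁ hS (hdh.of_le (by norm_num)) (x := y) (v := v) (s := 0)
          (by simpa using hint) v
        have h2 := hasDerivAt_line₁ hS (hd0.of_le (by norm_num)) (x := y) (v := v) (s := 0)
          (by simpa using hint) v
        have h3 := nonpos_second_deriv_of_isLocalMax hD
          (((h1.sub h2).div_const h).sub_const (inner ℝ p v)) hmaxl
        simp only [zero_smul, add_zero] at h3
        rw [div_le_iff₀ hh] at h3
        linarith
    have hGp : G (y, τ) = p := by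
      refine ext_inner_right ℝ fun v => ?_
      rw [← (hline v).1, hG, inner_smul_left, inner_sub_left, inner_gradVec, inner_gradVec]
      simp
    -- first order condition in time
    have htime : 0 ≤ timeDeriv T u y (τ + h) - timeDeriv T u y τ := by
      obtain ⟨ho0, hoh⟩ := hIo hτ
      have h1 := (d.mem_u.hasDerivAt_time hy hoh).comp_add_const τ h
      have h2 := d.mem_u.hasDerivAt_time hy ho0
      have h3 := nonneg_deriv_of_le_left ((h1.sub h2).div_const h) hτ.1 (fun σ hσ => by
        have := hmax y hy σ hσ
        have h4 : w y σ ≤ w y τ := by linarith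
        exact h4)
      rw [le_div_iff₀ hh] at h3
      linarith
    refine ⟨(y, τ), ⟨⟨hyΩ, hτ⟩, ?_⟩, ?_⟩
    · exact d.jacobian_le hΩ hT hκ hc₀ hn hh hyΩ hτ htime fun v => (hline v).2
    · simp only [hΦ, hGp]
      rw [real_inner_comm, hyτ]
  have : (volume : Measure (EuclideanSpace ℝ (Fin n) × ℝ)).IsAddHaarMeasure := by
    rw [Measure.volume_eq_prod]; infer_instance
  calc _ ≤ volume (Φ '' s) := measure_mono hcover
    _ ≤ ∫⁻ p in s, ENNReal.ofReal |(Φ' p).det| :=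
        addHaar_image_le_lintegral_abs_det_fderiv volume hsm
          fun p hp => (hΦ' p hp.1).hasFDerivWithinAt
    _ ≤ ∫⁻ p in s, ENNReal.ofReal (g p) :=
        setLIntegral_mono' hsm fun p hp => ENNReal.ofReal_le_ofReal (by
          rw [hdet p hp.1]; exact hp.2)
    _ ≤ _ := lintegral_mono_set fun p hp => hp.1

end MongeAmpereData

theorem formDet_le_pow {n : ℕ} {H : LinearMap.BilinForm ℝ (EuclideanSpace ℝ (Fin n))} {K : ℝ}
    (hs : ∀ v w, H v w = H w v) (hn : ∀ v, 0 ≤ H v v) (h : ∀ v, H v v ≤ K * ‖v‖ ^ 2) :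
    formDet H ≤ K ^ n := by
  obtain ⟨b, lam, hd⟩ := exists_diagonalizes H hs
  rw [hd.formDet_eq_prod]
  have : ∀ k, lam k ≤ K := fun k => by
    have := h (b k)
    rw [hd.basis_apply, if_pos rfl, b.norm_eq_one] at this
    simpa using this
  calc ∏ k, lam k ≤ ∏ _k : Fin n, K := Finset.prod_le_prod (fun k _ => hd.nonneg hn k)
        fun k _ => this k
    _ = _ := by simp

theorem IsUniformlyConvexDomain.exists_diam {n : ℕ} {Ω : Set (EuclideanSpace ℝ (Fin n))}
    (hΩ : IsUniformlyConvexDomain Ω) :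
    ∃ R : ℝ, 1 ≤ R ∧ ∀ x ∈ closure Ω, ∀ y ∈ closure Ω, ‖x - y‖ ≤ R := by
  obtain ⟨R, hR⟩ := hΩ.isBounded.closure.exists_norm_le
  refine ⟨|R| + |R| + 1, by linarith [abs_nonneg R], fun x hx y hy => ?_⟩
  have := norm_sub_le x y
  linarith [(hR x hx).trans (le_abs_self R), (hR y hy).trans (le_abs_self R)]

namespace MongeAmpereData

variable {n : ℕ} {Ω : Set (EuclideanSpace ℝ (Fin n))} {T c₀ κ K : ℝ} {J : ℝ≥0}
  {φ ψ u : EuclideanSpace ℝ (Fin n) → ℝ → ℝ} {x : EuclideanSpace ℝ (Fin n)} {t : ℝ}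

theorem abs_timeDeriv_φ_le (d : MongeAmpereData Ω T c₀ κ K J φ ψ u) (hx : x ∈ closure Ω)
    (ht : t ∈ Icc 0 T) : |timeDeriv T φ x t| ≤ K := by
  have := d.bound_φt 0 (by norm_num) x hx t ht
  rwa [norm_iteratedFDerivWithin_zero] at this

theorem timeDeriv_initial_le (hΩ : IsUniformlyConvexDomain Ω) (hT : 0 < T)
    (d : MongeAmpereData Ω T c₀ κ K J φ ψ u) (hx : x ∈ closure Ω) :
    timeDeriv T u x 0 ≤ K ^ n + K := by
  have h0 : (0 : ℝ) ∈ Icc 0 T := ⟨le_rfl, hT.le⟩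
  have h1 := formDet_le_pow (K := K) (d.hess_symm hΩ hx h0) (d.hess_nonneg hΩ hx h0) fun v => by
    rw [d.hess_initial hx]
    have := (le_abs_self _).trans (abs_hessForm_le (d.bound_φ 2 (by norm_num) x hx 0 h0) v v)
    linarith
  rw [d.equation x hx 0 h0] at h1
  linarith [neg_abs_le (ψ x 0), d.bound_ψ x hx 0 h0]

theorem lintegral_diff_le (hΩ : IsUniformlyConvexDomain Ω)
    (d : MongeAmpereData Ω T c₀ κ K J φ ψ u) {h : ℝ} (hh : 0 < h) {c : ℝ} (hc : 0 < c)
    (hmod : ∀ x ∈ closure Ω, ∀ t ∈ Icc 0 T, ∀ t' ∈ Icc 0 T, |t - t'| ≤ h →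
      |timeDeriv T ψ x t - timeDeriv T ψ x t'| ≤ 1) :
    ∫⁻ p in Ω ×ˢ Ioo 0 (T - h), ENNReal.ofReal
      ((|ψ p.1 (p.2 + h) - ψ p.1 p.2| / h) ^ (n + 1) / c) ≤
      ENNReal.ofReal (2 ^ n / c) * (J + volume (parabolicCylinder Ω T)) := by
  have hsub : Ω ×ˢ Ioo 0 (T - h) ⊆ parabolicCylinder Ω T :=
    prod_mono subset_rfl fun s hs => ⟨hs.1, by linarith [hs.2]⟩
  have hm : MeasurableSet (Ω ×ˢ Ioo 0 (T - h)) := (hΩ.isOpen.prod isOpen_Ioo).measurableSet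
  calc _ ≤ ∫⁻ p in Ω ×ˢ Ioo 0 (T - h), ENNReal.ofReal (2 ^ n / c) *
          (‖timeDeriv T ψ p.1 p.2‖ₑ ^ (n + 1) + 1) := by
        refine setLIntegral_mono' hm fun p hp => ?_
        have hx := subset_closure hp.1
        obtain ⟨θ, hθ, hs⟩ := d.mem_ψ.exists_slope hx hp.2.1.le
          (show p.2 < p.2 + h by linarith) (by linarith [hp.2.2])
        rw [add_sub_cancel_left] at hs
        have h1 := hmod p.1 hx θ ⟨hp.2.1.le.trans hθ.1.le, by linarith [hθ.2, hp.2.2]⟩ p.2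
          ⟨hp.2.1.le, by linarith [hp.2.2]⟩ (by
            rw [abs_of_pos (by linarith [hθ.1])]; linarith [hθ.2])
        have h2 : |ψ p.1 (p.2 + h) - ψ p.1 p.2| / h ≤ |timeDeriv T ψ p.1 p.2| + 1 := by
          have : |ψ p.1 (p.2 + h) - ψ p.1 p.2| / h = |timeDeriv T ψ p.1 θ| := by
            rw [hs, abs_div, abs_of_pos hh]
          rw [this]
          have := abs_sub_abs_le_abs_sub (timeDeriv T ψ p.1 θ) (timeDeriv T ψ p.1 p.2)
          linarith
        have h3 : (|ψ p.1 (p.2 + h) - ψ p.1 p.2| / h) ^ (n + 1) ≤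
            2 ^ n * (|timeDeriv T ψ p.1 p.2| ^ (n + 1) + 1) := by
          refine (pow_le_pow_left₀ (by positivity) h2 _).trans ?_
          have := add_pow_le (abs_nonneg (timeDeriv T ψ p.1 p.2)) zero_le_one (n + 1)
          simpa using this
        have h4 : (‖timeDeriv T ψ p.1 p.2‖ₑ ^ (n + 1) + 1) =
            ENNReal.ofReal (|timeDeriv T ψ p.1 p.2| ^ (n + 1) + 1) := by
          rw [ENNReal.ofReal_add (by positivity) zero_le_one, ENNReal.ofReal_pow (abs_nonneg _),
            ENNReal.ofReal_one, Real.enorm_eq_ofReal_abs]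
        rw [h4, ← ENNReal.ofReal_mul (by positivity)]
        refine ENNReal.ofReal_le_ofReal ?_
        rw [div_mul_eq_mul_div]
        exact div_le_div_of_nonneg_right h3 hc.le
    _ ≤ ∫⁻ p in parabolicCylinder Ω T, ENNReal.ofReal (2 ^ n / c) *
          (‖timeDeriv T ψ p.1 p.2‖ₑ ^ (n + 1) + 1) := lintegral_mono_set hsub
    _ = ENNReal.ofReal (2 ^ n / c) * ((∫⁻ p in parabolicCylinder Ω T,
          ‖timeDeriv T ψ p.1 p.2‖ₑ ^ (n + 1)) + volume (parabolicCylinder Ω T)) := by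
        rw [lintegral_const_mul' _ _ ENNReal.ofReal_ne_top, lintegral_add_right _ measurable_const,
          setLIntegral_one]
    _ ≤ _ := by gcongr; exact d.bound_ψt

/-- If the speed were large somewhere, the difference quotient of `u` in time would rise far above
its values on the parabolic boundary; `volume_le_lintegral` bounds the excess by the `L^(n + 1)` norm
of `ψ_t`. -/
theorem exists_speed_le (hΩ : IsUniformlyConvexDomain Ω) (hn : 1 ≤ n) (hT : 0 < T) (hκ : 0 < κ)
    (hc₀ : 0 < c₀) (hK : 0 ≤ K) (J : ℝ≥0) :
    ∃ C : ℝ, 1 ≤ C ∧ ∀ φ ψ u, MongeAmpereData Ω T c₀ κ K J φ ψ u →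
      ∀ x ∈ closure Ω, ∀ t ∈ Icc 0 T, timeDeriv T u x t + ψ x t ≤ C := by
  obtain ⟨m, hm⟩ : ∃ m, n = m + 1 := ⟨n - 1, by omega⟩
  obtain ⟨R, hR1, hR⟩ := hΩ.exists_diam
  have hR0 : 0 < R := by linarith
  set c := min c₀ (κ ^ n) ^ m with hc
  have hcp : 0 < c := pow_pos (lt_min hc₀ (by positivity)) m
  set β := (volume (Metric.ball (0 : EuclideanSpace ℝ (Fin n)) 1)).toReal with hβ
  have hβtop : volume (Metric.ball (0 : EuclideanSpace ℝ (Fin n)) 1) ≠ ⊤ :=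
    measure_ball_lt_top.ne
  have hβp : 0 < β := ENNReal.toReal_pos (Metric.measure_ball_pos volume _ one_pos).ne' hβtop
  have hVtop : volume (parabolicCylinder Ω T) ≠ ⊤ := by
    rw [parabolicCylinder, Measure.volume_eq_prod, Measure.prod_prod]
    exact ENNReal.mul_ne_top hΩ.isBounded.measure_lt_top.ne (by simp)
  set B := 2 ^ n / c * (J + (volume (parabolicCylinder Ω T)).toReal) with hB
  have hB0 : 0 ≤ B := by positivity
  set B' := B * 2 * (2 * R) ^ n / β with hB'
  have hB'0 : 0 ≤ B' := by positivity
  set L := 1 + B' with hL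
  set a := K ^ n + K + 1 with ha
  have hKn : 0 ≤ K ^ n := by positivity
  refine ⟨a + L + 1 + K, by linarith, fun φ ψ u d x hx t ht => ?_⟩
  suffices h : timeDeriv T u x t ≤ a + L + 1 by
    linarith [le_abs_self (ψ x t), d.bound_ψ x hx t ht]
  by_contra hcon
  push Not at hcon
  obtain ⟨δ₁, hδ₁, hmod₁⟩ := exists_uniform_time_modulus hΩ.isCompact_closure
    d.mem_u.continuousOn_timeDeriv
  obtain ⟨δ₂, hδ₂, hmod₂⟩ := exists_uniform_time_modulus hΩ.isCompact_closure
    d.mem_ψ.continuousOn_timeDeriv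
  set h := min (min δ₁ δ₂) T / 2 with hh
  have hmin : 0 < min (min δ₁ δ₂) T := lt_min (lt_min hδ₁ hδ₂) hT
  have hhp : 0 < h := half_pos hmin
  have hh1 : h < δ₁ := (half_lt_self hmin).trans_le ((min_le_left _ _).trans (min_le_left _ _))
  have hh2 : h < δ₂ := (half_lt_self hmin).trans_le ((min_le_left _ _).trans (min_le_right _ _))
  have hhT : h < T := (half_lt_self hmin).trans_le (min_le_right _ _)
  set t₁ := min t (T - h) with ht₁
  have ht₁m : t₁ ∈ Icc 0 (T - h) := ⟨le_min ht.1 (by linarith), min_le_right _ _⟩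
  have ht₁t : t₁ ≤ t := min_le_left _ _
  have htt₁ : t ≤ t₁ + h := by
    rcases min_choice t (T - h) with h1 | h1
    · rw [ht₁, h1]; linarith
    · rw [ht₁, h1]; linarith [ht.2]
  have hlarge : a + L < (u x (t₁ + h) - u x t₁) / h := by
    obtain ⟨θ, hθ, hs⟩ := d.mem_u.exists_slope hx ht₁m.1 (show t₁ < t₁ + h by linarith)
      (by linarith [ht₁m.2])
    rw [add_sub_cancel_left] at hs
    have := hmod₁ x hx t ht θ ⟨ht₁m.1.trans hθ.1.le, by linarith [hθ.2, ht₁m.2]⟩ (by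
      rw [abs_lt]; constructor <;> linarith [hθ.1, hθ.2])
    rw [← hs]
    linarith [le_abs_self (timeDeriv T u x t - timeDeriv T u x θ)]
  have hvol := d.volume_le_lintegral hΩ hT hκ hc₀ hm hhp (a := a) (L := L) (r := R) hR0
    (fun y hy => by
      obtain ⟨θ, hθ, hs⟩ := d.mem_u.exists_slope hy le_rfl hhp hhT.le
      rw [sub_zero] at hs
      rw [← hs]
      have h1 := hmod₁ y hy θ ⟨hθ.1.le, by linarith [hθ.2]⟩ 0 ⟨le_rfl, hT.le⟩ (by
        rw [sub_zero, abs_of_pos hθ.1]; linarith [hθ.2])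
      have h2 := d.timeDeriv_initial_le hΩ hT hy
      linarith [le_abs_self (timeDeriv T u y θ - timeDeriv T u y 0)])
    (fun y hy τ hτ => by
      have hyc := frontier_subset_closure hy
      rw [d.lateral_eq y hy τ ⟨hτ.1, by linarith [hτ.2]⟩,
        d.lateral_eq y hy (τ + h) ⟨by linarith [hτ.1], by linarith [hτ.2]⟩]
      obtain ⟨θ, hθ, hs⟩ := d.mem_φ.exists_slope hyc hτ.1 (show τ < τ + h by linarith)
        (by linarith [hτ.2])
      rw [add_sub_cancel_left] at hs
      rw [← hs]
      have := d.abs_timeDeriv_φ_le hyc (t := θ) ⟨by linarith [hθ.1, hτ.1],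
        by linarith [hθ.2, hτ.2]⟩
      linarith [le_abs_self (timeDeriv T φ y θ)])
    hx ht₁m (fun y hy => hR y hy x hx) hlarge
  have hint := hvol.trans (d.lintegral_diff_le hΩ hhp hcp fun y hy τ hτ τ' hτ' hττ =>
    hmod₂ y hy τ hτ τ' hτ' (hττ.trans_lt hh2))
  have hLp : 0 < L := by linarith
  have hρ : 0 < L / (2 * R) := by positivity
  have hdim : Module.finrank ℝ (EuclideanSpace ℝ (Fin n)) = n := by simp
  rw [Measure.volume_eq_prod, Measure.prod_prod, Measure.addHaar_ball_of_pos _ _ hρ, hdim,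
    Real.volume_Ioo] at hint
  have hreal := ENNReal.toReal_mono (ENNReal.mul_ne_top ENNReal.ofReal_ne_top
    (ENNReal.add_ne_top.2 ⟨ENNReal.coe_ne_top, hVtop⟩)) hint
  rw [ENNReal.toReal_mul, ENNReal.toReal_mul, ENNReal.toReal_mul,
    ENNReal.toReal_ofReal (by positivity), ENNReal.toReal_ofReal (by linarith),
    ENNReal.toReal_ofReal (by positivity), ENNReal.toReal_add ENNReal.coe_ne_top hVtop,
    ENNReal.coe_toReal] at hreal
  change (L / (2 * R)) ^ n * β * (a + L - (a + L / 2)) ≤ B at hreal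
  have h1 : L ^ (n + 1) ≤ B' := by
    rw [hB', le_div_iff₀ hβp]
    have h2 : (L / (2 * R)) ^ n * (2 * R) ^ n = L ^ n := by
      rw [← mul_pow]; congr 1; field_simp
    calc L ^ (n + 1) * β = ((L / (2 * R)) ^ n * β * (a + L - (a + L / 2))) *
          (2 * (2 * R) ^ n) := by rw [pow_succ, ← h2]; ring
      _ ≤ B * (2 * (2 * R) ^ n) := mul_le_mul_of_nonneg_right hreal (by positivity)
      _ = _ := by ring
  have h2 : L ≤ L ^ (n + 1) := le_self_pow₀ (by linarith) (by omega)
  linarith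

end MongeAmpereData

/-! ### Boundary gradient estimate -/

theorem nonpos_of_forall_le_mul {a C s₀ : ℝ} (hs₀ : 0 < s₀) (h : ∀ s ∈ Ioc 0 s₀, a ≤ C * s) :
    a ≤ 0 := by
  have h1 : Filter.Tendsto (fun s : ℝ => C * s) (𝓝[>] 0) (𝓝 (C * 0)) :=
    ((continuous_const.mul continuous_id).tendsto 0).mono_left nhdsWithin_le_nhds
  rw [mul_zero] at h1
  refine ge_of_tendsto h1 ?_
  filter_upwards [Ioc_mem_nhdsGT hs₀] with s hs using h s hs

theorem hessForm_le_of_isLocalMax {E : Type*} [NormedAddCommGroup E] [NormedSpace ℝ E] {S : Set E}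
    {f q : E → ℝ} (hS : UniqueDiffOn ℝ S) (hf : ContDiffOn ℝ 2 f S) {x : E} (hx : x ∈ interior S)
    {v : E} {l α : ℝ} (hq : ∀ s : ℝ, q (x + s • v) = q x + s * l + s ^ 2 * α)
    (hmax : ∀ᶠ z in 𝓝 x, f z - q z ≤ f x - q x) : hessForm S f x v v ≤ 2 * α := by
  have hev := eventually_line_mem_interior hx v
  have hD : ∀ᶠ s : ℝ in 𝓝 0, HasDerivAt (fun s : ℝ => f (x + s • v) - q (x + s • v))
      (fderivWithin ℝ f S (x + s • v) v - (l + 2 * s * α)) s := by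
    filter_upwards [hev] with s hs
    refine (hasDerivAt_line₀ (hf.differentiableOn (by norm_num)) hs).sub ?_
    have h1 : HasDerivAt (fun s : ℝ => q x + s * l + s ^ 2 * α) (1 * l + 2 * s * α) s := by
      have := (((hasDerivAt_id s).mul_const l).const_add (q x)).fun_add
        (((hasDerivAt_id s).pow 2).mul_const α)
      simpa using this
    rw [one_mul] at h1
    exact h1.congr_of_eventuallyEq (Filter.Eventually.of_forall hq)
  have h2 := hasDerivAt_line₁ hS hf (x := x) (v := v) (s := 0) (by simpa using hx) v
  have h3 : HasDerivAt (fun s : ℝ => l + 2 * s * α) (2 * α) 0 := by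
    simpa using (((hasDerivAt_id (0 : ℝ)).const_mul 2).mul_const α).const_add l
  have hc : ContinuousAt (fun s : ℝ => x + s • v) 0 := by fun_prop
  have hm : IsLocalMax (fun s : ℝ => f (x + s • v) - q (x + s • v)) 0 := by
    have h4 : Filter.Tendsto (fun s : ℝ => x + s • v) (𝓝 0) (𝓝 x) := by
      simpa [ContinuousAt] using hc
    filter_upwards [h4.eventually hmax] with s hs
    simpa using hs
  have := nonpos_second_deriv_of_isLocalMax hD (h2.sub h3) hm
  simp only [zero_smul, add_zero] at this
  linarith

theorem ConvexOn.closure_of_continuousOn {E : Type*} [NormedAddCommGroup E] [NormedSpace ℝ E]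
    {s : Set E} {f : E → ℝ} (hf : ConvexOn ℝ s f) (hc : ContinuousOn f (closure s)) :
    ConvexOn ℝ (closure s) f := by
  refine ⟨hf.1.closure, fun x hx y hy a b ha hb hab => ?_⟩
  have hxy : (x, y) ∈ closure (s ×ˢ s) := by rw [closure_prod_eq]; exact ⟨hx, hy⟩
  have hsub : ∀ p ∈ s ×ˢ s, a • p.1 + b • p.2 ∈ closure s := fun p hp =>
    subset_closure (hf.1 hp.1 hp.2 ha hb hab)
  have h1 : ContinuousWithinAt (fun p : E × E => f (a • p.1 + b • p.2)) (s ×ˢ s) (x, y) := by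
    have h0 : ContinuousWithinAt f (closure s) (a • x + b • y) :=
      hc _ (hf.1.closure hx hy ha hb hab)
    exact ContinuousWithinAt.comp (f := fun p : E × E => a • p.1 + b • p.2) (x := (x, y)) h0
      (by fun_prop) hsub
  have h2 : ContinuousWithinAt (fun p : E × E => a • f p.1 + b • f p.2) (s ×ˢ s) (x, y) := by
    have hx' := ContinuousWithinAt.comp (f := fun p : E × E => p.1) (x := (x, y)) (hc x hx)
      continuousWithinAt_fst (s := s ×ˢ s) (fun p hp => subset_closure hp.1)
    have hy' := ContinuousWithinAt.comp (f := fun p : E × E => p.2) (x := (x, y)) (hc y hy)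
      continuousWithinAt_snd (s := s ×ˢ s) (fun p hp => subset_closure hp.2)
    exact (hx'.const_smul a).add (hy'.const_smul b)
  exact h1.closure_le hxy h2 fun p hp => hf.2 hp.1 hp.2 ha hb hab

/-- A time slice of the problem: `f` is convex with `c₁ ≤ det D²f ≤ C₁` and agrees on the boundary
with a function `g` whose derivatives are bounded by `K`. -/
structure EllipticSlice {n : ℕ} (Ω : Set (EuclideanSpace ℝ (Fin n))) (K c₁ C₁ : ℝ)
    (f g : EuclideanSpace ℝ (Fin n) → ℝ) : Prop where
  smooth_f : ContDiffOn ℝ 4 f (closure Ω)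
  smooth_g : ContDiffOn ℝ 4 g (closure Ω)
  bound_g : ∀ j, j ≤ 4 → ∀ x ∈ closure Ω, ‖iteratedFDerivWithin ℝ j g (closure Ω) x‖ ≤ K
  convex : ConvexOn ℝ (closure Ω) f
  le_det : ∀ x ∈ closure Ω, c₁ ≤ formDet (hessForm (closure Ω) f x)
  det_le : ∀ x ∈ closure Ω, formDet (hessForm (closure Ω) f x) ≤ C₁
  boundary : ∀ x ∈ frontier Ω, f x = g x

theorem inner_line_add_mul_norm_sq {E : Type*} [NormedAddCommGroup E] [InnerProductSpace ℝ E]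
    (x y ν v : E) (a c s : ℝ) :
    a * inner ℝ (x + s • v - y) ν + c * ‖x + s • v - y‖ ^ 2 =
      a * inner ℝ (x - y) ν + c * ‖x - y‖ ^ 2 +
        s * (a * inner ℝ v ν + 2 * c * inner ℝ (x - y) v) + s ^ 2 * (c * ‖v‖ ^ 2) := by
  have h : x + s • v - y = (x - y) + s • v := by abel
  rw [h, inner_add_left, inner_smul_left, norm_add_sq_real, inner_smul_right, norm_smul, mul_pow,
    Real.norm_eq_abs, sq_abs]
  simp only [conj_trivial]
  ring

namespace EllipticSlice

variable {n : ℕ} {Ω : Set (EuclideanSpace ℝ (Fin n))} {K c₁ C₁ M : ℝ}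
  {f g : EuclideanSpace ℝ (Fin n) → ℝ} {x y ν : EuclideanSpace ℝ (Fin n)}
  {Q : LinearMap.BilinForm ℝ (EuclideanSpace ℝ (Fin n))}

theorem hess_symm (hΩ : IsUniformlyConvexDomain Ω) (h : EllipticSlice Ω K c₁ C₁ f g)
    (hx : x ∈ closure Ω) (v w : EuclideanSpace ℝ (Fin n)) :
    hessForm (closure Ω) f x v w = hessForm (closure Ω) f x w v :=
  hessForm_symm hΩ.uniqueDiffOn_closure hΩ.closure_subset (h.smooth_f.of_le (by norm_num)) hx v w

theorem hess_nonneg (hΩ : IsUniformlyConvexDomain Ω) (h : EllipticSlice Ω K c₁ C₁ f g)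
    (hx : x ∈ closure Ω) (v : EuclideanSpace ℝ (Fin n)) : 0 ≤ hessForm (closure Ω) f x v v :=
  hessForm_nonneg_of_convexOn_interior hΩ.uniqueDiffOn_closure hΩ.closure_subset
    (h.smooth_f.of_le (by norm_num)) (by
      rw [hΩ.interior_closure]; exact h.convex.subset subset_closure hΩ.convex) hx v

theorem abs_g_le (h : EllipticSlice Ω K c₁ C₁ f g) (hx : x ∈ closure Ω) : |g x| ≤ K := by
  have := h.bound_g 0 (by norm_num) x hx
  rwa [norm_iteratedFDerivWithin_zero] at this

theorem abs_hess_g_le (h : EllipticSlice Ω K c₁ C₁ f g) (hx : x ∈ closure Ω)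
    (v w : EuclideanSpace ℝ (Fin n)) : |hessForm (closure Ω) g x v w| ≤ K * ‖v‖ * ‖w‖ :=
  abs_hessForm_le (h.bound_g 2 (by norm_num) x hx) v w

theorem abs_fderiv_g_le (hΩ : IsUniformlyConvexDomain Ω) (h : EllipticSlice Ω K c₁ C₁ f g)
    (hx : x ∈ closure Ω) (v : EuclideanSpace ℝ (Fin n)) :
    |fderivWithin ℝ g (closure Ω) x v| ≤ K * ‖v‖ := by
  have h1 := norm_fderivWithin_le hΩ.uniqueDiffOn_closure hx (h.bound_g 1 (by norm_num) x hx)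
  exact (ContinuousLinearMap.le_opNorm _ v).trans (mul_le_mul_of_nonneg_right h1 (norm_nonneg v))

theorem f_le (hΩ : IsUniformlyConvexDomain Ω) (hn : 1 ≤ n) (hc₁ : 0 < c₁)
    (h : EllipticSlice Ω K c₁ C₁ f g) (hx : x ∈ closure Ω) : f x ≤ K := by
  obtain ⟨z, hz, hmax⟩ := hΩ.isCompact_closure.exists_isMaxOn ⟨x, hx⟩ h.smooth_f.continuousOn
  refine (hmax hx).trans ?_
  rcases hΩ.mem_or_frontier hz with h1 | h1
  · exfalso
    have hint : z ∈ interior (closure Ω) := by rwa [hΩ.interior_closure]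
    have h2 : ∀ v, hessForm (closure Ω) f z v v ≤ 0 * ‖v‖ ^ 2 := fun v => by
      have := hessForm_le_of_isLocalMax (q := fun _ => 0) (v := v) (l := 0) (α := 0)
        hΩ.uniqueDiffOn_closure (h.smooth_f.of_le (by norm_num)) hint (by simp) (by
          filter_upwards [isOpen_interior.mem_nhds hint] with w hw
          simpa using hmax (interior_subset hw))
      simpa using this
    have h3 := formDet_le_pow (h.hess_symm hΩ hz) (h.hess_nonneg hΩ hz) h2
    rw [zero_pow (by omega)] at h3
    linarith [h.le_det z hz]
  · rw [h.boundary z h1]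
    exact (le_abs_self _).trans (h.abs_g_le hz)

/-- The lower barrier `g - A b` with `b(x) = ⟨x - y, ν⟩ - |x - y|² / (2 M)`. -/
theorem barrier_le (hΩ : IsUniformlyConvexDomain Ω) (hn : 1 ≤ n) (hM : 1 ≤ M) (hK : 0 ≤ K)
    (hC₁ : 0 ≤ C₁) (h : EllipticSlice Ω K c₁ C₁ f g) (hF : BoundaryFrame Ω M y ν Q)
    (hx : x ∈ closure Ω) :
    g x - M * (K + C₁ + 1) * (inner ℝ (x - y) ν - ‖x - y‖ ^ 2 / (2 * M)) ≤ f x := by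
  set A := M * (K + C₁ + 1) with hA
  have hA0 : 0 < A := by positivity
  have hM0 : 0 < M := by linarith
  set q : EuclideanSpace ℝ (Fin n) → ℝ := fun x =>
    A * inner ℝ (x - y) ν + (-(K + C₁ + 1) / 2) * ‖x - y‖ ^ 2 with hq
  have hqe : ∀ x, q x = A * (inner ℝ (x - y) ν - ‖x - y‖ ^ 2 / (2 * M)) := fun x => by
    rw [hq, hA]; field_simp; ring
  rw [← hqe]
  have hcont : ContinuousOn (fun x => g x - f x - q x) (closure Ω) :=
    (h.smooth_g.continuousOn.sub h.smooth_f.continuousOn).sub (by fun_prop)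
  obtain ⟨z, hz, hmax⟩ := hΩ.isCompact_closure.exists_isMaxOn ⟨x, hx⟩ hcont
  suffices hzn : g z - f z - q z ≤ 0 by
    have := hmax hx
    change g x - f x - q x ≤ g z - f z - q z at this
    linarith
  rcases hΩ.mem_or_frontier hz with h1 | h1
  · exfalso
    have hint : z ∈ interior (closure Ω) := by rwa [hΩ.interior_closure]
    have hf2 := h.smooth_f.of_le (show (2 : WithTop ℕ∞) ≤ 4 by norm_num)
    have hg2 := h.smooth_g.of_le (show (2 : WithTop ℕ∞) ≤ 4 by norm_num)
    have h2 : ∀ v, (C₁ + 1) * ‖v‖ ^ 2 ≤ hessForm (closure Ω) f z v v := fun v => by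
      have := hessForm_le_of_isLocalMax (f := fun x => g x - f x) (q := q) (v := v)
        hΩ.uniqueDiffOn_closure (hg2.sub hf2) hint
        (fun s => inner_line_add_mul_norm_sq z y ν v A (-(K + C₁ + 1) / 2) s) (by
          filter_upwards [isOpen_interior.mem_nhds hint] with w hw
          exact hmax (interior_subset hw))
      rw [hessForm_sub hΩ.uniqueDiffOn_closure hg2 hf2 hz] at this
      have h3 := (abs_le.1 (h.abs_hess_g_le hz v v)).1
      nlinarith
    have h3 := pow_le_formDet (by linarith) (h.hess_symm hΩ hz) h2
    have h4 : C₁ + 1 ≤ (C₁ + 1) ^ n := le_self_pow₀ (by linarith) (by omega)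
    linarith [h.det_le z hz]
  · rw [h.boundary z h1, hqe]
    have h2 := hF.support z hz
    have h3 : 0 ≤ inner ℝ (z - y) ν - ‖z - y‖ ^ 2 / (2 * M) := by
      rw [sub_nonneg, div_le_iff₀ (by positivity)]
      nlinarith [sq_nonneg ‖z - y‖]
    have := mul_nonneg hA0.le h3
    linarith

theorem abs_normal_deriv_le (hΩ : IsUniformlyConvexDomain Ω) (hn : 1 ≤ n) (hM : 1 ≤ M)
    (hK : 0 ≤ K) (hc₁ : 0 < c₁) (hC₁ : 0 ≤ C₁) (h : EllipticSlice Ω K c₁ C₁ f g)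
    (hy : y ∈ frontier Ω) (hF : BoundaryFrame Ω M y ν Q) :
    |fderivWithin ℝ f (closure Ω) y ν - fderivWithin ℝ g (closure Ω) y ν| ≤
      M * (3 * K + C₁ + 1) := by
  have hM0 : 0 < M := by linarith
  have hyc := frontier_subset_closure hy
  have hs₀ : 0 < 1 / M := by positivity
  have hI : ∀ s ∈ Icc 0 (1 / M), y + s • ν ∈ closure Ω := fun s hs => by
    rcases hs.1.eq_or_lt with h0 | h0
    · rw [← h0]; simpa using hyc
    · exact subset_closure (hF.inward s ⟨h0, hs.2⟩)
  have hdf := hasDerivWithinAt_line₀ (h.smooth_f.differentiableOn (by norm_num)) hI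
    (left_mem_Icc.2 hs₀.le)
  have hdg := hasDerivWithinAt_line₀ (h.smooth_g.differentiableOn (by norm_num)) hI
    (left_mem_Icc.2 hs₀.le)
  simp only [zero_smul, add_zero] at hdf hdg
  have hgν := h.abs_fderiv_g_le hΩ hyc ν
  rw [hF.norm_eq, mul_one] at hgν
  have hfy := h.boundary y hy
  have hν1 : inner ℝ ν ν = (1 : ℝ) := by rw [real_inner_self_eq_norm_sq, hF.norm_eq]; norm_num
  rw [abs_le]
  constructor
  · -- comparison with the barrier
    have h1 := nonpos_right_deriv_of_le hs₀ ((hdg.sub hdf).sub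
      ((hasDerivWithinAt_id (0 : ℝ) (Icc 0 (1 / M))).const_mul (M * (K + C₁ + 1)))) (fun s hs => by
        have h2 := h.barrier_le hΩ hn hM hK hC₁ hF (hI s hs)
        rw [add_sub_cancel_left, inner_smul_left, hν1] at h2
        simp only [conj_trivial, mul_one] at h2
        have h3 : 0 ≤ M * (K + C₁ + 1) * (‖s • ν‖ ^ 2 / (2 * M)) := by positivity
        simp only [Pi.sub_apply, id, zero_smul, add_zero, mul_zero, hfy, sub_self]
        linarith)
    nlinarith [mul_nonneg hM0.le hK]
  · -- convexity along the normal
    set l := (f (y + (1 / M) • ν) - f y) * M with hl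
    have h1 := nonpos_right_deriv_of_le hs₀ (hdf.sub
      ((hasDerivWithinAt_id (0 : ℝ) (Icc 0 (1 / M))).const_mul l)) (fun s hs => by
        have hsM : s * M ≤ 1 := by rw [← le_div_iff₀ hM0]; exact hs.2
        have h2 := h.convex.2 hyc (hI _ (right_mem_Icc.2 hs₀.le))
          (show 0 ≤ 1 - s * M by linarith) (mul_nonneg hs.1 hM0.le) (by ring)
        have h3 : (1 - s * M) • y + (s * M) • (y + (1 / M) • ν) = y + s • ν := by
          rw [smul_add, smul_smul, show s * M * (1 / M) = s by field_simp]
          module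
        rw [h3] at h2
        simp only [Pi.sub_apply, id, zero_smul, add_zero, mul_zero, sub_zero, smul_eq_mul] at h2 ⊢
        rw [hl]
        linarith)
    have h2 := h.f_le hΩ hn hc₁ (hI _ (right_mem_Icc.2 hs₀.le))
    have h3 : -K ≤ f y := by rw [hfy]; exact (abs_le.1 (h.abs_g_le hyc)).1
    have h4 : l ≤ 2 * K * M := by rw [hl]; nlinarith
    have h5 := (abs_le.1 hgν).1
    nlinarith [mul_nonneg hM0.le hC₁]

theorem exists_bound (hΩ : IsUniformlyConvexDomain Ω) (h : EllipticSlice Ω K c₁ C₁ f g) {j : ℕ}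
    (hj : j ≤ 4) : ∃ K', 0 ≤ K' ∧ ∀ x ∈ closure Ω,
      ‖iteratedFDerivWithin ℝ j (fun y => f y - g y) (closure Ω) x‖ ≤ K' := by
  have h1 := (h.smooth_f.sub h.smooth_g).continuousOn_iteratedFDerivWithin (m := j)
    (by exact_mod_cast hj) hΩ.uniqueDiffOn_closure
  obtain ⟨C, hC⟩ := hΩ.isCompact_closure.exists_bound_of_continuousOn h1
  exact ⟨|C|, abs_nonneg C, fun x hx => (hC x hx).trans (le_abs_self C)⟩

theorem fderiv_sub (hΩ : IsUniformlyConvexDomain Ω) (h : EllipticSlice Ω K c₁ C₁ f g)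
    (hx : x ∈ closure Ω) (v : EuclideanSpace ℝ (Fin n)) :
    fderivWithin ℝ (fun y => f y - g y) (closure Ω) x v =
      fderivWithin ℝ f (closure Ω) x v - fderivWithin ℝ g (closure Ω) x v := by
  rw [fderivWithin_fun_sub (hΩ.uniqueDiffOn_closure x hx)
    (h.smooth_f.differentiableOn (by norm_num) x hx)
    (h.smooth_g.differentiableOn (by norm_num) x hx)]
  rfl

theorem tangential_deriv_eq (hΩ : IsUniformlyConvexDomain Ω) (hM : 1 ≤ M)
    (h : EllipticSlice Ω K c₁ C₁ f g) (hy : y ∈ frontier Ω) (hF : BoundaryFrame Ω M y ν Q)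
    {e : EuclideanSpace ℝ (Fin n)} (he : inner ℝ e ν = 0) :
    fderivWithin ℝ f (closure Ω) y e = fderivWithin ℝ g (closure Ω) y e := by
  have hM0 : 0 < M := by linarith
  have hyc := frontier_subset_closure hy
  -- it suffices to treat unit vectors
  suffices hu : ∀ e : EuclideanSpace ℝ (Fin n), ‖e‖ = 1 → inner ℝ e ν = 0 →
      fderivWithin ℝ (fun y => f y - g y) (closure Ω) y e = 0 by
    rcases eq_or_ne e 0 with rfl | hne
    · simp
    · have h1 := hu (‖e‖⁻¹ • e) (norm_smul_inv_norm hne) (by rw [inner_smul_left, he, mul_zero])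
      rw [map_smul, smul_eq_mul, mul_eq_zero, inv_eq_zero, norm_eq_zero, or_iff_right hne,
        h.fderiv_sub hΩ hyc] at h1
      linarith
  intro e he1 he
  obtain ⟨K', hK'0, hK'⟩ := h.exists_bound hΩ (j := 2) (by norm_num)
  have hp2 := (h.smooth_f.sub h.smooth_g).of_le (show (2 : WithTop ℕ∞) ≤ 4 by norm_num)
  set p : EuclideanSpace ℝ (Fin n) → ℝ := fun y => f y - g y with hp
  set D := fderivWithin ℝ p (closure Ω) y with hD
  have hp0 : ∀ x ∈ frontier Ω, p x = 0 := fun x hx => by rw [hp]; simp [h.boundary x hx]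
  have key : ∀ s ∈ Ioc 0 (1 / M), |D e| ≤ (M * |D ν| + K' * (1 + M) ^ 2) * s := by
    intro s hs
    have hs0 := hs.1
    have hs1 : s ≤ 1 := hs.2.trans (by rw [div_le_iff₀ hM0]; linarith)
    obtain ⟨z, -, hz, -, hfr, -, -, -⟩ := hF.points e he1 he s hs
    have ht := taylor_two hΩ.uniqueDiffOn_closure hΩ.convex.closure hp2 hK' hyc
      (frontier_subset_closure hfr)
    rw [hp0 _ hfr, hp0 y hy, ← hD] at ht
    have hn1 := norm_tangent_add_normal_le he1 hF.norm_eq hs0.le hs1 hz.1 hz.2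
    have hn2 : K' * ‖s • e + z • ν‖ ^ 2 ≤ K' * ((1 + M) * s) ^ 2 :=
      mul_le_mul_of_nonneg_left (pow_le_pow_left₀ (norm_nonneg _) hn1 2) hK'0
    have h1 : |D (s • e + z • ν)| ≤ K' * ((1 + M) * s) ^ 2 := by
      rw [sub_self, zero_sub, abs_neg] at ht; exact ht.trans hn2
    rw [map_add, map_smul, map_smul, smul_eq_mul, smul_eq_mul] at h1
    have h2 : |s * D e| ≤ |s * D e + z * D ν| + |z * D ν| := by
      have := abs_sub (s * D e + z * D ν) (z * D ν)
      rwa [add_sub_cancel_right] at this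
    rw [abs_mul, abs_mul z, abs_of_pos hs0, abs_of_nonneg hz.1] at h2
    have h3 : z * |D ν| ≤ M * s ^ 2 * |D ν| := mul_le_mul_of_nonneg_right hz.2 (abs_nonneg _)
    have h4 : s * |D e| ≤ s * ((M * |D ν| + K' * (1 + M) ^ 2) * s) := by
      calc s * |D e| ≤ K' * ((1 + M) * s) ^ 2 + M * s ^ 2 * |D ν| := by linarith
        _ = _ := by ring
    exact le_of_mul_le_mul_left h4 hs0
  exact abs_nonpos_iff.1 (nonpos_of_forall_le_mul (by positivity) key)

end EllipticSlice

/-! ### Tangential second derivatives at the boundary -/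

theorem second_order_expansion {n : ℕ} {Ω : Set (EuclideanSpace ℝ (Fin n))}
    (hΩ : IsUniformlyConvexDomain Ω) {p : EuclideanSpace ℝ (Fin n) → ℝ}
    (hp : ContDiffOn ℝ 4 p (closure Ω)) {K M : ℝ}
    (hK : ∀ j, 2 ≤ j → j ≤ 4 → ∀ x ∈ closure Ω, ‖iteratedFDerivWithin ℝ j p (closure Ω) x‖ ≤ K)
    {y ν e : EuclideanSpace ℝ (Fin n)} (hy : y ∈ closure Ω) (he : ‖e‖ = 1) (hν : ‖ν‖ = 1)
    {s z₁ z₂ : ℝ} (hs : 0 < s) (hs1 : s ≤ 1)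
    (hz₁ : z₁ ∈ Icc 0 (M * s ^ 2)) (hz₂ : z₂ ∈ Icc 0 (M * s ^ 2)) (hz : |z₁ - z₂| ≤ M * s ^ 3)
    (h₁ : y + (s • e + z₁ • ν) ∈ closure Ω) (h₂ : y + ((-s) • e + z₂ • ν) ∈ closure Ω) :
    |p (y + (s • e + z₁ • ν)) + p (y + ((-s) • e + z₂ • ν)) - 2 * p y -
      (z₁ + z₂) * fderivWithin ℝ p (closure Ω) y ν - s ^ 2 * hessForm (closure Ω) p y e e| ≤
      K * ((M + M ^ 2) + (1 + M) ^ 2 * M + 2 * (1 + M) ^ 4) * s ^ 4 := by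
  have hS := hΩ.uniqueDiffOn_closure
  have hK0 : 0 ≤ K := (norm_nonneg _).trans (hK 2 le_rfl (by norm_num) y hy)
  have t1 := taylor_four hS hΩ.convex.closure hp (hK 4 (by norm_num) le_rfl) hy h₁
  have t2 := taylor_four hS hΩ.convex.closure hp (hK 4 (by norm_num) le_rfl) hy h₂
  have n1 := norm_tangent_add_normal_le he hν hs.le hs1 hz₁.1 hz₁.2
  have n2 := norm_tangent_add_normal_le (e := -e) (by rwa [norm_neg]) hν hs.le hs1 hz₂.1 hz₂.2
  rw [smul_neg, ← neg_smul] at n2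
  have q1 := abs_quadratic_add_le
    (fun v w => hessForm_symm hS hΩ.closure_subset (hp.of_le (by norm_num)) hy v w)
    (fun v w => abs_hessForm_le (hK 2 le_rfl (by norm_num) y hy) v w) he hν hs.le hz₁ hz₂ hz
  have q2 := abs_cubic_increment_le (hK 3 (by norm_num) (by norm_num) y hy) he hν hs.le hs1 hz₁ hz₂
  have p1 : K * ‖s • e + z₁ • ν‖ ^ 4 ≤ K * ((1 + M) * s) ^ 4 :=
    mul_le_mul_of_nonneg_left (pow_le_pow_left₀ (norm_nonneg _) n1 4) hK0
  have p2 : K * ‖(-s) • e + z₂ • ν‖ ^ 4 ≤ K * ((1 + M) * s) ^ 4 :=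
    mul_le_mul_of_nonneg_left (pow_le_pow_left₀ (norm_nonneg _) n2 4) hK0
  have hlin : fderivWithin ℝ p (closure Ω) y (s • e + z₁ • ν) +
      fderivWithin ℝ p (closure Ω) y ((-s) • e + z₂ • ν) =
      (z₁ + z₂) * fderivWithin ℝ p (closure Ω) y ν := by
    simp only [map_add, map_smul, smul_eq_mul]; ring
  have e1 : K * ((1 + M) * s) ^ 4 = K * (1 + M) ^ 4 * s ^ 4 := by ring
  have e2 : K * ((M + M ^ 2) + (1 + M) ^ 2 * M + 2 * (1 + M) ^ 4) * s ^ 4 =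
      K * (2 * M + 2 * M ^ 2) * s ^ 4 / 2 + 6 * K * (1 + M) ^ 2 * M * s ^ 4 / 6 +
        2 * (K * (1 + M) ^ 4 * s ^ 4) := by ring
  rw [e1] at p1 p2
  rw [e2, ← hlin]
  have t1' := abs_le.1 (t1.trans p1)
  have t2' := abs_le.1 (t2.trans p2)
  have q1' := abs_le.1 q1
  have q2' := abs_le.1 q2
  rw [abs_le]
  constructor <;> linarith

theorem tangent_le_of_convexOn {E : Type*} [NormedAddCommGroup E] [NormedSpace ℝ E] {S : Set E}
    {f : E → ℝ} (hc : ConvexOn ℝ S f) (hf : DifferentiableOn ℝ f S) {x y : E} (hy : y ∈ S)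
    (hx : x ∈ S) : f y + fderivWithin ℝ f S y (x - y) ≤ f x := by
  have hI : ∀ s ∈ Icc (0 : ℝ) 1, y + s • (x - y) ∈ S := fun s hs => by
    have := hc.1.add_smul_mem hy (by simpa using hx : y + (x - y) ∈ S) hs
    exact this
  have hd := hasDerivWithinAt_line₀ hf hI (left_mem_Icc.2 zero_le_one)
  simp only [zero_smul, add_zero] at hd
  have h1 := nonpos_right_deriv_of_le one_pos (hd.sub
    ((hasDerivWithinAt_id (0 : ℝ) (Icc 0 1)).const_mul (f x - f y))) (fun s hs => by
      have h2 := hc.2 hy hx (show 0 ≤ 1 - s by linarith [hs.2]) hs.1 (by ring)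
      have h3 : (1 - s) • y + s • x = y + s • (x - y) := by module
      rw [h3] at h2
      simp only [Pi.sub_apply, id, zero_smul, add_zero, mul_zero, sub_zero, smul_eq_mul] at h2 ⊢
      linarith)
  linarith

namespace EllipticSlice

variable {n : ℕ} {Ω : Set (EuclideanSpace ℝ (Fin n))} {K c₁ C₁ M : ℝ}
  {f g : EuclideanSpace ℝ (Fin n) → ℝ} {x y ν : EuclideanSpace ℝ (Fin n)}
  {Q : LinearMap.BilinForm ℝ (EuclideanSpace ℝ (Fin n))}

/-- The tangential Hessian is determined by the boundary values and the normal derivative. -/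
theorem hess_tangential_eq (hΩ : IsUniformlyConvexDomain Ω) (hM : 1 ≤ M)
    (h : EllipticSlice Ω K c₁ C₁ f g) (hy : y ∈ frontier Ω) (hF : BoundaryFrame Ω M y ν Q)
    {e : EuclideanSpace ℝ (Fin n)} (he1 : ‖e‖ = 1) (he : inner ℝ e ν = 0) :
    hessForm (closure Ω) f y e e = hessForm (closure Ω) g y e e -
      (fderivWithin ℝ f (closure Ω) y ν - fderivWithin ℝ g (closure Ω) y ν) * Q e e := by
  have hM0 : 0 < M := by linarith
  have hyc := frontier_subset_closure hy
  have hf2 := h.smooth_f.of_le (show (2 : WithTop ℕ∞) ≤ 4 by norm_num)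
  have hg2 := h.smooth_g.of_le (show (2 : WithTop ℕ∞) ≤ 4 by norm_num)
  obtain ⟨K₂, hK₂, hK₂'⟩ := h.exists_bound hΩ (j := 2) (by norm_num)
  obtain ⟨K₃, hK₃, hK₃'⟩ := h.exists_bound hΩ (j := 3) (by norm_num)
  obtain ⟨K₄, hK₄, hK₄'⟩ := h.exists_bound hΩ (j := 4) (by norm_num)
  set K' := K₂ + K₃ + K₄ with hK'
  have hb : ∀ j, 2 ≤ j → j ≤ 4 → ∀ x ∈ closure Ω,
      ‖iteratedFDerivWithin ℝ j (fun y => f y - g y) (closure Ω) x‖ ≤ K' := by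
    intro j h2 h4 x hx
    interval_cases j
    · linarith [hK₂' x hx]
    · linarith [hK₃' x hx]
    · linarith [hK₄' x hx]
  have hp := h.smooth_f.sub h.smooth_g
  rw [← h.fderiv_sub hΩ hyc]
  have hH : hessForm (closure Ω) (fun y => f y - g y) y e e =
      hessForm (closure Ω) f y e e - hessForm (closure Ω) g y e e :=
    hessForm_sub hΩ.uniqueDiffOn_closure hf2 hg2 hyc e e
  have hp0 : ∀ x ∈ frontier Ω, f x - g x = 0 := fun x hx => by simp [h.boundary x hx]
  set D := fderivWithin ℝ (fun y => f y - g y) (closure Ω) y ν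
  set C := K' * ((M + M ^ 2) + (1 + M) ^ 2 * M + 2 * (1 + M) ^ 4)
  have key : ∀ s ∈ Ioc 0 (1 / M),
      |hessForm (closure Ω) (fun y => f y - g y) y e e + D * Q e e| ≤ (C + M * |D|) * s := by
    intro s hs
    have hs0 := hs.1
    have hs1 : s ≤ 1 := hs.2.trans (by rw [div_le_iff₀ hM0]; linarith)
    obtain ⟨z₁, z₂, hz₁, hz₂, hfr₁, hfr₂, hz, hzQ⟩ := hF.points e he1 he s hs
    have h1 := second_order_expansion hΩ hp hb hyc he1 hF.norm_eq hs0 hs1 hz₁ hz₂ hz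
      (frontier_subset_closure hfr₁) (frontier_subset_closure hfr₂)
    simp only [hp0 _ hfr₁, hp0 _ hfr₂, hp0 y hy] at h1
    change |0 + 0 - 2 * 0 - (z₁ + z₂) * D -
      s ^ 2 * hessForm (closure Ω) (fun y => f y - g y) y e e| ≤ C * s ^ 4 at h1
    have h2 : |(z₁ + z₂ - s ^ 2 * Q e e) * D| ≤ M * s ^ 4 * |D| := by
      rw [abs_mul]; exact mul_le_mul_of_nonneg_right hzQ (abs_nonneg _)
    have h3 : s ^ 2 * |hessForm (closure Ω) (fun y => f y - g y) y e e + D * Q e e| ≤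
        (C + M * |D|) * s ^ 4 := by
      have hab : s ^ 2 * |hessForm (closure Ω) (fun y => f y - g y) y e e + D * Q e e| =
          |s ^ 2 * (hessForm (closure Ω) (fun y => f y - g y) y e e + D * Q e e)| := by
        rw [abs_mul, abs_of_nonneg (sq_nonneg s)]
      rw [hab]
      have h1' := abs_le.1 h1
      have h2' := abs_le.1 h2
      rw [abs_le]
      constructor <;> linarith
    have hs2 : 0 < s ^ 2 := by positivity
    have h4 : s ^ 2 * |hessForm (closure Ω) (fun y => f y - g y) y e e + D * Q e e| ≤
        s ^ 2 * ((C + M * |D|) * s) := by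
      refine h3.trans ?_
      have h5 : s ^ 4 ≤ s ^ 3 := pow_le_pow_of_le_one hs0.le hs1 (by norm_num)
      calc (C + M * |D|) * s ^ 4 ≤ (C + M * |D|) * s ^ 3 :=
            mul_le_mul_of_nonneg_left h5 (by positivity)
        _ = _ := by ring
    exact le_of_mul_le_mul_left h4 hs2
  have h0 := abs_nonpos_iff.1 (nonpos_of_forall_le_mul (by positivity) key)
  linarith

theorem abs_hess_tangential_le (hΩ : IsUniformlyConvexDomain Ω) (hn : 1 ≤ n) (hM : 1 ≤ M)
    (hK : 0 ≤ K) (hc₁ : 0 < c₁) (hC₁ : 0 ≤ C₁) (h : EllipticSlice Ω K c₁ C₁ f g)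
    (hy : y ∈ frontier Ω) (hF : BoundaryFrame Ω M y ν Q)
    {e : EuclideanSpace ℝ (Fin n)} (he1 : ‖e‖ = 1) (he : inner ℝ e ν = 0) :
    hessForm (closure Ω) f y e e ≤ K + M * (3 * K + C₁ + 1) * M := by
  rw [h.hess_tangential_eq hΩ hM hy hF he1 he]
  have h1 := (abs_le.1 (h.abs_hess_g_le (frontier_subset_closure hy) e e)).2
  have h2 := h.abs_normal_deriv_le hΩ hn hM hK hc₁ hC₁ hy hF
  have h3 := hF.abs_le e e
  rw [he1] at h1 h3
  simp only [mul_one] at h1 h3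
  have h4 : |(fderivWithin ℝ f (closure Ω) y ν - fderivWithin ℝ g (closure Ω) y ν) * Q e e| ≤
      M * (3 * K + C₁ + 1) * M := by
    rw [abs_mul]
    exact mul_le_mul h2 h3 (abs_nonneg _) (by positivity)
  linarith [(abs_le.1 h4).1]

/-- Near a boundary point the excess of `f` over its tangent plane, at boundary points in direction
`e`, is at most `s² D²f(e, e) + O(s⁴)`. -/
theorem exists_points_excess_le (hΩ : IsUniformlyConvexDomain Ω) (hn : 1 ≤ n) (hM : 1 ≤ M)
    (hK : 0 ≤ K) (hc₁ : 0 < c₁) (hC₁ : 0 ≤ C₁) (h : EllipticSlice Ω K c₁ C₁ f g)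
    (hy : y ∈ frontier Ω) (hF : BoundaryFrame Ω M y ν Q)
    {e : EuclideanSpace ℝ (Fin n)} (he1 : ‖e‖ = 1) (he : inner ℝ e ν = 0) {s : ℝ}
    (hs : s ∈ Ioc 0 (1 / M)) :
    ∃ z₁ z₂ : ℝ, (s ^ 2 / M ≤ z₁ ∧ z₁ ≤ M * s ^ 2) ∧ (s ^ 2 / M ≤ z₂ ∧ z₂ ≤ M * s ^ 2) ∧
      y + (s • e + z₁ • ν) ∈ closure Ω ∧ y + ((-s) • e + z₂ • ν) ∈ closure Ω ∧
      f (y + (s • e + z₁ • ν)) - f y - fderivWithin ℝ f (closure Ω) y (s • e + z₁ • ν) ≤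
        s ^ 2 * hessForm (closure Ω) f y e e +
        (K * ((M + M ^ 2) + (1 + M) ^ 2 * M + 2 * (1 + M) ^ 4) +
          M * (M * (3 * K + C₁ + 1))) * s ^ 4 ∧
      f (y + ((-s) • e + z₂ • ν)) - f y - fderivWithin ℝ f (closure Ω) y ((-s) • e + z₂ • ν) ≤
        s ^ 2 * hessForm (closure Ω) f y e e +
        (K * ((M + M ^ 2) + (1 + M) ^ 2 * M + 2 * (1 + M) ^ 4) +
          M * (M * (3 * K + C₁ + 1))) * s ^ 4 := by
  have hM0 : 0 < M := by linarith
  have hyc := frontier_subset_closure hy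
  have hs0 := hs.1
  have hs1 : s ≤ 1 := hs.2.trans (by rw [div_le_iff₀ hM0]; linarith)
  obtain ⟨z₁, z₂, hz₁, hz₂, hfr₁, hfr₂, hz, hzQ⟩ := hF.points e he1 he s hs
  have hc₁' := frontier_subset_closure hfr₁
  have hc₂' := frontier_subset_closure hfr₂
  have hheight : ∀ σ z : ℝ, σ ^ 2 = s ^ 2 → y + (σ • e + z • ν) ∈ closure Ω → s ^ 2 / M ≤ z := by
    intro σ z hσ hmem
    have h1 := hF.support _ hmem
    rw [add_sub_cancel_left, inner_add_smul_normal hF.norm_eq he, norm_add_sq_real,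
      inner_smul_left, inner_smul_right, he, norm_smul, he1, mul_one, Real.norm_eq_abs, sq_abs,
      hσ] at h1
    rw [div_le_iff₀ hM0]
    simp only [mul_zero, add_zero] at h1
    nlinarith [sq_nonneg ‖z • ν‖]
  have h1 := second_order_expansion hΩ h.smooth_g (fun j _ hj => h.bound_g j hj) hyc he1
    hF.norm_eq hs0 hs1 hz₁ hz₂ hz hc₁' hc₂'
  have h2 : |(z₁ + z₂ - s ^ 2 * Q e e) *
      (fderivWithin ℝ f (closure Ω) y ν - fderivWithin ℝ g (closure Ω) y ν)| ≤
      M * s ^ 4 * (M * (3 * K + C₁ + 1)) := by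
    rw [abs_mul]
    exact mul_le_mul hzQ (h.abs_normal_deriv_le hΩ hn hM hK hc₁ hC₁ hy hF) (abs_nonneg _)
      (by positivity)
  have h3 := h.hess_tangential_eq hΩ hM hy hF he1 he
  have hlin : fderivWithin ℝ f (closure Ω) y (s • e + z₁ • ν) +
      fderivWithin ℝ f (closure Ω) y ((-s) • e + z₂ • ν) =
      (z₁ + z₂) * fderivWithin ℝ f (closure Ω) y ν := by
    simp only [map_add, map_smul, smul_eq_mul]; ring
  have t1 := tangent_le_of_convexOn h.convex (h.smooth_f.differentiableOn (by norm_num)) hyc hc₁'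
  have t2 := tangent_le_of_convexOn h.convex (h.smooth_f.differentiableOn (by norm_num)) hyc hc₂'
  rw [add_sub_cancel_left] at t1 t2
  have b1 := h.boundary _ hfr₁
  have b2 := h.boundary _ hfr₂
  have b0 := h.boundary y hy
  have h1' := (abs_le.1 h1).2
  have h2' := (abs_le.1 h2).1
  refine ⟨z₁, z₂, ⟨hheight s z₁ rfl hc₁', hz₁.2⟩, ⟨hheight (-s) z₂ (by ring) hc₂', hz₂.2⟩, hc₁',
    hc₂', ?_, ?_⟩
  · rw [h3]; linarith
  · rw [h3]; linarith

end EllipticSlice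

/-! ### Lower bound for the tangential second derivatives -/

/-- A convex set containing the points `o ± ρ i • b i` contains the ellipsoid with centre `o` and
semi-axes `ρ i / √n` along the `b i`. -/
theorem Convex.ellipsoid_subset {n : ℕ} {L : Set (EuclideanSpace ℝ (Fin n))} (hL : Convex ℝ L)
    (b : OrthonormalBasis (Fin n) ℝ (EuclideanSpace ℝ (Fin n))) {o : EuclideanSpace ℝ (Fin n)}
    (ho : o ∈ L) {ρ : Fin n → ℝ} (hρ : ∀ i, 0 < ρ i) (hp : ∀ i, o + ρ i • b i ∈ L)
    (hm : ∀ i, o - ρ i • b i ∈ L) {x : EuclideanSpace ℝ (Fin n)}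
    (hx : ∑ i, n / ρ i ^ 2 * inner ℝ (b i) (x - o) ^ 2 ≤ 1) : x ∈ L := by
  set t : Fin n → ℝ := fun i => inner ℝ (b i) (x - o) with ht
  have hz : ∀ i, ∃ z ∈ L, (|t i| / ρ i) • (z - o) = t i • b i := by
    intro i
    rcases le_or_gt 0 (t i) with h | h
    · refine ⟨_, hp i, ?_⟩
      rw [add_sub_cancel_left, smul_smul, abs_of_nonneg h, div_mul_cancel₀ _ (hρ i).ne']
    · refine ⟨_, hm i, ?_⟩
      rw [sub_sub_cancel_left, smul_neg, smul_smul, abs_of_neg h, div_mul_cancel₀ _ (hρ i).ne',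
        neg_smul, neg_neg]
  choose z hzL hz using hz
  have hW : ∑ i, |t i| / ρ i ≤ 1 := by
    have h1 := sq_sum_le_card_mul_sum_sq (s := Finset.univ) (f := fun i => |t i| / ρ i)
    rw [Finset.card_univ, Fintype.card_fin] at h1
    have h2 : (n : ℝ) * ∑ i, (|t i| / ρ i) ^ 2 = ∑ i, n / ρ i ^ 2 * t i ^ 2 := by
      rw [Finset.mul_sum]
      refine Finset.sum_congr rfl fun i _ => ?_
      rw [div_pow, sq_abs]; ring
    rw [h2] at h1
    exact (abs_le_one_iff_mul_self_le_one.2 (by rw [← sq]; exact h1.trans hx)).trans' (le_abs_self _)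
  have hmem := hL.sum_mem (t := (Finset.univ : Finset (Option (Fin n))))
    (w := fun i => i.elim (1 - ∑ i, |t i| / ρ i) fun i => |t i| / ρ i)
    (z := fun i => i.elim o z) (by
      rintro (_ | i) -
      · simpa using hW
      · exact div_nonneg (abs_nonneg _) (hρ i).le)
    (by simp [Fintype.sum_option]) (by
      rintro (_ | i) -
      · exact ho
      · exact hzL i)
  convert hmem
  simp only [Fintype.sum_option, Option.elim_none, Option.elim_some]
  have h1 : ∑ i, (|t i| / ρ i) • z i = ∑ i, t i • b i + (∑ i, |t i| / ρ i) • o := by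
    rw [Finset.sum_smul, ← Finset.sum_add_distrib]
    refine Finset.sum_congr rfl fun i _ => ?_
    rw [← hz i, smul_sub]; abel
  rw [h1, ht, b.sum_repr']
  module

/-- If the convex function `f` lies above an affine function and exceeds it by at most `a` at the
points `o ± ρ i • b i`, then `det D²f` is not too large at some point: a paraboloid touches `f`
inside the ellipsoid of `Convex.ellipsoid_subset`. -/
theorem exists_formDet_le_prod {n : ℕ} {S : Set (EuclideanSpace ℝ (Fin n))}
    (hS : UniqueDiffOn ℝ S) (hcl : S ⊆ closure (interior S)) (hc : IsCompact S)
    {f : EuclideanSpace ℝ (Fin n) → ℝ} (hf : ContDiffOn ℝ 2 f S) (hconv : ConvexOn ℝ S f)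
    {l : EuclideanSpace ℝ (Fin n) →L[ℝ] ℝ} {c a : ℝ} (ha : 0 < a) (hl : ∀ x ∈ S, l x + c ≤ f x)
    (b : OrthonormalBasis (Fin n) ℝ (EuclideanSpace ℝ (Fin n))) {o : EuclideanSpace ℝ (Fin n)}
    {ρ : Fin n → ℝ} (hρ : ∀ i, 0 < ρ i)
    (ho : o ∈ {x ∈ S | f x - l x ≤ c + a})
    (hp : ∀ i, o + ρ i • b i ∈ {x ∈ S | f x - l x ≤ c + a})
    (hm : ∀ i, o - ρ i • b i ∈ {x ∈ S | f x - l x ≤ c + a}) :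
    ∃ x ∈ S, formDet (hessForm S f x) ≤ ∏ i, 4 * a * (n / ρ i ^ 2) := by
  set R : Fin n → ℝ := fun i => n / ρ i ^ 2 with hR
  have hR0 : ∀ i, 0 ≤ R i := fun i => by positivity
  set p : EuclideanSpace ℝ (Fin n) → ℝ := fun x => ∑ i, R i * inner ℝ (b i) (x - o) ^ 2 with hpdef
  have hpc : Continuous p := by rw [hpdef]; fun_prop
  have hL : Convex ℝ {x ∈ S | f x - l x ≤ c + a} := by
    have h1 : ConvexOn ℝ S (fun x => f x - l x) := by
      have := hconv.add ((-l).toLinearMap.convexOn hconv.1)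
      refine this.congr fun x _ => ?_
      simp [sub_eq_add_neg]
    exact h1.convex_le (c + a)
  have hsub : ∀ x, p x ≤ 1 → x ∈ S ∧ f x - l x ≤ c + a := fun x hx =>
    hL.ellipsoid_subset b ho hρ hp hm hx
  have hpo : p o = 0 := by simp [hpdef]
  set q : EuclideanSpace ℝ (Fin n) → ℝ := fun x => l x + 2 * a * p x with hq
  have hKc : IsCompact (S ∩ {x | p x ≤ 1}) :=
    hc.inter_right (isClosed_le hpc continuous_const)
  obtain ⟨z, hz, hmax⟩ := hKc.exists_isMaxOn ⟨o, ho.1, by simp [hpo]⟩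
    (f := fun x => f x - q x) ((hf.continuousOn.mono inter_subset_left).sub (by fun_prop))
  have hzp : p z < 1 := by
    by_contra hcon
    have h1 : p z = 1 := le_antisymm hz.2 (not_lt.1 hcon)
    have h2 := hmax (show o ∈ S ∩ {x | p x ≤ 1} from ⟨ho.1, by simp [hpo]⟩)
    have h3 := (hsub z hz.2).2
    have h4 := hl o ho.1
    simp only [mem_ofPred_eq, hq, hpo, h1] at h2
    linarith
  have hopen : IsOpen {x | p x < 1} := isOpen_lt hpc continuous_const
  have hint : z ∈ interior S :=
    mem_interior.2 ⟨_, fun x hx => (hsub x (le_of_lt hx)).1, hopen, hzp⟩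
  have hhess : ∀ v, hessForm S f z v v ≤ 2 * (2 * a * ∑ i, R i * inner ℝ (b i) v ^ 2) := by
    intro v
    refine hessForm_le_of_isLocalMax (q := q)
      (l := l v + 2 * a * ∑ i, R i * (2 * inner ℝ (b i) (z - o) * inner ℝ (b i) v)) hS hf hint
      (fun s => ?_) ?_
    · have h1 : p (z + s • v) = p z + s * ∑ i, R i * (2 * inner ℝ (b i) (z - o) * inner ℝ (b i) v)
          + s ^ 2 * ∑ i, R i * inner ℝ (b i) v ^ 2 := by
        simp only [hpdef, Finset.mul_sum, ← Finset.sum_add_distrib]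
        refine Finset.sum_congr rfl fun i _ => ?_
        rw [show z + s • v - o = (z - o) + s • v by abel, inner_add_right, inner_smul_right]
        ring
      simp only [hq, h1, map_add, map_smul, smul_eq_mul]
      ring
    · filter_upwards [hopen.mem_nhds hzp] with x hx
      exact hmax ⟨(hsub x (le_of_lt hx)).1, le_of_lt hx⟩
  -- the Hessian of the paraboloid
  set A : LinearMap.BilinForm ℝ (EuclideanSpace ℝ (Fin n)) :=
    ∑ i, (4 * a * R i) • (LinearMap.mul ℝ ℝ).compl₁₂ (innerSL ℝ (b i)).toLinearMap
      (innerSL ℝ (b i)).toLinearMap with hA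
  have hAapp : ∀ v w, A v w = ∑ i, 4 * a * R i * (inner ℝ (b i) v * inner ℝ (b i) w) := by
    intro v w
    simp [hA, LinearMap.sum_apply]
  have hd : Diagonalizes A b fun i => 4 * a * R i := by
    refine ⟨fun k w => ?_, fun v w => ?_⟩
    · rw [hAapp, Finset.sum_eq_single k (fun i _ hi => by rw [b.inner_eq_ite, if_neg hi]; ring)
        (by simp), b.inner_eq_one, one_mul]
    · rw [hAapp, hAapp]
      exact Finset.sum_congr rfl fun i _ => by ring
  refine ⟨z, hz.1, ?_⟩
  rw [← hd.formDet_eq_prod]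
  refine formDet_mono (fun v w => hessForm_symm hS hcl hf hz.1 v w) hd.symm
    (hessForm_nonneg_of_convexOn_interior hS hcl hf (hconv.subset interior_subset
      hconv.1.interior) hz.1) fun v => (hhess v).trans_eq ?_
  rw [hAapp, Finset.mul_sum, Finset.mul_sum]
  exact Finset.sum_congr rfl fun i _ => by ring

theorem Convex.add_quarter_smul_mem {E : Type*} [AddCommGroup E] [Module ℝ E] {L : Set E}
    (hL : Convex ℝ L) {y ν v : E} {z w : ℝ} (hw : 0 < w) (hz : 0 ≤ z) (hzw : z ≤ 2 * w)
    (hy : y ∈ L) (hyw : y + w • ν ∈ L) (hv : y + (v + z • ν) ∈ L) :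
    y + (w / 2) • ν + (1 / 4 : ℝ) • v ∈ L := by
  have hr : z / w ≤ 2 := by rwa [div_le_iff₀ hw]
  have hr0 : 0 ≤ z / w := by positivity
  have h1 := hL hyw hy (show (0 : ℝ) ≤ (2 / 3 - z / w / 3) by linarith)
    (show (0 : ℝ) ≤ (1 / 3 + z / w / 3) by linarith) (by ring)
  have h2 := hL h1 hv (show (0 : ℝ) ≤ 3 / 4 by norm_num) (show (0 : ℝ) ≤ 1 / 4 by norm_num)
    (by norm_num)
  convert h2 using 1
  have hzw' : z = z / w * w := by field_simp
  generalize z / w = r at *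
  subst hzw'
  module

theorem exists_orthonormalBasis_of_pair {n : ℕ} {e ν : EuclideanSpace ℝ (Fin n)} (he : ‖e‖ = 1)
    (hν : ‖ν‖ = 1) (h : inner ℝ e ν = 0) :
    ∃ b : OrthonormalBasis (Fin n) ℝ (EuclideanSpace ℝ (Fin n)), ∃ i₀ i₁, b i₀ = e ∧ b i₁ = ν := by
  have hon : Orthonormal ℝ ![e, ν] := by
    rw [orthonormal_iff_ite]
    intro i j
    fin_cases i <;> fin_cases j <;> simp [h, he, hν, real_inner_comm e ν]
  obtain ⟨u, b', hu, hb'⟩ := hon.toSubtypeRange.exists_orthonormalBasis_extension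
  have hcard : Fintype.card u = Fintype.card (Fin n) := by
    rw [← Module.finrank_eq_card_basis b'.toBasis, finrank_euclideanSpace]
  let σ := Fintype.equivOfCardEq hcard
  refine ⟨b'.reindex σ, σ ⟨e, hu ⟨0, rfl⟩⟩, σ ⟨ν, hu ⟨1, rfl⟩⟩, ?_, ?_⟩ <;> simp [hb']

/-- Points of a convex set over `y ± r i • b i` at comparable heights span a box centred on the
normal line through `y`. -/
theorem Convex.exists_box {n : ℕ} {L : Set (EuclideanSpace ℝ (Fin n))} (hL : Convex ℝ L)
    {y : EuclideanSpace ℝ (Fin n)} (hy : y ∈ L)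
    (b : OrthonormalBasis (Fin n) ℝ (EuclideanSpace ℝ (Fin n))) {i₀ i₁ : Fin n}
    {r : Fin n → ℝ} {w₀ : ℝ} (hw₀ : 0 < w₀)
    (h₀ : ∃ z₁ z₂ : ℝ, w₀ ≤ z₁ ∧ w₀ ≤ z₂ ∧ y + (r i₀ • b i₀ + z₁ • b i₁) ∈ L ∧
      y + ((-r i₀) • b i₀ + z₂ • b i₁) ∈ L)
    (h : ∀ i, i ≠ i₀ → i ≠ i₁ → ∃ z₁ z₂ : ℝ, z₁ ∈ Icc 0 (2 * w₀) ∧ z₂ ∈ Icc 0 (2 * w₀) ∧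
      y + (r i • b i + z₁ • b i₁) ∈ L ∧ y + ((-r i) • b i + z₂ • b i₁) ∈ L) :
    ∃ o ∈ L, ∃ w, w₀ ≤ w ∧ ∀ i, o + (if i = i₁ then w / 2 else r i / 4) • b i ∈ L ∧
      o - (if i = i₁ then w / 2 else r i / 4) • b i ∈ L := by
  obtain ⟨z₁, z₂, hz₁, hz₂, hL₁, hL₂⟩ := h₀
  have hwge : w₀ ≤ (z₁ + z₂) / 2 := by linarith
  have hw0 : 0 < (z₁ + z₂) / 2 := by linarith
  have hwL : y + ((z₁ + z₂) / 2) • b i₁ ∈ L := by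
    have := hL hL₁ hL₂ (show (0 : ℝ) ≤ 1 / 2 by norm_num) (show (0 : ℝ) ≤ 1 / 2 by norm_num)
      (by norm_num)
    convert this using 1
    module
  obtain ⟨w, hw⟩ : ∃ w, (z₁ + z₂) / 2 = w := ⟨_, rfl⟩
  rw [hw] at hwge hw0 hwL
  have hoL : y + (w / 2) • b i₁ ∈ L := by
    have := hL.add_quarter_smul_mem (v := 0) hw0 le_rfl (by linarith) hy hwL (by simpa using hy)
    simpa using this
  refine ⟨_, hoL, w, hwge, fun i => ?_⟩
  have key : ∃ s₁ s₂ : ℝ, i ≠ i₁ → (0 ≤ s₁ ∧ s₁ ≤ 2 * w) ∧ (0 ≤ s₂ ∧ s₂ ≤ 2 * w) ∧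
      y + (r i • b i + s₁ • b i₁) ∈ L ∧ y + ((-r i) • b i + s₂ • b i₁) ∈ L := by
    by_cases h0 : i = i₀
    · rw [h0]
      exact ⟨z₁, z₂, fun _ => ⟨⟨by linarith, by linarith⟩, ⟨by linarith, by linarith⟩, hL₁, hL₂⟩⟩
    · by_cases h1 : i = i₁
      · exact ⟨0, 0, fun h2 => absurd h1 h2⟩
      · obtain ⟨s₁, s₂, h2, h3, h4⟩ := h i h0 h1
        exact ⟨s₁, s₂, fun _ => ⟨⟨h2.1, by linarith [h2.2]⟩, ⟨h3.1, by linarith [h3.2]⟩, h4⟩⟩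
  obtain ⟨s₁, s₂, hs⟩ := key
  split_ifs with h1
  · rw [h1]
    constructor
    · convert hwL using 1; module
    · convert hy using 1; module
  · obtain ⟨hs₁, hs₂, hm₁, hm₂⟩ := hs h1
    have a1 := hL.add_quarter_smul_mem hw0 hs₁.1 hs₁.2 hy hwL hm₁
    have a2 := hL.add_quarter_smul_mem hw0 hs₂.1 hs₂.2 hy hwL hm₂
    constructor
    · convert a1 using 1; module
    · convert a2 using 1; module

theorem prod_box_le {n : ℕ} {i₀ i₁ : Fin n} (hne : i₀ ≠ i₁) {M δ k w : ℝ} (hM : 1 ≤ M)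
    (hδ0 : 0 < δ) (hδ1 : δ ≤ 1) (hk0 : 0 < k) (hw : (δ * k) ^ 2 / M ≤ w) :
    ∏ i, 4 * k ^ 4 * (n / (if i = i₁ then w / 2 else
      (if i = i₀ then δ * k else δ * k ^ 2) / 4) ^ 2) ≤ (64 * n * M ^ 2 / δ ^ 4) ^ n * k ^ 2 := by
  have hM0 : 0 < M := by linarith
  have hn0 : (0 : ℝ) ≤ n := Nat.cast_nonneg n
  have hδ42 : δ ^ 4 ≤ δ ^ 2 := pow_le_pow_of_le_one hδ0.le hδ1 (by norm_num)
  have hM2 : 1 ≤ M ^ 2 := one_le_pow₀ hM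
  have hbase : 64 * n / δ ^ 2 ≤ 64 * n * M ^ 2 / δ ^ 4 := by
    refine (div_le_div_of_nonneg_left (by positivity) (by positivity) hδ42).trans ?_
    exact div_le_div_of_nonneg_right (le_mul_of_one_le_right (by positivity) hM2) (by positivity)
  have hfac : ∀ i, 4 * k ^ 4 * (n / (if i = i₁ then w / 2 else
      (if i = i₀ then δ * k else δ * k ^ 2) / 4) ^ 2) ≤
      64 * n * M ^ 2 / δ ^ 4 * (if i = i₀ then k ^ 2 else 1) := by
    intro i
    by_cases h1 : i = i₁
    · rw [if_pos h1, if_neg (fun h0 => hne (h0.symm.trans h1))]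
      calc 4 * k ^ 4 * (n / (w / 2) ^ 2) ≤ 4 * k ^ 4 * (n / ((δ * k) ^ 2 / M / 2) ^ 2) := by
            gcongr
        _ = 16 * n * M ^ 2 / δ ^ 4 := by field_simp; ring
        _ ≤ _ := by rw [mul_one]; gcongr; norm_num
    · rw [if_neg h1]
      split_ifs with h0
      · calc 4 * k ^ 4 * (n / (δ * k / 4) ^ 2) = 64 * n / δ ^ 2 * k ^ 2 := by field_simp; ring
          _ ≤ _ := mul_le_mul_of_nonneg_right hbase (by positivity)
      · calc 4 * k ^ 4 * (n / (δ * k ^ 2 / 4) ^ 2) = 64 * n / δ ^ 2 * 1 := by field_simp; ring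
          _ ≤ _ := mul_le_mul_of_nonneg_right hbase (by positivity)
  refine (Finset.prod_le_prod (fun i _ => by positivity) fun i _ => hfac i).trans_eq ?_
  rw [Finset.prod_mul_distrib, Finset.prod_const, Finset.card_univ, Fintype.card_fin,
    Finset.prod_ite_eq' Finset.univ i₀, if_pos (Finset.mem_univ _)]

namespace EllipticSlice

variable {n : ℕ} {Ω : Set (EuclideanSpace ℝ (Fin n))} {K c₁ C₁ M : ℝ}
  {f g : EuclideanSpace ℝ (Fin n) → ℝ} {y ν : EuclideanSpace ℝ (Fin n)}
  {Q : LinearMap.BilinForm ℝ (EuclideanSpace ℝ (Fin n))}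

/-- The set where the convex function `f` exceeds its tangent plane at `y` by at most `a`. -/
def tangentSection (S : Set (EuclideanSpace ℝ (Fin n))) (f : EuclideanSpace ℝ (Fin n) → ℝ)
    (y : EuclideanSpace ℝ (Fin n)) (a : ℝ) : Set (EuclideanSpace ℝ (Fin n)) :=
  {x ∈ S | f x - fderivWithin ℝ f S y x ≤ (f y - fderivWithin ℝ f S y y) + a}

theorem convex_tangentSection (h : EllipticSlice Ω K c₁ C₁ f g) (a : ℝ) :
    Convex ℝ (tangentSection (closure Ω) f y a) := by
  have h1 : ConvexOn ℝ (closure Ω) (fun x => f x - fderivWithin ℝ f (closure Ω) y x) := by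
    refine (h.convex.add ((-(fderivWithin ℝ f (closure Ω) y)).toLinearMap.convexOn
      h.convex.1)).congr fun x _ => ?_
    simp [sub_eq_add_neg]
  exact h1.convex_le _

theorem exists_points_tangentSection (hΩ : IsUniformlyConvexDomain Ω) (hn : 1 ≤ n) (hM : 1 ≤ M)
    (hK : 0 ≤ K) (hc₁ : 0 < c₁) (hC₁ : 0 ≤ C₁) (h : EllipticSlice Ω K c₁ C₁ f g)
    (hy : y ∈ frontier Ω) (hF : BoundaryFrame Ω M y ν Q)
    {e : EuclideanSpace ℝ (Fin n)} (he1 : ‖e‖ = 1) (he : inner ℝ e ν = 0) {s a : ℝ}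
    (hs : s ∈ Ioc 0 (1 / M)) (ha : s ^ 2 * hessForm (closure Ω) f y e e +
        (K * ((M + M ^ 2) + (1 + M) ^ 2 * M + 2 * (1 + M) ^ 4) +
          M * (M * (3 * K + C₁ + 1))) * s ^ 4 ≤ a) :
    ∃ z₁ z₂ : ℝ, (s ^ 2 / M ≤ z₁ ∧ z₁ ≤ M * s ^ 2) ∧ (s ^ 2 / M ≤ z₂ ∧ z₂ ≤ M * s ^ 2) ∧
      y + (s • e + z₁ • ν) ∈ tangentSection (closure Ω) f y a ∧
      y + ((-s) • e + z₂ • ν) ∈ tangentSection (closure Ω) f y a := by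
  obtain ⟨z₁, z₂, hz₁, hz₂, hm₁, hm₂, he₁, he₂⟩ :=
    h.exists_points_excess_le hΩ hn hM hK hc₁ hC₁ hy hF he1 he hs
  have key : ∀ v, y + v ∈ closure Ω → f (y + v) - f y - fderivWithin ℝ f (closure Ω) y v ≤ a →
      y + v ∈ tangentSection (closure Ω) f y a :=
    fun v hv hle => ⟨hv, by rw [map_add]; linarith⟩
  exact ⟨z₁, z₂, hz₁, hz₂, key _ hm₁ (he₁.trans ha), key _ hm₂ (he₂.trans ha)⟩

/-- If `D²f(e, e)` is tiny at a boundary point, then a section of `f` contains a box which is much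
longer in the direction `e` than the lower bound for the determinant allows. -/
theorem le_of_hess_tangential_le (hΩ : IsUniformlyConvexDomain Ω) (hn : 1 ≤ n) (hM : 1 ≤ M)
    (hK : 0 ≤ K) (hc₁ : 0 < c₁) (hC₁ : 0 ≤ C₁) (h : EllipticSlice Ω K c₁ C₁ f g)
    (hy : y ∈ frontier Ω) (hF : BoundaryFrame Ω M y ν Q)
    {e : EuclideanSpace ℝ (Fin n)} (he1 : ‖e‖ = 1) (he : inner ℝ e ν = 0) {Ct C₂ δ k : ℝ}
    (hCt : K + M * (3 * K + C₁ + 1) * M = Ct)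
    (hC₂ : K * ((M + M ^ 2) + (1 + M) ^ 2 * M + 2 * (1 + M) ^ 4) +
      M * (M * (3 * K + C₁ + 1)) = C₂) (hδ0 : 0 < δ) (hδM : δ ≤ 1 / M)
    (hδC : δ ^ 2 * (Ct + C₂) ≤ 1 / 2) (hk0 : 0 < k) (hkM : k ≤ 1 / M)
    (hsmall : hessForm (closure Ω) f y e e ≤ k ^ 2 / 2) :
    c₁ ≤ (64 * n * M ^ 2 / δ ^ 4) ^ n * k ^ 2 := by
  have hM0 : 0 < M := by linarith
  have hM1 : 1 / M ≤ 1 := by rw [div_le_iff₀ hM0]; linarith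
  have hδ1 : δ ≤ 1 := hδM.trans hM1
  have hk1 : k ≤ 1 := hkM.trans hM1
  have hCt0 : 0 ≤ Ct := by rw [← hCt]; positivity
  have hC₂0 : 0 ≤ C₂ := by rw [← hC₂]; positivity
  have hk4 : 0 < k ^ 4 := pow_pos hk0 4
  have hyc := frontier_subset_closure hy
  have hyL : y ∈ tangentSection (closure Ω) f y (k ^ 4) := ⟨hyc, by linarith⟩
  have hδk : δ * k ≤ 1 / M := by
    calc δ * k ≤ 1 * (1 / M) := mul_le_mul hδ1 hkM hk0.le (by norm_num)
      _ = _ := one_mul _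
  have hs1 : δ * k ^ 2 ≤ 1 / M := by
    calc δ * k ^ 2 = δ * k * k := by ring
      _ ≤ 1 / M * 1 := mul_le_mul hδk hk1 hk0.le (by positivity)
      _ = _ := mul_one _
  obtain ⟨b, i₀, i₁, hi₀, hi₁⟩ := exists_orthonormalBasis_of_pair he1 hF.norm_eq he
  have hne : i₀ ≠ i₁ := by
    rintro rfl
    rw [hi₀] at hi₁
    rw [hi₁, real_inner_self_eq_norm_sq, hF.norm_eq] at he
    norm_num at he
  have hex : (δ * k) ^ 2 * hessForm (closure Ω) f y e e + C₂ * (δ * k) ^ 4 ≤ k ^ 4 := by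
    have h1 : (δ * k) ^ 2 * hessForm (closure Ω) f y e e ≤ (1 * k) ^ 2 * (k ^ 2 / 2) :=
      mul_le_mul (pow_le_pow_left₀ (by positivity) (by gcongr) 2) hsmall
        (h.hess_nonneg hΩ hyc e) (by positivity)
    have h2 : C₂ * (δ * k) ^ 4 ≤ 1 / 2 * k ^ 4 := by
      have h3 : C₂ * δ ^ 4 ≤ 1 / 2 := by
        have h4 : δ ^ 4 ≤ δ ^ 2 := pow_le_pow_of_le_one hδ0.le hδ1 (by norm_num)
        have h5 := mul_le_mul_of_nonneg_left h4 hC₂0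
        linarith [mul_nonneg (sq_nonneg δ) hCt0]
      calc C₂ * (δ * k) ^ 4 = C₂ * δ ^ 4 * k ^ 4 := by ring
        _ ≤ _ := mul_le_mul_of_nonneg_right h3 (by positivity)
    linarith
  -- `M (δ k²)² ≤ 2 (δ k)² / M` because `k ≤ 1 / M`
  have hhigh : M * (δ * k ^ 2) ^ 2 ≤ 2 * ((δ * k) ^ 2 / M) := by
    have h3 : k * M ≤ 1 := by rwa [← le_div_iff₀ hM0]
    have h4 : M * (δ * k ^ 2) ^ 2 ≤ (δ * k) ^ 2 / M := by
      rw [le_div_iff₀ hM0]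
      calc M * (δ * k ^ 2) ^ 2 * M = (δ * k) ^ 2 * (k * M) ^ 2 := by ring
        _ ≤ (δ * k) ^ 2 * 1 := mul_le_mul_of_nonneg_left
            (pow_le_one₀ (by positivity) h3) (by positivity)
        _ = _ := mul_one _
    have : 0 ≤ (δ * k) ^ 2 / M := by positivity
    linarith
  obtain ⟨o, ho, w, hw, hbox⟩ := (h.convex_tangentSection (k ^ 4)).exists_box hyL b (i₀ := i₀) (i₁ := i₁)
    (r := fun i => if i = i₀ then δ * k else δ * k ^ 2) (w₀ := (δ * k) ^ 2 / M) (by positivity)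
    (by
      obtain ⟨z₁, z₂, hz₁, hz₂, hm⟩ := h.exists_points_tangentSection hΩ hn hM hK hc₁ hC₁ hy hF
        he1 he (s := δ * k) (a := k ^ 4) ⟨by positivity, hδk⟩ (by rw [hC₂]; exact hex)
      rw [hi₀, hi₁, if_pos rfl]
      exact ⟨z₁, z₂, hz₁.1, hz₂.1, hm⟩)
    (fun i h0 h1 => by
      have hbe : inner ℝ (b i) ν = 0 := by rw [← hi₁, b.inner_eq_ite, if_neg h1]
      have hex' : (δ * k ^ 2) ^ 2 * hessForm (closure Ω) f y (b i) (b i) +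
          C₂ * (δ * k ^ 2) ^ 4 ≤ k ^ 4 := by
        have h3 := h.abs_hess_tangential_le hΩ hn hM hK hc₁ hC₁ hy hF (b.norm_eq_one i) hbe
        rw [hCt] at h3
        have h4 : (δ * k ^ 2) ^ 4 ≤ (δ * k ^ 2) ^ 2 :=
          pow_le_pow_of_le_one (by positivity) (hs1.trans hM1) (by norm_num)
        have h5 : (δ * k ^ 2) ^ 2 * (Ct + C₂) ≤ 1 / 2 * k ^ 4 := by
          calc (δ * k ^ 2) ^ 2 * (Ct + C₂) = δ ^ 2 * (Ct + C₂) * k ^ 4 := by ring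
            _ ≤ _ := mul_le_mul_of_nonneg_right hδC (by positivity)
        have h6 := mul_le_mul_of_nonneg_left h3 (sq_nonneg (δ * k ^ 2))
        have h7 := mul_le_mul_of_nonneg_left h4 hC₂0
        linarith
      obtain ⟨z₁, z₂, hz₁, hz₂, hm⟩ := h.exists_points_tangentSection hΩ hn hM hK hc₁ hC₁ hy hF
        (b.norm_eq_one i) hbe (s := δ * k ^ 2) (a := k ^ 4) ⟨by positivity, hs1⟩
        (by rw [hC₂]; exact hex')
      have hp0 : 0 ≤ (δ * k ^ 2) ^ 2 / M := by positivity
      rw [hi₁, if_neg h0]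
      exact ⟨z₁, z₂, ⟨hp0.trans hz₁.1, hz₁.2.trans hhigh⟩,
        ⟨hp0.trans hz₂.1, hz₂.2.trans hhigh⟩, hm⟩)
  have hw0 : 0 < w := lt_of_lt_of_le (by positivity) hw
  obtain ⟨x, hx, hdet⟩ := exists_formDet_le_prod hΩ.uniqueDiffOn_closure hΩ.closure_subset
    hΩ.isCompact_closure (h.smooth_f.of_le (by norm_num)) h.convex hk4
    (l := fderivWithin ℝ f (closure Ω) y) (c := f y - fderivWithin ℝ f (closure Ω) y y)
    (fun x hx => by
      have := tangent_le_of_convexOn h.convex (h.smooth_f.differentiableOn (by norm_num)) hyc hx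
      rw [map_sub] at this
      linarith) b (fun i => by split_ifs <;> positivity) ho (fun i => (hbox i).1)
    fun i => (hbox i).2
  exact ((h.le_det x hx).trans hdet).trans (prod_box_le hne hM hδ0 hδ1 hk0 hw)

theorem exists_le_hess_tangential (hΩ : IsUniformlyConvexDomain Ω) (hn : 1 ≤ n) (hM : 1 ≤ M)
    (hK : 0 ≤ K) (hc₁ : 0 < c₁) (hC₁ : 0 ≤ C₁) :
    ∃ c₂ : ℝ, 0 < c₂ ∧ ∀ f g y ν Q, EllipticSlice Ω K c₁ C₁ f g → y ∈ frontier Ω →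
      BoundaryFrame Ω M y ν Q → ∀ e, ‖e‖ = 1 → inner ℝ e ν = 0 →
      c₂ ≤ hessForm (closure Ω) f y e e := by
  have hM0 : 0 < M := by linarith
  have hn0 : (1 : ℝ) ≤ n := by exact_mod_cast hn
  obtain ⟨Ct, hCt⟩ : ∃ Ct, K + M * (3 * K + C₁ + 1) * M = Ct := ⟨_, rfl⟩
  obtain ⟨C₂, hC₂⟩ : ∃ C₂, K * ((M + M ^ 2) + (1 + M) ^ 2 * M + 2 * (1 + M) ^ 4) +
    M * (M * (3 * K + C₁ + 1)) = C₂ := ⟨_, rfl⟩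
  have hCt0 : 0 ≤ Ct := by rw [← hCt]; positivity
  have hC₂0 : 0 ≤ C₂ := by rw [← hC₂]; positivity
  obtain ⟨δ, hδ⟩ : ∃ δ, δ = 1 / (M + 2 * (Ct + C₂)) := ⟨_, rfl⟩
  have hδ0 : 0 < δ := by rw [hδ]; positivity
  have hδM : δ ≤ 1 / M := by rw [hδ]; exact one_div_le_one_div_of_le hM0 (by linarith)
  have hM1 : 1 / M ≤ 1 := by rw [div_le_iff₀ hM0]; linarith
  have hδC : δ ^ 2 * (Ct + C₂) ≤ 1 / 2 := by
    have h1 : δ * (Ct + C₂) ≤ 1 / 2 := by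
      rw [hδ, one_div_mul_eq_div, div_le_iff₀ (by positivity)]; linarith
    calc δ ^ 2 * (Ct + C₂) = δ * (δ * (Ct + C₂)) := by ring
      _ ≤ 1 * (1 / 2) := mul_le_mul (hδM.trans hM1) h1 (by positivity) (by norm_num)
      _ = _ := by ring
  obtain ⟨B, hB⟩ : ∃ B, B = (64 * n * M ^ 2 / δ ^ 4) ^ n := ⟨_, rfl⟩
  have hB0 : 0 < B := by rw [hB]; positivity
  -- `k` is so small that `B k² < c₁`
  obtain ⟨k, hk⟩ : ∃ k, k = min (1 / M) (c₁ / (2 * B)) := ⟨_, rfl⟩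
  have hk0 : 0 < k := by rw [hk]; exact lt_min (by positivity) (by positivity)
  have hkM : k ≤ 1 / M := by rw [hk]; exact min_le_left _ _
  have hk1 : k ≤ 1 := hkM.trans hM1
  have hkB : B * k ^ 2 < c₁ := by
    have h1 : k ≤ c₁ / (2 * B) := by rw [hk]; exact min_le_right _ _
    rw [le_div_iff₀ (by positivity)] at h1
    have h2 : B * k ^ 2 ≤ B * k := mul_le_mul_of_nonneg_left (by rw [sq]; nlinarith) hB0.le
    linarith
  refine ⟨k ^ 2 / 2, by positivity, fun f g y ν Q h hy hF e he1 he => ?_⟩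
  by_contra hcon
  push Not at hcon
  refine hkB.not_ge ?_
  rw [hB]
  exact h.le_of_hess_tangential_le hΩ hn hM hK hc₁ hC₁ hy hF he1 he hCt hC₂ hδ0 hδM hδC hk0 hkM
    hcon.le

end EllipticSlice

/-! ### Mixed second derivatives at the boundary -/

theorem le_prod_mul_sum_inv {n : ℕ} (hn : 1 ≤ n) {lam : Fin n → ℝ} (hl : ∀ k, 0 < lam k)
    {c₁ C₁ : ℝ} (hC₁ : 1 ≤ C₁) (h₁ : c₁ ≤ ∏ k, lam k) (h₂ : ∏ k, lam k ≤ C₁) :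
    c₁ / C₁ ≤ (∏ k, lam k) * ∑ k, 1 / lam k := by
  have hP : 0 < ∏ k, lam k := Finset.prod_pos fun k _ => hl k
  obtain ⟨k, hk⟩ : ∃ k, lam k ≤ C₁ := by
    by_contra hc
    push Not at hc
    have h3 : C₁ ^ n < ∏ k, lam k := by
      have := Finset.prod_lt_prod_of_nonempty (s := (Finset.univ : Finset (Fin n)))
        (f := fun _ => C₁) (g := lam) (fun _ _ => by linarith) (fun k _ => hc k)
        ⟨⟨0, hn⟩, Finset.mem_univ _⟩
      simpa using this
    linarith [le_self_pow₀ hC₁ (show n ≠ 0 by omega)]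
  have h4 : 1 / C₁ ≤ ∑ k, 1 / lam k :=
    (one_div_le_one_div_of_le (hl k) hk).trans
      (Finset.single_le_sum (f := fun k => 1 / lam k)
        (fun k _ => (one_div_pos.2 (hl k)).le) (Finset.mem_univ k))
  calc c₁ / C₁ = c₁ * (1 / C₁) := by ring
    _ ≤ (∏ k, lam k) * (1 / C₁) := mul_le_mul_of_nonneg_right h₁ (by positivity)
    _ ≤ _ := mul_le_mul_of_nonneg_left h4 hP.le

section TiltedDeriv

variable {E : Type*} [NormedAddCommGroup E] [NormedSpace ℝ E]

/-- The derivative of `f` at `x` in the direction `e + Q(x - y, e) ν`. Near a boundary point `y`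
with normal `ν` and second fundamental form `Q` this direction is tangential up to
`O(|x - y|²)`. -/
noncomputable def tiltedDeriv (S : Set E) (f : E → ℝ) (y ν e : E) (Q : LinearMap.BilinForm ℝ E)
    (x : E) : ℝ :=
  fderivWithin ℝ f S x e + Q (x - y) e * fderivWithin ℝ f S x ν

variable {S : Set E} {f : E → ℝ} {y ν e : E} {Q : LinearMap.BilinForm ℝ E}

theorem hasDerivAt_tilt (x v : E) (s : ℝ) :
    HasDerivAt (fun r : ℝ => Q (x + r • v - y) e) (Q v e) s := by
  have h1 : HasDerivAt (fun r : ℝ => Q (x - y) e + r * Q v e) (1 * Q v e) s :=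
    ((hasDerivAt_id s).mul_const (Q v e)).const_add _
  rw [one_mul] at h1
  refine h1.congr_of_eventuallyEq (Filter.Eventually.of_forall fun r => ?_)
  simp only [map_add, map_sub, map_smul, LinearMap.add_apply, LinearMap.sub_apply,
    LinearMap.smul_apply, smul_eq_mul]
  ring

theorem hasDerivWithinAt_tiltedDeriv (hS : UniqueDiffOn ℝ S) (hf : ContDiffOn ℝ 2 f S) {I : Set ℝ}
    {x v : E} (hI : ∀ s ∈ I, x + s • v ∈ S) {s : ℝ} (hs : s ∈ I) :
    HasDerivWithinAt (fun r : ℝ => tiltedDeriv S f y ν e Q (x + r • v))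
      (hessForm S f (x + s • v) v e + (Q v e * fderivWithin ℝ f S (x + s • v) ν +
        Q (x + s • v - y) e * hessForm S f (x + s • v) v ν)) I s :=
  (hasDerivWithinAt_line₁ hS hf hI hs e).fun_add
    ((hasDerivAt_tilt x v s).hasDerivWithinAt.fun_mul (hasDerivWithinAt_line₁ hS hf hI hs ν))

theorem hasDerivAt_tiltedDeriv (hS : UniqueDiffOn ℝ S) (hf : ContDiffOn ℝ 2 f S) {x v : E} {s : ℝ}
    (hx : x + s • v ∈ interior S) :
    HasDerivAt (fun r : ℝ => tiltedDeriv S f y ν e Q (x + r • v))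
      (hessForm S f (x + s • v) v e + (Q v e * fderivWithin ℝ f S (x + s • v) ν +
        Q (x + s • v - y) e * hessForm S f (x + s • v) v ν)) s :=
  (hasDerivWithinAt_tiltedDeriv hS hf (I := (fun r : ℝ => x + r • v) ⁻¹' S) (fun _ h => h)
    (show x + s • v ∈ S from interior_subset hx)).hasDerivAt (line_preimage_mem_nhds hx)

theorem second_deriv_tiltedDeriv (hS : UniqueDiffOn ℝ S) (hf : ContDiffOn ℝ 3 f S) {x v : E}
    (hx : x ∈ interior S) :
    HasDerivAt (fun s : ℝ => hessForm S f (x + s • v) v e +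
      (Q v e * fderivWithin ℝ f S (x + s • v) ν +
        Q (x + s • v - y) e * hessForm S f (x + s • v) v ν))
      (iteratedFDerivWithin ℝ 3 f S x ![v, v, e] + (2 * Q v e * hessForm S f x v ν +
        Q (x - y) e * iteratedFDerivWithin ℝ 3 f S x ![v, v, ν])) 0 := by
  have hx' : x + (0 : ℝ) • v ∈ interior S := by simpa using hx
  have h1 := (hasDerivAt_line₂ hS hf hx' v e).fun_add
    (((hasDerivAt_line₁ hS (hf.of_le (by norm_num)) hx' ν).const_mul (Q v e)).fun_add
      ((hasDerivAt_tilt (Q := Q) (y := y) (e := e) x v 0).fun_mul (hasDerivAt_line₂ hS hf hx' v ν)))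
  refine h1.congr_deriv ?_
  simp only [zero_smul, add_zero]
  ring

end TiltedDeriv

theorem EllipticSlice.abs_tiltedDeriv_sub_le {n : ℕ} {Ω : Set (EuclideanSpace ℝ (Fin n))}
    {K c₁ C₁ M : ℝ} {f g : EuclideanSpace ℝ (Fin n) → ℝ} {x ν' y ν e : EuclideanSpace ℝ (Fin n)}
    {Q Q' : LinearMap.BilinForm ℝ (EuclideanSpace ℝ (Fin n))}
    (hΩ : IsUniformlyConvexDomain Ω) (hn : 1 ≤ n) (hM : 1 ≤ M) (hK : 0 ≤ K) (hc₁ : 0 < c₁)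
    (hC₁ : 0 ≤ C₁) (h : EllipticSlice Ω K c₁ C₁ f g) (hx : x ∈ frontier Ω)
    (hF' : BoundaryFrame Ω M x ν' Q') (hF : BoundaryFrame Ω M y ν Q) (he1 : ‖e‖ = 1)
    (he : inner ℝ e ν = 0) :
    |tiltedDeriv (closure Ω) f y ν e Q x - tiltedDeriv (closure Ω) g y ν e Q x| ≤
      M * ‖x - y‖ ^ 2 * (M * (3 * K + C₁ + 1)) := by
  set η := e + Q (x - y) e • ν with hη
  set a := inner ℝ ν' η with ha
  have hν' : inner ℝ ν' ν' = (1 : ℝ) := by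
    rw [real_inner_self_eq_norm_sq, hF'.norm_eq]; norm_num
  have hinner : IsInnerNormal Ω x ν' := ⟨hF'.norm_eq, fun z hz => by
    have := (sq_nonneg _).trans (hF'.support z hz)
    exact nonneg_of_mul_nonneg_right this (by linarith)⟩
  have h1 := hF.normal_variation x hx ν' hinner e he
  rw [he1, mul_one] at h1
  have h2 := h.tangential_deriv_eq hΩ hM hx hF' (e := η - a • ν') (by
    rw [inner_sub_left, inner_smul_left, hν', real_inner_comm, ha]; simp)
  have h3 := h.abs_normal_deriv_le hΩ hn hM hK hc₁ hC₁ hx hF'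
  have htilt : ∀ p : EuclideanSpace ℝ (Fin n) → ℝ, tiltedDeriv (closure Ω) p y ν e Q x =
      fderivWithin ℝ p (closure Ω) x η := fun p => by
    rw [tiltedDeriv, hη, map_add, map_smul, smul_eq_mul]
  rw [htilt, htilt]
  simp only [map_sub, map_smul, smul_eq_mul] at h2
  have h4 : fderivWithin ℝ f (closure Ω) x η - fderivWithin ℝ g (closure Ω) x η =
      a * (fderivWithin ℝ f (closure Ω) x ν' - fderivWithin ℝ g (closure Ω) x ν') := by linarith
  rw [h4, abs_mul]
  exact mul_le_mul h1 h3 (abs_nonneg _) (by positivity)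

namespace MongeAmpereData

variable {n : ℕ} {Ω : Set (EuclideanSpace ℝ (Fin n))} {T c₀ κ K C₁ M R : ℝ} {J : ℝ≥0}
  {φ ψ u : EuclideanSpace ℝ (Fin n) → ℝ → ℝ} {x y ν e : EuclideanSpace ℝ (Fin n)} {t : ℝ}
  {Q : LinearMap.BilinForm ℝ (EuclideanSpace ℝ (Fin n))}

theorem ellipticSlice (hΩ : IsUniformlyConvexDomain Ω) (hT : 0 < T) (hκ : 0 < κ)
    (d : MongeAmpereData Ω T c₀ κ K J φ ψ u)
    (hC : ∀ x ∈ closure Ω, ∀ t ∈ Icc 0 T, timeDeriv T u x t + ψ x t ≤ C₁) (ht : t ∈ Icc 0 T) :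
    EllipticSlice Ω K (min c₀ (κ ^ n)) C₁ (fun y => u y t) (fun y => φ y t) where
  smooth_f := d.mem_u.contDiffOn_slice ht
  smooth_g := d.mem_φ.contDiffOn_slice ht
  bound_g j hj x hx := d.bound_φ j hj x hx t ht
  convex := (d.convex t ht).closure_of_continuousOn (d.mem_u.contDiffOn_slice ht).continuousOn
  le_det x hx := by rw [d.equation x hx t ht]; exact d.le_speed hΩ hT hκ hx ht
  det_le x hx := by rw [d.equation x hx t ht]; exact hC x hx t ht
  boundary x hx := d.lateral_eq x hx t ht

/-- The equation, differentiated in a space direction. -/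
theorem sum_third_eq (hΩ : IsUniformlyConvexDomain Ω) (d : MongeAmpereData Ω T c₀ κ K J φ ψ u)
    (hx : x ∈ Ω) (ht : t ∈ Icc 0 T)
    {b : OrthonormalBasis (Fin n) ℝ (EuclideanSpace ℝ (Fin n))} {lam : Fin n → ℝ}
    (hd : Diagonalizes (hessForm (closure Ω) (fun y => u y t) x) b lam) (hl : ∀ k, 0 < lam k)
    (τ : EuclideanSpace ℝ (Fin n)) :
    (∏ k, lam k) * ∑ k, iteratedFDerivWithin ℝ 3 (fun y => u y t) (closure Ω) x ![b k, b k, τ] /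
        lam k =
      fderivWithin ℝ (fun y => timeDeriv T u y t) (closure Ω) x τ +
        fderivWithin ℝ (fun y => ψ y t) (closure Ω) x τ := by
  have hS := hΩ.uniqueDiffOn_closure
  have hint : x ∈ interior (closure Ω) := by rwa [hΩ.interior_closure]
  have hint' : x + (0 : ℝ) • τ ∈ interior (closure Ω) := by simpa using hint
  have hu4 := d.mem_u.contDiffOn_slice ht
  have hu3 : ContDiffOn ℝ 3 (fun y => u y t) (closure Ω) := hu4.of_le (by norm_num)
  have hev := eventually_line_mem_interior hint τ
  have h1 := (hasDerivAt_line₀ ((d.mem_u.contDiffOn_timeDeriv ht).differentiableOn (by norm_num))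
    hint').fun_add (hasDerivAt_line₀
      ((d.mem_ψ.contDiffOn_slice ht).differentiableOn (by norm_num)) hint')
  have h2 := deriv_formDet
    (H := fun s : ℝ => hessForm (closure Ω) (fun y => u y t) (x + s • τ)) (s₀ := 0)
    (by simpa using hd) hl (hev.mono fun s hs => d.hess_symm hΩ (interior_subset hs) ht)
    (fun k l => hasDerivAt_line₂ hS hu3 hint' (b k) (b l))
    (h1.congr_of_eventuallyEq (hev.mono fun s hs => d.equation _ (interior_subset hs) t ht))
  simp only [zero_smul, add_zero] at h2
  rw [h2, hd.formDet_eq_prod]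
  congr 1
  refine Finset.sum_congr rfl fun k _ => ?_
  rw [third_deriv_swap₁₂ hS hΩ.closure_subset hu4 (subset_closure hx),
    third_deriv_swap₀₁ hS hΩ.closure_subset hu4 (subset_closure hx)]

theorem continuousOn_fderivWithin {w : EuclideanSpace ℝ (Fin n) → ℝ → ℝ}
    (hΩ : IsUniformlyConvexDomain Ω) (hw : MemParabolicC 4 Ω T w)
    (v : EuclideanSpace ℝ (Fin n)) :
    ContinuousOn (fun p : EuclideanSpace ℝ (Fin n) × ℝ =>
      fderivWithin ℝ (fun y => w y p.2) (closure Ω) p.1 v) (closure Ω ×ˢ Icc 0 T) := by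
  have h1 := (ContinuousMultilinearMap.apply ℝ (fun _ : Fin 1 => EuclideanSpace ℝ (Fin n)) ℝ
    ![v]).continuous.comp_continuousOn (hw.continuousOn_iterated (j := 1) (by norm_num))
  refine h1.congr fun p hp => ?_
  exact (iteratedFDerivWithin_one_apply_fderiv hΩ.uniqueDiffOn_closure hp.1 ![v]).symm

theorem abs_fderiv_le {f : EuclideanSpace ℝ (Fin n) → ℝ} (hΩ : IsUniformlyConvexDomain Ω)
    (hx : x ∈ closure Ω) (h : ‖iteratedFDerivWithin ℝ 1 f (closure Ω) x‖ ≤ K)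
    (v : EuclideanSpace ℝ (Fin n)) : |fderivWithin ℝ f (closure Ω) x v| ≤ K * ‖v‖ :=
  (ContinuousLinearMap.le_opNorm _ v).trans (mul_le_mul_of_nonneg_right
    (norm_fderivWithin_le hΩ.uniqueDiffOn_closure hx h) (norm_nonneg v))

/-- At an interior space-time maximum of the difference of the tilted derivatives of `u` and `φ` and
a barrier with Hessian `-2 a`, the constant `a` is not large. -/
theorem barrier_const_le (hΩ : IsUniformlyConvexDomain Ω) (hM : 1 ≤ M)
    (d : MongeAmpereData Ω T c₀ κ K J φ ψ u)
    (hC : timeDeriv T u x t + ψ x t ≤ C₁) (hR : ‖x - y‖ ≤ R) (hx : x ∈ Ω) (ht : t ∈ Ioo 0 T)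
    (hF : BoundaryFrame Ω M y ν Q) (he1 : ‖e‖ = 1) {A a : ℝ}
    (hmax : ∀ z ∈ closure Ω, ∀ s ∈ Icc 0 t,
      tiltedDeriv (closure Ω) (fun y => u y s) y ν e Q z -
        tiltedDeriv (closure Ω) (fun y => φ y s) y ν e Q z -
        (A * inner ℝ (z - y) ν + (-a) * ‖z - y‖ ^ 2) ≤
      tiltedDeriv (closure Ω) (fun y => u y t) y ν e Q x -
        tiltedDeriv (closure Ω) (fun y => φ y t) y ν e Q x -
        (A * inner ℝ (x - y) ν + (-a) * ‖x - y‖ ^ 2))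
    {b : OrthonormalBasis (Fin n) ℝ (EuclideanSpace ℝ (Fin n))} {lam : Fin n → ℝ}
    (hd : Diagonalizes (hessForm (closure Ω) (fun y => u y t) x) b lam) (hl : ∀ k, 0 < lam k) :
    2 * a * ((∏ k, lam k) * ∑ k, 1 / lam k) ≤ 2 * K * (1 + M * R) + 2 * M * C₁ +
      (K * (1 + M * R) + 2 * M * K) * ((∏ k, lam k) * ∑ k, 1 / lam k) := by
  have hS := hΩ.uniqueDiffOn_closure
  have hint : x ∈ interior (closure Ω) := by rwa [hΩ.interior_closure]
  have hxc := subset_closure hx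
  have htc := Ioo_subset_Icc_self ht
  have hP : 0 < ∏ k, lam k := Finset.prod_pos fun k _ => hl k
  have hPC : ∏ k, lam k ≤ C₁ := by
    rw [← hd.formDet_eq_prod, d.equation x hxc t htc]; exact hC
  have hu3 : ContDiffOn ℝ 3 (fun y => u y t) (closure Ω) :=
    (d.mem_u.contDiffOn_slice htc).of_le (by norm_num)
  have hφ3 : ContDiffOn ℝ 3 (fun y => φ y t) (closure Ω) :=
    (d.mem_φ.contDiffOn_slice htc).of_le (by norm_num)
  set q := Q (x - y) e with hq
  have hqle : |q| ≤ M * R := by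
    have := hF.abs_le (x - y) e
    rw [he1, mul_one] at this
    exact this.trans (mul_le_mul_of_nonneg_left hR (by linarith))
  set D3u : EuclideanSpace ℝ (Fin n) → EuclideanSpace ℝ (Fin n) → ℝ := fun v w =>
    iteratedFDerivWithin ℝ 3 (fun y => u y t) (closure Ω) x ![v, v, w] with hD3u
  set D3φ : EuclideanSpace ℝ (Fin n) → EuclideanSpace ℝ (Fin n) → ℝ := fun v w =>
    iteratedFDerivWithin ℝ 3 (fun y => φ y t) (closure Ω) x ![v, v, w] with hD3φ
  set Hu := hessForm (closure Ω) (fun y => u y t) x with hHu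
  set Hφ := hessForm (closure Ω) (fun y => φ y t) x with hHφ
  -- the space derivatives at the maximum
  have hspace : ∀ v, ‖v‖ = 1 → (D3u v e + (2 * Q v e * Hu v ν + q * D3u v ν)) -
      (D3φ v e + (2 * Q v e * Hφ v ν + q * D3φ v ν)) + 2 * a ≤ 0 := by
    intro v hv
    have hev := eventually_line_mem_interior hint v
    have hB : ∀ s : ℝ, HasDerivAt (fun r : ℝ => A * inner ℝ (x + r • v - y) ν +
        (-a) * ‖x + r • v - y‖ ^ 2) ((A * inner ℝ v ν + 2 * (-a) * inner ℝ (x - y) v) +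
          2 * s * (-a)) s := by
      intro s
      have h1 := (((hasDerivAt_id s).mul_const
        (A * inner ℝ v ν + 2 * (-a) * inner ℝ (x - y) v)).const_add
          (A * inner ℝ (x - y) ν + (-a) * ‖x - y‖ ^ 2)).fun_add
        (((hasDerivAt_id s).pow 2).mul_const ((-a) * ‖v‖ ^ 2))
      rw [hv] at h1
      refine (h1.congr_of_eventuallyEq (Filter.Eventually.of_forall fun r => ?_)).congr_deriv ?_
      · simp only [inner_line_add_mul_norm_sq x y ν v, hv, id, Pi.pow_apply]
      · simp
    have hD1 : ∀ᶠ s : ℝ in 𝓝 0, HasDerivAt _ _ s := hev.mono fun s hs =>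
      ((hasDerivAt_tiltedDeriv (y := y) (ν := ν) (e := e) (Q := Q) hS
        (hu3.of_le (by norm_num)) hs).fun_sub
        (hasDerivAt_tiltedDeriv (y := y) (ν := ν) (e := e) (Q := Q) hS
          (hφ3.of_le (by norm_num)) hs)).fun_sub (hB s)
    have hB2 : HasDerivAt (fun s : ℝ => (A * inner ℝ v ν + 2 * (-a) * inner ℝ (x - y) v) +
          2 * s * (-a)) (-2 * a) 0 := by
      have := (((hasDerivAt_id (0 : ℝ)).const_mul 2).mul_const (-a)).const_add
        (A * inner ℝ v ν + 2 * (-a) * inner ℝ (x - y) v)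
      exact this.congr_deriv (by ring)
    have hD2 := ((second_deriv_tiltedDeriv (y := y) (ν := ν) (e := e) (Q := Q) (v := v) hS hu3
      hint).fun_sub (second_deriv_tiltedDeriv (y := y) (ν := ν) (e := e) (Q := Q) (v := v) hS hφ3
        hint)).fun_sub hB2
    have := nonpos_second_deriv_of_isLocalMax hD1 hD2 (by
      filter_upwards [hev] with s hs
      have := hmax _ (interior_subset hs) t (right_mem_Icc.2 ht.1.le)
      simpa using this)
    linarith
  -- the time derivative at the maximum
  have htime : 0 ≤ (fderivWithin ℝ (fun y => timeDeriv T u y t) (closure Ω) x e +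
      q * fderivWithin ℝ (fun y => timeDeriv T u y t) (closure Ω) x ν) -
      (fderivWithin ℝ (fun y => timeDeriv T φ y t) (closure Ω) x e +
      q * fderivWithin ℝ (fun y => timeDeriv T φ y t) (closure Ω) x ν) := by
    have hD : ∀ {w : EuclideanSpace ℝ (Fin n) → ℝ → ℝ}, MemParabolicC 4 Ω T w →
        HasDerivAt (fun s => tiltedDeriv (closure Ω) (fun y => w y s) y ν e Q x)
          (fderivWithin ℝ (fun y => timeDeriv T w y t) (closure Ω) x e +
            q * fderivWithin ℝ (fun y => timeDeriv T w y t) (closure Ω) x ν) t := fun hw =>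
      (hw.hasDerivAt_fderivWithin hΩ hx ht e).fun_add
        ((hw.hasDerivAt_fderivWithin hΩ hx ht ν).const_mul q)
    refine nonneg_deriv_of_le_left ((hD d.mem_u).fun_sub (hD d.mem_φ)) ht.1 fun s hs => ?_
    have := hmax x hxc s hs
    linarith
  -- the linearized operator
  have he' := d.sum_third_eq hΩ hx htc hd hl e
  have hν' := d.sum_third_eq hΩ hx htc hd hl ν
  have hmix : ∑ k, Q (b k) e * Hu (b k) ν / lam k = Q ν e := by
    have h1 : ∀ k, Q (b k) e * Hu (b k) ν / lam k = Q (inner ℝ (b k) ν • b k) e := fun k => by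
      rw [hd.apply_eq, map_smul, LinearMap.smul_apply, smul_eq_mul]
      field_simp [(hl k).ne']
    rw [Finset.sum_congr rfl fun k _ => h1 k, ← LinearMap.sum_apply, ← map_sum, b.sum_repr']
  have hsum : ∑ k, (D3u (b k) e / lam k + 2 * (Q (b k) e * Hu (b k) ν / lam k) +
      q * (D3u (b k) ν / lam k)) + 2 * a * ∑ k, 1 / lam k ≤
      (K * (1 + M * R) + 2 * M * K) * ∑ k, 1 / lam k := by
    rw [Finset.mul_sum, Finset.mul_sum, ← Finset.sum_add_distrib]
    refine Finset.sum_le_sum fun k _ => ?_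
    have h1 := hspace (b k) (b.norm_eq_one k)
    have h2 : D3φ (b k) e + (2 * Q (b k) e * Hφ (b k) ν + q * D3φ (b k) ν) ≤
        K * (1 + M * R) + 2 * M * K := by
      have a1 := abs_third_le (d.bound_φ 3 (by norm_num) x hxc t htc) (b k) (b k) e
      have a2 := abs_third_le (d.bound_φ 3 (by norm_num) x hxc t htc) (b k) (b k) ν
      have a3 := abs_hessForm_le (d.bound_φ 2 (by norm_num) x hxc t htc) (b k) ν
      have a4 := hF.abs_le (b k) e
      rw [b.norm_eq_one, he1, mul_one, mul_one, mul_one] at a1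
      rw [b.norm_eq_one, hF.norm_eq, mul_one, mul_one, mul_one] at a2
      rw [b.norm_eq_one, hF.norm_eq, mul_one, mul_one] at a3
      rw [b.norm_eq_one, he1, mul_one, mul_one] at a4
      have a5 : |Q (b k) e * Hφ (b k) ν| ≤ M * K := by
        rw [abs_mul]; exact mul_le_mul a4 a3 (abs_nonneg _) (by linarith)
      have a6 : |q * D3φ (b k) ν| ≤ M * R * K := by
        rw [abs_mul]
        exact mul_le_mul hqle a2 (abs_nonneg _) ((abs_nonneg q).trans hqle)
      linarith [le_abs_self (D3φ (b k) e), le_abs_self (Q (b k) e * Hφ (b k) ν),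
        le_abs_self (q * D3φ (b k) ν)]
    have h3 : (D3u (b k) e + 2 * (Q (b k) e * Hu (b k) ν) + q * D3u (b k) ν + 2 * a) / lam k ≤
        (K * (1 + M * R) + 2 * M * K) / lam k :=
      div_le_div_of_nonneg_right (by linarith) (hl k).le
    calc _ = (D3u (b k) e + 2 * (Q (b k) e * Hu (b k) ν) + q * D3u (b k) ν + 2 * a) / lam k := by
          ring
      _ ≤ _ := h3
      _ = _ := by ring
  rw [Finset.sum_add_distrib, Finset.sum_add_distrib, ← Finset.mul_sum, ← Finset.mul_sum,
    hmix] at hsum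
  have hmul := mul_le_mul_of_nonneg_left hsum hP.le
  have hψ : ∀ v, ‖v‖ = 1 → |fderivWithin ℝ (fun y => ψ y t) (closure Ω) x v| ≤ K := fun v hv => by
    have := (ContinuousLinearMap.le_opNorm _ v).trans
      (mul_le_mul_of_nonneg_right (d.bound_Dψ x hxc t htc) (norm_nonneg v))
    rwa [hv, mul_one] at this
  have hφt : ∀ v, ‖v‖ = 1 → |fderivWithin ℝ (fun y => timeDeriv T φ y t) (closure Ω) x v| ≤ K :=
    fun v hv => by
      have := abs_fderiv_le hΩ hxc (d.bound_φt 1 (by norm_num) x hxc t htc) v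
      rwa [hv, mul_one] at this
  have hMR : 0 ≤ M * R := (abs_nonneg q).trans hqle
  have g1 := (abs_le.1 (hψ e he1)).1
  have g2 := (abs_le.1 (hφt e he1)).1
  have g3 : |q * fderivWithin ℝ (fun y => ψ y t) (closure Ω) x ν| ≤ M * R * K := by
    rw [abs_mul]; exact mul_le_mul hqle (hψ ν hF.norm_eq) (abs_nonneg _) hMR
  have g4 : |q * fderivWithin ℝ (fun y => timeDeriv T φ y t) (closure Ω) x ν| ≤ M * R * K := by
    rw [abs_mul]; exact mul_le_mul hqle (hφt ν hF.norm_eq) (abs_nonneg _) hMR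
  have g5 : |(∏ k, lam k) * Q ν e| ≤ C₁ * M := by
    rw [abs_mul, abs_of_pos hP]
    have := hF.abs_le ν e
    rw [hF.norm_eq, he1, mul_one, mul_one] at this
    exact mul_le_mul hPC this (abs_nonneg _) (hP.le.trans hPC)
  have g3' := (abs_le.1 g3).1
  have g4' := (abs_le.1 g4).1
  have g5' := (abs_le.1 g5).1
  have hexp : (∏ k, lam k) * (∑ k, D3u (b k) e / lam k + 2 * Q ν e +
      q * ∑ k, D3u (b k) ν / lam k + 2 * a * ∑ k, 1 / lam k) =
      (∏ k, lam k) * ∑ k, D3u (b k) e / lam k + 2 * ((∏ k, lam k) * Q ν e) +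
      q * ((∏ k, lam k) * ∑ k, D3u (b k) ν / lam k) +
      2 * a * ((∏ k, lam k) * ∑ k, 1 / lam k) := by ring
  rw [hexp, he', hν'] at hmul
  linarith

end MongeAmpereData

namespace MongeAmpereData

variable {n : ℕ} {Ω : Set (EuclideanSpace ℝ (Fin n))} {T c₀ κ K C₁ M : ℝ} {J : ℝ≥0}
  {φ ψ u : EuclideanSpace ℝ (Fin n) → ℝ → ℝ}

/-- Bound for the mixed tangential-normal derivatives at the boundary, by comparing the tilted
derivative of `u - φ` with the barrier `A ⟨x - y, ν⟩ - a |x - y|²`. -/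
theorem exists_abs_mixed_le (hΩ : IsUniformlyConvexDomain Ω) (hn : 1 ≤ n) (hT : 0 < T) (hκ : 0 < κ)
    (hc₀ : 0 < c₀) (hK : 0 ≤ K) (hC₁ : 1 ≤ C₁) (hM : 1 ≤ M)
    (hfr : ∀ y ∈ frontier Ω, ∃ ν Q, BoundaryFrame Ω M y ν Q) (J : ℝ≥0) :
    ∃ C₃ : ℝ, 0 ≤ C₃ ∧ ∀ φ ψ u, MongeAmpereData Ω T c₀ κ K J φ ψ u →
      (∀ x ∈ closure Ω, ∀ t ∈ Icc 0 T, timeDeriv T u x t + ψ x t ≤ C₁) →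
      ∀ y ∈ frontier Ω, ∀ t ∈ Icc 0 T, ∀ ν Q, BoundaryFrame Ω M y ν Q →
      ∀ e, ‖e‖ = 1 → inner ℝ e ν = 0 →
        |hessForm (closure Ω) (fun y => u y t) y ν e| ≤ C₃ := by
  have hM0 : 0 < M := by linarith
  obtain ⟨R, hR1, hR⟩ := hΩ.exists_diam
  obtain ⟨c₁, hc₁⟩ : ∃ c₁, min c₀ (κ ^ n) = c₁ := ⟨_, rfl⟩
  have hc₁0 : 0 < c₁ := by rw [← hc₁]; exact lt_min hc₀ (by positivity)
  obtain ⟨N, hN⟩ : ∃ N, M * (3 * K + C₁ + 1) = N := ⟨_, rfl⟩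
  have hN0 : 0 ≤ N := by rw [← hN]; positivity
  obtain ⟨Ca, hCa⟩ : ∃ Ca, 2 * K * (1 + M * R) + 2 * M * C₁ = Ca := ⟨_, rfl⟩
  obtain ⟨Cb, hCb⟩ : ∃ Cb, K * (1 + M * R) + 2 * M * K = Cb := ⟨_, rfl⟩
  have hCa0 : 0 ≤ Ca := by rw [← hCa]; positivity
  have hCb0 : 0 ≤ Cb := by rw [← hCb]; positivity
  obtain ⟨θ, hθ⟩ : ∃ θ, c₁ / C₁ = θ := ⟨_, rfl⟩
  have hθ0 : 0 < θ := by rw [← hθ]; positivity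
  -- the constant `a` exceeds what is possible at an interior maximum
  obtain ⟨a, ha⟩ : ∃ a, a = (Cb + Ca / θ + 1) / 2 := ⟨_, rfl⟩
  have ha0 : 0 ≤ a := by rw [ha]; positivity
  obtain ⟨A, hA⟩ : ∃ A, A = M * (a + M * N) := ⟨_, rfl⟩
  have hA0 : 0 ≤ A := by rw [hA]; positivity
  refine ⟨K + A + M * N, by positivity, fun φ ψ u d hC y hy t ht ν Q hF => ?_⟩
  have hS := hΩ.uniqueDiffOn_closure
  have hyc := frontier_subset_closure hy
  suffices hup : ∀ e, ‖e‖ = 1 → inner ℝ e ν = 0 →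
      hessForm (closure Ω) (fun y => u y t) y ν e ≤ K + A + M * N by
    intro e he1 he
    have h1 := hup (-e) (by rwa [norm_neg]) (by rw [inner_neg_left, he, neg_zero])
    rw [map_neg] at h1
    exact abs_le.2 ⟨by linarith, hup e he1 he⟩
  intro e he1 he
  have hbar : ∀ z ∈ closure Ω, M * N * ‖z - y‖ ^ 2 ≤
      A * inner ℝ (z - y) ν + (-a) * ‖z - y‖ ^ 2 := fun z hz => by
    have h1 := mul_le_mul_of_nonneg_left (hF.support z hz) (show 0 ≤ a + M * N by positivity)
    rw [hA]
    linarith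
  have hbar0 : ∀ z ∈ closure Ω, 0 ≤ A * inner ℝ (z - y) ν + (-a) * ‖z - y‖ ^ 2 := fun z hz =>
    le_trans (by positivity) (hbar z hz)
  have hslice : ∀ s ∈ Icc 0 T, EllipticSlice Ω K c₁ C₁ (fun y => u y s) (fun y => φ y s) :=
    fun s hs => by rw [← hc₁]; exact d.ellipticSlice hΩ hT hκ hC hs
  have hle : ∀ z ∈ closure Ω, ∀ s ∈ Icc 0 T,
      tiltedDeriv (closure Ω) (fun y => u y s) y ν e Q z -
        tiltedDeriv (closure Ω) (fun y => φ y s) y ν e Q z -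
        (A * inner ℝ (z - y) ν + (-a) * ‖z - y‖ ^ 2) ≤ 0 := by
    intro z hz s hs
    by_contra hcon
    push Not at hcon
    obtain ⟨x, hx, τ, hτ, hxτ, hmax⟩ := exists_first_touching hΩ.isCompact_closure (T := T)
      (G := fun z s => tiltedDeriv (closure Ω) (fun y => u y s) y ν e Q z -
        tiltedDeriv (closure Ω) (fun y => φ y s) y ν e Q z -
        (A * inner ℝ (z - y) ν + (-a) * ‖z - y‖ ^ 2)) (by
          have hq : Continuous fun p : EuclideanSpace ℝ (Fin n) × ℝ => Q (p.1 - y) e := by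
            have : Continuous fun v => Q v e :=
              LinearMap.continuous_of_finiteDimensional (Q.flip e)
            exact this.comp (by fun_prop)
          have hw : ∀ {w : EuclideanSpace ℝ (Fin n) → ℝ → ℝ}, MemParabolicC 4 Ω T w →
              ContinuousOn (fun p : EuclideanSpace ℝ (Fin n) × ℝ =>
                tiltedDeriv (closure Ω) (fun y => w y p.2) y ν e Q p.1)
                (closure Ω ×ˢ Icc 0 T) := fun hw =>
            (continuousOn_fderivWithin hΩ hw e).add
              (hq.continuousOn.mul (continuousOn_fderivWithin hΩ hw ν))
          exact ((hw d.mem_u).sub (hw d.mem_φ)).sub (by fun_prop))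
      (fun z hz => by
        have h1 : ∀ v, fderivWithin ℝ (fun y => u y 0) (closure Ω) z v =
            fderivWithin ℝ (fun y => φ y 0) (closure Ω) z v := fun v => by
          rw [fderivWithin_congr (fun y hy => d.initial_eq y hy) (d.initial_eq z hz)]
        simp only [tiltedDeriv, h1, sub_self, zero_sub]
        exact lt_of_le_of_lt (neg_nonpos.2 (hbar0 z hz)) (half_pos hcon)) hz hs
      (half_lt_self hcon)
    have hτc := Ioo_subset_Icc_self hτ
    rcases hΩ.mem_or_frontier hx with hxΩ | hxf
    · obtain ⟨b, lam, hd⟩ := exists_diagonalizes _ (d.hess_symm hΩ hx hτc)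
      have hdet := (hslice τ hτc).le_det x hx
      have hl := hd.pos (d.hess_nonneg hΩ hx hτc) (hc₁0.trans_le hdet)
      have h1 := d.barrier_const_le hΩ hM (hC x hx τ hτc) (hR x hx y hyc) hxΩ hτ hF he1
        (fun z hz s hs => (hmax z hz s hs).trans_eq hxτ.symm) hd hl
      have h2 := le_prod_mul_sum_inv (c₁ := c₁) hn hl hC₁ (by rwa [← hd.formDet_eq_prod])
        (by rw [← hd.formDet_eq_prod]; exact (hslice τ hτc).det_le x hx)
      rw [hθ] at h2
      rw [hCa, hCb, ha] at h1
      have h3 : Ca ≤ Ca / θ * ((∏ k, lam k) * ∑ k, 1 / lam k) := by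
        calc Ca = Ca / θ * θ := by field_simp
          _ ≤ _ := mul_le_mul_of_nonneg_left h2 (by positivity)
      linarith
    · obtain ⟨ν', Q', hF'⟩ := hfr x hxf
      have h1 := (le_abs_self _).trans ((hslice τ hτc).abs_tiltedDeriv_sub_le hΩ hn hM hK hc₁0
        (by linarith) hxf hF' hF he1 he)
      rw [hN] at h1
      have h2 := hbar x hx
      have h3 := half_pos hcon
      linarith
  -- differentiate along the normal at `y`
  have hI : ∀ s ∈ Icc 0 (1 / M), y + s • ν ∈ closure Ω := fun s hs => by
    rcases hs.1.eq_or_lt with h0 | h0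
    · rw [← h0]; simpa using hyc
    · exact subset_closure (hF.inward s ⟨h0, hs.2⟩)
  have hM1 : 0 < 1 / M := by positivity
  have hleft := left_mem_Icc.2 hM1.le
  have htan := (hslice t ht).tangential_deriv_eq hΩ hM hy hF he
  have hB : HasDerivWithinAt (fun r : ℝ => A * inner ℝ (y + r • ν - y) ν +
      (-a) * ‖y + r • ν - y‖ ^ 2) A (Icc 0 (1 / M)) 0 := by
    have hν : inner ℝ ν ν = (1 : ℝ) := by
      rw [real_inner_self_eq_norm_sq, hF.norm_eq]; norm_num
    have h1 := ((((hasDerivAt_id (0 : ℝ)).const_mul A).fun_add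
      (((hasDerivAt_id (0 : ℝ)).pow 2).const_mul (-a))).hasDerivWithinAt (s := Icc 0 (1 / M)))
    have h2 : ∀ r : ℝ, A * inner ℝ (y + r • ν - y) ν + (-a) * ‖y + r • ν - y‖ ^ 2 =
        A * r + (-a) * r ^ 2 := fun r => by
      rw [add_sub_cancel_left, inner_smul_left, hν, norm_smul, hF.norm_eq, mul_one, mul_one,
        Real.norm_eq_abs, sq_abs]
      rfl
    simp only [h2]
    simpa using h1
  have hder := ((hasDerivWithinAt_tiltedDeriv (y := y) (ν := ν) (e := e) (Q := Q) hS
    ((hslice t ht).smooth_f.of_le (by norm_num)) hI hleft).fun_sub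
    (hasDerivWithinAt_tiltedDeriv (y := y) (ν := ν) (e := e) (Q := Q) hS
      ((hslice t ht).smooth_g.of_le (by norm_num)) hI hleft)).fun_sub hB
  have h1 := nonpos_right_deriv_of_le hM1 hder fun s hs => by
    refine (hle _ (hI s hs) t ht).trans_eq ?_
    simp [tiltedDeriv, htan]
  simp only [zero_smul, add_zero, sub_self, map_zero, LinearMap.zero_apply, zero_mul] at h1
  have h2 := (hslice t ht).abs_normal_deriv_le hΩ hn hM hK hc₁0 (by linarith) hy hF
  have h3 := (hslice t ht).abs_hess_g_le hyc ν e
  have h4 := hF.abs_le ν e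
  rw [hF.norm_eq, he1, mul_one, mul_one] at h3 h4
  rw [hN] at h2
  have h5 : |Q ν e * (fderivWithin ℝ (fun y => u y t) (closure Ω) y ν -
      fderivWithin ℝ (fun y => φ y t) (closure Ω) y ν)| ≤ M * N := by
    rw [abs_mul]; exact mul_le_mul h4 h2 (abs_nonneg _) hM0.le
  linarith [(abs_le.1 h3).2, (abs_le.1 h5).1]

end MongeAmpereData

/-! ### Lower bound for the Hessian on the parabolic boundary -/

theorem Diagonalizes.apply_self {n : ℕ} {H : LinearMap.BilinForm ℝ (EuclideanSpace ℝ (Fin n))}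
    {b : OrthonormalBasis (Fin n) ℝ (EuclideanSpace ℝ (Fin n))} {lam : Fin n → ℝ}
    (h : Diagonalizes H b lam) (v : EuclideanSpace ℝ (Fin n)) :
    H v v = ∑ k, lam k * inner ℝ (b k) v ^ 2 := by
  conv_lhs => rw [← b.sum_repr' v]
  exact h.apply_sum _

theorem OrthonormalBasis.norm_sq_eq_sum {n : ℕ}
    (b : OrthonormalBasis (Fin n) ℝ (EuclideanSpace ℝ (Fin n))) (v : EuclideanSpace ℝ (Fin n)) :
    ‖v‖ ^ 2 = ∑ k, inner ℝ (b k) v ^ 2 := by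
  rw [← b.sum_sq_norm_inner_right v]
  simp

theorem le_form_of_le_formDet {n : ℕ} {H : LinearMap.BilinForm ℝ (EuclideanSpace ℝ (Fin n))}
    {c C : ℝ} (hC : 0 < C) (hs : ∀ v w, H v w = H w v) (hn : ∀ v, 0 ≤ H v v)
    (h : ∀ v, H v v ≤ C * ‖v‖ ^ 2) (hdet : c ≤ formDet H) (v : EuclideanSpace ℝ (Fin n)) :
    c / C ^ (n - 1) * ‖v‖ ^ 2 ≤ H v v := by
  obtain ⟨b, lam, hd⟩ := exists_diagonalizes H hs
  rw [hd.apply_self, b.norm_sq_eq_sum, Finset.mul_sum]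
  refine Finset.sum_le_sum fun k _ => mul_le_mul_of_nonneg_right ?_ (sq_nonneg _)
  rw [div_le_iff₀ (by positivity)]
  refine hdet.trans ?_
  rw [hd.formDet_eq_prod, ← Finset.mul_prod_erase _ _ (Finset.mem_univ k)]
  refine mul_le_mul_of_nonneg_left ?_ (hd.nonneg hn k)
  have h1 : ∀ j, lam j ≤ C := fun j => by
    have := h (b j)
    rwa [hd.basis_apply, if_pos rfl, b.norm_eq_one, one_pow, mul_one] at this
  calc ∏ j ∈ Finset.univ.erase k, lam j ≤ ∏ _j ∈ Finset.univ.erase k, C :=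
        Finset.prod_le_prod (fun j _ => hd.nonneg hn j) fun j _ => h1 j
    _ = _ := by simp

theorem form_le_of_formDet_le {n : ℕ} {H : LinearMap.BilinForm ℝ (EuclideanSpace ℝ (Fin n))}
    {c C : ℝ} (hc : 0 < c) (hs : ∀ v w, H v w = H w v)
    (h : ∀ v, c * ‖v‖ ^ 2 ≤ H v v) (hdet : formDet H ≤ C) (v : EuclideanSpace ℝ (Fin n)) :
    H v v ≤ C / c ^ (n - 1) * ‖v‖ ^ 2 := by
  obtain ⟨b, lam, hd⟩ := exists_diagonalizes H hs
  have h1 : ∀ j, c ≤ lam j := fun j => by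
    have := h (b j)
    rwa [hd.basis_apply, if_pos rfl, b.norm_eq_one, one_pow, mul_one] at this
  rw [hd.apply_self, b.norm_sq_eq_sum, Finset.mul_sum]
  refine Finset.sum_le_sum fun k _ => mul_le_mul_of_nonneg_right ?_ (sq_nonneg _)
  rw [le_div_iff₀ (by positivity)]
  refine le_trans ?_ hdet
  rw [hd.formDet_eq_prod, ← Finset.mul_prod_erase _ _ (Finset.mem_univ k)]
  refine mul_le_mul_of_nonneg_left ?_ (hc.le.trans (h1 k))
  calc c ^ (n - 1) = ∏ _j ∈ Finset.univ.erase k, c := by simp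
    _ ≤ ∏ j ∈ Finset.univ.erase k, lam j :=
        Finset.prod_le_prod (fun j _ => hc.le) fun j _ => h1 j

/-- A form which is under control in the directions orthogonal to `ν` and has determinant bounded
below is bounded below. If `H(ν, ν)` is large, it dominates the mixed terms; otherwise `H` is bounded
and its determinant controls the lowest eigenvalue. -/
theorem exists_le_form {n : ℕ} {c₁ c₂ C₂ C₃ : ℝ} (hc₁ : 0 < c₁) (hc₂ : 0 < c₂) (hC₂ : 0 ≤ C₂)
    (hC₃ : 0 ≤ C₃) :
    ∃ c : ℝ, 0 < c ∧ ∀ (H : LinearMap.BilinForm ℝ (EuclideanSpace ℝ (Fin n)))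
      (ν : EuclideanSpace ℝ (Fin n)), (∀ v w, H v w = H w v) → (∀ v, 0 ≤ H v v) → ‖ν‖ = 1 →
      (∀ e, ‖e‖ = 1 → inner ℝ e ν = 0 → c₂ ≤ H e e ∧ H e e ≤ C₂ ∧ |H ν e| ≤ C₃) →
      c₁ ≤ formDet H → ∀ v, c * ‖v‖ ^ 2 ≤ H v v := by
  obtain ⟨N, hN⟩ : ∃ N, N = 2 * C₃ ^ 2 / c₂ + c₂ / 2 := ⟨_, rfl⟩
  have hN0 : 0 < N := by rw [hN]; positivity
  obtain ⟨C, hC⟩ : ∃ C, C = C₂ + C₃ + N := ⟨_, rfl⟩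
  have hC0 : 0 < C := by rw [hC]; positivity
  refine ⟨min (c₂ / 2) (c₁ / C ^ (n - 1)), lt_min (by positivity) (by positivity),
    fun H ν hs hnn hν htan hdet => ?_⟩
  have hνν : inner ℝ ν ν = (1 : ℝ) := by rw [real_inner_self_eq_norm_sq, hν]; norm_num
  have hscale : ∀ w, inner ℝ w ν = 0 →
      c₂ * ‖w‖ ^ 2 ≤ H w w ∧ H w w ≤ C₂ * ‖w‖ ^ 2 ∧ |H ν w| ≤ C₃ * ‖w‖ := by
    intro w hw
    rcases eq_or_ne w 0 with rfl | hne
    · simp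
    have hw0 : 0 < ‖w‖ := norm_pos_iff.2 hne
    obtain ⟨h1, h2, h3⟩ := htan (‖w‖⁻¹ • w) (norm_smul_inv_norm hne)
      (by rw [inner_smul_left, hw, mul_zero])
    have e1 : H (‖w‖⁻¹ • w) (‖w‖⁻¹ • w) = H w w / ‖w‖ ^ 2 := by
      simp only [map_smul, LinearMap.smul_apply, smul_eq_mul]; field_simp
    have e2 : H ν (‖w‖⁻¹ • w) = H ν w / ‖w‖ := by
      simp only [map_smul, smul_eq_mul]; field_simp
    rw [e1] at h1 h2
    rw [e2, abs_div, abs_of_pos hw0] at h3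
    exact ⟨(le_div_iff₀ (by positivity)).1 h1, (div_le_iff₀ (by positivity)).1 h2,
      (div_le_iff₀ hw0).1 h3⟩
  have hdec : ∀ v, ∃ s w, inner ℝ w ν = 0 ∧ H v v = H w w + 2 * s * H ν w + s ^ 2 * H ν ν ∧
      ‖v‖ ^ 2 = ‖w‖ ^ 2 + s ^ 2 := by
    intro v
    obtain ⟨s, hsdef⟩ : ∃ s, s = inner ℝ v ν := ⟨_, rfl⟩
    obtain ⟨w, hwdef⟩ : ∃ w, w = v - s • ν := ⟨_, rfl⟩
    have hw : inner ℝ w ν = 0 := by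
      rw [hwdef, inner_sub_left, inner_smul_left, hνν, hsdef]; simp
    have hv : v = w + s • ν := by rw [hwdef]; abel
    refine ⟨s, w, hw, ?_, ?_⟩
    · rw [hv]
      simp only [map_add, map_smul, LinearMap.add_apply, LinearMap.smul_apply, smul_eq_mul]
      rw [hs w ν]; ring
    · rw [hv, norm_add_sq_real, inner_smul_right, hw, norm_smul, hν, mul_one, Real.norm_eq_abs,
        sq_abs]
      ring
  rcases le_or_gt N (H ν ν) with hcase | hcase
  · intro v
    obtain ⟨s, w, hw, hH, hnorm⟩ := hdec v
    obtain ⟨h1, -, h3⟩ := hscale w hw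
    have h4 : |2 * s * H ν w| ≤ c₂ / 2 * ‖w‖ ^ 2 + 2 * C₃ ^ 2 / c₂ * s ^ 2 := by
      have h5 : |2 * s * H ν w| ≤ 2 * |s| * (C₃ * ‖w‖) := by
        rw [abs_mul, abs_mul, abs_two]
        exact mul_le_mul_of_nonneg_left h3 (by positivity)
      refine h5.trans ?_
      rw [← sq_abs s]
      have h6 : 0 ≤ (c₂ * ‖w‖ - 2 * C₃ * |s|) ^ 2 / (2 * c₂) := by positivity
      have h7 : (c₂ * ‖w‖ - 2 * C₃ * |s|) ^ 2 / (2 * c₂) =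
          c₂ / 2 * ‖w‖ ^ 2 + 2 * C₃ ^ 2 / c₂ * |s| ^ 2 - 2 * |s| * (C₃ * ‖w‖) := by
        field_simp; ring
      linarith
    have h8 := mul_le_mul_of_nonneg_left hcase (sq_nonneg s)
    have h9 : min (c₂ / 2) (c₁ / C ^ (n - 1)) * ‖v‖ ^ 2 ≤ c₂ / 2 * ‖v‖ ^ 2 :=
      mul_le_mul_of_nonneg_right (min_le_left _ _) (sq_nonneg _)
    refine h9.trans ?_
    rw [hH, hnorm]
    rw [hN] at h8
    linarith [(abs_le.1 h4).1]
  · have hup : ∀ v, H v v ≤ C * ‖v‖ ^ 2 := by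
      intro v
      obtain ⟨s, w, hw, hH, hnorm⟩ := hdec v
      obtain ⟨-, h2, h3⟩ := hscale w hw
      have h4 : |2 * s * H ν w| ≤ C₃ * (‖w‖ ^ 2 + s ^ 2) := by
        have h5 : |2 * s * H ν w| ≤ 2 * |s| * (C₃ * ‖w‖) := by
          rw [abs_mul, abs_mul, abs_two]
          exact mul_le_mul_of_nonneg_left h3 (by positivity)
        rw [← sq_abs s]
        have := mul_nonneg hC₃ (sq_nonneg (‖w‖ - |s|))
        linarith
      have h5 := mul_le_mul_of_nonneg_left hcase.le (sq_nonneg s)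
      rw [hH, hnorm, hC]
      have h6 := mul_nonneg hC₂ (sq_nonneg s)
      have h7 := mul_nonneg hN0.le (sq_nonneg ‖w‖)
      linarith [(abs_le.1 h4).2]
    intro v
    exact (mul_le_mul_of_nonneg_right (min_le_right _ _) (sq_nonneg _)).trans
      (le_form_of_le_formDet hC0 hs hnn hup hdet v)

namespace MongeAmpereData

variable {n : ℕ} {Ω : Set (EuclideanSpace ℝ (Fin n))} {T c₀ κ K C₁ : ℝ} {J : ℝ≥0}
  {φ ψ u : EuclideanSpace ℝ (Fin n) → ℝ → ℝ}

theorem exists_le_hess_lateral (hΩ : IsUniformlyConvexDomain Ω) (hn : 1 ≤ n) (hT : 0 < T)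
    (hκ : 0 < κ) (hc₀ : 0 < c₀) (hK : 0 ≤ K) (hC₁ : 1 ≤ C₁) (J : ℝ≥0) :
    ∃ c : ℝ, 0 < c ∧ ∀ φ ψ u, MongeAmpereData Ω T c₀ κ K J φ ψ u →
      (∀ x ∈ closure Ω, ∀ t ∈ Icc 0 T, timeDeriv T u x t + ψ x t ≤ C₁) →
      ∀ y ∈ frontier Ω, ∀ t ∈ Icc 0 T, ∀ v,
        c * ‖v‖ ^ 2 ≤ hessForm (closure Ω) (fun y => u y t) y v v := by
  obtain ⟨M, hM, hfr⟩ := hΩ.exists_boundaryFrame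
  have hM0 : 0 < M := by linarith
  have hC₁0 : 0 ≤ C₁ := by linarith
  have hc₁0 : 0 < min c₀ (κ ^ n) := lt_min hc₀ (by positivity)
  obtain ⟨c₂, hc₂, htan⟩ := EllipticSlice.exists_le_hess_tangential hΩ hn hM hK hc₁0 hC₁0
  obtain ⟨C₃, hC₃, hmix⟩ := exists_abs_mixed_le hΩ hn hT hκ hc₀ hK hC₁ hM hfr J
  obtain ⟨c, hc, hform⟩ := exists_le_form (n := n) (C₂ := K + M * (3 * K + C₁ + 1) * M) hc₁0 hc₂
    (by positivity) hC₃
  refine ⟨c, hc, fun φ ψ u d hC y hy t ht => ?_⟩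
  obtain ⟨ν, Q, hF⟩ := hfr y hy
  have hyc := frontier_subset_closure hy
  have hs := d.ellipticSlice hΩ hT hκ hC ht
  exact hform _ ν (hs.hess_symm hΩ hyc) (hs.hess_nonneg hΩ hyc) hF.norm_eq
    (fun e he1 he => ⟨htan _ _ y ν Q hs hy hF e he1 he,
      hs.abs_hess_tangential_le hΩ hn hM hK hc₁0 hC₁0 hy hF he1 he,
      hmix φ ψ u d hC y hy t ht ν Q hF e he1 he⟩) (hs.le_det y hyc)

end MongeAmpereData

/-! ### Lower bound for the Hessian in the interior -/

section MinimumDirection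

variable {n : ℕ} {S : Set (EuclideanSpace ℝ (Fin n))} {f : EuclideanSpace ℝ (Fin n) → ℝ}
  {x : EuclideanSpace ℝ (Fin n)}

theorem third_deriv_apply_sum (u v : EuclideanSpace ℝ (Fin n))
    (b : Fin n → EuclideanSpace ℝ (Fin n)) (c : Fin n → ℝ) :
    iteratedFDerivWithin ℝ 3 f S x ![u, v, ∑ l, c l • b l] =
      ∑ l, c l * iteratedFDerivWithin ℝ 3 f S x ![u, v, b l] := by
  have e : ∀ z, Function.update ![u, v, 0] 2 z = ![u, v, z] := fun z => by
    ext i; fin_cases i <;> simp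
  have := map_sum ((iteratedFDerivWithin ℝ 3 f S x).toMultilinearMap.toLinearMap ![u, v, 0] 2)
    (fun l => c l • b l) Finset.univ
  simp only [map_smul, MultilinearMap.toLinearMap_apply, e, smul_eq_mul] at this
  exact this

/-- Let `μ` be the lowest value of `D²f` on unit vectors over all of `S`, attained at `x` in the
direction `ξ`. The form `D²f - μ` at `x + s v`, evaluated on the moving direction `ξ + s w`, is
nonnegative and vanishes at `s = 0`, so its second derivative in `s` is nonnegative. -/
theorem second_deriv_min_direction (hS : UniqueDiffOn ℝ S) (hcl : S ⊆ closure (interior S))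
    (hf : ContDiffOn ℝ 4 f S) (hx : x ∈ interior S) {μ : ℝ} {ξ : EuclideanSpace ℝ (Fin n)}
    (hle : ∀ z ∈ S, ∀ w, μ * ‖w‖ ^ 2 ≤ hessForm S f z w w)
    (heq : hessForm S f x ξ ξ = μ * ‖ξ‖ ^ 2) (v w : EuclideanSpace ℝ (Fin n)) :
    0 ≤ iteratedFDerivWithin ℝ 4 f S x ![v, v, ξ, ξ] +
      4 * iteratedFDerivWithin ℝ 3 f S x ![v, ξ, w] + 2 * hessForm S f x w w -
        2 * μ * ‖w‖ ^ 2 := by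
  have hf3 : ContDiffOn ℝ 3 f S := hf.of_le (by norm_num)
  have hev := eventually_line_mem_interior hx v
  have hx0 : x + (0 : ℝ) • v ∈ interior S := by simpa using hx
  have hq : ∀ s : ℝ, HasDerivAt (fun s : ℝ => μ * (‖ξ‖ ^ 2 + s * (2 * inner ℝ ξ w) +
      s ^ 2 * ‖w‖ ^ 2)) (μ * (2 * inner ℝ ξ w + 2 * s * ‖w‖ ^ 2)) s := fun s => by
    have := ((((hasDerivAt_id s).mul_const (2 * inner ℝ ξ w)).const_add (‖ξ‖ ^ 2)).fun_add
      (((hasDerivAt_id s).pow 2).mul_const (‖w‖ ^ 2))).const_mul μ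
    simpa using this
  have hD1 : ∀ᶠ s : ℝ in 𝓝 0, HasDerivAt _ _ s := hev.mono fun s hs =>
    (((hasDerivAt_line₂ hS hf3 hs ξ ξ).fun_add
      (((hasDerivAt_id s).const_mul 2).fun_mul (hasDerivAt_line₂ hS hf3 hs ξ w))).fun_add
      (((hasDerivAt_id s).fun_pow 2).fun_mul (hasDerivAt_line₂ hS hf3 hs w w))).fun_sub (hq s)
  have hq2 : HasDerivAt (fun s : ℝ => μ * (2 * inner ℝ ξ w + 2 * s * ‖w‖ ^ 2))
      (2 * μ * ‖w‖ ^ 2) 0 := by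
    have := ((((hasDerivAt_id (0 : ℝ)).const_mul 2).mul_const (‖w‖ ^ 2)).const_add
      (2 * inner ℝ ξ w)).const_mul μ
    exact this.congr_deriv (by ring)
  have hD2 := (((hasDerivAt_line₃ hS hf hx0 v ξ ξ).fun_add
    (((hasDerivAt_line₂ hS hf3 hx0 ξ w).const_mul 2).fun_add
      (((hasDerivAt_id (0 : ℝ)).const_mul 2).fun_mul (hasDerivAt_line₃ hS hf hx0 v ξ w)))).fun_add
    ((((hasDerivAt_id (0 : ℝ)).const_mul 2).fun_mul (hasDerivAt_line₂ hS hf3 hx0 w w)).fun_add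
      (((hasDerivAt_id (0 : ℝ)).fun_pow 2).fun_mul (hasDerivAt_line₃ hS hf hx0 v w w)))).fun_sub hq2
  have key := nonneg_second_deriv_of_isLocalMin (x := 0) (hD1.mono fun s hs =>
    hs.congr_deriv (by simp only [id]; ring)) hD2 (by
      filter_upwards [hev] with s hs
      have h1 := hle _ (interior_subset hs) (ξ + s • w)
      have h2 : hessForm S f (x + s • v) (ξ + s • w) (ξ + s • w) =
          hessForm S f (x + s • v) ξ ξ + 2 * s * hessForm S f (x + s • v) ξ w +
            s ^ 2 * hessForm S f (x + s • v) w w := by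
        simp only [map_add, map_smul, LinearMap.add_apply, LinearMap.smul_apply, smul_eq_mul]
        rw [hessForm_symm hS hcl (hf.of_le (by norm_num)) (interior_subset hs) w ξ]
        ring
      rw [h2, norm_add_sq_real, inner_smul_right, norm_smul, mul_pow, Real.norm_eq_abs, sq_abs]
        at h1
      simp only [id, zero_smul, add_zero, mul_zero, zero_mul, ne_eq, OfNat.ofNat_ne_zero,
        not_false_eq_true, zero_pow, heq, sub_self]
      linarith)
  simp only [id, zero_smul, add_zero, mul_one, mul_zero, zero_mul, ne_eq, OfNat.ofNat_ne_zero,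
    not_false_eq_true, zero_pow] at key
  norm_num at key
  linarith

/-- The case of `second_deriv_min_direction` with the optimal `w = - ∑ (D³f(ξ, b k, b l) / lam l) b l`
for `v = b k`. -/
theorem two_mul_sum_sq_le_fourth_deriv (hS : UniqueDiffOn ℝ S) (hcl : S ⊆ closure (interior S))
    (hf : ContDiffOn ℝ 4 f S) (hx : x ∈ interior S) {μ : ℝ} (hμ : 0 ≤ μ)
    {ξ : EuclideanSpace ℝ (Fin n)}
    (hle : ∀ z ∈ S, ∀ w, μ * ‖w‖ ^ 2 ≤ hessForm S f z w w)
    (heq : hessForm S f x ξ ξ = μ * ‖ξ‖ ^ 2)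
    {b : OrthonormalBasis (Fin n) ℝ (EuclideanSpace ℝ (Fin n))} {lam : Fin n → ℝ}
    (hd : Diagonalizes (hessForm S f x) b lam) (hl : ∀ k, 0 < lam k) (k : Fin n) :
    2 * ∑ l, iteratedFDerivWithin ℝ 3 f S x ![ξ, b k, b l] ^ 2 / lam l ≤
      iteratedFDerivWithin ℝ 4 f S x ![ξ, ξ, b k, b k] := by
  have hxS := interior_subset hx
  set c : Fin n → ℝ := fun l => -(iteratedFDerivWithin ℝ 3 f S x ![ξ, b k, b l] / lam l) with hc
  have h1 := second_deriv_min_direction hS hcl hf hx hle heq (b k) (∑ l, c l • b l)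
  rw [third_deriv_apply_sum, hd.apply_sum, fourth_deriv_swap_pairs hS hcl hf hxS] at h1
  have e1 : ∑ l, c l * iteratedFDerivWithin ℝ 3 f S x ![b k, ξ, b l] =
      -∑ l, iteratedFDerivWithin ℝ 3 f S x ![ξ, b k, b l] ^ 2 / lam l := by
    rw [← Finset.sum_neg_distrib]
    refine Finset.sum_congr rfl fun l _ => ?_
    rw [third_deriv_swap₀₁ hS hcl hf hxS, hc]
    ring
  have e2 : ∑ l, lam l * c l ^ 2 =
      ∑ l, iteratedFDerivWithin ℝ 3 f S x ![ξ, b k, b l] ^ 2 / lam l := by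
    refine Finset.sum_congr rfl fun l _ => ?_
    have := (hl l).ne'
    rw [hc]
    field_simp
  rw [e1, e2] at h1
  have h2 : 0 ≤ 2 * μ * ‖∑ l, c l • b l‖ ^ 2 := by positivity
  linarith

end MinimumDirection

namespace MongeAmpereData

variable {n : ℕ} {Ω : Set (EuclideanSpace ℝ (Fin n))} {T c₀ κ K : ℝ} {J : ℝ≥0}
  {φ ψ u : EuclideanSpace ℝ (Fin n) → ℝ → ℝ} {x : EuclideanSpace ℝ (Fin n)} {t : ℝ}

/-- The equation, differentiated twice in a direction `ξ` in which the Hessian is minimal: the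
concavity of `ψ` makes `D²u_t(ξ, ξ)` nonnegative. -/
theorem hess_timeDeriv_nonneg (hΩ : IsUniformlyConvexDomain Ω)
    (d : MongeAmpereData Ω T c₀ κ K J φ ψ u) (hx : x ∈ Ω) (ht : t ∈ Icc 0 T) {μ : ℝ} (hμ : 0 < μ)
    {ξ : EuclideanSpace ℝ (Fin n)}
    (hle : ∀ z ∈ closure Ω, ∀ w, μ * ‖w‖ ^ 2 ≤ hessForm (closure Ω) (fun y => u y t) z w w)
    (heq : hessForm (closure Ω) (fun y => u y t) x ξ ξ = μ * ‖ξ‖ ^ 2) :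
    0 ≤ hessForm (closure Ω) (fun y => timeDeriv T u y t) x ξ ξ := by
  have hS := hΩ.uniqueDiffOn_closure
  have hint : x ∈ interior (closure Ω) := by rwa [hΩ.interior_closure]
  have hxc := subset_closure hx
  have hint0 : x + (0 : ℝ) • ξ ∈ interior (closure Ω) := by simpa using hint
  have hev := eventually_line_mem_interior hint ξ
  have hu4 := d.mem_u.contDiffOn_slice ht
  have hu3 : ContDiffOn ℝ 3 (fun y => u y t) (closure Ω) := hu4.of_le (by norm_num)
  have hut := d.mem_u.contDiffOn_timeDeriv ht
  have hψ2 : ContDiffOn ℝ 2 (fun y => ψ y t) (closure Ω) :=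
    (d.mem_ψ.contDiffOn_slice ht).of_le (by norm_num)
  obtain ⟨b, lam, hd⟩ := exists_diagonalizes _ (d.hess_symm hΩ hxc ht)
  have hl : ∀ k, 0 < lam k := fun k => by
    have := hle x hxc (b k)
    rw [hd.basis_apply, if_pos rfl, b.norm_eq_one, one_pow, mul_one] at this
    linarith
  have h1 := second_deriv_formDet_ge
    (H := fun s : ℝ => hessForm (closure Ω) (fun y => u y t) (x + s • ξ)) (s₀ := 0)
    (by simpa using hd) hl (hev.mono fun s hs => d.hess_symm hΩ (interior_subset hs) ht)
    (fun k l => hev.mono fun s hs => hasDerivAt_line₂ hS hu3 hs (b k) (b l))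
    (fun k l => hasDerivAt_line₃ hS hu4 hint0 ξ (b k) (b l))
    (F' := fun s => fderivWithin ℝ (fun y => timeDeriv T u y t) (closure Ω) (x + s • ξ) ξ +
      fderivWithin ℝ (fun y => ψ y t) (closure Ω) (x + s • ξ) ξ)
    (by
      filter_upwards [hev.eventually_nhds] with s hs
      refine ((hasDerivAt_line₀ (hut.differentiableOn (by norm_num)) hs.self_of_nhds).fun_add
        (hasDerivAt_line₀ (hψ2.differentiableOn (by norm_num))
          hs.self_of_nhds)).congr_of_eventuallyEq ?_
      filter_upwards [hs] with r hr using d.equation _ (interior_subset hr) t ht)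
    ((hasDerivAt_line₁ hS hut hint0 ξ).fun_add (hasDerivAt_line₁ hS hψ2 hint0 ξ))
  simp only [zero_smul, add_zero] at h1
  have hF : 0 ≤ formDet (hessForm (closure Ω) (fun y => u y t) x) :=
    formDet_nonneg (d.hess_symm hΩ hxc ht) (d.hess_nonneg hΩ hxc ht)
  have h2 : 0 ≤ ∑ k, iteratedFDerivWithin ℝ 4 (fun y => u y t) (closure Ω) x ![ξ, ξ, b k, b k] /
      lam k - 2 * ∑ k, ∑ l, iteratedFDerivWithin ℝ 3 (fun y => u y t) (closure Ω) x
        ![ξ, b k, b l] ^ 2 / (lam k * lam l) := by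
    rw [Finset.mul_sum, ← Finset.sum_sub_distrib]
    refine Finset.sum_nonneg fun k _ => ?_
    have h3 := two_mul_sum_sq_le_fourth_deriv hS hΩ.closure_subset hu4 hint hμ.le hle heq hd hl k
    have h4 := div_le_div_of_nonneg_right h3 (hl k).le
    rw [sub_nonneg]
    refine le_trans (le_of_eq ?_) h4
    rw [mul_div_assoc, Finset.sum_div]
    congr 1
    exact Finset.sum_congr rfl fun l _ => by rw [div_div, mul_comm (lam l)]
  linarith [mul_nonneg hF h2, d.hess_ψ_nonpos hΩ hxc ht ξ]

theorem continuousOn_hess_self (d : MongeAmpereData Ω T c₀ κ K J φ ψ u) :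
    ContinuousOn (fun p : (EuclideanSpace ℝ (Fin n) × EuclideanSpace ℝ (Fin n)) × ℝ =>
      hessForm (closure Ω) (fun y => u y p.2) p.1.1 p.1.2 p.1.2)
      ((closure Ω ×ˢ Metric.sphere 0 1) ×ˢ Icc 0 T) := by
  set b := EuclideanSpace.basisFun (Fin n) ℝ with hb
  have h1 : ∀ p : (EuclideanSpace ℝ (Fin n) × EuclideanSpace ℝ (Fin n)) × ℝ,
      hessForm (closure Ω) (fun y => u y p.2) p.1.1 p.1.2 p.1.2 =
      ∑ k, ∑ l, inner ℝ (b k) p.1.2 * inner ℝ (b l) p.1.2 *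
        hessForm (closure Ω) (fun y => u y p.2) p.1.1 (b k) (b l) := fun p => by
    conv_lhs => rw [← b.sum_repr' p.1.2]
    exact form_apply_sum _ _ _
  simp only [h1]
  refine continuousOn_finsetSum _ fun k _ => continuousOn_finsetSum _ fun l _ => ?_
  refine ContinuousOn.mul (by fun_prop) ?_
  have h2 := (ContinuousMultilinearMap.apply ℝ (fun _ : Fin 2 => EuclideanSpace ℝ (Fin n)) ℝ
    ![b k, b l]).continuous.comp_continuousOn (d.mem_u.continuousOn_iterated (j := 2) (by norm_num))
  exact h2.comp (f := fun p : (EuclideanSpace ℝ (Fin n) × EuclideanSpace ℝ (Fin n)) × ℝ =>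
    (p.1.1, p.2)) (by fun_prop) fun p hp => ⟨hp.1.1, hp.2⟩

/-- The minimum principle for the lowest eigenvalue of the Hessian: `D²u(ξ, ξ) + ε t` over all unit
vectors `ξ` cannot first reach a level below its values on the parabolic boundary in the interior. -/
theorem le_hess (hΩ : IsUniformlyConvexDomain Ω) (d : MongeAmpereData Ω T c₀ κ K J φ ψ u)
    {c : ℝ} (hcκ : c ≤ κ)
    (hlat : ∀ y ∈ frontier Ω, ∀ t ∈ Icc 0 T, ∀ v,
      c * ‖v‖ ^ 2 ≤ hessForm (closure Ω) (fun y => u y t) y v v)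
    (hx : x ∈ closure Ω) (ht : t ∈ Icc 0 T) (v : EuclideanSpace ℝ (Fin n)) :
    c * ‖v‖ ^ 2 ≤ hessForm (closure Ω) (fun y => u y t) x v v := by
  have hscale : ∀ (H : LinearMap.BilinForm ℝ (EuclideanSpace ℝ (Fin n))) (m : ℝ),
      (∀ w, ‖w‖ = 1 → m ≤ H w w) → ∀ w, m * ‖w‖ ^ 2 ≤ H w w := by
    intro H m hH w
    rcases eq_or_ne w 0 with rfl | hne
    · simp
    have hw0 : 0 < ‖w‖ := norm_pos_iff.2 hne
    have h1 := hH (‖w‖⁻¹ • w) (norm_smul_inv_norm hne)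
    have e1 : H (‖w‖⁻¹ • w) (‖w‖⁻¹ • w) = H w w / ‖w‖ ^ 2 := by
      simp only [map_smul, LinearMap.smul_apply, smul_eq_mul]; field_simp
    rw [e1] at h1
    exact (le_div_iff₀ (by positivity)).1 h1
  refine hscale _ c (fun v hv => ?_) v
  by_contra hcon
  push Not at hcon
  have hm0 := d.hess_nonneg hΩ hx ht v
  obtain ⟨m, hm⟩ : ∃ m, hessForm (closure Ω) (fun y => u y t) x v v = m := ⟨_, rfl⟩
  rw [hm] at hcon hm0
  have hTt := ht.1.trans ht.2
  -- an intermediate level and a small slope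
  obtain ⟨c', hc'⟩ : ∃ c', c' = (m + c) / 2 := ⟨_, rfl⟩
  obtain ⟨ε, hε⟩ : ∃ ε, ε = (c' - m) / (2 * (T + 1)) := ⟨_, rfl⟩
  have hT1 : 0 < T + 1 := by linarith
  have hε0 : 0 < ε := by rw [hε]; exact div_pos (by linarith) (by linarith)
  have hεT : ε * T < (c' - m) / 2 := by
    have : ε * (T + 1) = (c' - m) / 2 := by rw [hε]; field_simp
    linarith
  obtain ⟨⟨y, ξ⟩, ⟨hy, hξ⟩, τ, hτ, hyτ, hmax⟩ := exists_first_touching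
    (hΩ.isCompact_closure.prod (isCompact_sphere (0 : EuclideanSpace ℝ (Fin n)) 1)) (T := T)
    (G := fun p s => -(hessForm (closure Ω) (fun y => u y s) p.1 p.2 p.2 + ε * s)) (c := -c')
    (d.continuousOn_hess_self.add (by fun_prop)).neg
    (fun p hp => by
      have h1 := d.initial p.1 hp.1 p.2
      rw [← d.hess_initial hp.1, mem_sphere_zero_iff_norm.1 hp.2] at h1
      simp only [mul_zero, add_zero]
      linarith) (y₁ := (x, v)) ⟨hx, mem_sphere_zero_iff_norm.2 hv⟩ ht (by
      have := mul_le_mul_of_nonneg_left ht.2 hε0.le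
      change -c' < -(hessForm (closure Ω) (fun y => u y t) x v v + ε * t)
      rw [hm]
      linarith)
  simp only at hy hξ hyτ
  have hξ1 := mem_sphere_zero_iff_norm.1 hξ
  have hτc := Ioo_subset_Icc_self hτ
  have hετ : 0 < ε * τ := mul_pos hε0 hτ.1
  have hετ' : ε * τ ≤ ε * T := mul_le_mul_of_nonneg_left hτ.2.le hε0.le
  obtain ⟨μ, hμ⟩ : ∃ μ, hessForm (closure Ω) (fun y => u y τ) y ξ ξ = μ := ⟨_, rfl⟩
  rw [hμ] at hyτ
  have hμ0 : 0 < μ := by linarith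
  have hyΩ : y ∈ Ω := by
    rcases hΩ.mem_or_frontier hy with h | h
    · exact h
    · have h1 := hlat y h τ hτc ξ
      rw [hξ1, hμ] at h1
      linarith
  have hnonneg := d.hess_timeDeriv_nonneg hΩ hyΩ hτc hμ0 (ξ := ξ) (fun z hz =>
    hscale _ μ fun w hw => by
      have := hmax (z, w) ⟨hz, mem_sphere_zero_iff_norm.2 hw⟩ τ (right_mem_Icc.2 hτ.1.le)
      simp only at this
      linarith) (by rw [hξ1, hμ]; ring)
  have htime := nonneg_deriv_of_le_left (((d.mem_u.hasDerivAt_hessForm hΩ hyΩ hτ ξ ξ).fun_add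
    ((hasDerivAt_id τ).const_mul ε)).fun_neg) hτ.1 fun s hs => by
      have := hmax (y, ξ) ⟨hy, hξ⟩ s hs
      simp only [id] at this ⊢
      rw [hμ]
      linarith
  linarith

end MongeAmpereData

/-! ### The eigenvalues of the Hessian -/

theorem apply_of_hasEigenvalue_spaceHessian {n : ℕ} {Ω : Set (EuclideanSpace ℝ (Fin n))}
    {w : EuclideanSpace ℝ (Fin n) → ℝ → ℝ} {x : EuclideanSpace ℝ (Fin n)} {t μ : ℝ}
    (h : Module.End.HasEigenvalue (Matrix.toLin' (spaceHessian Ω w x t)) μ) :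
    ∃ v : EuclideanSpace ℝ (Fin n), 0 < ‖v‖ ^ 2 ∧
      hessForm (closure Ω) (fun y => w y t) x v v = μ * ‖v‖ ^ 2 := by
  obtain ⟨v, hv⟩ := h.exists_hasEigenvector
  have hv1 := hv.apply_eq_smul
  rw [Matrix.toLin'_apply] at hv1
  have hne : WithLp.toLp 2 v ≠ 0 := fun h0 => hv.2 (by simpa using h0)
  refine ⟨WithLp.toLp 2 v, by positivity, ?_⟩
  have hA : LinearMap.BilinForm.toMatrix (EuclideanSpace.basisFun (Fin n) ℝ).toBasis
      (hessForm (closure Ω) (fun y => w y t) x) = spaceHessian Ω w x t := by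
    ext i k
    simp [LinearMap.BilinForm.toMatrix_apply, spaceHessian, hessForm_apply]
  rw [LinearMap.BilinForm.apply_eq_dotProduct_toMatrix_mulVec
    (EuclideanSpace.basisFun (Fin n) ℝ).toBasis, hA]
  have hr : ⇑((EuclideanSpace.basisFun (Fin n) ℝ).toBasis.repr (WithLp.toLp 2 v)) = v := by
    ext i; simp
  rw [hr, hv1, dotProduct_smul, smul_eq_mul, EuclideanSpace.norm_sq_eq]
  simp [dotProduct, sq]

theorem theorem2p5 (n : ℕ) (hn : 1 ≤ n) (T : ℝ) (hT : 0 < T)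
    (Ω : Set (EuclideanSpace ℝ (Fin n))) (hΩ : IsUniformlyConvexDomain Ω)
    (c₀ : ℝ) (hc₀ : 0 < c₀) (κ : ℝ) (hκ : 0 < κ)
    (Kφ Kψ KDψ Kψt : ℝ≥0) :
    ∃ C : ℝ, 0 < C ∧
      ∀ φ ψ u : EuclideanSpace ℝ (Fin n) → ℝ → ℝ,
        -- the data are smooth on the closed cylinder
        ContDiffOn ℝ ∞ (fun p : EuclideanSpace ℝ (Fin n) × ℝ => φ p.1 p.2)
          (closedCylinder Ω T) →
        ContDiffOn ℝ ∞ (fun p : EuclideanSpace ℝ (Fin n) × ℝ => ψ p.1 p.2)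
          (closedCylinder Ω T) →
        -- the lateral condition on the data
        (∀ x ∈ frontier Ω, ∀ t ∈ Icc 0 T, c₀ ≤ timeDeriv T φ x t + ψ x t) →
        -- uniform convexity of the initial datum: its Hessian is at least `κ`
        (∀ x ∈ closure Ω, ∀ v : EuclideanSpace ℝ (Fin n),
          κ * ‖v‖ ^ 2 ≤ iteratedFDerivWithin ℝ 2 (fun y => φ y 0) (closure Ω) x ![v, v]) →
        -- concavity of the right-hand side in space
        (∀ t ∈ Icc 0 T, ConcaveOn ℝ Ω (fun x => ψ x t)) →
        -- bounds on the data
        parabolicNorm 4 Ω T φ ≤ Kφ →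
        eLpNorm (fun p : EuclideanSpace ℝ (Fin n) × ℝ => ψ p.1 p.2) ⊤
          (volume.restrict (parabolicCylinder Ω T)) ≤ Kψ →
        eLpNorm (fun p : EuclideanSpace ℝ (Fin n) × ℝ => spaceGrad Ω ψ p.1 p.2) ⊤
          (volume.restrict (parabolicCylinder Ω T)) ≤ KDψ →
        eLpNorm (fun p : EuclideanSpace ℝ (Fin n) × ℝ => timeDeriv T ψ p.1 p.2) (n + 1)
          (volume.restrict (parabolicCylinder Ω T)) ≤ Kψt →
        -- the solution
        MemParabolicC 4 Ω T u →
        (∀ t ∈ Icc 0 T, ConvexOn ℝ Ω (fun x => u x t)) →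
        SolvesParabolicMongeAmpere Ω T φ ψ u →
        ∀ p ∈ closedCylinder Ω T, ∀ μ : ℝ,
          Module.End.HasEigenvalue (Matrix.toLin' (spaceHessian Ω u p.1 p.2)) μ →
            1 / C ≤ μ ∧ μ ≤ C := by
  obtain ⟨K, hK⟩ : ∃ K : ℝ, (n : ℝ) ^ 4 * Kφ + Kψ + KDψ + 1 = K := ⟨_, rfl⟩
  have hK0 : 0 ≤ K := by rw [← hK]; positivity
  obtain ⟨C₁, hC₁, hspeed⟩ :=
    MongeAmpereData.exists_speed_le hΩ hn hT hκ hc₀ hK0 (Kψt ^ (n + 1))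
  obtain ⟨c', hc', hlat⟩ :=
    MongeAmpereData.exists_le_hess_lateral hΩ hn hT hκ hc₀ hK0 hC₁ (Kψt ^ (n + 1))
  obtain ⟨c, hc⟩ : ∃ c, min c' κ = c := ⟨_, rfl⟩
  have hc0 : 0 < c := by rw [← hc]; exact lt_min hc' hκ
  have hcc' : c ≤ c' := hc ▸ min_le_left _ _
  have hcκ : c ≤ κ := hc ▸ min_le_right _ _
  have hup0 : 0 < C₁ / c ^ (n - 1) := by positivity
  refine ⟨1 / c + C₁ / c ^ (n - 1), by positivity, ?_⟩
  intro φ ψ u hφ hψ hlatφ hinit hconc hKφ hKψ hKDψ hKψt hu hconv hsol p hp μ hμ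
  have d := mongeAmpereData_of_hypotheses hn hT hΩ hφ hψ hlatφ hinit hconc hKφ hKψ hKDψ hKψt hu
    hconv hsol
  rw [hK] at d
  have hlow : ∀ v, c * ‖v‖ ^ 2 ≤ hessForm (closure Ω) (fun y => u y p.2) p.1 v v :=
    d.le_hess hΩ hcκ (fun y hy t ht v =>
      (mul_le_mul_of_nonneg_right hcc' (sq_nonneg _)).trans
        (hlat φ ψ u d (hspeed φ ψ u d) y hy t ht v)) hp.1 hp.2
  have hhigh := form_le_of_formDet_le hc0 (d.hess_symm hΩ hp.1 hp.2) hlow (C := C₁) (by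
    rw [d.equation p.1 hp.1 p.2 hp.2]; exact hspeed φ ψ u d p.1 hp.1 p.2 hp.2)
  obtain ⟨v, hv, hval⟩ := apply_of_hasEigenvalue_spaceHessian hμ
  have h1 := hlow v
  have h2 := hhigh v
  rw [hval] at h1 h2
  have h3 := le_of_mul_le_mul_right h1 hv
  have h4 := le_of_mul_le_mul_right h2 hv
  have h5 : 0 < 1 / c := by positivity
  refine ⟨le_trans ?_ h3, by linarith⟩
  rw [div_le_iff₀ (by positivity)]
  have h6 : c * (1 / c) = 1 := by field_simp
  nlinarith [mul_pos hc0 hup0]
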